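/- For positive integers $l$, let $P_l$ be the path on $l$ vertices, let $tP_2$ be the disjoint union of $t$ copies of $P_2$ (empty for $t=0$), and let $\cup$ denote disjoint union of graphs. For a graph $H$, let $AR(n,H)$ be the maximum number of colors in an edge-coloring of the complete graph $K_n$ that contains no rainbow copy of $H$, i.e. no (not necessarily induced) copy of $H$ whose edges have pairwise distinct colors. For all integers $t\ge 0$ and $n\ge 2t+4$, this maximum is attained for $H=P_4\cup tP_2$ and $$ AR(n,P_4\cup tP_2)=\begin{cases} 3 & \text{when } t=0,\ n=4,\\ 2 & \text{when } t=0,\ n\ge 5,\\ \tfrac12 t(3t+7)+1 & \text{when } 1\le t\le 4,\ n=2t+4,\\ t(2t+1)+2 & \text{when } t\ge 5,\ n=2t+4,\\ t(2t+1)+1 & \text{when } t\ge 1,\ 2t+5\le n\le \tfrac{5t+3}{2},\\ t\left(n-\tfrac{t+1}{2}\right)+1 & \text{when } t\ge 1,\ n\ge 2t+5,\ n\ge \tfrac{5t+3}{2}. \end{cases} $$ -/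

import Mathlib

/-- The disjoint union `t G` of `t` copies of the graph `G`. -/
def disjointCopies (t : ℕ) {V : Type*} (G : SimpleGraph V) : SimpleGraph (Fin t × V) where
  Adj a b := a.1 = b.1 ∧ G.Adj a.2 b.2
  symm := ⟨fun _ _ h => ⟨h.1.symm, h.2.symm⟩⟩
  loopless := ⟨fun _ h => G.irrefl h.2⟩

/-- The linear forest `P₄ ∪ t P₂`, the disjoint union of a path on four vertices and of `t` paths
on two vertices. -/
def pathForest (t : ℕ) :
    SimpleGraph (Fin 4 ⊕ (Fin t × Fin 2)) :=
  SimpleGraph.pathGraph 4 ⊕g disjointCopies t (SimpleGraph.pathGraph 2)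

/-- A copy `f` of `H` in `G` is rainbow under the edge-coloring `c` of `G` if its edges have
pairwise distinct colors. -/
def IsRainbowCopy {V W C : Type*} {G : SimpleGraph V} {H : SimpleGraph W}
    (c : G.edgeSet → C) (f : SimpleGraph.Copy H G) : Prop :=
  Function.Injective fun e : H.edgeSet => c (f.mapEdgeSet e)

/-- The numbers of colors that occur in edge-colorings of the complete graph `K_n` without a
rainbow copy of `H`. Colors are natural numbers, which is no restriction as `K_n` is finite. -/
def rainbowFreeColorCounts (n : ℕ) {W : Type*} (H : SimpleGraph W) : Set ℕ :=
  {m | ∃ c : (⊤ : SimpleGraph (Fin n)).edgeSet → ℕ,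
    (Set.range c).ncard = m ∧
      ∀ f : SimpleGraph.Copy H (⊤ : SimpleGraph (Fin n)), ¬ IsRainbowCopy c f}

/-- The anti-Ramsey number `AR(n, H)`: the maximum number of colors in an edge-coloring of `K_n`
without a rainbow copy of `H`. -/
noncomputable def antiRamsey (n : ℕ) {W : Type*} (H : SimpleGraph W) : ℕ :=
  sSup (rainbowFreeColorCounts n H)

/-! The graph P₄ ∪ tP₂ contains a matching with t + 2 edges, so a coloring without a rainbow
matching of that size has no rainbow P₄ ∪ tP₂ either. Conversely, let M be a rainbow matching with t
+ 2 edges in a coloring without rainbow P₄ ∪ tP₂. An edge of a new color that joins two edges of M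
would form a rainbow P₄ with them, disjoint from the other t edges of M. Similar exchanges leave at
most max(2, n - 2t - 4) new colors on the edges leaving M and one new color off M
(`NoRainbowPath.card_colors_le`). For t ≥ 1 these are few colors, and the problem reduces to
colorings without a rainbow matching with t + 2 edges. The case t = 0 needs only small additions.

Lower bounds. Make all edges of a clique on 2t + 1 vertices, or all edges meeting a fixed set of t
vertices, differently colored and give one further color to the rest. For n = 2t + 4 a rainbow
matching with t + 2 edges would be perfect, and a parity argument allows two further colors next to
the clique (`exists_noRainbow_of_pair`).

Upper bounds. One edge of each color forms a rainbow graph. If its matchings have at most m edges,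
Erdős–Gallai (`card_adjPairs_le`, `card_colors_le`) bounds the number of edges by the maximum of
m(2m + 1) and mn - m(m + 1)/2. The claimed values are essentially this bound for m = t plus one
color, although rainbow matchings with t + 1 edges may exist. The tool is a soft edge: an edge uv of
a rainbow matching with t + 1 edges whose color also occurs on an edge xy disjoint from the
matching. Since xy can keep the color, u and v are free, and exchanges allow only two new colors
between uv and each other edge of the matching and two more towards the vertices off the matching
(`Config.card_fresh_le`, `Config.card_fresh_compl_le`). Deleting r soft edges costs about 2rt colors
and leaves rainbow matchings with at most t + 1 - r edges that avoid the colors of the soft edges.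
For r = 2 or 3, Erdős–Gallai for the rest then gives the bound.

For n ≥ 2t + 5 at least three vertices remain off a rainbow matching with t + 1 edges, and the edges
among them only have colors of the matching. If they span a monochromatic triangle, then a matching
of t edges cannot be augmented without the color of the triangle (`bound_of_mono`). If they show
three colors, there are three soft edges (`bound_of_three_colors`). If they show two, there are two
soft edges, and one has to check that these four vertices see at most two new colors among
themselves and off the matching (`TwoEdges.bound_of_cover`).

For n = 2t + 4 consider a rainbow matching with t edges and the four uncovered vertices u, v, x, y,
where uv and xy share a new color. Mixed configurations, which have two soft edges, are treated by
hand (`Mixed.card_colors_le`). Without them, opposite pairs among u, v, x, y agree in color as soon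
as one of them has a new color, so these vertices see one, two or three new colors. With three or
two, an averaging argument (`exists_edge_fresh`) finds a matching edge ab with many new colors
towards u, v, x, y, and these force further soft edges or, for t = 2, a direct count on eight
vertices (`card_fresh_le_five`). With one new color throughout, either a matching of t edges cannot
be augmented without that color, or the augmentation reveals a second soft edge
(`Config.card_colors_le_of_common`). -/

namespace AntiRamsey

/-! ### Matchings: augmentation and alternating paths. -/

variable {V : Type*} [DecidableEq V]

/-- `IsMatched G s`: the graph `G` has a matching with vertex set `s`. -/
inductive IsMatched (G : SimpleGraph V) : Finset V → Prop
  | nil : IsMatched G ∅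
  | cons {s : Finset V} {a b : V} : IsMatched G s → a ∉ s → b ∉ s → G.Adj a b →
      IsMatched G (insert a (insert b s))

namespace IsMatched

variable {G : SimpleGraph V}

theorem even_card {s : Finset V} (h : IsMatched G s) : Even s.card := by
  induction h with
  | nil => simp
  | @cons s a b _ ha hb hab ih =>
    have : a ∉ insert b s := by simp [ha, hab.ne]
    rw [Finset.card_insert_of_notMem this, Finset.card_insert_of_notMem hb]
    grind

/-- Every vertex of a matching has a partner, and the pair can be removed. -/
theorem exists_partner {s : Finset V} (h : IsMatched G s) {v : V} (hv : v ∈ s) :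
    ∃ b s', v ∉ s' ∧ b ∉ s' ∧ G.Adj v b ∧ s = insert v (insert b s') ∧ IsMatched G s' := by
  induction h with
  | nil => simp at hv
  | @cons s a b hs ha hb hab ih =>
    by_cases hva : v = a
    · subst hva; exact ⟨b, s, ha, hb, hab, rfl, hs⟩
    by_cases hvb : v = b
    · subst hvb; exact ⟨a, s, hb, ha, hab.symm, Finset.insert_comm _ _ _, hs⟩
    obtain ⟨b', s', h1, h2, h3, h4, h5⟩ := ih (by grind)
    refine ⟨b', insert a (insert b s'), by grind, by grind, h3, by grind, ?_⟩
    exact h5.cons (by grind) (by grind) hab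

/-- A matching that is smaller than another one can be augmented. -/
theorem exists_augment (n : ℕ) : ∀ {S T : Finset V}, S.card ≤ n → IsMatched G S → IsMatched G T →
    S.card < T.card →
    ∃ p q, p ∈ T ∧ p ∉ S ∧ q ∈ T ∧ q ∉ S ∧ p ≠ q ∧ IsMatched G (insert p (insert q S)) := by
  induction n with
  | zero =>
    intro S T hS _ hT hlt
    have hS0 : S = ∅ := by simpa using hS
    subst hS0
    obtain ⟨p, hp⟩ : T.Nonempty := Finset.card_pos.mp (by simpa using hlt)
    obtain ⟨q, T', h1, h2, h3, rfl, -⟩ := hT.exists_partner hp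
    exact ⟨p, q, by grind, by simp, by grind, by simp, h3.ne, nil.cons (by simp) (by simp) h3⟩
  | succ n ih =>
    intro S T hSn hS hT hlt
    obtain ⟨p, hpT, hpS⟩ := Finset.exists_mem_notMem_of_card_lt_card hlt
    obtain ⟨p1, T', h1, h2, h3, hTe, hT'⟩ := hT.exists_partner hpT
    have hp1 := h3.ne
    by_cases hp1S : p1 ∈ S
    · obtain ⟨p2, S', k1, k2, k3, hSe, hS'⟩ := hS.exists_partner hp1S
      have hp2 := k3.ne
      have cT : T.card = T'.card + 2 := by
        rw [hTe, Finset.card_insert_of_notMem (by clear ih; grind), Finset.card_insert_of_notMem h2]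
      have cS : S.card = S'.card + 2 := by
        rw [hSe, Finset.card_insert_of_notMem (by clear ih; grind), Finset.card_insert_of_notMem k2]
      obtain ⟨x, y, hx1, hx2, hy1, hy2, hxy, hM⟩ := ih (S := S') (T := T') (by omega) hS' hT'
        (by omega)
      clear ih
      -- The induction has removed the edge p1 p2 from `S` and p p1 from `T`. If the augmentation
      -- uses p2, it is prolonged through p1 to p; otherwise p1 p2 is put back.
      by_cases hx : x = p2
      · refine ⟨p, y, by grind, hpS, by grind, by grind, by grind, ?_⟩
        have := hM.cons (a := p) (b := p1) (by grind) (by grind) h3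
        convert this using 1; grind
      by_cases hy : y = p2
      · refine ⟨p, x, by grind, hpS, by grind, by grind, by grind, ?_⟩
        have := hM.cons (a := p) (b := p1) (by grind) (by grind) h3
        convert this using 1; grind
      refine ⟨x, y, by grind, by grind, by grind, by grind, hxy, ?_⟩
      have := hM.cons (a := p1) (b := p2) (by grind) (by grind) k3
      convert this using 1; grind
    · exact ⟨p, p1, hpT, hpS, by grind, hp1S, hp1, hS.cons hpS hp1S h3⟩

/-- Exchange along an alternating path that starts in a vertex `w` covered only by `S`. -/
theorem exists_exchange (n : ℕ) : ∀ {S T : Finset V} {w : V}, S.card ≤ n → IsMatched G S →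
    IsMatched G T → w ∈ S → w ∉ T →
    (∃ z ∈ T, z ∉ S ∧ IsMatched G (insert z (S.erase w))) ∨
      ∃ T', IsMatched G T' ∧ T' ⊆ S ∪ T ∧ T'.card = T.card + 2 := by
  induction n with
  | zero =>
    intro S T w hS _ _ hw
    have : S = ∅ := by simpa using hS
    grind
  | succ n ih =>
    intro S T w hSn hS hT hwS hwT
    obtain ⟨w1, S', h1, h2, h3, hSe, hS'⟩ := hS.exists_partner hwS
    have hw1 := h3.ne
    have cS : S.card = S'.card + 2 := by
      rw [hSe, Finset.card_insert_of_notMem (by clear ih; grind), Finset.card_insert_of_notMem h2]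
    -- The alternating path starts with w w1 in `S` and w1 w2 in `T`. If w1 is not covered by `T`,
    -- then `T` is augmented; if w2 is not covered by `S`, the path ends there with z = w2.
    by_cases hw1T : w1 ∈ T
    · obtain ⟨w2, T', k1, k2, k3, hTe, hT'⟩ := hT.exists_partner hw1T
      have hw2 := k3.ne
      have cT : T.card = T'.card + 2 := by
        rw [hTe, Finset.card_insert_of_notMem (by clear ih; grind), Finset.card_insert_of_notMem k2]
      by_cases hw2S : w2 ∈ S
      · have hw2S' : w2 ∈ S' := by clear ih; grind
        rcases ih (S := S') (T := T') (w := w2) (by omega) hS' hT' hw2S' k2 with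
          ⟨z, hz, hzS, hM⟩ | ⟨T'', hM, hsub, hcard⟩ <;> clear ih
        · left
          refine ⟨z, by grind, by grind, ?_⟩
          have := hM.cons (a := w1) (b := w2) (by grind) (by grind) k3
          convert this using 1; grind
        · right
          have hw : w ∉ T'' := fun h => by have := hsub h; grind
          have hw1' : w1 ∉ T'' := fun h => by have := hsub h; grind
          refine ⟨insert w (insert w1 T''), hM.cons hw hw1' h3, by grind, ?_⟩
          rw [Finset.card_insert_of_notMem (by grind), Finset.card_insert_of_notMem hw1']
          omega
      · clear ih
        left
        refine ⟨w2, by grind, hw2S, ?_⟩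
        have := hS'.cons (a := w1) (b := w2) h2 (by grind) k3
        convert this using 1; grind
    · clear ih
      right
      refine ⟨insert w (insert w1 T), hT.cons hwT hw1T h3, by grind, ?_⟩
      rw [Finset.card_insert_of_notMem (by grind), Finset.card_insert_of_notMem hw1T]

end IsMatched

end AntiRamsey

/-! ### The Erdős–Gallai theorem. -/

namespace AntiRamsey

variable {V : Type*} [DecidableEq V]

open Classical in
/-- The ordered pairs of adjacent vertices inside `A`. -/
noncomputable def adjPairs (G : SimpleGraph V) (A : Finset V) : Finset (V × V) :=
  A.offDiag.filter fun p => G.Adj p.1 p.2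

theorem mem_adjPairs {G : SimpleGraph V} {A : Finset V} {p : V × V} :
    p ∈ adjPairs G A ↔ p.1 ∈ A ∧ p.2 ∈ A ∧ G.Adj p.1 p.2 := by
  classical
  simp only [adjPairs, Finset.mem_filter, Finset.mem_offDiag]
  constructor
  · rintro ⟨⟨h1, h2, -⟩, h3⟩; exact ⟨h1, h2, h3⟩
  · rintro ⟨h1, h2, h3⟩; exact ⟨⟨h1, h2, h3.ne⟩, h3⟩

theorem card_adjPairs_le_erase (G : SimpleGraph V) {A : Finset V} {v : V} (hv : v ∈ A) :
    (adjPairs G A).card ≤ (adjPairs G (A.erase v)).card + 2 * (A.card - 1) := by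
  have hsub : adjPairs G A ⊆ adjPairs G (A.erase v) ∪ ((A.erase v).image (fun x => (v, x)) ∪
      (A.erase v).image (fun x => (x, v))) := by
    rintro ⟨a, b⟩ h
    rw [mem_adjPairs] at h
    obtain ⟨h1, h2, h3⟩ := h
    have := h3.ne
    simp only [Finset.mem_union, mem_adjPairs, Finset.mem_image, Finset.mem_erase, Prod.mk.injEq]
    simp only at h1 h2 h3 this
    by_cases ha : a = v
    · right; left; exact ⟨b, ⟨by grind, h2⟩, ha.symm, rfl⟩
    by_cases hb : b = v
    · right; right; exact ⟨a, ⟨by grind, h1⟩, rfl, hb.symm⟩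
    left; exact ⟨⟨ha, h1⟩, ⟨hb, h2⟩, h3⟩
  have h1 := Finset.card_le_card hsub
  have h2 := Finset.card_union_le (adjPairs G (A.erase v))
    ((A.erase v).image (fun x => (v, x)) ∪ (A.erase v).image (fun x => (x, v)))
  have h3 := Finset.card_union_le ((A.erase v).image (fun x => (v, x)))
    ((A.erase v).image (fun x => (x, v)))
  have h4 := Finset.card_image_le (s := A.erase v) (f := fun x => (v, x))
  have h5 := Finset.card_image_le (s := A.erase v) (f := fun x => (x, v))
  have h6 := Finset.card_erase_of_mem hv
  omega

/-- A vertex w of the maximum matching on `s` has at most one neighbor off `s`: an alternating path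
between this matching and a maximum matching missing w frees w at the price of covering one vertex
z, after which a neighbor of w other than z would augment. So there are at most 2m(2m - 1) ordered
pairs inside `s`, 2m in each direction across, and none off `s`. -/
theorem card_adjPairs_le_of_inessential {G : SimpleGraph V} {A s : Finset V} {m : ℕ}
    (hmax : ∀ s ⊆ A, IsMatched G s → s.card ≤ 2 * m)
    (hall : ∀ v ∈ A, ∃ s ⊆ A.erase v, IsMatched G s ∧ 2 * m ≤ s.card)
    (hsA : s ⊆ A) (hs : IsMatched G s) (hcard : s.card = 2 * m) :
    (adjPairs G A).card ≤ 4 * m ^ 2 + 2 * m := by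
  classical
  have key : ∀ w ∈ s, ∀ b ∈ A, ∀ b' ∈ A, b ∉ s → b' ∉ s → G.Adj w b → G.Adj w b' → b = b' := by
    intro w hw b hbA b' hbA' hb hb' hwb hwb'
    by_contra hne
    obtain ⟨T, hTA, hT, hTc⟩ := hall w (hsA hw)
    have hwT : w ∉ T := fun h => by have := hTA h; simp at this
    have hTA' : T ⊆ A := hTA.trans (Finset.erase_subset _ _)
    rcases IsMatched.exists_exchange s.card le_rfl hs hT hw hwT with ⟨z, hz, hzs, hM⟩ | ⟨T', hM, hsub, hc⟩
    · have aux : ∀ b ∈ A, b ∉ s → G.Adj w b → b ≠ z → False := by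
        intro b hbA hb hwb hbz
        have hM' := hM.cons (a := w) (b := b) (by grind) (by grind) hwb
        have hle := hmax _ (by
          have := hTA' hz
          have := hsA hw
          intro x hx
          simp only [Finset.mem_insert, Finset.mem_erase] at hx
          rcases hx with rfl | rfl | rfl | ⟨-, h⟩
          · assumption
          · assumption
          · assumption
          · exact hsA h) hM'
        rw [Finset.card_insert_of_notMem (by grind), Finset.card_insert_of_notMem (by grind),
          Finset.card_insert_of_notMem (by grind), Finset.card_erase_of_mem hw] at hle
        have := Finset.card_pos.mpr ⟨w, hw⟩
        omega
      by_cases hbz : b = z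
      · exact aux b' hbA' hb' hwb' (by grind)
      · exact aux b hbA hb hwb hbz
    · have := hmax T' (hsub.trans (Finset.union_subset hsA hTA')) hM
      omega
  set O := ((adjPairs G A).filter fun p => p.1 ∈ s ∧ p.2 ∉ s) with hO
  set I := ((adjPairs G A).filter fun p => p.1 ∉ s ∧ p.2 ∈ s) with hI
  have hOc : O.card ≤ s.card := by
    refine Finset.card_le_card_of_injOn Prod.fst (fun p hp => ?_) ?_
    · simp [hO] at hp; exact hp.2.1
    · rintro ⟨a, b⟩ h ⟨a', b'⟩ h' heq
      simp only [hO, Finset.coe_filter, mem_adjPairs, Set.mem_ofPred_eq] at h h' heq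
      subst heq
      have := key a h.2.1 b h.1.2.1 b' h'.1.2.1 h.2.2 h'.2.2 h.1.2.2 h'.1.2.2
      rw [this]
  have hIc : I.card ≤ s.card := by
    refine Finset.card_le_card_of_injOn Prod.snd (fun p hp => ?_) ?_
    · simp [hI] at hp; exact hp.2.2
    · rintro ⟨b, a⟩ h ⟨b', a'⟩ h' heq
      simp only [hI, Finset.coe_filter, mem_adjPairs, Set.mem_ofPred_eq] at h h' heq
      subst heq
      have := key a h.2.2 b h.1.1 b' h'.1.1 h.2.1 h'.2.1 h.1.2.2.symm h'.1.2.2.symm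
      rw [this]
  have hsub : adjPairs G A ⊆ s.offDiag ∪ (O ∪ I) := by
    rintro ⟨a, b⟩ h
    have h' := mem_adjPairs.mp h
    simp only at h'
    have hne := h'.2.2.ne
    by_cases ha : a ∈ s <;> by_cases hb : b ∈ s
    · simp [ha, hb, hne]
    · simp [hO, h, ha, hb]
    · simp [hI, h, ha, hb]
    · exfalso
      have := hmax _ (by
        intro x hx
        simp only [Finset.mem_insert] at hx
        rcases hx with rfl | rfl | hx
        · exact h'.1
        · exact h'.2.1
        · exact hsA hx) (hs.cons ha hb h'.2.2)
      rw [Finset.card_insert_of_notMem (by grind), Finset.card_insert_of_notMem hb] at this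
      omega
  have h1 := Finset.card_le_card hsub
  have h2 := Finset.card_union_le s.offDiag (O ∪ I)
  have h3 := Finset.card_union_le O I
  have h4 : s.offDiag.card + s.card = s.card * s.card := by
    rw [Finset.offDiag_card]
    have : s.card ≤ s.card * s.card := Nat.le_mul_self _
    omega
  rw [hcard] at h4
  nlinarith

/-- The Erdős–Gallai theorem on the number of edges of a graph without a matching of `m + 1`
edges, for ordered pairs of adjacent vertices. -/
theorem card_adjPairs_le (G : SimpleGraph V) (n : ℕ) : ∀ (A : Finset V) (m : ℕ), A.card ≤ n →
    (∀ s ⊆ A, IsMatched G s → s.card ≤ 2 * m) →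
    (adjPairs G A).card ≤ 4 * m ^ 2 + 2 * m ∨
      (adjPairs G A).card + m * (m + 1) ≤ 2 * m * A.card := by
  induction n with
  | zero =>
    intro A m hA _
    have : A = ∅ := by simpa using hA
    subst this
    left; simp [adjPairs]
  | succ n ih =>
    intro A m hA hmax
    -- A vertex met by all maximum matchings is deleted, which lowers the matching number. If there
    -- is none, `card_adjPairs_le_of_inessential` applies.
    by_cases hex : ∃ v ∈ A, ∀ s ⊆ A.erase v, IsMatched G s → s.card < 2 * m
    · obtain ⟨v, hv, hlt⟩ := hex
      have hm : 0 < 2 * m := by simpa using hlt ∅ (by simp) .nil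
      obtain ⟨k, rfl⟩ : ∃ k, m = k + 1 := ⟨m - 1, by omega⟩
      have hle := card_adjPairs_le_erase G hv
      have hc := Finset.card_erase_of_mem hv
      have hpos := Finset.card_pos.mpr ⟨v, hv⟩
      have := ih (A.erase v) k (by omega) (fun s hs hM => by
        have h1 := hlt s hs hM
        obtain ⟨j, hj⟩ := hM.even_card
        omega)
      rw [hc] at this
      obtain ⟨N, hN⟩ : ∃ N, A.card = N + 1 := ⟨A.card - 1, by omega⟩
      rw [hN, Nat.add_sub_cancel] at this hle
      rw [hN]
      rcases this with h | h
      -- Putting back `v` adds at most 2N ordered pairs. For N ≤ 4k + 3 the clique bound grows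
      -- enough to absorb them, and for larger N the other bound is the weaker one.
      · by_cases hNk : N ≤ 4 * k + 3
        · left; nlinarith
        · right; push Not at hNk; nlinarith [Nat.mul_le_mul_left k (show 4 * k + 4 ≤ N by omega)]
      · right; nlinarith
    · push Not at hex
      left
      rcases A.eq_empty_or_nonempty with rfl | ⟨v, hv⟩
      · simp [adjPairs]
      obtain ⟨s, hs, hM, hc⟩ := hex v hv
      have hsA := hs.trans (Finset.erase_subset v A)
      exact card_adjPairs_le_of_inessential hmax hex hsA hM (le_antisymm (hmax s hsA hM) hc)

end AntiRamsey

/-! ### Rainbow matchings and rainbow graphs. -/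

namespace AntiRamsey

variable {V : Type*} [DecidableEq V]

/-- The colors that the edge-coloring `c` takes inside `A`. -/
def colors (c : V → V → ℕ) (A : Finset V) : Finset ℕ :=
  A.offDiag.image fun p => c p.1 p.2

theorem mem_colors {c : V → V → ℕ} {A : Finset V} {γ : ℕ} :
    γ ∈ colors c A ↔ ∃ a ∈ A, ∃ b ∈ A, a ≠ b ∧ c a b = γ := by
  simp only [colors, Finset.mem_image, Finset.mem_offDiag, Prod.exists]
  constructor
  · rintro ⟨a, b, ⟨ha, hb, hab⟩, h⟩; exact ⟨a, ha, b, hb, hab, h⟩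
  · rintro ⟨a, ha, b, hb, hab, h⟩; exact ⟨a, b, ⟨ha, hb, hab⟩, h⟩

/-- `IsRainbow G c s C`: the graph `G` has a matching with vertex set `s` whose edges have pairwise
distinct colors under `c`, and the set of these colors is `C`. -/
inductive IsRainbow (G : SimpleGraph V) (c : V → V → ℕ) : Finset V → Finset ℕ → Prop
  | nil : IsRainbow G c ∅ ∅
  | cons {s : Finset V} {C : Finset ℕ} {a b : V} : IsRainbow G c s C → a ∉ s → b ∉ s → G.Adj a b →
      c a b ∉ C → IsRainbow G c (insert a (insert b s)) (insert (c a b) C)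

/-- No two edges of `G` have the same color. -/
def InjOnEdges (G : SimpleGraph V) (c : V → V → ℕ) : Prop :=
  ∀ a b a' b', G.Adj a b → G.Adj a' b' → c a b = c a' b' → (a = a' ∧ b = b') ∨ (a = b' ∧ b = a')

namespace IsRainbow

variable {G : SimpleGraph V} {c : V → V → ℕ} {s : Finset V} {C : Finset ℕ}

theorem isMatched (h : IsRainbow G c s C) : IsMatched G s := by
  induction h with
  | nil => exact .nil
  | cons _ ha hb hab _ ih => exact ih.cons ha hb hab

theorem card_eq (h : IsRainbow G c s C) : s.card = 2 * C.card := by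
  induction h with
  | nil => simp
  | @cons s C a b _ ha hb hab hc ih =>
    have := hab.ne
    rw [Finset.card_insert_of_notMem (by simp [ha, this]), Finset.card_insert_of_notMem hb,
      Finset.card_insert_of_notMem hc]
    omega

theorem mono {G' : SimpleGraph V} (h : IsRainbow G c s C) (hG : ∀ a b, G.Adj a b → G'.Adj a b) :
    IsRainbow G' c s C := by
  induction h with
  | nil => exact .nil
  | cons _ ha hb hab hc ih => exact ih.cons ha hb (hG _ _ hab) hc

theorem top (h : IsRainbow G c s C) : IsRainbow ⊤ c s C :=
  h.mono fun _ _ hab => hab.ne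

theorem add {a b : V} (h : IsRainbow ⊤ c s C) (ha : a ∉ s) (hb : b ∉ s) (hab : a ≠ b)
    (hc : c a b ∉ C) : IsRainbow ⊤ c (insert a (insert b s)) (insert (c a b) C) :=
  h.cons ha hb hab hc

theorem pair {a b : V} (hab : a ≠ b) : IsRainbow ⊤ c {a, b} {c a b} := by
  have := (nil (G := ⊤) (c := c)).add (a := a) (b := b) (by simp) (by simp) hab (by simp)
  simpa using this

theorem union {s' : Finset V} {C' : Finset ℕ} (h : IsRainbow G c s C) (h' : IsRainbow G c s' C')
    (hs : Disjoint s s') (hC : Disjoint C C') : IsRainbow G c (s ∪ s') (C ∪ C') := by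
  induction h with
  | nil => simpa using h'
  | @cons s C a b _ ha hb hab hc ih =>
    rw [Finset.disjoint_insert_left, Finset.disjoint_insert_left] at hs
    rw [Finset.disjoint_insert_left] at hC
    have := (ih hs.2.2 hC.2).cons (a := a) (b := b) (by simp [ha, hs.1]) (by simp [hb, hs.2.1]) hab
      (by simp [hc, hC.1])
    simpa [Finset.insert_union] using this

/-- The edge of a given color can be removed from a rainbow matching. -/
theorem exists_edge (h : IsRainbow G c s C) {γ : ℕ} (hγ : γ ∈ C) :
    ∃ a b s', a ∉ s' ∧ b ∉ s' ∧ G.Adj a b ∧ c a b = γ ∧ s = insert a (insert b s') ∧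
      IsRainbow G c s' (C.erase γ) := by
  induction h with
  | nil => simp at hγ
  | @cons s C a b hs ha hb hab hc ih =>
    by_cases hγ' : γ = c a b
    · subst hγ'
      exact ⟨a, b, s, ha, hb, hab, rfl, rfl, by rwa [Finset.erase_insert hc]⟩
    · obtain ⟨x, y, s', h1, h2, h3, h4, h5, h6⟩ := ih (by grind)
      refine ⟨x, y, insert a (insert b s'), by grind, by grind, h3, h4, by grind, ?_⟩
      have := h6.cons (a := a) (b := b) (by grind) (by grind) hab (by grind)
      convert this using 1
      grind

/-- The edge at a given vertex can be removed from a rainbow matching. -/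
theorem exists_partner (hc : ∀ a b, c a b = c b a) (h : IsRainbow G c s C) {v : V} (hv : v ∈ s) :
    ∃ b s', v ∉ s' ∧ b ∉ s' ∧ G.Adj v b ∧ c v b ∈ C ∧ s = insert v (insert b s') ∧
      IsRainbow G c s' (C.erase (c v b)) := by
  induction h with
  | nil => simp at hv
  | @cons s C a b hs ha hb hab hcab ih =>
    by_cases hva : v = a
    · subst hva
      exact ⟨b, s, ha, hb, hab, by simp, rfl, by rwa [Finset.erase_insert hcab]⟩
    by_cases hvb : v = b
    · subst hvb
      exact ⟨a, s, hb, ha, hab.symm, by simp [hc v a], Finset.insert_comm _ _ _, by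
        rwa [hc v a, Finset.erase_insert hcab]⟩
    obtain ⟨y, s', h1, h2, h3, h4, h5, h6⟩ := ih (by grind)
    refine ⟨y, insert a (insert b s'), by grind, by grind, h3, by grind, by grind, ?_⟩
    have := h6.cons (a := a) (b := b) (by grind) (by grind) hab (by grind)
    convert this using 1
    grind

theorem subset_colors (h : IsRainbow G c s C) {A : Finset V} (hs : s ⊆ A) : C ⊆ colors c A := by
  intro γ hγ
  obtain ⟨a, b, s', -, -, h3, h4, rfl, -⟩ := h.exists_edge hγ
  exact mem_colors.mpr ⟨a, hs (by simp), b, hs (by simp), h3.ne, h4⟩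

theorem of_isMatched (hG : InjOnEdges G c) (h : IsMatched G s) : ∃ C, IsRainbow G c s C := by
  induction h with
  | nil => exact ⟨∅, nil⟩
  | @cons s a b _ ha hb hab ih =>
    obtain ⟨C, hC⟩ := ih
    refine ⟨_, hC.cons ha hb hab fun hmem => ?_⟩
    obtain ⟨x, y, s', -, -, h3, h4, rfl, -⟩ := hC.exists_edge hmem
    rcases hG _ _ _ _ hab h3 h4.symm with ⟨rfl, rfl⟩ | ⟨rfl, rfl⟩ <;> simp at ha

/-- If each edge `ab` of a rainbow matching carries at most `k` elements of `X a ∪ X b`, then there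
are at most `k` per edge in total. -/
theorem card_biUnion_le {X : V → Finset ℕ} {k : ℕ} (h : IsRainbow G c s C)
    (hX : ∀ a b s', a ∉ s' → b ∉ s' → G.Adj a b → c a b ∈ C → s = insert a (insert b s') →
      IsRainbow G c s' (C.erase (c a b)) → (X a ∪ X b).card ≤ k) :
    (s.biUnion X).card ≤ k * C.card := by
  induction h with
  | nil => simp
  | @cons s C a b hs ha hb hab hc ih =>
    have h1 := ih (by
      intro x y s' hx hy hxy hxyC he hs'
      subst he
      simp only [Finset.mem_insert, not_or] at ha hb
      have hne : c a b ≠ c x y := fun e => hc (e ▸ hxyC)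
      refine hX x y (insert a (insert b s')) (by simp; tauto) (by simp; tauto) hxy
        (by simp [hxyC]) (by ext z; simp; tauto) ?_
      rw [Finset.erase_insert_of_ne hne]
      exact hs'.cons ha.2.2 hb.2.2 hab (by simp [hc]))
    have h2 := hX a b s ha hb hab (by simp) rfl (by rwa [Finset.erase_insert hc])
    rw [Finset.biUnion_insert, Finset.biUnion_insert, ← Finset.union_assoc,
      Finset.card_insert_of_notMem hc]
    calc _ ≤ (X a ∪ X b).card + (s.biUnion X).card := Finset.card_union_le _ _
      _ ≤ _ := by nlinarith

/-- The edges of a rainbow matching as a graph. -/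
theorem exists_graph (hc : ∀ a b, c a b = c b a) (h : IsRainbow ⊤ c s C) :
    ∃ G, IsRainbow G c s C ∧ InjOnEdges G c ∧ ∀ a b, G.Adj a b → a ∈ s ∧ b ∈ s ∧ c a b ∈ C := by
  induction h with
  | nil => exact ⟨⊥, nil, by simp [InjOnEdges], by simp⟩
  | @cons s C a b hs ha hb hab hcab ih =>
    obtain ⟨G, h1, h2, h3⟩ := ih
    have hab' : a ≠ b := hab
    let G' : SimpleGraph V := G ⊔ SimpleGraph.edge a b
    have hG' : ∀ x y, G'.Adj x y ↔ G.Adj x y ∨ (x = a ∧ y = b) ∨ (x = b ∧ y = a) := by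
      intro x y
      simp only [G', SimpleGraph.sup_adj, SimpleGraph.edge_adj]
      grind
    refine ⟨G', (h1.mono fun x y h => (hG' x y).mpr (.inl h)).cons ha hb
      ((hG' a b).mpr (by simp)) hcab, ?_, ?_⟩
    · intro x y x' y' hxy hxy' heq
      rw [hG'] at hxy hxy'
      have e1 := h3 x y
      have e2 := h3 x' y'
      have e3 := h2 x y x' y'
      have e4 := hc a b
      grind
    · intro x y hxy
      rw [hG'] at hxy
      have := h3 x y
      have := hc a b
      grind

/-- A graph that contains a given rainbow matching and one edge of each of the remaining colors
inside `A` that are not in `D`. -/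
theorem exists_rep (hc : ∀ a b, c a b = c b a) (h : IsRainbow ⊤ c s C) (A : Finset V)
    {D : Finset ℕ} (hD : Disjoint C D) :
    ∃ G, IsRainbow G c s C ∧ InjOnEdges G c ∧ (∀ a b, G.Adj a b → c a b ∉ D) ∧
      ∀ γ ∈ colors c A, γ ∉ D → γ ∉ C → ∃ a ∈ A, ∃ b ∈ A, G.Adj a b ∧ c a b = γ := by
  obtain ⟨G, h1, h2, h3⟩ := h.exists_graph hc
  choose f hfA g hgA hne hfg using fun γ (hγ : γ ∈ colors c A) => mem_colors.mp hγ
  have hfc : ∀ γ γ' h h', γ = γ' → f γ h = f γ' h' ∧ g γ h = g γ' h' := by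
    rintro _ _ _ _ rfl; exact ⟨rfl, rfl⟩
  -- The relation holds for the chosen representative edge of its color, provided that this color is
  -- neither forbidden nor already used by the matching.
  let r : V → V → Prop := fun a b =>
    c a b ∉ D ∧ c a b ∉ C ∧ ∃ hγ : c a b ∈ colors c A, f _ hγ = a ∧ g _ hγ = b
  have hr : ∀ a b, r a b → a ∈ A ∧ b ∈ A ∧ a ≠ b ∧ c a b ∉ D ∧ c a b ∉ C := by
    rintro a b ⟨h4, h5, hγ, e1, e2⟩
    have k1 := hfA _ hγ
    have k2 := hgA _ hγ
    have k3 := hne _ hγ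
    rw [e1] at k1 k3; rw [e2] at k2 k3
    exact ⟨k1, k2, k3, h4, h5⟩
  have hr2 : ∀ a b a' b', r a b → r a' b' → c a b = c a' b' → a = a' ∧ b = b' := by
    rintro a b a' b' ⟨-, -, hγ, e1, e2⟩ ⟨-, -, hγ', e1', e2'⟩ he
    obtain ⟨k1, k2⟩ := hfc _ _ hγ hγ' he
    exact ⟨by rw [← e1, ← e1', k1], by rw [← e2, ← e2', k2]⟩
  let G' : SimpleGraph V := G ⊔ SimpleGraph.fromRel r
  have hG' : ∀ x y, G'.Adj x y ↔ G.Adj x y ∨ r x y ∨ r y x := by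
    intro x y
    simp only [G', SimpleGraph.sup_adj, SimpleGraph.fromRel_adj]
    constructor
    · rintro (h | ⟨-, h⟩)
      exacts [.inl h, .inr h]
    · rintro (h | h | h)
      exacts [.inl h, .inr ⟨(hr _ _ h).2.2.1, .inl h⟩, .inr ⟨(hr _ _ h).2.2.1.symm, .inr h⟩]
  refine ⟨G', h1.mono fun x y h => (hG' x y).mpr (.inl h), ?_, ?_, ?_⟩
  · have aux : ∀ x y x' y', G.Adj x y → (r x' y' ∨ r y' x') → c x y ≠ c x' y' := by
      intro x y x' y' hxy hxy' he
      rcases hxy' with h | h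
      · exact (hr _ _ h).2.2.2.2 (he ▸ (h3 _ _ hxy).2.2)
      · exact (hr _ _ h).2.2.2.2 (hc x' y' ▸ he ▸ (h3 _ _ hxy).2.2)
    intro x y x' y' hxy hxy' he
    rw [hG'] at hxy hxy'
    rcases hxy with hxy | hxy <;> rcases hxy' with hxy' | hxy'
    · exact h2 _ _ _ _ hxy hxy' he
    · exact absurd he (aux _ _ _ _ hxy hxy')
    · exact absurd he.symm (aux _ _ _ _ hxy' hxy)
    · rcases hxy with hxy | hxy <;> rcases hxy' with hxy' | hxy'
      · exact .inl (hr2 _ _ _ _ hxy hxy' he)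
      · obtain ⟨e1, e2⟩ := hr2 _ _ _ _ hxy hxy' (by rw [he, hc])
        exact .inr ⟨e1, e2⟩
      · obtain ⟨e1, e2⟩ := hr2 _ _ _ _ hxy hxy' (by rw [← he, hc])
        exact .inr ⟨e2, e1⟩
      · obtain ⟨e1, e2⟩ := hr2 _ _ _ _ hxy hxy' (by rw [hc, he, hc])
        exact .inl ⟨e2, e1⟩
  · intro a b hab
    rw [hG'] at hab
    rcases hab with hab | hab | hab
    · exact Finset.disjoint_left.mp hD (h3 _ _ hab).2.2
    · exact (hr _ _ hab).2.2.2.1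
    · rw [hc]; exact (hr _ _ hab).2.2.2.1
  · intro γ hγ hγD hγC
    refine ⟨f γ hγ, hfA γ hγ, g γ hγ, hgA γ hγ, (hG' _ _).mpr (.inr (.inl ?_)), hfg γ hγ⟩
    have e := hfg γ hγ
    exact ⟨by rwa [e], by rwa [e], by rwa [e], (hfc _ _ _ _ e).1, (hfc _ _ _ _ e).2⟩

/-- Let `cd` be a pair of vertices and let two disjoint rainbow matchings without common colors
have `m` edges altogether. If there is no rainbow matching with `m + 2` edges, then between `cd` and
each edge of the first matching there are at most two further colors. -/
theorem card_biUnion_fresh_le {m : ℕ}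
    (hno : ∀ s C, IsRainbow ⊤ c s C → C.card < m + 1)
    (h : IsRainbow ⊤ c s C) {E : Finset V} {D : Finset ℕ} (hE : IsRainbow ⊤ c E D)
    (hsE : Disjoint s E) (hCD : Disjoint C D) (hm : C.card + D.card = m) {x y : V} (hxy : x ≠ y)
    (hx : x ∉ s ∪ E) (hy : y ∉ s ∪ E) :
    (s.biUnion fun h => ({c x h, c y h} : Finset ℕ) \ (C ∪ D)).card ≤ 2 * C.card := by
  refine h.card_biUnion_le fun a b s' ha hb hab hγ he hs' => ?_
  have hab' : a ≠ b := hab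
  subst he
  -- If xp and yq had distinct new colors, they could replace the edge ab and enlarge the matching.
  -- So both ways of joining xy to ab disjointly contribute at most one new color.
  have key : ∀ p q, ((p = a ∧ q = b) ∨ (p = b ∧ q = a)) → c x p ∉ C ∪ D → c y q ∉ C ∪ D →
      c x p = c y q := by
    intro p q hpq h1 h2
    by_contra hne
    have hu := hs'.union hE (by
      rw [Finset.disjoint_left] at hsE ⊢
      intro z hz; exact hsE (by simp [hz])) (by
      rw [Finset.disjoint_left] at hCD ⊢
      intro z hz; exact hCD (Finset.mem_of_mem_erase hz))
    have haE : a ∉ E := Finset.disjoint_left.mp hsE (by simp)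
    have hbE : b ∉ E := Finset.disjoint_left.mp hsE (by simp)
    simp only [Finset.mem_union, Finset.mem_insert, not_or] at hx hy h1 h2
    have hp : p ∉ s' ∪ E ∧ q ∉ s' ∪ E ∧ p ≠ q ∧ x ≠ p ∧ x ≠ q ∧ y ≠ p ∧ y ≠ q := by
      rcases hpq with ⟨rfl, rfl⟩ | ⟨rfl, rfl⟩ <;> simp [*] <;> tauto
    have h3 := (hu.add (a := x) (b := p) (by simp; tauto) hp.1 hp.2.2.2.1 (by
      simp; tauto)).add (a := y) (b := q) (by simp; tauto) (by
        have := hp.2.1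
        simp only [Finset.mem_insert, not_or]; grind) hp.2.2.2.2.2.2 (by
        simp; exact ⟨fun e => hne e.symm, by tauto⟩)
    have h4 := hno _ _ h3
    rw [Finset.card_insert_of_notMem (by simp; exact ⟨fun e => hne e.symm, by tauto⟩),
      Finset.card_insert_of_notMem (by simp; tauto), Finset.card_union_of_disjoint (by
      rw [Finset.disjoint_left] at hCD ⊢
      intro z hz; exact hCD (Finset.mem_of_mem_erase hz)), Finset.card_erase_of_mem hγ] at h4
    have := Finset.card_pos.mpr ⟨_, hγ⟩
    omega
  have k1 := key a b (by simp)
  have k2 := key b a (by simp)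
  rw [← Finset.union_sdiff_distrib]
  by_cases e1 : c x a ∈ C ∪ D <;> by_cases e2 : c y b ∈ C ∪ D <;> by_cases e3 : c x b ∈ C ∪ D <;>
    by_cases e4 : c y a ∈ C ∪ D <;>
    first
    | exact (Finset.card_le_card (t := {c x a, c x b}) (fun z hz => by grind)).trans
        Finset.card_le_two
    | exact (Finset.card_le_card (t := {c x a, c y a}) (fun z hz => by grind)).trans
        Finset.card_le_two
    | exact (Finset.card_le_card (t := {c y b, c x b}) (fun z hz => by grind)).trans
        Finset.card_le_two
    | exact (Finset.card_le_card (t := {c y b, c y a}) (fun z hz => by grind)).trans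
        Finset.card_le_two

end IsRainbow

theorem card_le_adjPairs {G : SimpleGraph V} {c : V → V → ℕ} (hc : ∀ a b, c a b = c b a)
    {A : Finset V} {F : Finset ℕ}
    (hF : ∀ γ ∈ F, ∃ a ∈ A, ∃ b ∈ A, G.Adj a b ∧ c a b = γ) : 2 * F.card ≤ (adjPairs G A).card := by
  refine (Finset.mul_card_image_le_card_of_maps_to (s := (adjPairs G A).filter
    fun p => c p.1 p.2 ∈ F) (t := F) (f := fun p => c p.1 p.2) (by simp) 2 fun γ hγ => ?_).trans
    (Finset.card_filter_le _ _)
  obtain ⟨a, ha, b, hb, hab, rfl⟩ := hF γ hγ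
  have : ({(a, b), (b, a)} : Finset (V × V)).card = 2 := Finset.card_pair (by simp [hab.ne])
  rw [← this]
  refine Finset.card_le_card fun p hp => ?_
  simp only [Finset.mem_insert, Finset.mem_singleton] at hp
  rcases hp with rfl | rfl
  · simp [mem_adjPairs, ha, hb, hab, hγ]
  · simp [mem_adjPairs, ha, hb, hab.symm, hγ, hc b a]

/-- The Erdős–Gallai theorem in terms of colors. -/
theorem card_colors_le (c : V → V → ℕ) (hc : ∀ a b, c a b = c b a) (A : Finset V) (D : Finset ℕ)
    (m : ℕ) (h : ∀ s C, IsRainbow ⊤ c s C → s ⊆ A → Disjoint C D → C.card ≤ m) :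
    (colors c A \ D).card ≤ 2 * m ^ 2 + m ∨
      2 * (colors c A \ D).card + m * (m + 1) ≤ 2 * m * A.card := by
  obtain ⟨G, -, h2, h3, h4⟩ := (IsRainbow.nil (G := ⊤) (c := c)).exists_rep hc A (D := D) (by simp)
  have h5 := card_le_adjPairs (G := G) hc (A := A) (F := colors c A \ D) (fun γ hγ => by
    rw [Finset.mem_sdiff] at hγ
    exact h4 γ hγ.1 hγ.2 (by simp))
  have := card_adjPairs_le G A.card A m le_rfl (fun s hs hM => by
    obtain ⟨C, hC⟩ := IsRainbow.of_isMatched h2 hM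
    have := h s C hC.top hs (Finset.disjoint_left.mpr fun γ hγ => by
      obtain ⟨a, b, _, _, _, hab, rfl, _⟩ := hC.exists_edge hγ
      exact h3 a b hab)
    rw [hC.card_eq]; omega)
  omega

end AntiRamsey

/-! ### New colors at a free pair of vertices. -/

namespace AntiRamsey

variable {V : Type*} [DecidableEq V]

/-- The colors outside `X` of the edges between `{x, y}` and `s`. -/
def fresh (c : V → V → ℕ) (X : Finset ℕ) (x y : V) (s : Finset V) : Finset ℕ :=
  s.biUnion fun h => ({c x h, c y h} : Finset ℕ) \ X

theorem left_mem_or_fresh {c : V → V → ℕ} (X : Finset ℕ) (x y : V) {s : Finset V} {h : V}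
    (hs : h ∈ s) : c x h ∈ X ∨ c x h ∈ fresh c X x y s := by
  by_cases hX : c x h ∈ X
  · exact .inl hX
  · exact .inr (Finset.mem_biUnion.mpr ⟨h, hs, by simp [hX]⟩)

theorem right_mem_or_fresh {c : V → V → ℕ} (X : Finset ℕ) (x y : V) {s : Finset V} {h : V}
    (hs : h ∈ s) : c y h ∈ X ∨ c y h ∈ fresh c X x y s := by
  by_cases hX : c y h ∈ X
  · exact .inl hX
  · exact .inr (Finset.mem_biUnion.mpr ⟨h, hs, by simp [hX]⟩)

/-- There is no rainbow matching with more than `m` edges. -/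
def NoRainbow (c : V → V → ℕ) (m : ℕ) : Prop :=
  ∀ s C, IsRainbow ⊤ c s C → C.card < m + 1

theorem card_fresh_le {c : V → V → ℕ} {m : ℕ} (hno : NoRainbow c m) {s E : Finset V}
    {C D : Finset ℕ} (h : IsRainbow ⊤ c s C) (hE : IsRainbow ⊤ c E D) (hsE : Disjoint s E)
    (hCD : Disjoint C D) (hm : C.card + D.card = m) {x y : V} (hxy : x ≠ y) (hx : x ∉ s ∪ E)
    (hy : y ∉ s ∪ E) {X : Finset ℕ} (hX : C ∪ D ⊆ X) : (fresh c X x y s).card ≤ 2 * C.card := by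
  refine (Finset.card_le_card ?_).trans
    (IsRainbow.card_biUnion_fresh_le hno h hE hsE hCD hm hxy hx hy)
  exact Finset.biUnion_mono fun h _ => Finset.sdiff_subset_sdiff le_rfl hX

theorem card_sdiff_le_two {X : Finset ℕ} {p p' q q' : ℕ} (hp : p ∉ X → p' ∉ X → p = p')
    (hq : q ∉ X → q' ∉ X → q = q') : (({p, p', q, q'} : Finset ℕ) \ X).card ≤ 2 := by
  by_cases e1 : p ∈ X <;> by_cases e2 : p' ∈ X <;> by_cases e3 : q ∈ X <;> by_cases e4 : q' ∈ X <;>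
  first
  | exact (Finset.card_le_card (t := {p, q}) (fun z hz => by grind)).trans Finset.card_le_two
  | exact (Finset.card_le_card (t := {p, q'}) (fun z hz => by grind)).trans Finset.card_le_two
  | exact (Finset.card_le_card (t := {p', q}) (fun z hz => by grind)).trans Finset.card_le_two
  | exact (Finset.card_le_card (t := {p', q'}) (fun z hz => by grind)).trans Finset.card_le_two

section extend

variable {c : V → V → ℕ} {m : ℕ} {s : Finset V} {C : Finset ℕ}

/-- In this and the following lemmas k disjoint edges off a rainbow matching with m + 1 - k edges
are considered. They cannot all have new and distinct colors. -/
theorem NoRainbow.mem_of_add_one (hno : NoRainbow c m) (h : IsRainbow ⊤ c s C) (hm : C.card = m)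
    {a b : V} (ha : a ∉ s) (hb : b ∉ s) (hab : a ≠ b) : c a b ∈ C := by
  by_contra hc
  have := hno _ _ (h.add ha hb hab hc)
  rw [Finset.card_insert_of_notMem hc] at this
  omega

theorem NoRainbow.eq_of_add_two (hno : NoRainbow c m) (h : IsRainbow ⊤ c s C) (hm : C.card + 1 = m)
    {a b d e : V} (hs : a ∉ s ∧ b ∉ s ∧ d ∉ s ∧ e ∉ s) (hnd : [a, b, d, e].Nodup)
    (h1 : c a b ∉ C) (h2 : c d e ∉ C) : c a b = c d e := by
  by_contra hne
  simp only [List.nodup_cons, List.mem_cons, not_or, List.not_mem_nil, not_false_eq_true,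
    List.nodup_nil, and_true] at hnd
  have h' := h.add hs.1 hs.2.1 (by grind) h1
  have := hno.mem_of_add_one h' (by rw [Finset.card_insert_of_notMem h1]; omega) (a := d) (b := e)
    (by simp; grind) (by simp; grind) (by grind)
  rw [Finset.mem_insert] at this
  grind

theorem NoRainbow.false_of_add_three (hno : NoRainbow c m) (h : IsRainbow ⊤ c s C)
    (hm : C.card + 2 = m) {a b d e f g : V}
    (hs : a ∉ s ∧ b ∉ s ∧ d ∉ s ∧ e ∉ s ∧ f ∉ s ∧ g ∉ s) (hnd : [a, b, d, e, f, g].Nodup)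
    (h1 : c a b ∉ C) (h2 : c d e ∉ C) (h3 : c f g ∉ C) (h12 : c a b ≠ c d e) (h13 : c a b ≠ c f g)
    (h23 : c d e ≠ c f g) : False := by
  simp only [List.nodup_cons, List.mem_cons, not_or, List.not_mem_nil, not_false_eq_true,
    List.nodup_nil, and_true] at hnd
  have h' := h.add hs.1 hs.2.1 (by grind) h1
  exact h23 (hno.eq_of_add_two h' (by rw [Finset.card_insert_of_notMem h1]; omega)
    (by simp; grind) (by simp; grind) (by simp; grind) (by simp; grind))

theorem NoRainbow.false_of_add_four (hno : NoRainbow c m) (h : IsRainbow ⊤ c s C)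
    (hm : C.card + 3 = m) {a b d e f g k l : V}
    (hs : a ∉ s ∧ b ∉ s ∧ d ∉ s ∧ e ∉ s ∧ f ∉ s ∧ g ∉ s ∧ k ∉ s ∧ l ∉ s)
    (hnd : [a, b, d, e, f, g, k, l].Nodup)
    (h1 : c a b ∉ C) (h2 : c d e ∉ C) (h3 : c f g ∉ C) (h4 : c k l ∉ C)
    (hcd : [c a b, c d e, c f g, c k l].Nodup) : False := by
  simp only [List.nodup_cons, List.mem_cons, not_or, List.not_mem_nil, not_false_eq_true,
    List.nodup_nil, and_true] at hnd hcd
  have h' := h.add hs.1 hs.2.1 (by grind) h1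
  exact hno.false_of_add_three h' (by rw [Finset.card_insert_of_notMem h1]; omega)
    (a := d) (b := e) (d := f) (e := g) (f := k) (g := l)
    (by simp; grind) (by simp; grind) (by simp; grind) (by simp; grind) (by simp; grind)
    (by grind) (by grind) (by grind)

end extend

section bounds

variable [Fintype V] {c : V → V → ℕ} {m : ℕ}

/-- If a rainbow matching avoiding the colors `D` cannot be augmented by two vertices, then there
are few colors outside `D`. -/
theorem card_colors_sdiff_le_of_no_augment (hc : ∀ a b, c a b = c b a) {s : Finset V}
    {C D : Finset ℕ} (h : IsRainbow ⊤ c s C) (hD : Disjoint C D)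
    (hno : ∀ p q C', p ∉ s → q ∉ s → p ≠ q → IsRainbow ⊤ c (insert p (insert q s)) C' →
      Disjoint C' D → False) :
    (colors c Finset.univ \ D).card ≤ 2 * C.card ^ 2 + C.card ∨
      2 * (colors c Finset.univ \ D).card + C.card * (C.card + 1) ≤
        2 * C.card * Fintype.card V := by
  obtain ⟨G, h1, h2, h3, h4⟩ := h.exists_rep hc Finset.univ hD
  have h5 := card_le_adjPairs (G := G) hc (A := Finset.univ) (F := colors c Finset.univ \ D)
    (fun γ hγ => by
      rw [Finset.mem_sdiff] at hγ
      by_cases hγC : γ ∈ C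
      · obtain ⟨a, b, _, _, _, hab, he, -⟩ := h1.exists_edge hγC
        exact ⟨a, Finset.mem_univ _, b, Finset.mem_univ _, hab, he⟩
      · exact h4 γ hγ.1 hγ.2 hγC)
  have := card_adjPairs_le G (Finset.univ : Finset V).card Finset.univ C.card le_rfl
    -- A larger matching of the rainbow graph would augment the given one to a matching covering `s`
    -- and two more vertices, and any matching of this graph is rainbow and avoids `D`.
    (fun S _ hM => by
      by_contra hlt
      obtain ⟨p, q, -, hp, -, hq, hpq, hM'⟩ := IsMatched.exists_augment s.card le_rfl h1.isMatched hM
        (by rw [h1.card_eq]; omega)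
      obtain ⟨C', hC'⟩ := IsRainbow.of_isMatched h2 hM'
      exact hno p q C' hp hq hpq hC'.top (Finset.disjoint_left.mpr fun γ hγ => by
        obtain ⟨a, b, _, _, _, hab, rfl, _⟩ := hC'.exists_edge hγ
        exact h3 a b hab))
  rw [Finset.card_univ] at this
  omega

/-- Deleting the vertices of the rainbow matching `S` loses only the colors `D` and `Y`. -/
theorem exists_card_colors_le (hc : ∀ a b, c a b = c b a) (hno : NoRainbow c m)
    {s S : Finset V} {C D Y : Finset ℕ} (h : IsRainbow ⊤ c s C) (hS : IsRainbow ⊤ c S D)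
    (hsS : Disjoint s S) (hY : ∀ p ∈ S, ∀ q, q ≠ p → c p q ∈ C ∪ D ∪ Y) {j : ℕ}
    (hj : j + D.card = m) :
    ∃ k, (colors c Finset.univ).card ≤ D.card + Y.card + k ∧
      (k ≤ 2 * j ^ 2 + j ∨ 2 * k + j * (j + 1) ≤ 2 * j * (Fintype.card V - S.card)) := by
  refine ⟨(colors c (Finset.univ \ S) \ D).card, ?_, ?_⟩
  · have hsub : colors c Finset.univ ⊆ (D ∪ Y) ∪ (colors c (Finset.univ \ S) \ D) := by
      intro γ hγ
      by_cases hγD : γ ∈ D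
      · simp [hγD]
      have hC : C ⊆ colors c (Finset.univ \ S) := h.subset_colors fun x hx => by
        simpa using Finset.disjoint_left.mp hsS hx
      obtain ⟨a, -, b, -, hab, rfl⟩ := mem_colors.mp hγ
      by_cases ha : a ∈ S
      · have := hY a ha b hab.symm
        simp only [Finset.mem_union] at this
        rcases this with (h | h) | h
        · have := hC h; simp [this, hγD]
        · simp [h]
        · simp [h]
      by_cases hb : b ∈ S
      · have := hY b hb a hab
        rw [hc] at this
        simp only [Finset.mem_union] at this
        rcases this with (h | h) | h
        · have := hC h; simp [this, hγD]
        · simp [h]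
        · simp [h]
      have : c a b ∈ colors c (Finset.univ \ S) :=
        mem_colors.mpr ⟨a, by simpa using ha, b, by simpa using hb, hab, rfl⟩
      simp [this, hγD]
    have h1 := Finset.card_le_card hsub
    have h2 := Finset.card_union_le (D ∪ Y) (colors c (Finset.univ \ S) \ D)
    have h3 := Finset.card_union_le D Y
    omega
  -- A rainbow matching off `S` without colors of `D` can be united with the matching on `S`, so it
  -- has at most m - |D| edges.
  · have := card_colors_le c hc (Finset.univ \ S) D j (fun s' C' h' hs' hCD => by
      have := hno _ _ (h'.union hS (Finset.disjoint_left.mpr fun x hx => by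
        have := hs' hx; simpa using this) hCD)
      rw [Finset.card_union_of_disjoint hCD] at this
      omega)
    rwa [Finset.card_sdiff_of_subset (Finset.subset_univ _), Finset.card_univ] at this

end bounds

end AntiRamsey

/-! ### Soft edges. -/

namespace AntiRamsey

variable {V : Type*} [DecidableEq V]

/-- A rainbow matching and two disjoint edges `uv` and `xy` of the same new color outside of it. -/
structure Config (c : V → V → ℕ) (s : Finset V) (C : Finset ℕ) (u v x y : V) : Prop where
  rainbow : IsRainbow ⊤ c s C
  notMem : u ∉ s ∧ v ∉ s ∧ x ∉ s ∧ y ∉ s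
  nodup : [u, v, x, y].Nodup
  new : c u v ∉ C
  eq : c x y = c u v

namespace Config

variable {c : V → V → ℕ} {s : Finset V} {C : Finset ℕ} {u v x y : V}

theorem symm (k : Config c s C u v x y) : Config c s C x y u v :=
  ⟨k.rainbow, by have := k.notMem; tauto, by have := k.nodup; grind, by rw [k.eq]; exact k.new,
    k.eq.symm⟩

theorem swap (hc : ∀ a b, c a b = c b a) (k : Config c s C u v x y) : Config c s C v u x y :=
  ⟨k.rainbow, by have := k.notMem; tauto, by have := k.nodup; grind, by rw [hc]; exact k.new,
    by rw [k.eq, hc]⟩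

theorem swap_right (hc : ∀ a b, c a b = c b a) (k : Config c s C u v x y) : Config c s C u v y x :=
  (k.symm.swap hc).symm

theorem ne (k : Config c s C u v x y) : u ≠ v ∧ u ≠ x ∧ u ≠ y ∧ v ≠ x ∧ v ≠ y ∧ x ≠ y := by
  have := k.nodup
  simp only [List.nodup_cons, List.mem_cons, not_or, List.not_mem_nil, not_false_eq_true,
    List.nodup_nil, and_true] at this
  tauto

theorem add_left (k : Config c s C u v x y) :
    IsRainbow ⊤ c (insert u (insert v s)) (insert (c u v) C) :=
  k.rainbow.add k.notMem.1 k.notMem.2.1 k.ne.1 k.new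

theorem add_right (k : Config c s C u v x y) :
    IsRainbow ⊤ c (insert x (insert y s)) (insert (c u v) C) := by
  simpa [k.eq] using k.symm.add_left

variable {t : ℕ}

/-- Since xy carries the color of uv, the vertices u and v are free next to the rainbow matching
with t + 1 edges that consists of the given one and xy. Only the edges of the part on `s'` are
exchanged; the other part just stays in the matching, so that the colors towards it can be counted
elsewhere. -/
theorem card_fresh_le (hno : NoRainbow c (t + 1)) (k : Config c s C u v x y) (hC : C.card = t)
    {s' s'' : Finset V} {C' C'' : Finset ℕ} (h' : IsRainbow ⊤ c s' C') (h'' : IsRainbow ⊤ c s'' C'')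
    (hs : Disjoint s' s'') (hCC : Disjoint C' C'') (he : s' ∪ s'' = s) (he' : C' ∪ C'' = C)
    {X : Finset ℕ} (hX : insert (c u v) C ⊆ X) : (fresh c X u v s').card ≤ 2 * C'.card := by
  obtain ⟨k1, k2, k3, k4⟩ := k.notMem
  obtain ⟨n1, n2, n3, n4, n5, n6⟩ := k.ne
  have k5 := k.new
  have k6 := k.eq
  subst he he'
  simp only [Finset.mem_union, not_or] at k1 k2 k3 k4 k5
  have h3 := h''.add (a := x) (b := y) k3.2 k4.2 n6 (by rw [k6]; exact k5.2)
  have hd : Disjoint C' (insert (c x y) C'') := by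
    rw [Finset.disjoint_insert_right]; exact ⟨by rw [k6]; exact k5.1, hCC⟩
  refine AntiRamsey.card_fresh_le hno h' h3 (by
      rw [Finset.disjoint_insert_right, Finset.disjoint_insert_right]; tauto)
      hd ?_ n1 ?_ ?_ ?_
  · rw [Finset.card_union_of_disjoint hCC] at hC
    rw [Finset.card_insert_of_notMem (by rw [k6]; exact k5.2)]
    omega
  · simp; tauto
  · simp; tauto
  · refine subset_trans ?_ hX
    rw [k6]
    intro z; simp

theorem card_fresh_self_le (hno : NoRainbow c (t + 1)) (k : Config c s C u v x y) (hC : C.card = t)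
    {X : Finset ℕ} (hX : insert (c u v) C ⊆ X) : (fresh c X u v s).card ≤ 2 * C.card :=
  k.card_fresh_le hno hC k.rainbow .nil (by simp) (by simp) (by simp) (by simp) hX

theorem card_fresh_pair_le (hno : NoRainbow c (t + 1)) {a b : V} {γ : ℕ}
    (k : Config c (insert a (insert b s)) (insert γ C) u v x y) (h : IsRainbow ⊤ c s C)
    (hC : C.card + 1 = t) (ha : a ∉ s) (hb : b ∉ s) (hab : a ≠ b) (hγ : c a b = γ) (hγC : γ ∉ C)
    {X : Finset ℕ} (hX : insert (c u v) (insert γ C) ⊆ X) :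
    (fresh c X u v s).card ≤ 2 * C.card := by
  have h2 := IsRainbow.pair (c := c) hab
  rw [hγ] at h2
  refine k.card_fresh_le hno (by rw [Finset.card_insert_of_notMem hγC]; exact hC) h h2 ?_ ?_ ?_ ?_ hX
  · simp [ha, hb]
  · simp [hγC]
  · ext z; simp
  · ext z; simp

theorem card_fresh_pair_pair_le (hno : NoRainbow c (t + 1)) {a b d e : V} {γ δ : ℕ}
    (k : Config c (insert a (insert b (insert d (insert e s)))) (insert γ (insert δ C)) u v x y)
    (h : IsRainbow ⊤ c s C) (hC : C.card + 2 = t) (hs : a ∉ s ∧ b ∉ s ∧ d ∉ s ∧ e ∉ s)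
    (hnd : [a, b, d, e].Nodup) (hγ : c a b = γ) (hγC : γ ∉ C) (hδ : c d e = δ) (hδC : δ ∉ C)
    (hγδ : γ ≠ δ) {X : Finset ℕ} (hX : insert (c u v) (insert γ (insert δ C)) ⊆ X) :
    (fresh c X u v s).card ≤ 2 * C.card := by
  simp only [List.nodup_cons, List.mem_cons, not_or, List.not_mem_nil, not_false_eq_true,
    List.nodup_nil, and_true] at hnd
  have h2 := (IsRainbow.pair (c := c) (show d ≠ e by tauto)).add (a := a) (b := b) (by simp; tauto)
    (by simp; tauto) (by tauto) (by simp [hγ, hδ, hγδ])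
  rw [hγ, hδ] at h2
  refine k.card_fresh_le hno ?_ h h2 ?_ ?_ ?_ ?_ hX
  · rw [Finset.card_insert_of_notMem (by simp; tauto), Finset.card_insert_of_notMem hδC]; exact hC
  · simp; tauto
  · simp; tauto
  · ext z; simp
  · ext z; simp

theorem mem_of_notMem (hno : NoRainbow c (t + 1)) (k : Config c s C u v x y) (hC : C.card = t)
    {a b : V} (ha : a ∉ s ∧ a ≠ x ∧ a ≠ y) (hb : b ∉ s ∧ b ≠ x ∧ b ≠ y) (hab : a ≠ b) :
    c a b ∈ insert (c u v) C :=
  hno.mem_of_add_one k.add_right (by rw [Finset.card_insert_of_notMem k.new, hC])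
    (by simp; tauto) (by simp; tauto) hab

/-- Edges from u or v to an uncovered vertex other than x and y have old colors because xy and the
matching avoid them. Among the four edges to x and y, the disjoint ones ux and vy have the same
color if both colors are new, and likewise uy and vx. -/
theorem card_fresh_compl_le [Fintype V] (hno : NoRainbow c (t + 1)) (k : Config c s C u v x y)
    (hC : C.card = t) {X : Finset ℕ} (hX : insert (c u v) C ⊆ X) :
    (fresh c X u v (Finset.univ \ insert u (insert v s))).card ≤ 2 := by
  obtain ⟨k1, k2, k3, k4⟩ := k.notMem
  obtain ⟨n1, n2, n3, n4, n5, n6⟩ := k.ne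
  have hX' : ∀ γ, γ ∉ X → γ ∉ C := fun γ h h' => h (hX (by simp [h']))
  refine (Finset.card_le_card (t := ({c u x, c v y, c u y, c v x} : Finset ℕ) \ X) ?_).trans
    (card_sdiff_le_two (fun h1 h2 => ?_) fun h1 h2 => ?_)
  · intro γ hγ
    simp only [fresh, Finset.mem_biUnion, Finset.mem_sdiff, Finset.mem_univ, true_and,
      Finset.mem_insert, not_or, Finset.mem_singleton] at hγ ⊢
    obtain ⟨z, ⟨hzu, hzv, hzs⟩, hz, hγX⟩ := hγ
    refine ⟨?_, hγX⟩
    by_cases hzx : z = x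
    · subst hzx; tauto
    by_cases hzy : z = y
    · subst hzy; tauto
    exfalso
    rcases hz with rfl | rfl
    · exact hγX (hX (k.mem_of_notMem hno hC ⟨k1, n2, n3⟩ ⟨hzs, hzx, hzy⟩ (Ne.symm hzu)))
    · exact hγX (hX (k.mem_of_notMem hno hC ⟨k2, n4, n5⟩ ⟨hzs, hzx, hzy⟩ (Ne.symm hzv)))
  · exact hno.eq_of_add_two k.rainbow (by omega) ⟨k1, k3, k2, k4⟩ (by simp; grind) (hX' _ h1)
      (hX' _ h2)
  · exact hno.eq_of_add_two k.rainbow (by omega) ⟨k1, k4, k2, k3⟩ (by simp; grind) (hX' _ h1)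
      (hX' _ h2)

end Config

/-- The upper bound on the number of colors for a large number `N` of vertices. -/
def Bound (t N K : ℕ) : Prop := K ≤ 2 * t ^ 2 + t + 1 ∨ 2 * K + t * (t + 1) ≤ 2 * t * N + 2

variable [Fintype V] {c : V → V → ℕ} {s : Finset V} {C : Finset ℕ} {t : ℕ}

/-- Remove the edge uv with the color of the triangle from the matching. If the remaining t edges
could be augmented by p and q without this color, then p and q would have to meet every edge of this
color off them. But meeting all edges of the triangle takes two of its vertices, and uv is then
missed. So Erdős–Gallai with m = t bounds the other colors. -/
theorem bound_of_mono (hc : ∀ a b, c a b = c b a) (hno : NoRainbow c (t + 1))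
    (h : IsRainbow ⊤ c s C) (hC : C.card = t + 1) {x y z : V} (hx : x ∉ s) (hy : y ∉ s) (hz : z ∉ s)
    (hxy : x ≠ y) (hyz : y ≠ z) (hxz : x ≠ z) (h1 : c y z = c x y) (h2 : c x z = c x y) :
    Bound t (Fintype.card V) (colors c Finset.univ).card := by
  have hγ := hno.mem_of_add_one h hC hx hy hxy
  obtain ⟨u, v, s1, hu, hv, huv, he, rfl, h3⟩ := h.exists_edge hγ
  have huv' : u ≠ v := huv
  have hC1 : (C.erase (c x y)).card = t := by rw [Finset.card_erase_of_mem hγ]; omega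
  have := card_colors_sdiff_le_of_no_augment hc h3 (D := {c x y}) (by simp) (by
    intro p q C' hp hq hpq hC' hd
    have hd' : c x y ∉ C' := by simpa using hd
    have h4 : C'.card = t + 1 := by
      have h5 := hC'.card_eq
      have h6 := h3.card_eq
      rw [Finset.card_insert_of_notMem (by simp; tauto), Finset.card_insert_of_notMem hq, h6, hC1]
        at h5
      omega
    have key : ∀ a b, a ∉ s1 → b ∉ s1 → a ≠ b → c a b = c x y → a = p ∨ a = q ∨ b = p ∨ b = q := by
      intro a b ha hb hab he
      by_contra hcon
      simp only [not_or] at hcon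
      have := hno.mem_of_add_one hC' h4 (a := a) (b := b) (by simp; tauto) (by simp; tauto) hab
      rw [he] at this
      exact hd' this
    simp only [Finset.mem_insert, not_or] at hx hy hz
    have k1 := key x y (by tauto) (by tauto) hxy rfl
    have k2 := key y z (by tauto) (by tauto) hyz h1
    have k3 := key x z (by tauto) (by tauto) hxz h2
    have k4 := key u v (by tauto) (by tauto) huv' he
    grind)
  rw [hC1] at this
  have h5 := Finset.le_card_sdiff {c x y} (colors c Finset.univ)
  rw [Finset.card_singleton] at h5
  unfold Bound
  rcases this with h6 | h6
  · left; omega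
  · right; omega

/-- Deleting six vertices loses at most 3 + 6t colors, and Erdős–Gallai with m = t - 2 on the other
vertices leaves room for exactly that kind of loss. -/
theorem bound_of_three_soft (hc : ∀ a b, c a b = c b a) (hno : NoRainbow c (t + 1))
    (hN : 2 * t + 5 ≤ Fintype.card V) {S : Finset V} {D Y : Finset ℕ} (h : IsRainbow ⊤ c s C)
    (hC : C.card + 2 = t) (hS : IsRainbow ⊤ c S D) (hD : D.card = 3) (hsS : Disjoint s S)
    (hY : ∀ p ∈ S, ∀ q, q ≠ p → c p q ∈ C ∪ D ∪ Y) (hYt : Y.card ≤ 6 * t) :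
    Bound t (Fintype.card V) (colors c Finset.univ).card := by
  obtain ⟨k, h1, h2⟩ := exists_card_colors_le hc hno h hS hsS hY (j := C.card) (by omega)
  rw [hS.card_eq, hD] at h2
  generalize C.card = j at *
  subst hC
  obtain ⟨N, hN'⟩ := Nat.exists_eq_add_of_le hN
  rw [hN'] at h2 ⊢
  unfold Bound
  have e : 2 * (j + 2) + 5 + N - 2 * 3 = 2 * j + 3 + N := by omega
  rw [e] at h2
  rcases h2 with h2 | h2
  -- For t = 2 and t = 3 the clique bound for m = t is too small, and the bound that is linear in N
  -- is used, with N ≥ 2t + 5.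
  · by_cases hj : 2 ≤ j
    · left; nlinarith
    · right; interval_cases j <;> simp at * <;> omega
  · right; nlinarith

theorem bound_of_two_soft (hc : ∀ a b, c a b = c b a) (hno : NoRainbow c (t + 1))
    (hN : 2 * t + 5 ≤ Fintype.card V) {S : Finset V} {D Y : Finset ℕ} (h : IsRainbow ⊤ c s C)
    (hC : C.card + 1 = t) (hS : IsRainbow ⊤ c S D) (hD : D.card = 2) (hsS : Disjoint s S)
    (hY : ∀ p ∈ S, ∀ q, q ≠ p → c p q ∈ C ∪ D ∪ Y) (hYt : Y.card + 2 ≤ 4 * t) :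
    Bound t (Fintype.card V) (colors c Finset.univ).card := by
  obtain ⟨k, h1, h2⟩ := exists_card_colors_le hc hno h hS hsS hY (j := C.card) (by omega)
  rw [hS.card_eq, hD] at h2
  generalize C.card = j at *
  subst hC
  obtain ⟨N, hN'⟩ := Nat.exists_eq_add_of_le hN
  rw [hN'] at h2 ⊢
  unfold Bound
  have e : 2 * (j + 1) + 5 + N - 2 * 2 = 2 * j + 3 + N := by omega
  rw [e] at h2
  rcases h2 with h2 | h2
  · left; nlinarith
  · right; nlinarith

end AntiRamsey

/-! ### Three soft edges. -/

namespace AntiRamsey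

variable {V : Type*} [DecidableEq V]

theorem mem_of_fresh_subset {c : V → V → ℕ} {X T : Finset ℕ} {s : Finset V} {x y : V}
    (hX : X ⊆ T) (hT : fresh c X x y s ⊆ T) : ∀ h ∈ s, c x h ∈ T ∧ c y h ∈ T := fun _ hs =>
  ⟨(left_mem_or_fresh X x y hs).elim (fun h => hX h) fun h => hT h,
    (right_mem_or_fresh X x y hs).elim (fun h => hX h) fun h => hT h⟩

variable [Fintype V] {c : V → V → ℕ} {s : Finset V} {C : Finset ℕ} {t : ℕ}

theorem card_union_six_le (F₁ F₂ F₃ G₁ G₂ G₃ : Finset ℕ) :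
    (F₁ ∪ F₂ ∪ F₃ ∪ G₁ ∪ G₂ ∪ G₃).card ≤
      F₁.card + F₂.card + F₃.card + G₁.card + G₂.card + G₃.card := by
  refine (Finset.card_union_le _ _).trans (Nat.add_le_add_right ?_ _)
  refine (Finset.card_union_le _ _).trans (Nat.add_le_add_right ?_ _)
  refine (Finset.card_union_le _ _).trans (Nat.add_le_add_right ?_ _)
  refine (Finset.card_union_le _ _).trans (Nat.add_le_add_right ?_ _)
  exact Finset.card_union_le _ _

/-- Pure bookkeeping for six deleted vertices. The relation stands for "the color lies in the
counted set"; keeping it abstract makes the case distinction cheap. -/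
theorem cover_six {V : Type*} {A : V → V → Prop} (hA : ∀ x y, A x y → A y x) {s : Finset V} {u v a b p q : V}
    (h1 : A u v) (h2 : A a b) (h3 : A p q) (f1 : ∀ z ∈ s, A u z ∧ A v z)
    (f2 : ∀ z ∈ s, A a z ∧ A b z) (f3 : ∀ z ∈ s, A p z ∧ A q z)
    (g1 : (A a u ∧ A b u) ∧ A a v ∧ A b v) (g2 : (A p u ∧ A q u) ∧ A p v ∧ A q v)
    (g3 : (A p a ∧ A q a) ∧ A p b ∧ A q b)
    (r : ∀ z, z ∉ s → z ≠ u → z ≠ v → z ≠ a → z ≠ b → z ≠ p → z ≠ q →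
      (A u z ∧ A v z) ∧ (A a z ∧ A b z) ∧ A p z ∧ A q z) (P : V)
    (hP : P = u ∨ P = v ∨ P = a ∨ P = b ∨ P = p ∨ P = q) (z : V) (hz : z ≠ P) : A P z := by
  by_cases zs : z ∈ s
  · rcases hP with rfl | rfl | rfl | rfl | rfl | rfl
    exacts [(f1 z zs).1, (f1 z zs).2, (f2 z zs).1, (f2 z zs).2, (f3 z zs).1, (f3 z zs).2]
  clear f1 f2 f3
  by_cases z1 : z = u
  · subst z1; clear r
    rcases hP with rfl | rfl | rfl | rfl | rfl | rfl
    exacts [absurd rfl hz, hA _ _ h1, g1.1.1, g1.1.2, g2.1.1, g2.1.2]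
  by_cases z2 : z = v
  · subst z2; clear r
    rcases hP with rfl | rfl | rfl | rfl | rfl | rfl
    exacts [h1, absurd rfl hz, g1.2.1, g1.2.2, g2.2.1, g2.2.2]
  by_cases z3 : z = a
  · subst z3; clear r
    rcases hP with rfl | rfl | rfl | rfl | rfl | rfl
    exacts [hA _ _ g1.1.1, hA _ _ g1.2.1, absurd rfl hz, hA _ _ h2, g3.1.1, g3.1.2]
  by_cases z4 : z = b
  · subst z4; clear r
    rcases hP with rfl | rfl | rfl | rfl | rfl | rfl
    exacts [hA _ _ g1.1.2, hA _ _ g1.2.2, h2, absurd rfl hz, g3.2.1, g3.2.2]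
  by_cases z5 : z = p
  · subst z5; clear r
    rcases hP with rfl | rfl | rfl | rfl | rfl | rfl
    exacts [hA _ _ g2.1.1, hA _ _ g2.2.1, hA _ _ g3.1.1, hA _ _ g3.2.1, absurd rfl hz, hA _ _ h3]
  by_cases z6 : z = q
  · subst z6; clear r
    rcases hP with rfl | rfl | rfl | rfl | rfl | rfl
    exacts [hA _ _ g2.1.2, hA _ _ g2.2.2, hA _ _ g3.1.2, hA _ _ g3.2.2, h3, absurd rfl hz]
  obtain ⟨⟨r1, r2⟩, ⟨r3, r4⟩, r5, r6⟩ := r z zs z1 z2 z3 z4 z5 z6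
  rcases hP with rfl | rfl | rfl | rfl | rfl | rfl <;> assumption

-- Each pair among the three soft edges is counted once: uv towards `s` gives 2(t - 2) new colors,
-- ab towards `s` and uv gives 2(t - 1), pq towards all of them gives 2t, and each of the three sees
-- at most two more off the matching. The total is 6t, as `bound_of_three_soft` allows.
set_option maxHeartbeats 1000000 in
theorem bound_of_three_config (hc : ∀ a b, c a b = c b a) (hno : NoRainbow c (t + 1))
    (hN : 2 * t + 5 ≤ Fintype.card V) (h : IsRainbow ⊤ c s C) (hC : C.card + 2 = t)
    {u v a b p q x₁ y₁ x₂ y₂ x₃ y₃ : V}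
    (k₁ : Config c (insert a (insert b (insert p (insert q s))))
      (insert (c a b) (insert (c p q) C)) u v x₁ y₁)
    (k₂ : Config c (insert u (insert v (insert p (insert q s))))
      (insert (c u v) (insert (c p q) C)) a b x₂ y₂)
    (k₃ : Config c (insert u (insert v (insert a (insert b s))))
      (insert (c u v) (insert (c a b) C)) p q x₃ y₃) :
    Bound t (Fintype.card V) (colors c Finset.univ).card := by
  obtain ⟨m1, m2, -, -⟩ := k₁.notMem
  obtain ⟨m3, m4, -, -⟩ := k₂.notMem
  obtain ⟨m5, m6, -, -⟩ := k₃.notMem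
  have w1 := k₁.new
  have w2 := k₂.new
  have w3 := k₃.new
  have o1 := k₁.ne.1
  have o2 := k₂.ne.1
  have o3 := k₃.ne.1
  simp only [Finset.mem_insert, not_or] at m1 m2 m3 m4 m5 m6 w1 w2 w3
  have d1 : (insert (c a b) (insert (c p q) C)).card = t := by
    rw [Finset.card_insert_of_notMem (by simp [*]), Finset.card_insert_of_notMem (by grind)]
    omega
  have d2 : (insert (c u v) (insert (c p q) C)).card = t := by
    rw [Finset.card_insert_of_notMem (by simp [*]), Finset.card_insert_of_notMem (by grind)]
    omega
  have d3 : (insert (c u v) (insert (c a b) C)).card = t := by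
    rw [Finset.card_insert_of_notMem (by simp [*]), Finset.card_insert_of_notMem (by grind)]
    omega
  obtain ⟨X, hX⟩ : ∃ X, X = insert (c u v) (insert (c a b) (insert (c p q) C)) := ⟨_, rfl⟩
  have X1 : insert (c u v) (insert (c a b) (insert (c p q) C)) ⊆ X := hX ▸ subset_rfl
  have X2 : insert (c a b) (insert (c u v) (insert (c p q) C)) ⊆ X := by
    rw [hX]; intro z; simp; tauto
  have X3 : insert (c p q) (insert (c u v) (insert (c a b) C)) ⊆ X := by
    rw [hX]; intro z; simp; tauto
  have e1 := k₁.card_fresh_pair_pair_le hno h (by omega) (by grind) (by simp; grind) rfl (by grind)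
    rfl (by grind) (by grind) X1
  have e2 := k₂.card_fresh_le hno d2 (h.add (a := u) (b := v) (by grind) (by grind) o1 (by grind))
    (IsRainbow.pair (c := c) o3) (by simp [*]) (by simp [*]) (by ext z; simp; tauto)
    (by ext z; simp) X2
  have e3 := k₃.card_fresh_self_le hno d3 X3
  have g1 := k₁.card_fresh_compl_le hno d1 X1
  have g2 := k₂.card_fresh_compl_le hno d2 X2
  have g3 := k₃.card_fresh_compl_le hno d3 X3
  rw [Finset.card_insert_of_notMem (by grind)] at e2
  rw [d3] at e3
  clear d1 d2 d3
  generalize hF1 : fresh c X u v s = F1 at e1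
  generalize hF2 : fresh c X a b _ = F2 at e2
  generalize hF3 : fresh c X p q _ = F3 at e3
  generalize hG1 : fresh c X u v _ = G1 at g1
  generalize hG2 : fresh c X a b _ = G2 at g2
  generalize hG3 : fresh c X p q _ = G3 at g3
  have hle := card_union_six_le F1 F2 F3 G1 G2 G3
  have hSr : IsRainbow ⊤ c {u, v, a, b, p, q} {c u v, c a b, c p q} :=
    ((IsRainbow.pair (c := c) o3).add (a := a) (b := b) (by simp [*]) (by simp [*]) o2
      (by simp [*])).add (a := u) (b := v) (by simp [*]) (by simp [*]) o1 (by simp [*])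
  have hD : ({c u v, c a b, c p q} : Finset ℕ).card = 3 := Finset.card_eq_three.mpr
    ⟨_, _, _, by grind, by grind, by grind, rfl⟩
  refine bound_of_three_soft hc hno hN h hC hSr hD (by simp [*])
    (Y := F1 ∪ F2 ∪ F3 ∪ G1 ∪ G2 ∪ G3) ?_ (by omega)
  generalize hT : C ∪ {c u v, c a b, c p q} ∪ (F1 ∪ F2 ∪ F3 ∪ G1 ∪ G2 ∪ G3) = T
  have hXT : X ⊆ T := by rw [hX, ← hT]; intro z; simp; tauto
  have f1 := mem_of_fresh_subset hXT (hF1.trans_subset (by rw [← hT]; intro z hz; simp [hz]))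
  have f2 := mem_of_fresh_subset hXT (hF2.trans_subset (by rw [← hT]; intro z hz; simp [hz]))
  have f3 := mem_of_fresh_subset hXT (hF3.trans_subset (by rw [← hT]; intro z hz; simp [hz]))
  have f4 := mem_of_fresh_subset hXT (hG1.trans_subset (by rw [← hT]; intro z hz; simp [hz]))
  have f5 := mem_of_fresh_subset hXT (hG2.trans_subset (by rw [← hT]; intro z hz; simp [hz]))
  have f6 := mem_of_fresh_subset hXT (hG3.trans_subset (by rw [← hT]; intro z hz; simp [hz]))
  have f7 : c u v ∈ T ∧ c a b ∈ T ∧ c p q ∈ T := by rw [← hT]; simp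
  clear hle hF1 hF2 hF3 hG1 hG2 hG3 e1 e2 e3 g1 g2 g3 X1 X2 X3 k₁ k₂ k₃ hSr hT hD hno hXT hX w1 w2 w3
  simp only [Finset.mem_sdiff, Finset.mem_univ, true_and] at f4 f5 f6
  intro P hP z hz
  simp only [Finset.mem_insert, Finset.mem_singleton] at hP
  refine cover_six (A := fun x y => c x y ∈ T) (s := s) (fun x y h => by rwa [hc]) f7.1 f7.2.1
    f7.2.2 f1 (fun z hz => f2 z (by simp [hz])) (fun z hz => f3 z (by simp [hz]))
    ⟨f2 u (by simp), f2 v (by simp)⟩ ⟨f3 u (by simp), f3 v (by simp)⟩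
    ⟨f3 a (by simp), f3 b (by simp)⟩ (fun z z0 z1 z2 z3 z4 z5 z6 => ?_) P hP z hz
  refine ⟨f4 z ?_, f5 z ?_, f6 z ?_⟩ <;>
    simp only [Finset.mem_insert, not_or] <;> exact ⟨by assumption, by assumption, by assumption,
      by assumption, by assumption, by assumption, by assumption⟩

-- Here pq is soft only with respect to the matching that has ux in place of uv. The counting is the
-- same as for `bound_of_three_config`, except that now ab is counted towards pq, and v is one of
-- the vertices off the third matching.
set_option maxHeartbeats 1000000 in
theorem bound_of_three_config' (hc : ∀ a b, c a b = c b a) (hno : NoRainbow c (t + 1))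
    (hN : 2 * t + 5 ≤ Fintype.card V) (h : IsRainbow ⊤ c s C) (hC : C.card + 2 = t)
    {u v a b p q x₁ y₁ x₂ y₂ x₃ y₃ x : V}
    (k₁ : Config c (insert a (insert b (insert p (insert q s))))
      (insert (c a b) (insert (c p q) C)) u v x₁ y₁)
    (k₂ : Config c (insert u (insert v (insert p (insert q s))))
      (insert (c u v) (insert (c p q) C)) a b x₂ y₂)
    (k₃ : Config c (insert u (insert x (insert a (insert b s))))
      (insert (c u x) (insert (c a b) C)) p q x₃ y₃)
    (hx : x ∉ insert u (insert v (insert a (insert b (insert p (insert q s))))))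
    (hρ : c u x ∉ insert (c a b) C) :
    Bound t (Fintype.card V) (colors c Finset.univ).card := by
  obtain ⟨m1, m2, -, -⟩ := k₁.notMem
  obtain ⟨m3, m4, -, -⟩ := k₂.notMem
  obtain ⟨m5, m6, -, -⟩ := k₃.notMem
  have w1 := k₁.new
  have w2 := k₂.new
  have w3 := k₃.new
  have o1 := k₁.ne.1
  have o2 := k₂.ne.1
  have o3 := k₃.ne.1
  simp only [Finset.mem_insert, not_or] at m1 m2 m3 m4 m5 m6 w1 w2 w3 hx hρ
  have d1 : (insert (c a b) (insert (c p q) C)).card = t := by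
    rw [Finset.card_insert_of_notMem (by simp [*]), Finset.card_insert_of_notMem (by grind)]
    omega
  have d2 : (insert (c u v) (insert (c p q) C)).card = t := by
    rw [Finset.card_insert_of_notMem (by simp [*]), Finset.card_insert_of_notMem (by grind)]
    omega
  have d3 : (insert (c u x) (insert (c a b) C)).card = t := by
    rw [Finset.card_insert_of_notMem (by simp [*]), Finset.card_insert_of_notMem (by grind)]
    omega
  obtain ⟨X, hX⟩ : ∃ X, X = insert (c u v) (insert (c a b) (insert (c p q) C)) := ⟨_, rfl⟩
  have X1 : insert (c u v) (insert (c a b) (insert (c p q) C)) ⊆ X := hX ▸ subset_rfl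
  have X2 : insert (c a b) (insert (c u v) (insert (c p q) C)) ⊆ X := by
    rw [hX]; intro z; simp; tauto
  have X3 : insert (c p q) (insert (c u x) (insert (c a b) C)) ⊆ insert (c u x) X := by
    rw [hX]; intro z; simp; tauto
  have e1 := k₁.card_fresh_pair_pair_le hno h (by omega) (by grind) (by simp; grind) rfl (by grind)
    rfl (by grind) (by grind) X1
  have e2 := k₂.card_fresh_self_le hno d2 X2
  have e3 := k₃.card_fresh_le hno d3 (h.add (a := u) (b := x) (by grind) (by grind) (by grind)
    (by grind)) (IsRainbow.pair (c := c) o2) (by simp [*, Ne.symm hx.2.2.1, Ne.symm hx.2.2.2.1])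
    (by simp [*, Ne.symm hρ.1]) (by ext z; simp; tauto) (by ext z; simp) X3
  have g1 := k₁.card_fresh_compl_le hno d1 X1
  have g2 := k₂.card_fresh_compl_le hno d2 X2
  have g3 := k₃.card_fresh_compl_le hno d3 X3
  rw [d2] at e2
  rw [Finset.card_insert_of_notMem (by grind)] at e3
  clear d1 d2 d3
  generalize hF1 : fresh c X u v s = F1 at e1
  generalize hF2 : fresh c X a b _ = F2 at e2
  generalize hF3 : fresh c (insert (c u x) X) p q _ = F3 at e3
  generalize hG1 : fresh c X u v _ = G1 at g1
  generalize hG2 : fresh c X a b _ = G2 at g2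
  generalize hG3 : fresh c (insert (c u x) X) p q _ = G3 at g3
  have hle := card_union_six_le F1 F2 F3 G1 G2 G3
  have hSr : IsRainbow ⊤ c {u, v, a, b, p, q} {c u v, c a b, c p q} :=
    ((IsRainbow.pair (c := c) o3).add (a := a) (b := b) (by simp [*]) (by simp [*]) o2
      (by simp [*])).add (a := u) (b := v) (by simp [*]) (by simp [*]) o1 (by simp [*])
  have hD : ({c u v, c a b, c p q} : Finset ℕ).card = 3 := Finset.card_eq_three.mpr
    ⟨_, _, _, by grind, by grind, by grind, rfl⟩
  refine bound_of_three_soft hc hno hN h hC hSr hD (by simp [*])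
    (Y := F1 ∪ F2 ∪ F3 ∪ G1 ∪ G2 ∪ G3) ?_ (by omega)
  generalize hT : C ∪ {c u v, c a b, c p q} ∪ (F1 ∪ F2 ∪ F3 ∪ G1 ∪ G2 ∪ G3) = T
  have hXT : X ⊆ T := by rw [hX, ← hT]; intro z; simp; tauto
  have f1 := mem_of_fresh_subset hXT (hF1.trans_subset (by rw [← hT]; intro z hz; simp [hz]))
  have f2 := mem_of_fresh_subset hXT (hF2.trans_subset (by rw [← hT]; intro z hz; simp [hz]))
  have f4 := mem_of_fresh_subset hXT (hG1.trans_subset (by rw [← hT]; intro z hz; simp [hz]))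
  simp only [Finset.mem_sdiff, Finset.mem_univ, true_and] at f4
  -- The color of ux counts as old in the third configuration. It is nevertheless paid for, as a
  -- color between uv and a vertex off the first matching.
  have hXT' : insert (c u x) X ⊆ T := Finset.insert_subset (f4 x (by simpa using hx)).1 hXT
  have f3 := mem_of_fresh_subset hXT' (hF3.trans_subset (by rw [← hT]; intro z hz; simp [hz]))
  have f5 := mem_of_fresh_subset hXT (hG2.trans_subset (by rw [← hT]; intro z hz; simp [hz]))
  have f6 := mem_of_fresh_subset hXT' (hG3.trans_subset (by rw [← hT]; intro z hz; simp [hz]))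
  have f7 : c u v ∈ T ∧ c a b ∈ T ∧ c p q ∈ T := by rw [← hT]; simp
  clear hle hF1 hF2 hF3 hG1 hG2 hG3 e1 e2 e3 g1 g2 g3 X1 X2 X3 k₁ k₂ k₃ hSr hT hD hno hXT hX w1 w2 w3
  simp only [Finset.mem_sdiff, Finset.mem_univ, true_and] at f5 f6
  intro P hP z hz
  simp only [Finset.mem_insert, Finset.mem_singleton] at hP
  have hv : c p v ∈ T ∧ c q v ∈ T := f6 v (by simp only [Finset.mem_insert, not_or]; tauto)
  refine cover_six (A := fun x y => c x y ∈ T) (s := s) (fun x y h => by rwa [hc]) f7.1 f7.2.1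
    f7.2.2 f1 (fun z hz => f2 z (by simp [hz])) (fun z hz => f3 z (by simp [hz]))
    ⟨f2 u (by simp), f2 v (by simp)⟩ ⟨f3 u (by simp), hv⟩
    ?_ (fun z z0 z1 z2 z3 z4 z5 z6 => ?_) P hP z hz
  · have i1 := f2 p (by simp)
    have i2 := f2 q (by simp)
    rw [hc a p, hc b p] at i1
    rw [hc a q, hc b q] at i2
    exact ⟨⟨i1.1, i2.1⟩, i1.2, i2.2⟩
  refine ⟨f4 z ?_, f5 z ?_, ?_⟩
  · simp only [Finset.mem_insert, not_or]
    exact ⟨z1, z2, z3, z4, z5, z6, z0⟩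
  · simp only [Finset.mem_insert, not_or]
    exact ⟨z3, z4, z1, z2, z5, z6, z0⟩
  · by_cases zx : z = x
    · subst zx
      exact f3 z (by simp)
    · refine f6 z ?_
      simp only [Finset.mem_insert, not_or]
      exact ⟨z5, z6, z1, zx, z3, z4, z0⟩

end AntiRamsey

/-! ### Two soft edges. -/

namespace AntiRamsey

variable {V : Type*} [DecidableEq V]

theorem IsRainbow.exists_eq_insert {c : V → V → ℕ} {s : Finset V} {C : Finset ℕ}
    (h : IsRainbow ⊤ c s C) {γ : ℕ} (hγ : γ ∈ C) :
    ∃ a b s' C', a ∉ s' ∧ b ∉ s' ∧ a ≠ b ∧ c a b = γ ∧ γ ∉ C' ∧ s = insert a (insert b s') ∧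
      C = insert γ C' ∧ IsRainbow ⊤ c s' C' := by
  obtain ⟨a, b, s', h1, h2, h3, h4, h5, h6⟩ := h.exists_edge hγ
  exact ⟨a, b, s', C.erase γ, h1, h2, h3, h4, by simp, h5, (Finset.insert_erase hγ).symm, h6⟩

/-- A rainbow matching with two distinguished edges `uv` and `ab`. -/
structure TwoEdges (c : V → V → ℕ) (s : Finset V) (C : Finset ℕ) (u v a b : V) : Prop where
  rainbow : IsRainbow ⊤ c s C
  notMem : u ∉ s ∧ v ∉ s ∧ a ∉ s ∧ b ∉ s
  nodup : [u, v, a, b].Nodup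
  new : c u v ∉ C ∧ c a b ∉ C
  ne_color : c u v ≠ c a b

namespace TwoEdges

variable {c : V → V → ℕ} {s : Finset V} {C : Finset ℕ} {u v a b : V}

theorem symm (k : TwoEdges c s C u v a b) : TwoEdges c s C a b u v :=
  ⟨k.rainbow, by have := k.notMem; tauto, by have := k.nodup; grind, k.new.symm, k.ne_color.symm⟩

theorem swap (hc : ∀ a b, c a b = c b a) (k : TwoEdges c s C u v a b) : TwoEdges c s C v u a b :=
  ⟨k.rainbow, by have := k.notMem; tauto, by have := k.nodup; grind, by rw [hc v u]; exact k.new,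
    by rw [hc v u]; exact k.ne_color⟩

theorem ne (k : TwoEdges c s C u v a b) : u ≠ v ∧ u ≠ a ∧ u ≠ b ∧ v ≠ a ∧ v ≠ b ∧ a ≠ b := by
  have := k.nodup
  simp only [List.nodup_cons, List.mem_cons, not_or, List.not_mem_nil, not_false_eq_true,
    List.nodup_nil, and_true] at this
  tauto

theorem right (k : TwoEdges c s C u v a b) :
    IsRainbow ⊤ c (insert a (insert b s)) (insert (c a b) C) :=
  k.rainbow.add k.notMem.2.2.1 k.notMem.2.2.2 k.ne.2.2.2.2.2 k.new.2

theorem full (k : TwoEdges c s C u v a b) :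
    IsRainbow ⊤ c (insert u (insert v (insert a (insert b s))))
      (insert (c u v) (insert (c a b) C)) := by
  have h1 := k.notMem
  have h2 := k.ne
  have h3 := k.new
  have h4 := k.ne_color
  exact k.right.add (by simp; tauto) (by simp; tauto) h2.1 (by simp; tauto)

theorem set_symm (u v a b : V) (s : Finset V) : insert u (insert v (insert a (insert b s))) =
    insert a (insert b (insert u (insert v s))) := by
  ext z; simp; tauto

theorem set_swap (u v a b : V) (s : Finset V) : insert u (insert v (insert a (insert b s))) =
    insert v (insert u (insert a (insert b s))) := by
  ext z; simp; tauto

theorem config (k : TwoEdges c s C u v a b) {x y : V}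
    (hx : x ∉ insert u (insert v (insert a (insert b s))))
    (hy : y ∉ insert u (insert v (insert a (insert b s)))) (hxy : x ≠ y) (h : c x y = c u v) :
    Config c (insert a (insert b s)) (insert (c a b) C) u v x y := by
  have h1 := k.notMem
  have h2 := k.ne
  have h3 := k.new
  have h4 := k.ne_color
  simp only [Finset.mem_insert, not_or] at hx hy
  exact ⟨k.right, by simp; tauto, by simp; grind, by simp; tauto, h⟩

end TwoEdges

variable [Fintype V] {c : V → V → ℕ} {s : Finset V} {C : Finset ℕ} {t : ℕ} {u v a b x y z : V}

/-- Replace uv by ux in the matching. Then vy is disjoint from it, so the matching edge pq with the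
color of vy is a third soft edge besides uv and ab. -/
theorem TwoEdges.bound_of_third (hc : ∀ a b, c a b = c b a) (hno : NoRainbow c (t + 1))
    (hN : 2 * t + 5 ≤ Fintype.card V) (k : TwoEdges c s C u v a b) (hC : C.card + 1 = t)
    {x₁ y₁ x₂ y₂ : V}
    (h1 : Config c (insert a (insert b s)) (insert (c a b) C) u v x₁ y₁)
    (h2 : Config c (insert u (insert v s)) (insert (c u v) C) a b x₂ y₂)
    (hx : x ∉ insert u (insert v (insert a (insert b s))))
    (hy : y ∉ insert u (insert v (insert a (insert b s)))) (hxy : x ≠ y)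
    (hux : c u x ∉ insert (c u v) (insert (c a b) C)) (hvy : c v y ∈ C) :
    Bound t (Fintype.card V) (colors c Finset.univ).card := by
  obtain ⟨p, q, s', C', hp, hq, hpq, hcol, hγ, rfl, rfl, h⟩ := k.rainbow.exists_eq_insert hvy
  rw [← hcol] at h1 h2 hvy hγ hC k hux
  rw [Finset.card_insert_of_notMem hγ] at hC
  refine bound_of_three_config' hc hno hN h (by omega) (x₃ := v) (y₃ := y) h1 h2 ⟨?_, ?_, ?_, ?_, ?_⟩
    hx (by simp only [Finset.mem_insert, not_or] at hux ⊢; tauto)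
  · have := k.right
    obtain ⟨n1, n2, n3, n4⟩ := k.notMem
    obtain ⟨n5, n6, n7, n8, n9, n10⟩ := k.ne
    have n11 := k.new
    simp only [Finset.mem_insert, not_or] at n1 n2 n3 n4 n11 hx hux
    exact (h.add n3.2.2 n4.2.2 n10 n11.2.2).add (by simp; tauto) (by simp; tauto) (Ne.symm hx.1)
      (by simp; tauto)
  · obtain ⟨n1, n2, n3, n4⟩ := k.notMem
    obtain ⟨n5, n6, n7, n8, n9, n10⟩ := k.ne
    simp only [Finset.mem_insert, not_or] at n1 n2 n3 n4 hx hy ⊢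
    clear h1 h2 k hno h hc
    grind
  · obtain ⟨n1, n2, n3, n4⟩ := k.notMem
    simp only [Finset.mem_insert, not_or] at n1 n2 n3 n4 hx hy ⊢
    clear h1 h2 k hno h hc
    simp; grind
  · have n11 := k.new
    simp only [Finset.mem_insert, not_or] at hux n11 ⊢
    exact ⟨fun e => hux.2.2.1 e.symm, fun e => n11.2.1 e.symm, hγ⟩
  · exact hcol.symm

/-- The soft edges uv and ab see at most 2(t - 1) new colors each towards the other matching edges.
Together with the two colors of `I` these are 4t - 2, which is what `bound_of_two_soft` permits. -/
theorem TwoEdges.bound_of_cover (hc : ∀ a b, c a b = c b a) (hno : NoRainbow c (t + 1))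
    (hN : 2 * t + 5 ≤ Fintype.card V) (k : TwoEdges c s C u v a b) (hC : C.card + 1 = t)
    {x₁ y₁ x₂ y₂ : V}
    (h1 : Config c (insert a (insert b s)) (insert (c a b) C) u v x₁ y₁)
    (h2 : Config c (insert u (insert v s)) (insert (c u v) C) a b x₂ y₂)
    {I : Finset ℕ} (hI : I.card ≤ 2)
    (hR : ∀ p, p = u ∨ p = v ∨ p = a ∨ p = b →
      ∀ z ∉ insert u (insert v (insert a (insert b s))),
        c p z ∈ insert (c u v) (insert (c a b) C) ∪ I)
    (hE : ∀ p, p = a ∨ p = b → ∀ q, q = u ∨ q = v →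
        c p q ∈ insert (c u v) (insert (c a b) C) ∪ I) :
    Bound t (Fintype.card V) (colors c Finset.univ).card := by
  obtain ⟨n1, n2, n3, n4⟩ := k.notMem
  obtain ⟨n5, n6, n7, n8, n9, n10⟩ := k.ne
  obtain ⟨n11, n12⟩ := k.new
  have n13 := k.ne_color
  obtain ⟨X, hX⟩ : ∃ X, X = insert (c u v) (insert (c a b) C) := ⟨_, rfl⟩
  rw [← hX] at hR hE
  have X2 : insert (c a b) (insert (c u v) C) ⊆ X := by
    rw [hX]; intro z; simp; tauto
  have e1 := h1.card_fresh_pair_le hno k.rainbow hC n3 n4 n10 rfl n12 hX.ge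
  have e2 := h2.card_fresh_pair_le hno k.rainbow hC n1 n2 n5 rfl n11 X2
  have hS : IsRainbow ⊤ c {u, v, a, b} {c u v, c a b} :=
    (IsRainbow.pair (c := c) n10).add (a := u) (b := v) (by simp [*]) (by simp [*]) n5 (by simp [*])
  generalize hF1 : fresh c X u v s = F1 at e1
  generalize hF2 : fresh c X a b s = F2 at e2
  have hc1 := Finset.card_union_le (F1 ∪ F2) I
  have hc2 := Finset.card_union_le F1 F2
  refine bound_of_two_soft hc hno hN k.rainbow hC hS (Finset.card_pair n13) (by simp [*])
    (Y := F1 ∪ F2 ∪ I) ?_ (by omega)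
  generalize hT : C ∪ {c u v, c a b} ∪ (F1 ∪ F2 ∪ I) = T
  have hXT : X ⊆ T := by rw [hX, ← hT]; intro z; simp; tauto
  have f1 := mem_of_fresh_subset hXT (hF1.trans_subset (by rw [← hT]; intro z hz; simp [hz]))
  have f2 := mem_of_fresh_subset hXT (hF2.trans_subset (by rw [← hT]; intro z hz; simp [hz]))
  have hXI : X ∪ I ⊆ T := Finset.union_subset hXT (by rw [← hT]; intro z hz; simp [hz])
  have hE' : ∀ p, p = a ∨ p = b → ∀ q, q = u ∨ q = v → c p q ∈ T :=
    fun p hp q hq => hXI (hE p hp q hq)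
  have hR' : ∀ p, p = u ∨ p = v ∨ p = a ∨ p = b →
      ∀ z ∉ insert u (insert v (insert a (insert b s))), c p z ∈ T :=
    fun p hp z hz => hXI (hR p hp z hz)
  have huv : c u v ∈ T := by rw [← hT]; simp
  have hab : c a b ∈ T := by rw [← hT]; simp
  clear hE hR hXI hT hF1 hF2 hX e1 e2 X2 hXT hS
  intro p hp z hz
  simp only [Finset.mem_insert, Finset.mem_singleton] at hp
  by_cases hzs : z ∈ s
  · rcases hp with rfl | rfl | rfl | rfl
    exacts [(f1 z hzs).1, (f1 z hzs).2, (f2 z hzs).1, (f2 z hzs).2]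
  by_cases hz1 : z ∈ insert u (insert v (insert a (insert b s)))
  · simp only [Finset.mem_insert, hzs, or_false] at hz1
    rcases hp with rfl | rfl | rfl | rfl <;> rcases hz1 with rfl | rfl | rfl | rfl <;>
    first
    | exact absurd rfl hz
    | assumption
    | (rw [hc]; assumption)
    | exact hE' _ (by simp) _ (by simp)
    | (rw [hc]; exact hE' _ (by simp) _ (by simp))
  · exact hR' p hp z hz1

end AntiRamsey

/-! ### Two colors off the matching. -/

namespace AntiRamsey

variable {V : Type*} [DecidableEq V] {c : V → V → ℕ} {s : Finset V} {C : Finset ℕ} {t : ℕ}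
  {u v a b x y z : V}

/-- If the color of `uw` is fresh, then the color of `uv` does not occur among the other vertices
outside of the matching. -/
theorem TwoEdges.ne_of_fresh (hno : NoRainbow c (t + 1)) (k : TwoEdges c s C u v a b)
    (hC : C.card + 1 = t) {w : V} (hw : w ∉ insert u (insert v (insert a (insert b s))))
    (hx : x ∉ insert u (insert v (insert a (insert b s))))
    (hy : y ∉ insert u (insert v (insert a (insert b s)))) (hxy : x ≠ y) (hxw : x ≠ w) (hyw : y ≠ w)
    (huw : c u w ∉ insert (c u v) (insert (c a b) C)) :
    IsRainbow ⊤ c (insert u (insert w (insert a (insert b s))))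
      (insert (c u w) (insert (c a b) C)) ∧ (insert (c u w) (insert (c a b) C)).card = t + 1 ∧
    c x y ≠ c u v := by
  obtain ⟨n1, n2, n3, n4⟩ := k.notMem
  obtain ⟨n5, n6, n7, n8, n9, n10⟩ := k.ne
  obtain ⟨n11, n12⟩ := k.new
  have n13 := k.ne_color
  simp only [Finset.mem_insert, not_or] at hw hx hy huw
  have h1 := k.right.add (a := u) (b := w) (by simp [*]) (by simp [*]) (Ne.symm hw.1) (by simp [*])
  have h2 : (insert (c u w) (insert (c a b) C)).card = t + 1 := by
    rw [Finset.card_insert_of_notMem (by simp [*]), Finset.card_insert_of_notMem n12, hC]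
  refine ⟨h1, h2, fun h => ?_⟩
  have := hno.mem_of_add_one h1 h2 (a := x) (b := y) (by simp [*]) (by simp [*]) hxy
  rw [h] at this
  simp only [Finset.mem_insert] at this
  rcases this with h | h | h
  exacts [huw.1 h.symm, n13 h, n11 h]

variable [Fintype V]

/-- If ux had a new color, then vy and vz would not, as xz and xy have the color of uv. Next to the
matching with ux instead of uv, the edges vy and vz then have the color of ab or one in `C`. A color
in `C` makes a third soft edge, and otherwise vyz is a monochromatic triangle. -/
theorem TwoEdges.left_mem (hc : ∀ a b, c a b = c b a) (hno : NoRainbow c (t + 1))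
    (hN : 2 * t + 5 ≤ Fintype.card V)
    (hB : ¬ Bound t (Fintype.card V) (colors c Finset.univ).card)
    (k : TwoEdges c s C u v a b) (hC : C.card + 1 = t)
    (hx : x ∉ insert u (insert v (insert a (insert b s))))
    (hy : y ∉ insert u (insert v (insert a (insert b s))))
    (hz : z ∉ insert u (insert v (insert a (insert b s)))) (hxy : x ≠ y) (hxz : x ≠ z) (hyz : y ≠ z)
    (cxy : c x y = c u v) (cxz : c x z = c u v) (cyz : c y z = c a b) :
    c u x ∈ insert (c u v) (insert (c a b) C) := by
  by_contra hux
  have h1 := k.config hx hy hxy cxy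
  have h2 := k.symm.config (by rwa [← set_symm]) (by rwa [← set_symm]) hyz cyz
  have hvy : c v y ∈ insert (c u v) (insert (c a b) C) := by
    by_contra hvy
    rw [set_swap] at hx hy hz
    rw [hc u v] at hvy
    exact ((k.swap hc).ne_of_fresh hno hC hy hx hz hxz hxy hyz.symm hvy).2.2 (by rw [cxz, hc])
  have hvz : c v z ∈ insert (c u v) (insert (c a b) C) := by
    by_contra hvz
    rw [set_swap] at hx hy hz
    rw [hc u v] at hvz
    exact ((k.swap hc).ne_of_fresh hno hC hz hx hy hxy hxz hyz hvz).2.2 (by rw [cxy, hc])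
  obtain ⟨m1, m2, -⟩ := k.ne_of_fresh hno hC hx hy hz hyz hxy.symm hxz.symm hux
  obtain ⟨n1, n2, n3, n4⟩ := k.notMem
  obtain ⟨n5, n6, n7, n8, n9, n10⟩ := k.ne
  obtain ⟨n11, n12⟩ := k.new
  have n13 := k.ne_color
  have hx' := hx; have hy' := hy; have hz' := hz; have hux' := hux
  simp only [Finset.mem_insert, not_or] at hx hy hz hux
  have hv' : v ∉ insert u (insert x (insert a (insert b s))) := by
    simp [*, n5.symm, Ne.symm hx.2.1]
  have key : ∀ w, w ∉ insert u (insert x (insert a (insert b s))) → v ≠ w →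
      c v w ∈ insert (c u v) (insert (c a b) C) → c v w = c a b ∨ c v w ∈ C := by
    intro w hw hvw h
    have := hno.mem_of_add_one m1 m2 hv' hw hvw
    simp only [Finset.mem_insert] at this h
    rcases h with h | h | h
    · rcases this with h' | h' | h'
      · exact absurd (h'.symm.trans h) hux.1
      · exact .inl h'
      · exact .inr h'
    · exact .inl h
    · exact .inr h
  have hy'' : y ∉ insert u (insert x (insert a (insert b s))) := by simp [*, hxy.symm]
  have hz'' : z ∉ insert u (insert x (insert a (insert b s))) := by simp [*, hxz.symm]
  have hvy' : v ≠ y := Ne.symm hy.2.1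
  have hvz' : v ≠ z := Ne.symm hz.2.1
  rcases key y hy'' hvy' hvy with e1 | e1
  · rcases key z hz'' hvz' hvz with e2 | e2
    · exact hB (bound_of_mono hc hno m1 m2 hv' hy'' hz'' hvy' hyz hvz' (by rw [cyz, e1])
        (by rw [e2, e1]))
    · exact hB (k.bound_of_third hc hno hN hC h1 h2 hx' hz' hxz hux' e2)
  · exact hB (k.bound_of_third hc hno hN hC h1 h2 hx' hy' hxy hux' e1)

/-- It remains to count the new colors between ab and uv. The edge x₁y₁ keeps the color of uv, so au
and bv, if both new, have the same color, and so do av and bu. This leaves two colors. -/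
theorem TwoEdges.bound_of_no_fresh (hc : ∀ a b, c a b = c b a) (hno : NoRainbow c (t + 1))
    (hN : 2 * t + 5 ≤ Fintype.card V) (k : TwoEdges c s C u v a b) (hC : C.card + 1 = t)
    {x₁ y₁ x₂ y₂ : V}
    (h1 : Config c (insert a (insert b s)) (insert (c a b) C) u v x₁ y₁)
    (h2 : Config c (insert u (insert v s)) (insert (c u v) C) a b x₂ y₂)
    (hR : ∀ p, p = u ∨ p = v ∨ p = a ∨ p = b →
      ∀ z ∉ insert u (insert v (insert a (insert b s))),
        c p z ∈ insert (c u v) (insert (c a b) C)) :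
    Bound t (Fintype.card V) (colors c Finset.univ).card := by
  obtain ⟨n1, n2, n3, n4⟩ := k.notMem
  obtain ⟨n5, n6, n7, n8, n9, n10⟩ := k.ne
  obtain ⟨n11, n12⟩ := k.new
  obtain ⟨-, -, n13, n14⟩ := h1.notMem
  obtain ⟨-, m2, m3, m4, m5, m6⟩ := h1.ne
  simp only [Finset.mem_insert, not_or] at n13 n14
  have h3 := k.rainbow.add (a := x₁) (b := y₁) (by tauto) (by tauto) m6 (by rw [h1.eq]; exact n11)
  rw [h1.eq] at h3
  have h4 : (insert (c u v) C).card + 1 = t + 1 := by rw [Finset.card_insert_of_notMem n11, hC]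
  have key : ∀ p q, [a, p, b, q].Nodup → (p = u ∧ q = v ∨ p = v ∧ q = u) →
      c a p ∉ insert (c u v) (insert (c a b) C) → c b q ∉ insert (c u v) (insert (c a b) C) →
      c a p = c b q := by
    intro p q hnd hpq e1 e2
    simp only [Finset.mem_insert, not_or] at e1 e2
    refine hno.eq_of_add_two h3 h4 ?_ hnd (by simp [e1]) (by simp [e2])
    simp only [Finset.mem_insert, not_or]
    rcases hpq with ⟨rfl, rfl⟩ | ⟨rfl, rfl⟩ <;>
    exact ⟨⟨Ne.symm n13.1, Ne.symm n14.1, n3⟩, ⟨by assumption, by assumption, by assumption⟩,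
      ⟨Ne.symm n13.2.1, Ne.symm n14.2.1, n4⟩, by assumption, by assumption, by assumption⟩
  refine k.bound_of_cover hc hno hN hC h1 h2
    (I := {c a u, c b v, c a v, c b u} \ insert (c u v) (insert (c a b) C))
    (card_sdiff_le_two (key u v (by simp; grind) (by simp))
    (key v u (by simp; grind) (by simp))) (fun p hp z hz => Finset.mem_union_left _ (hR p hp z hz))
    ?_
  intro p hp q hq
  rw [Finset.union_sdiff_self_eq_union]
  refine Finset.mem_union_right _ ?_
  rcases hp with rfl | rfl <;> rcases hq with rfl | rfl <;> simp

/-- Suppose the colors differ. If p = b, then ay, pq and xz together with `s` form a rainbow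
matching with t + 2 edges. If p = a, the edge bx is disjoint from two matchings with t + 1 edges:
one has ay in place of ab, the other has yz and aq in place of ab and uv. Comparing their colors
puts the color of bx into `C`, which yields a third soft edge. -/
theorem TwoEdges.eq_of_fresh (hc : ∀ a b, c a b = c b a) (hno : NoRainbow c (t + 1))
    (hN : 2 * t + 5 ≤ Fintype.card V)
    (hB : ¬ Bound t (Fintype.card V) (colors c Finset.univ).card)
    (k : TwoEdges c s C u v a b) (hC : C.card + 1 = t)
    (hx : x ∉ insert u (insert v (insert a (insert b s))))
    (hy : y ∉ insert u (insert v (insert a (insert b s))))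
    (hz : z ∉ insert u (insert v (insert a (insert b s)))) (hxy : x ≠ y) (hxz : x ≠ z) (hyz : y ≠ z)
    (cxy : c x y = c u v) (cxz : c x z = c u v) (cyz : c y z = c a b)
    (hay : c a y ∉ insert (c u v) (insert (c a b) C)) {p q : V} (hp : p = a ∨ p = b)
    (hq : q = u ∨ q = v) (hpq : c p q ∉ insert (c u v) (insert (c a b) C)) : c p q = c a y := by
  by_contra hne
  have h1 := k.config hx hy hxy cxy
  have h2 := k.symm.config (by rwa [← set_symm]) (by rwa [← set_symm]) hyz cyz
  obtain ⟨n1, n2, n3, n4⟩ := k.notMem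
  obtain ⟨n5, n6, n7, n8, n9, n10⟩ := k.ne
  obtain ⟨n11, n12⟩ := k.new
  have n13 := k.ne_color
  have hx' := hx; have hy' := hy; have hay' := hay
  simp only [Finset.mem_insert, not_or] at hx hy hz hay hpq
  have hqs : q ∉ s ∧ q ≠ a ∧ q ≠ b ∧ q ≠ x ∧ q ≠ y ∧ q ≠ z := by
    rcases hq with rfl | rfl
    · exact ⟨n1, n6, n7, Ne.symm hx.1, Ne.symm hy.1, Ne.symm hz.1⟩
    · exact ⟨n2, n8, n9, Ne.symm hx.2.1, Ne.symm hy.2.1, Ne.symm hz.2.1⟩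
  rcases hp with rfl | rfl
  · have hay2 : c p y ∉ insert (c p b) (insert (c u v) C) := by
      simp only [Finset.mem_insert, not_or]; exact ⟨hay.2.1, hay.1, hay.2.2⟩
    rw [set_symm] at hx' hy'
    obtain ⟨m1, m2, -⟩ := k.symm.ne_of_fresh hno hC hy' hx' (by rw [← set_symm]; simp [*]) hxz hxy
      hyz.symm hay2
    have e1 := hno.mem_of_add_one m1 m2 (a := b) (b := x) (by
      simp only [Finset.mem_insert, not_or]
      exact ⟨n10.symm, Ne.symm hy.2.2.2.1, n7.symm, n9.symm, n4⟩) (by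
      simp only [Finset.mem_insert, not_or]
      exact ⟨hx.2.2.1, hxy, hx.1, hx.2.1, hx.2.2.2.2⟩) (Ne.symm hx.2.2.2.1)
    have h3 := (k.rainbow.add hy.2.2.2.2 hz.2.2.2.2 hyz (by rwa [cyz])).add (a := p) (b := q)
      (by simp only [Finset.mem_insert, not_or]; exact ⟨Ne.symm hy.2.2.1, Ne.symm hz.2.2.1, n3⟩)
      (by simp only [Finset.mem_insert, not_or]; exact ⟨hqs.2.2.2.2.1, hqs.2.2.2.2.2, hqs.1⟩)
      (Ne.symm hqs.2.1) (by rw [cyz]; simp only [Finset.mem_insert, not_or]; exact hpq.2)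
    have e2 := hno.mem_of_add_one h3 (by
      rw [cyz, Finset.card_insert_of_notMem (by simp [hpq]), Finset.card_insert_of_notMem n12]
      omega) (a := b) (b := x) (by
      simp only [Finset.mem_insert, not_or]
      exact ⟨n10.symm, Ne.symm hqs.2.2.1, Ne.symm hy.2.2.2.1, Ne.symm hz.2.2.2.1, n4⟩) (by
      simp only [Finset.mem_insert, not_or]
      exact ⟨hx.2.2.1, Ne.symm hqs.2.2.2.1, hxy, hxz, hx.2.2.2.2⟩) (Ne.symm hx.2.2.2.1)
    rw [cyz] at e2
    simp only [Finset.mem_insert] at e1 e2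
    have e3 : c b x ∈ C := by
      rcases e1 with e1 | e1 | e1
      · rcases e2 with e2 | e2 | e2
        · exact absurd (e2.symm.trans e1) hne
        · exact absurd (e1.symm.trans e2) hay.2.1
        · exact e2
      · rcases e2 with e2 | e2 | e2
        · exact absurd (e2.symm.trans e1) hpq.1
        · exact absurd (e1.symm.trans e2) n13
        · exact e2
      · exact e1
    exact hB (k.symm.bound_of_third hc hno hN hC h2 h1 hy' hx' hxy.symm hay2 e3)
  · refine hno.false_of_add_three k.rainbow (by omega) (a := a) (b := y) (d := p) (e := q) (f := x)
      (g := z) ⟨n3, hy.2.2.2.2, n4, hqs.1, hx.2.2.2.2, hz.2.2.2.2⟩ ?_ hay.2.2 hpq.2.2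
      (by rwa [cxz]) (Ne.symm hne) (by rw [cxz]; exact hay.1) (by rw [cxz]; exact hpq.1)
    clear h1 h2 k hno hc
    simp; grind

/-- By the coloring of the triangle, u and v see no new colors off the matching. If a or b sees one,
at y or z, then every new color between ab and uv equals it, so the at most two new colors of the
soft edge ab off the matching are all that is needed. -/
theorem TwoEdges.bound_of_three_left (hc : ∀ a b, c a b = c b a) (hno : NoRainbow c (t + 1))
    (hN : 2 * t + 5 ≤ Fintype.card V)
    (k : TwoEdges c s C u v a b) (hC : C.card + 1 = t)
    (hx : x ∉ insert u (insert v (insert a (insert b s))))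
    (hy : y ∉ insert u (insert v (insert a (insert b s))))
    (hz : z ∉ insert u (insert v (insert a (insert b s)))) (hxy : x ≠ y) (hxz : x ≠ z) (hyz : y ≠ z)
    (hR : ∀ w ∉ insert u (insert v (insert a (insert b s))), w = x ∨ w = y ∨ w = z)
    (cxy : c x y = c u v) (cxz : c x z = c u v) (cyz : c y z = c a b) :
    Bound t (Fintype.card V) (colors c Finset.univ).card := by
  by_contra hB
  have h1 := k.config hx hy hxy cxy
  have h2 := k.symm.config (by rwa [← set_symm]) (by rwa [← set_symm]) hyz cyz
  have e1 : ∀ p, p = u ∨ p = v → ∀ w ∉ insert u (insert v (insert a (insert b s))),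
      c p w ∈ insert (c u v) (insert (c a b) C) := by
    intro p hp w hw
    wlog hpu : p = u generalizing u v
    · have hpv : p = v := by tauto
      rw [hc u v, set_swap] at *
      exact this (k.swap hc) hx hy hz hR cxy cxz (h1.swap hc)
        ((k.swap hc).symm.config (by rwa [← set_symm]) (by rwa [← set_symm]) hyz cyz)
        (.inl hpv) hw hpv
    subst hpu
    rcases hR w hw with rfl | rfl | rfl
    · exact k.left_mem hc hno hN hB hC hx hy hz hxy hxz hyz cxy cxz cyz
    · by_contra hf
      exact (k.ne_of_fresh hno hC hy hx hz hxz hxy hyz.symm hf).2.2 cxz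
    · by_contra hf
      exact (k.ne_of_fresh hno hC hz hx hy hxy hxz hyz hf).2.2 cxy
  by_cases hf : ∀ p, p = a ∨ p = b → ∀ w ∉ insert u (insert v (insert a (insert b s))),
      c p w ∈ insert (c u v) (insert (c a b) C)
  · exact hB (k.bound_of_no_fresh hc hno hN hC h1 h2 fun p hp => by
      rcases hp with hp | hp | hp
      exacts [e1 p (.inl hp), e1 p (.inr hp), hf p hp])
  push Not at hf
  obtain ⟨p, hp, w, hw, hpw⟩ := hf
  -- A new color from a or b to x would forbid the color of ab on yz.
  have hwx : w ≠ x := by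
    rintro rfl
    rcases hp with rfl | rfl
    · rw [set_symm] at hx hy hz
      rw [Finset.insert_comm] at hpw
      exact (k.symm.ne_of_fresh hno hC hx hy hz hyz hxy.symm hxz.symm hpw).2.2 cyz
    · rw [set_symm, set_swap] at hx hy hz
      rw [Finset.insert_comm, hc a p] at hpw
      exact ((k.symm.swap hc).ne_of_fresh hno hC hx hy hz hyz hxy.symm hxz.symm hpw).2.2
        (by rw [cyz, hc])
  have key : ∀ p' q', p' = a ∨ p' = b → q' = u ∨ q' = v →
      c p' q' ∉ insert (c u v) (insert (c a b) C) → c p' q' = c p w := by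
    intro p' q' hp' hq' hf
    have e : insert u (insert v (insert a (insert b s))) =
        insert u (insert v (insert b (insert a s))) := by rw [Finset.insert_comm a b]
    rcases hp with rfl | rfl
    · rcases hR w hw with rfl | rfl | rfl
      · exact absurd rfl hwx
      · exact k.eq_of_fresh hc hno hN hB hC hx hy hz hxy hxz hyz cxy cxz cyz hpw hp' hq' hf
      · exact k.eq_of_fresh hc hno hN hB hC hx hz hy hxz hxy hyz.symm cxz cxy (by rw [hc, cyz]) hpw
          hp' hq' hf
    · rw [e] at hx hy hz
      rw [hc a p] at hf hpw cyz
      rcases hR w hw with rfl | rfl | rfl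
      · exact absurd rfl hwx
      · exact (k.symm.swap hc).symm.eq_of_fresh hc hno hN hB hC hx hy hz hxy hxz hyz cxy cxz cyz hpw
          hp'.symm hq' hf
      · exact (k.symm.swap hc).symm.eq_of_fresh hc hno hN hB hC hx hz hy hxz hxy hyz.symm cxz cxy
          (by rw [hc, cyz]) hpw hp'.symm hq' hf
  obtain ⟨X, hX⟩ : ∃ X, X = insert (c u v) (insert (c a b) C) := ⟨_, rfl⟩
  have hI := h2.card_fresh_compl_le hno (by
    rw [Finset.card_insert_of_notMem k.new.1, hC]) (X := X) (by rw [hX, Finset.insert_comm])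
  rw [← set_symm] at hI
  have hab : ∀ p, p = a ∨ p = b → ∀ w ∉ insert u (insert v (insert a (insert b s))),
      c p w ∈ X ∪ fresh c X a b (Finset.univ \ insert u (insert v (insert a (insert b s)))) := by
    intro p hp w hw
    have hw' : w ∈ Finset.univ \ insert u (insert v (insert a (insert b s))) :=
      Finset.mem_sdiff.mpr ⟨Finset.mem_univ _, hw⟩
    rw [Finset.mem_union]
    rcases hp with rfl | rfl
    exacts [left_mem_or_fresh X _ _ hw', right_mem_or_fresh X _ _ hw']
  refine hB (k.bound_of_cover hc hno hN hC h1 h2 hI ?_ ?_)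
  · intro p hp w hw
    rw [← hX]
    rcases hp with hp | hp | hp
    · exact Finset.mem_union_left _ (hX ▸ e1 p (.inl hp) w hw)
    · exact Finset.mem_union_left _ (hX ▸ e1 p (.inr hp) w hw)
    · exact hab p hp w hw
  · intro p' hp' q' hq'
    rw [← hX]
    by_cases hf : c p' q' ∈ X
    · exact Finset.mem_union_left _ hf
    · rw [key p' q' hp' hq' (hX ▸ hf)]
      exact hab p hp w hw

end AntiRamsey

/-! ### Rainbow matchings on at least 2t + 5 vertices. -/

namespace AntiRamsey

variable {V : Type*} [DecidableEq V] [Fintype V] {c : V → V → ℕ} {s : Finset V} {C : Finset ℕ}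
  {t : ℕ} {u v a b x y z : V}

/-- A new color on u w₀ excludes the color of uv among the uncovered vertices other than w₀. Hence
all edges among them have the color of ab, and there are at least three such vertices, so a
monochromatic triangle arises. -/
theorem TwoEdges.left_mem_of_four (hc : ∀ a b, c a b = c b a) (hno : NoRainbow c (t + 1))
    (hB : ¬ Bound t (Fintype.card V) (colors c Finset.univ).card)
    (k : TwoEdges c s C u v a b) (hC : C.card + 1 = t)
    (h2 : ∀ x ∉ insert u (insert v (insert a (insert b s))),
      ∀ y ∉ insert u (insert v (insert a (insert b s))), x ≠ y → c x y = c u v ∨ c x y = c a b)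
    {w w₀ : V} (hx : x ∉ insert u (insert v (insert a (insert b s))))
    (hy : y ∉ insert u (insert v (insert a (insert b s))))
    (hz : z ∉ insert u (insert v (insert a (insert b s))))
    (hw : w ∉ insert u (insert v (insert a (insert b s)))) (hxy : x ≠ y) (hxz : x ≠ z) (hyz : y ≠ z)
    (hxw : x ≠ w) (hyw : y ≠ w) (hzw : z ≠ w)
    (hw₀ : w₀ ∉ insert u (insert v (insert a (insert b s)))) :
    c u w₀ ∈ insert (c u v) (insert (c a b) C) := by
  by_contra hf
  have e : ∀ x ∉ insert u (insert v (insert a (insert b s))),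
      ∀ y ∉ insert u (insert v (insert a (insert b s))), x ≠ y → x ≠ w₀ → y ≠ w₀ →
      c x y = c a b := fun x hx y hy hxy h1 h2' =>
    (h2 x hx y hy hxy).resolve_left (k.ne_of_fresh hno hC hw₀ hx hy hxy h1 h2' hf).2.2
  have hfull : (insert (c u v) (insert (c a b) C)).card = t + 1 := by
    have h1 := k.new
    have h2 := k.ne_color
    rw [Finset.card_insert_of_notMem (by simp; tauto), Finset.card_insert_of_notMem h1.2, hC]
  have key : ∀ x ∉ insert u (insert v (insert a (insert b s))),
      ∀ y ∉ insert u (insert v (insert a (insert b s))),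
      ∀ z ∉ insert u (insert v (insert a (insert b s))), x ≠ y → y ≠ z → x ≠ z → x ≠ w₀ → y ≠ w₀ →
      z ≠ w₀ → False := by
    intro x hx y hy z hz hxy hyz hxz h1 h2 h3
    refine hB (bound_of_mono hc hno k.full hfull hx hy hz hxy hyz hxz ?_ ?_)
    · rw [e y hy z hz hyz h2 h3, e x hx y hy hxy h1 h2]
    · rw [e x hx z hz hxz h1 h3, e x hx y hy hxy h1 h2]
  by_cases h1 : x = w₀
  · subst h1; exact key y hy z hz w hw hyz hzw hyw hxy.symm hxz.symm hxw.symm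
  by_cases h2 : y = w₀
  · subst h2; exact key x hx z hz w hw hxz hzw hxw h1 hyz.symm hyw.symm
  by_cases h3 : z = w₀
  · subst h3; exact key x hx y hy w hw hxy hyw hxw h1 h2 hzw.symm
  exact key x hx y hy z hz hxy hyz hxz h1 h2 h3

/-- Each of the three colors occurs on an edge of the matching, and these three edges are soft. -/
theorem bound_of_three_colors (hc : ∀ a b, c a b = c b a) (hno : NoRainbow c (t + 1))
    (hN : 2 * t + 5 ≤ Fintype.card V) (h : IsRainbow ⊤ c s C) (hC : C.card = t + 1)
    {x₁ y₁ x₂ y₂ x₃ y₃ : V} (h₁ : x₁ ∉ s ∧ y₁ ∉ s ∧ x₁ ≠ y₁) (h₂ : x₂ ∉ s ∧ y₂ ∉ s ∧ x₂ ≠ y₂)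
    (h₃ : x₃ ∉ s ∧ y₃ ∉ s ∧ x₃ ≠ y₃) (h12 : c x₁ y₁ ≠ c x₂ y₂) (h13 : c x₁ y₁ ≠ c x₃ y₃)
    (h23 : c x₂ y₂ ≠ c x₃ y₃) :
    Bound t (Fintype.card V) (colors c Finset.univ).card := by
  have m1 := hno.mem_of_add_one h hC h₁.1 h₁.2.1 h₁.2.2
  have m2 := hno.mem_of_add_one h hC h₂.1 h₂.2.1 h₂.2.2
  have m3 := hno.mem_of_add_one h hC h₃.1 h₃.2.1 h₃.2.2
  obtain ⟨u, v, s1, C1, a1, a2, a3, a4, a5, rfl, rfl, k1⟩ := h.exists_eq_insert m1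
  rw [Finset.mem_insert] at m2 m3
  obtain ⟨a, b, s2, C2, b1, b2, b3, b4, b5, rfl, rfl, k2⟩ :=
    k1.exists_eq_insert (m2.resolve_left h12.symm)
  have m3 := m3.resolve_left h13.symm
  rw [Finset.mem_insert] at m3
  obtain ⟨p, q, s3, C3, d1, d2, d3, d4, d5, rfl, rfl, k3⟩ :=
    k2.exists_eq_insert (m3.resolve_left h23.symm)
  rw [← a4] at h12 h13 a5 hC
  rw [← b4] at h12 h23 b5 hC a5
  rw [← d4] at h13 h23 d5 hC b5 a5
  rw [Finset.card_insert_of_notMem a5, Finset.card_insert_of_notMem b5,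
    Finset.card_insert_of_notMem d5] at hC
  simp only [Finset.mem_insert, not_or] at a1 a2 a5 b1 b2 b5 d1 d2 h₁ h₂ h₃
  have r1 := k3.add d1 d2 d3 d5
  clear h k1 k2 m1 m2 m3
  have n1 : [u, v, a, b, p, q].Nodup := by clear hno hc r1; simp; grind
  have n2 : u ∉ s3 ∧ v ∉ s3 ∧ a ∉ s3 ∧ b ∉ s3 ∧ p ∉ s3 ∧ q ∉ s3 := by
    simp only [a1, a2, b1, b2, d1, d2, not_false_eq_true, and_self]
  have n3 : c u v ≠ c a b ∧ c u v ≠ c p q ∧ c a b ≠ c p q ∧ c u v ∉ C3 ∧ c a b ∉ C3 ∧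
      c p q ∉ C3 := by
    simp only [a5, b5, d5, not_false_eq_true, and_self, ne_eq]
  simp only [List.nodup_cons, List.mem_cons, not_or, List.not_mem_nil, not_false_eq_true,
    List.nodup_nil, and_true] at n1
  clear a1 a2 a5 b1 b2 b5 d1 d2 d5
  have r2 := k3.add n2.2.2.1 n2.2.2.2.1 b3 n3.2.2.2.2.1
  refine bound_of_three_config hc hno hN k3 (by omega) (u := u) (v := v) (a := a) (b := b) (p := p)
    (q := q) (x₁ := x₁) (y₁ := y₁) (x₂ := x₂) (y₂ := y₂) (x₃ := x₃) (y₃ := y₃) ?_ ?_ ?_ <;>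
    clear hno hc hN hC
  · refine ⟨r1.add (by simp [n1, n2]) (by simp [n1, n2]) b3 (by simp [n3]), ?_, ?_, ?_, a4.symm⟩
    · simp [n1, n2, h₁]
    · simp; grind
    · simp [n3]
  · refine ⟨r1.add (by simp [n1, n2]) (by simp [n1, n2]) a3 (by simp [n3]), ?_, ?_, ?_, b4.symm⟩
    · simp [n1, n2, h₂]; grind
    · simp; grind
    · simp [n3]; exact n3.1.symm
  · refine ⟨r2.add (by simp [n1, n2]) (by simp [n1, n2]) a3 (by simp [n3]), ?_, ?_, ?_, d4.symm⟩
    · simp [n2, h₃]; grind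
    · simp; grind
    · simp [n3]; exact ⟨n3.2.1.symm, n3.2.2.1.symm⟩

set_option maxHeartbeats 800000 in
/-- The upper bound for colorings without rainbow matchings with `t + 2` edges. -/
theorem bound_of_noRainbow (hc : ∀ a b, c a b = c b a) (hno : NoRainbow c (t + 1))
    (hN : 2 * t + 5 ≤ Fintype.card V) :
    Bound t (Fintype.card V) (colors c Finset.univ).card := by
  by_contra hB
  -- Without a rainbow matching with t + 1 edges, Erdős–Gallai with m = t is already stronger than
  -- the bound.
  obtain ⟨s, C, h, hC⟩ : ∃ s C, IsRainbow ⊤ c s C ∧ C.card = t + 1 := by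
    by_contra hcon
    push Not at hcon
    have := card_colors_le c hc Finset.univ ∅ t (fun s C h _ _ => by
      have := hno s C h
      have := hcon s C h
      omega)
    rw [Finset.sdiff_empty, Finset.card_univ] at this
    refine hB ?_
    unfold Bound
    omega
  have hs : 3 ≤ (Finset.univ \ s).card := by
    rw [Finset.card_sdiff_of_subset (Finset.subset_univ _), h.card_eq, Finset.card_univ]
    omega
  obtain ⟨x, hx, y, hy, z, hz, hxy, hxz, hyz⟩ := Finset.two_lt_card.mp hs
  simp only [Finset.mem_sdiff, Finset.mem_univ, true_and] at hx hy hz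
  obtain ⟨x₁, y₁, x₂, y₂, h₁, h₂, h12⟩ : ∃ x₁ y₁ x₂ y₂, (x₁ ∉ s ∧ y₁ ∉ s ∧ x₁ ≠ y₁) ∧
      (x₂ ∉ s ∧ y₂ ∉ s ∧ x₂ ≠ y₂) ∧ c x₁ y₁ ≠ c x₂ y₂ := by
    by_cases e1 : c y z = c x y
    · by_cases e2 : c x z = c x y
      · exact absurd (bound_of_mono hc hno h hC hx hy hz hxy hyz hxz e1 e2) hB
      · exact ⟨x, z, x, y, ⟨hx, hz, hxz⟩, ⟨hx, hy, hxy⟩, e2⟩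
    · exact ⟨y, z, x, y, ⟨hy, hz, hyz⟩, ⟨hx, hy, hxy⟩, e1⟩
  have htwo : ∀ p ∉ s, ∀ q ∉ s, p ≠ q → c p q = c x₁ y₁ ∨ c p q = c x₂ y₂ := by
    intro p hp q hq hpq
    by_contra hcon
    rw [not_or] at hcon
    exact hB (bound_of_three_colors hc hno hN h hC h₁ h₂ ⟨hp, hq, hpq⟩ h12 (Ne.symm hcon.1)
      (Ne.symm hcon.2))
  have hmono : ¬ (c y z = c x y ∧ c x z = c x y) := fun e =>
    hB (bound_of_mono hc hno h hC hx hy hz hxy hyz hxz e.1 e.2)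
  have m1 := hno.mem_of_add_one h hC h₁.1 h₁.2.1 h₁.2.2
  have m2 := hno.mem_of_add_one h hC h₂.1 h₂.2.1 h₂.2.2
  obtain ⟨u, v, s1, C1, a1, a2, a3, a4, a5, rfl, rfl, k1⟩ := h.exists_eq_insert m1
  rw [Finset.mem_insert] at m2
  obtain ⟨a, b, s2, C2, b1, b2, b3, b4, b5, rfl, rfl, k2⟩ :=
    k1.exists_eq_insert (m2.resolve_left h12.symm)
  have hC2 : C2.card + 1 = t := by
    rw [Finset.card_insert_of_notMem a5, Finset.card_insert_of_notMem b5] at hC; omega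
  have k : TwoEdges c s2 C2 u v a b := by
    simp only [Finset.mem_insert, not_or] at a1 a2 a5
    refine ⟨k2, ⟨a1.2.2, a2.2.2, b1, b2⟩, ?_, ⟨by rw [a4]; exact a5.2, by rwa [b4]⟩, by rwa [a4, b4]⟩
    simp [a1, a2, a3, b3]
  rw [← a4, ← b4] at htwo
  have c1 := k.config h₁.1 h₁.2.1 h₁.2.2 a4.symm
  have c2 := k.symm.config (by rw [← TwoEdges.set_symm]; exact h₂.1)
    (by rw [← TwoEdges.set_symm]; exact h₂.2.1) h₂.2.2 b4.symm
  have e1 : insert u (insert v (insert a (insert b s2))) =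
      insert a (insert b (insert u (insert v s2))) := TwoEdges.set_symm _ _ _ _ _
  have e2 : insert u (insert v (insert a (insert b s2))) =
      insert v (insert u (insert a (insert b s2))) := TwoEdges.set_swap _ _ _ _ _
  have e3 : insert u (insert v (insert a (insert b s2))) =
      insert b (insert a (insert u (insert v s2))) := by rw [e1, Finset.insert_comm]
  by_cases hfour : ∃ w ∉ insert u (insert v (insert a (insert b s2))), x ≠ w ∧ y ≠ w ∧ z ≠ w
  · obtain ⟨w, hw, hxw, hyw, hzw⟩ := hfour
    refine hB (k.bound_of_no_fresh hc hno hN hC2 c1 c2 ?_)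
    intro p hp w₀ hw₀
    rcases hp with rfl | rfl | rfl | rfl
    · exact k.left_mem_of_four hc hno hB hC2 htwo hx hy hz hw hxy hxz hyz hxw hyw hzw hw₀
    · rw [e2] at htwo hx hy hz hw hw₀
      rw [hc u p] at *
      exact (k.swap hc).left_mem_of_four hc hno hB hC2 htwo hx hy hz hw hxy hxz hyz hxw hyw hzw hw₀
    · rw [e1] at htwo hx hy hz hw hw₀
      rw [Finset.insert_comm]
      exact k.symm.left_mem_of_four hc hno hB hC2 (fun p hp q hq hpq => (htwo p hp q hq hpq).symm)
        hx hy hz hw hxy hxz hyz hxw hyw hzw hw₀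
    · rw [e3] at htwo hx hy hz hw hw₀
      rw [hc a p] at *
      rw [Finset.insert_comm]
      exact (k.symm.swap hc).left_mem_of_four hc hno hB hC2
        (fun p hp q hq hpq => (htwo p hp q hq hpq).symm) hx hy hz hw hxy hxz hyz hxw hyw hzw hw₀
  · have hR : ∀ w ∉ insert u (insert v (insert a (insert b s2))), w = x ∨ w = y ∨ w = z := by
      intro w hw
      by_contra hcon
      simp only [not_or] at hcon
      exact hfour ⟨w, hw, Ne.symm hcon.1, Ne.symm hcon.2.1, Ne.symm hcon.2.2⟩
    have hR2 : ∀ w ∉ insert u (insert v (insert a (insert b s2))), w = y ∨ w = x ∨ w = z :=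
      fun w hw => by have := hR w hw; tauto
    have hR3 : ∀ w ∉ insert u (insert v (insert a (insert b s2))), w = z ∨ w = x ∨ w = y :=
      fun w hw => by have := hR w hw; tauto
    have cyx := hc y x
    have czx := hc z x
    have czy := hc z y
    -- The triangle xyz is not monochromatic, so after permuting its vertices and possibly
    -- exchanging uv with ab, two of its edges have the color of uv and the third that of ab.
    rcases htwo x hx y hy hxy with f1 | f1 <;> rcases htwo x hx z hz hxz with f2 | f2 <;>
      rcases htwo y hy z hz hyz with f3 | f3
    · exact hmono ⟨by rw [f1, f3], by rw [f1, f2]⟩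
    · exact hB (k.bound_of_three_left hc hno hN hC2 hx hy hz hxy hxz hyz hR f1 f2 f3)
    · exact hB (k.bound_of_three_left hc hno hN hC2 hy hx hz hxy.symm hyz hxz hR2 (by rwa [cyx]) f3
        f2)
    · rw [e1] at hx hy hz hR3
      exact hB (k.symm.bound_of_three_left hc hno hN hC2 hz hx hy hxz.symm hyz.symm hxy hR3
        (by rwa [czx]) (by rwa [czy]) f1)
    · exact hB (k.bound_of_three_left hc hno hN hC2 hz hx hy hxz.symm hyz.symm hxy hR3
        (by rwa [czx]) (by rwa [czy]) f1)
    · rw [e1] at hx hy hz hR2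
      exact hB (k.symm.bound_of_three_left hc hno hN hC2 hy hx hz hxy.symm hyz hxz hR2
        (by rwa [cyx]) f3 f2)
    · rw [e1] at hx hy hz hR
      exact hB (k.symm.bound_of_three_left hc hno hN hC2 hx hy hz hxy hxz hyz hR f1 f2 f3)
    · exact hmono ⟨by rw [f1, f3], by rw [f1, f2]⟩

end AntiRamsey

/-! ### Soft edges on 2t + 4 vertices. -/

namespace AntiRamsey

variable {V : Type*} [DecidableEq V] {c : V → V → ℕ} {s : Finset V} {C : Finset ℕ} {t : ℕ}

theorem IsRainbow.six {a b d e f g : V} (h : IsRainbow ⊤ c s C)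
    (hs : a ∉ s ∧ b ∉ s ∧ d ∉ s ∧ e ∉ s ∧ f ∉ s ∧ g ∉ s) (hnd : [a, b, d, e, f, g].Nodup)
    (h1 : c a b ∉ C) (h2 : c d e ∉ C) (h12 : c a b ≠ c d e) :
    IsRainbow ⊤ c (insert a (insert b (insert d (insert e s)))) (insert (c a b) (insert (c d e) C)) ∧
    f ∉ insert a (insert b (insert d (insert e s))) ∧
    g ∉ insert a (insert b (insert d (insert e s))) := by
  simp only [List.nodup_cons, List.mem_cons, not_or, List.not_mem_nil, not_false_eq_true,
    List.nodup_nil, and_true] at hnd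
  obtain ⟨n1, n2, n3, n4, n5⟩ := hnd
  obtain ⟨s1, s2, s3, s4, s5, s6⟩ := hs
  refine ⟨(h.add s3 s4 n3.1 h2).add (by simp [n1, s1]) (by simp [n2, s2]) n1.1 (by simp [h12, h1]),
    ?_, ?_⟩ <;> simp only [Finset.mem_insert, not_or]
  · exact ⟨Ne.symm n1.2.2.2.1, Ne.symm n2.2.2.1, Ne.symm n3.2.1, Ne.symm n4.1, s5⟩
  · exact ⟨Ne.symm n1.2.2.2.2, Ne.symm n2.2.2.2, Ne.symm n3.2.2, Ne.symm n4.2, s6⟩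

variable [Fintype V]

/-- Deleting the vertices of the rainbow matching `S` loses only the colors `D` and `Y`. -/
theorem exists_card_colors_le_of_cover {m : ℕ} (hc : ∀ a b, c a b = c b a) (hno : NoRainbow c m)
    {S : Finset V} {D Y : Finset ℕ} (hS : IsRainbow ⊤ c S D)
    (hY : ∀ p ∈ S, ∀ q, q ≠ p → c p q ∈ colors c (Finset.univ \ S) ∪ D ∪ Y) {j : ℕ}
    (hj : j + D.card = m) :
    ∃ k, (colors c Finset.univ).card ≤ D.card + Y.card + k ∧
      (k ≤ 2 * j ^ 2 + j ∨ 2 * k + j * (j + 1) ≤ 2 * j * (Fintype.card V - S.card)) := by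
  refine ⟨(colors c (Finset.univ \ S) \ D).card, ?_, ?_⟩
  · have hsub : colors c Finset.univ ⊆ (D ∪ Y) ∪ (colors c (Finset.univ \ S) \ D) := by
      have : colors c Finset.univ ⊆ colors c (Finset.univ \ S) ∪ D ∪ Y := by
        intro γ hγ
        obtain ⟨a, -, b, -, hab, rfl⟩ := mem_colors.mp hγ
        by_cases ha : a ∈ S
        · exact hY a ha b hab.symm
        by_cases hb : b ∈ S
        · rw [hc]; exact hY b hb a hab
        exact Finset.mem_union_left _ (Finset.mem_union_left _
          (mem_colors.mpr ⟨a, by simpa using ha, b, by simpa using hb, hab, rfl⟩))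
      intro γ hγ
      have := this hγ
      simp only [Finset.mem_union, Finset.mem_sdiff] at this ⊢
      tauto
    have h1 := Finset.card_le_card hsub
    have h2 := Finset.card_union_le (D ∪ Y) (colors c (Finset.univ \ S) \ D)
    have h3 := Finset.card_union_le D Y
    omega
  · have := card_colors_le c hc (Finset.univ \ S) D j (fun s' C' h' hs' hCD => by
      have := hno _ _ (h'.union hS (Finset.disjoint_left.mpr fun x hx => by
        have := hs' hx; simpa using this) hCD)
      rw [Finset.card_union_of_disjoint hCD] at this
      omega)
    rwa [Finset.card_sdiff_of_subset (Finset.subset_univ _), Finset.card_univ] at this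

/-- After deleting four vertices, 2(t - 1) + 2 remain, where the clique bound is the larger one in
Erdős–Gallai with m = t - 1. -/
theorem card_colors_le_of_two_soft (hc : ∀ a b, c a b = c b a) (hno : NoRainbow c (t + 1))
    (hN : Fintype.card V = 2 * t + 4) (ht : 1 ≤ t) {S : Finset V} {D Y : Finset ℕ}
    (hS : IsRainbow ⊤ c S D) (hD : D.card = 2)
    (hY : ∀ p ∈ S, ∀ q, q ≠ p → c p q ∈ colors c (Finset.univ \ S) ∪ D ∪ Y) :
    (colors c Finset.univ).card + 3 * t ≤ 2 * t ^ 2 + 3 + Y.card := by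
  obtain ⟨j, rfl⟩ := Nat.exists_eq_add_of_le' ht
  obtain ⟨k, h1, h2⟩ := exists_card_colors_le_of_cover hc hno hS hY (j := j) (by omega)
  have e : 2 * (j + 1) + 4 - 2 * 2 = 2 * j + 2 := by omega
  rw [hS.card_eq, hD, hN, e] at h2
  rcases h2 with h2 | h2
  · nlinarith
  · rcases j with _ | j
    · simp at h2; omega
    · nlinarith

/-- The same count with six vertices deleted: 2(t - 2) + 2 remain, and m = t - 2. -/
theorem card_colors_le_of_three_soft (hc : ∀ a b, c a b = c b a) (hno : NoRainbow c (t + 1))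
    (hN : Fintype.card V = 2 * t + 4) (ht : 2 ≤ t) {S : Finset V} {D Y : Finset ℕ}
    (hS : IsRainbow ⊤ c S D) (hD : D.card = 3)
    (hY : ∀ p ∈ S, ∀ q, q ≠ p → c p q ∈ colors c (Finset.univ \ S) ∪ D ∪ Y) :
    (colors c Finset.univ).card + 7 * t ≤ 2 * t ^ 2 + 9 + Y.card := by
  obtain ⟨j, rfl⟩ := Nat.exists_eq_add_of_le' ht
  obtain ⟨k, h1, h2⟩ := exists_card_colors_le_of_cover hc hno hS hY (j := j) (by omega)
  have e : 2 * (j + 2) + 4 - 2 * 3 = 2 * j + 2 := by omega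
  rw [hS.card_eq, hD, hN, e] at h2
  rcases h2 with h2 | h2
  · nlinarith
  · rcases j with _ | j
    · simp at h2; omega
    · nlinarith

/-- If a color `c p q` of a rainbow matching can be replaced by two edges `ij` and `kl` outside of it
together with `pq`, then the edge `de` of that color meets few new colors. -/
theorem IsRainbow.soft_edge (hno : NoRainbow c (t + 1)) (h : IsRainbow ⊤ c s C)
    (hC : C.card + 2 = t) {d e : V} (hd : d ∉ s) (he : e ∉ s) (hde : d ≠ e) (hγ : c d e ∉ C)
    {i j k l p q : V} (hs : i ∉ insert d (insert e s) ∧ j ∉ insert d (insert e s) ∧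
      k ∉ insert d (insert e s) ∧ l ∉ insert d (insert e s) ∧ p ∉ insert d (insert e s) ∧
      q ∉ insert d (insert e s))
    (hnd : [i, j, k, l, p, q].Nodup) (hij : c i j ∉ insert (c d e) C)
    (hkl : c k l ∉ insert (c d e) C) (hne : c i j ≠ c k l) (hpq : c p q = c d e) :
    Config c (insert i (insert j (insert k (insert l s)))) (insert (c i j) (insert (c k l) C))
        d e p q ∧ ∃ F : Finset ℕ, F.card ≤ 2 * t + 2 ∧
      ∀ z, z ≠ d → z ≠ e → c d z ∈ insert (c i j) (insert (c k l) (insert (c d e) C)) ∪ F ∧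
        c e z ∈ insert (c i j) (insert (c k l) (insert (c d e) C)) ∪ F := by
  simp only [Finset.mem_insert, not_or] at hs hij hkl
  obtain ⟨h1, h2, h3⟩ := h.six ⟨hs.1.2.2, hs.2.1.2.2, hs.2.2.1.2.2, hs.2.2.2.1.2.2,
    hs.2.2.2.2.1.2.2, hs.2.2.2.2.2.2.2⟩ hnd hij.2 hkl.2 hne
  have k1 : Config c (insert i (insert j (insert k (insert l s))))
      (insert (c i j) (insert (c k l) C)) d e p q := by
    refine ⟨h1, ⟨?_, ?_, h2, h3⟩, ?_, ?_, hpq⟩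
    · simp only [Finset.mem_insert, not_or]
      exact ⟨Ne.symm hs.1.1, Ne.symm hs.2.1.1, Ne.symm hs.2.2.1.1, Ne.symm hs.2.2.2.1.1, hd⟩
    · simp only [Finset.mem_insert, not_or]
      exact ⟨Ne.symm hs.1.2.1, Ne.symm hs.2.1.2.1, Ne.symm hs.2.2.1.2.1, Ne.symm hs.2.2.2.1.2.1, he⟩
    · clear hno h h1 h2 h3
      simp only [List.nodup_cons, List.mem_cons, not_or, List.not_mem_nil, not_false_eq_true,
        List.nodup_nil, and_true] at hnd ⊢
      exact ⟨⟨hde, Ne.symm hs.2.2.2.2.1.1, Ne.symm hs.2.2.2.2.2.1⟩,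
        ⟨Ne.symm hs.2.2.2.2.1.2.1, Ne.symm hs.2.2.2.2.2.2.1⟩, hnd.2.2.2.2⟩
    · simp only [Finset.mem_insert, not_or]
      exact ⟨Ne.symm hij.1, Ne.symm hkl.1, hγ⟩
  have hc2 : (insert (c i j) (insert (c k l) C)).card = t := by
    rw [Finset.card_insert_of_notMem (by simp [hij, hne]), Finset.card_insert_of_notMem hkl.2, ← hC]
  obtain ⟨X, hX⟩ : ∃ X, X = insert (c i j) (insert (c k l) (insert (c d e) C)) := ⟨_, rfl⟩
  have hX' : insert (c d e) (insert (c i j) (insert (c k l) C)) ⊆ X := by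
    rw [hX]; intro z; simp; tauto
  have f1 := k1.card_fresh_self_le hno hc2 hX'
  have f2 := k1.card_fresh_compl_le hno hc2 hX'
  rw [hc2] at f1
  -- There are 2t new colors towards the t edges of the new matching and two towards the vertices
  -- off it.
  refine ⟨k1, _ ∪ _, (Finset.card_union_le _ _).trans (Nat.add_le_add f1 f2), fun z hzd hze => ?_⟩
  rw [← hX]
  by_cases hz : z ∈ insert i (insert j (insert k (insert l s)))
  · exact ⟨Finset.mem_union.mpr ((left_mem_or_fresh X d e hz).imp_right (Finset.mem_union_left _)),
      Finset.mem_union.mpr ((right_mem_or_fresh X d e hz).imp_right (Finset.mem_union_left _))⟩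
  · have hz' : z ∈ Finset.univ \ insert d (insert e (insert i (insert j (insert k (insert l s))))) := by
      rw [Finset.mem_sdiff, Finset.mem_insert, Finset.mem_insert, not_or, not_or]
      exact ⟨Finset.mem_univ _, hzd, hze, hz⟩
    exact ⟨Finset.mem_union.mpr ((left_mem_or_fresh X d e hz').imp_right (Finset.mem_union_right _)),
      Finset.mem_union.mpr ((right_mem_or_fresh X d e hz').imp_right (Finset.mem_union_right _))⟩

theorem exists_soft_edge (hno : NoRainbow c (t + 1)) (h : IsRainbow ⊤ c s C) (hC : C.card + 1 = t)
    {i j k l p q : V} (hs : i ∉ s ∧ j ∉ s ∧ k ∉ s ∧ l ∉ s ∧ p ∉ s ∧ q ∉ s)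
    (hnd : [i, j, k, l, p, q].Nodup) (hij : c i j ∉ C) (hkl : c k l ∉ C) (hne : c i j ≠ c k l)
    (hpq : c p q ∈ C) :
    ∃ d e s' C', ∃ F : Finset ℕ, d ∉ s' ∧ e ∉ s' ∧ d ≠ e ∧ c d e = c p q ∧ c p q ∉ C' ∧
      s = insert d (insert e s') ∧ C = insert (c p q) C' ∧ IsRainbow ⊤ c s' C' ∧
      Config c (insert i (insert j (insert k (insert l s')))) (insert (c i j) (insert (c k l) C'))
        d e p q ∧ F.card ≤ 2 * t + 2 ∧
      ∀ z, z ≠ d → z ≠ e → c d z ∈ insert (c i j) (insert (c k l) C) ∪ F ∧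
        c e z ∈ insert (c i j) (insert (c k l) C) ∪ F := by
  obtain ⟨d, e, s', C', hd, he, hde, hcol, hγ, rfl, rfl, h'⟩ := h.exists_eq_insert hpq
  rw [← hcol] at hγ hC hij hkl ⊢
  rw [Finset.card_insert_of_notMem hγ] at hC
  obtain ⟨k1, F, hF, hcov⟩ := h'.soft_edge hno hC hd he hde hγ hs hnd hij hkl hne hcol.symm
  exact ⟨d, e, s', C', F, hd, he, hde, rfl, hγ, rfl, rfl, h', k1, hF, hcov⟩

end AntiRamsey

/-! ### Mixed configurations. -/

namespace AntiRamsey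

variable {V : Type*} [DecidableEq V]

/-- A rainbow matching that covers all vertices but six. -/
structure Six (c : V → V → ℕ) (s : Finset V) (C : Finset ℕ) (a b u v x y : V) : Prop where
  rainbow : IsRainbow ⊤ c s C
  notMem : a ∉ s ∧ b ∉ s ∧ u ∉ s ∧ v ∉ s ∧ x ∉ s ∧ y ∉ s
  nodup : [a, b, u, v, x, y].Nodup
  cover : ∀ z, z ∈ s ∨ z = a ∨ z = b ∨ z = u ∨ z = v ∨ z = x ∨ z = y

/-- Three disjoint pairs of vertices outside of a rainbow matching such that two of them have
distinct new colors, whereas the third one has a color of the matching. -/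
def Replaceable (c : V → V → ℕ) (s : Finset V) (C : Finset ℕ) : Prop :=
  ∃ i j k l p q, (i ∉ s ∧ j ∉ s ∧ k ∉ s ∧ l ∉ s ∧ p ∉ s ∧ q ∉ s) ∧ [i, j, k, l, p, q].Nodup ∧
    c i j ∉ C ∧ c k l ∉ C ∧ c i j ≠ c k l ∧ c p q ∈ C

/-- A configuration of two edges `uv` and `xy` of a new color, an edge `ux` with the color of the
edge `ab` of the matching, and an opposite edge `vy` with a new color. -/
structure Mixed (c : V → V → ℕ) (s : Finset V) (C : Finset ℕ) (a b u v x y : V) : Prop where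
  six : Six c s C a b u v x y
  uv : c u v ∉ C
  xy : c x y = c u v
  ab : c a b ∉ C
  ux : c u x = c a b
  uv_ne : c u v ≠ c a b
  vy : c v y ∉ C
  vy_ne : c v y ≠ c a b

variable {c : V → V → ℕ} {s : Finset V} {C : Finset ℕ} {t : ℕ} {a b u v x y : V}

theorem Six.ne (k : Six c s C a b u v x y) :
    (a ≠ b ∧ a ≠ u ∧ a ≠ v ∧ a ≠ x ∧ a ≠ y ∧ b ≠ u ∧ b ≠ v ∧ b ≠ x ∧ b ≠ y ∧ u ≠ v ∧ u ≠ x ∧ u ≠ y ∧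
      v ≠ x ∧ v ≠ y ∧ x ≠ y) ∧
    (b ≠ a ∧ u ≠ a ∧ v ≠ a ∧ x ≠ a ∧ y ≠ a ∧ u ≠ b ∧ v ≠ b ∧ x ≠ b ∧ y ≠ b ∧ v ≠ u ∧ x ≠ u ∧ y ≠ u ∧
      x ≠ v ∧ y ≠ v ∧ y ≠ x) := by
  have := k.nodup
  simp only [List.nodup_cons, List.mem_cons, not_or, List.not_mem_nil, not_false_eq_true,
    List.nodup_nil, and_true] at this
  obtain ⟨⟨h1, h2, h3, h4, h5⟩, ⟨h6, h7, h8, h9⟩, ⟨h10, h11, h12⟩, ⟨h13, h14⟩, h15⟩ := this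
  exact ⟨⟨h1, h2, h3, h4, h5, h6, h7, h8, h9, h10, h11, h12, h13, h14, h15⟩, Ne.symm h1, Ne.symm h2,
    Ne.symm h3, Ne.symm h4, Ne.symm h5, Ne.symm h6, Ne.symm h7, Ne.symm h8, Ne.symm h9, Ne.symm h10,
    Ne.symm h11, Ne.symm h12, Ne.symm h13, Ne.symm h14, Ne.symm h15⟩

theorem Six.swap (k : Six c s C a b u v x y) : Six c s C b a u v x y := by
  have h := k.ne
  have h' := k.notMem
  refine ⟨k.rainbow, by simp [h'], by simp [h], fun z => ?_⟩
  have := k.cover z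
  tauto

theorem Six.exchange (k : Six c s C a b u v x y) : Six c s C a b x y u v := by
  have h := k.ne
  have h' := k.notMem
  refine ⟨k.rainbow, by simp [h'], by simp [h], fun z => ?_⟩
  have := k.cover z
  tauto

namespace Mixed

theorem swap (hc : ∀ a b, c a b = c b a) (k : Mixed c s C a b u v x y) : Mixed c s C b a u v x y :=
  ⟨k.six.swap, k.uv, k.xy, by rw [hc]; exact k.ab, by rw [hc b a]; exact k.ux,
    by rw [hc b a]; exact k.uv_ne, k.vy, by rw [hc b a]; exact k.vy_ne⟩

theorem exchange (hc : ∀ a b, c a b = c b a) (k : Mixed c s C a b u v x y) :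
    Mixed c s C a b x y u v :=
  ⟨k.six.exchange, by rw [k.xy]; exact k.uv, k.xy.symm, k.ab, by rw [hc]; exact k.ux,
    by rw [k.xy]; exact k.uv_ne, by rw [hc]; exact k.vy, by rw [hc]; exact k.vy_ne⟩

theorem config_left (k : Mixed c s C a b u v x y) :
    Config c (insert a (insert b s)) (insert (c a b) C) u v x y := by
  have h := k.six.ne
  have h' := k.six.notMem
  exact ⟨k.six.rainbow.add h'.1 h'.2.1 h.1.1 k.ab, by simp [h, h'], by simp [h],
    by simp [k.uv, k.uv_ne], k.xy⟩

/-- This is the second soft edge of a mixed configuration: ux repeats the color of ab, and the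
vertices v and y stay matched to each other by their new color. -/
theorem config_right (k : Mixed c s C a b u v x y) :
    Config c (insert v (insert y s)) (insert (c v y) C) a b u x := by
  have h := k.six.ne
  have h' := k.six.notMem
  exact ⟨k.six.rainbow.add (by simp [h']) (by simp [h']) (by simp [h]) k.vy, by simp [h, h'],
    by simp [h], by simp [k.ab, k.vy_ne.symm], k.ux⟩

/-- The colors inside of `{u, v, x, y}` and those of the matching with the edge `ab`. -/
def base (c : V → V → ℕ) (C : Finset ℕ) (a b u v x y : V) : Finset ℕ :=
  insert (c a b) C ∪ colors c {u, v, x, y}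

/-- The new colors inside of `{u, v, x, y}`. -/
def live (c : V → V → ℕ) (C : Finset ℕ) (a b u v x y : V) : Finset ℕ :=
  colors c {u, v, x, y} \ insert (c a b) C

/-- The new colors between `{a, b}` and `{u, v, x, y}`. -/
def cross (c : V → V → ℕ) (C : Finset ℕ) (a b u v x y : V) : Finset ℕ :=
  fresh c (base c C a b u v x y) a b {u, v, x, y}

theorem mem_colors_four (hc : ∀ a b, c a b = c b a) {γ : ℕ} (hnd : [u, v, x, y].Nodup) :
    γ ∈ colors c {u, v, x, y} ↔
      c u v = γ ∨ c u x = γ ∨ c u y = γ ∨ c v x = γ ∨ c v y = γ ∨ c x y = γ := by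
  simp only [List.nodup_cons, List.mem_cons, not_or, List.not_mem_nil, not_false_eq_true,
    List.nodup_nil, and_true] at hnd
  rw [mem_colors]
  constructor
  · rintro ⟨p, hp, q, hq, hpq, rfl⟩
    simp only [Finset.mem_insert, Finset.mem_singleton] at hp hq
    rcases hp with hp | hp | hp | hp <;> rcases hq with hq | hq | hq | hq <;>
      first
      | exact absurd (hp.trans hq.symm) hpq
      | simp [hp, hq, hc v u, hc x u, hc y u, hc x v, hc y v, hc y x]
  · rintro (h | h | h | h | h | h)
    · exact ⟨u, by simp, v, by simp, by tauto, h⟩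
    · exact ⟨u, by simp, x, by simp, by tauto, h⟩
    · exact ⟨u, by simp, y, by simp, by tauto, h⟩
    · exact ⟨v, by simp, x, by simp, by tauto, h⟩
    · exact ⟨v, by simp, y, by simp, by tauto, h⟩
    · exact ⟨x, by simp, y, by simp, by tauto, h⟩

/-- The edges uv and xy give one live color, vy a second one, ux none, and uy and vx agree when both
are new. -/
theorem card_live_le (hc : ∀ a b, c a b = c b a) (hno : NoRainbow c (t + 1)) (hC : C.card + 1 = t)
    (k : Mixed c s C a b u v x y) : (live c C a b u v x y).card ≤ 3 := by
  have h := k.six.ne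
  have h' := k.six.notMem
  have k1 := k.config_left
  have e : c u y ∉ insert (c a b) C → c v x ∉ insert (c a b) C → c u y = c v x :=
    fun h1 h2 => hno.eq_of_add_two k1.rainbow (by rw [Finset.card_insert_of_notMem k.ab, hC])
      (by simp [h, h']) (by simp [h]) h1 h2
  have hsub : live c C a b u v x y ⊆
      {c u v, c v y} ∪ (({c u y, c v x} : Finset ℕ) \ insert (c a b) C) := by
    intro γ hγ
    rw [live, Finset.mem_sdiff, mem_colors_four hc (by simp [h])] at hγ
    obtain ⟨h1, h2⟩ := hγ
    rcases h1 with rfl | rfl | rfl | rfl | rfl | rfl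
    · simp
    · rw [k.ux] at h2; simp at h2
    · simp only [Finset.mem_union, Finset.mem_sdiff]; exact .inr ⟨by simp, h2⟩
    · simp only [Finset.mem_union, Finset.mem_sdiff]; exact .inr ⟨by simp, h2⟩
    · simp
    · rw [k.xy]; simp
  have h1 : (({c u y, c v x} : Finset ℕ) \ insert (c a b) C).card ≤ 1 := by
    rw [Finset.card_le_one]
    intro p hp q hq
    rw [Finset.mem_sdiff, Finset.mem_insert, Finset.mem_singleton] at hp hq
    obtain ⟨rfl | rfl, hp⟩ := hp <;> obtain ⟨rfl | rfl, hq⟩ := hq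
    · rfl
    · exact e hp hq
    · exact (e hq hp).symm
    · rfl
  have h2 := Finset.card_le_card hsub
  have h3 := Finset.card_union_le {c u v, c v y} (({c u y, c v x} : Finset ℕ) \ insert (c a b) C)
  have h4 := Finset.card_le_two (a := c u v) (b := c v y)
  omega

theorem uv_mem_live (k : Mixed c s C a b u v x y) : c u v ∈ live c C a b u v x y := by
  have h := k.six.ne
  rw [live, Finset.mem_sdiff, mem_colors]
  exact ⟨⟨u, by simp, v, by simp, h.1.2.2.2.2.2.2.2.2.2.1, rfl⟩, by simp [k.uv, k.uv_ne]⟩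

theorem notMem_of_notMem_base {γ : ℕ}
    (h : γ ∉ base c C a b u v x y) : γ ∉ C ∧ γ ≠ c a b ∧
      ∀ p ∈ ({u, v, x, y} : Finset V), ∀ q ∈ ({u, v, x, y} : Finset V), p ≠ q → γ ≠ c p q := by
  simp only [base, Finset.mem_union, Finset.mem_insert, not_or] at h
  refine ⟨h.1.2, h.1.1, fun p hp q hq hpq he => h.2 ?_⟩
  exact mem_colors.mpr ⟨p, hp, q, hq, hpq, he.symm⟩

/-- Edges from `a` and `b` to two vertices have the same color if both colors are new and the two
other vertices have a new color. -/
theorem eq_of_live (hno : NoRainbow c (t + 1)) (hC : C.card + 1 = t) (k : Mixed c s C a b u v x y) {p q r w : V} (hpq : p ∉ s ∧ q ∉ s ∧ r ∉ s ∧ w ∉ s)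
    (hnd : [a, p, b, q, r, w].Nodup) (hrw : c r w ∉ C)
    (h1 : c a p ∉ C ∧ c a p ≠ c r w) (h2 : c b q ∉ C ∧ c b q ≠ c r w) : c a p = c b q := by
  by_contra hne
  have h := k.six.notMem
  exact hno.false_of_add_three k.six.rainbow (by omega) (by simp [h, hpq]) hnd h1.1 h2.1 hrw hne
    h1.2 h2.2

theorem base_subset {T : Finset ℕ} (h1 : insert (c a b) C ⊆ T)
    (h2 : c u v ∈ T) (h3 : (live c C a b u v x y).erase (c u v) ⊆ T) : base c C a b u v x y ⊆ T := by
  refine Finset.union_subset h1 fun γ hγ => ?_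
  by_cases e1 : γ ∈ insert (c a b) C
  · exact h1 e1
  by_cases e2 : γ = c u v
  · rwa [e2]
  exact h3 (Finset.mem_erase.mpr ⟨e2, Finset.mem_sdiff.mpr ⟨hγ, e1⟩⟩)

/-- The edges inside of the six vertices. -/
theorem mem_of_base_subset (hc : ∀ a b, c a b = c b a) {T : Finset ℕ}
    (h1 : base c C a b u v x y ⊆ T) (h2 : cross c C a b u v x y ⊆ T) {p q : V}
    (hp : p = a ∨ p = b ∨ p ∈ ({u, v, x, y} : Finset V))
    (hq : q = a ∨ q = b ∨ q ∈ ({u, v, x, y} : Finset V)) (hpq : p ≠ q) : c p q ∈ T := by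
  have f := mem_of_fresh_subset h1 h2
  have hab : c a b ∈ T := h1 (by simp [base])
  rcases hp with hp | hp | hp <;> rcases hq with hq | hq | hq
  · exact absurd (hp.trans hq.symm) hpq
  · rwa [hp, hq]
  · rw [hp]; exact (f q hq).1
  · rwa [hp, hq, hc]
  · exact absurd (hp.trans hq.symm) hpq
  · rw [hp]; exact (f q hq).2
  · rw [hq, hc]; exact (f p hp).1
  · rw [hq, hc]; exact (f p hp).2
  · exact h1 (Finset.mem_union_right _ (mem_colors.mpr ⟨p, hp, q, hq, hpq, rfl⟩))

variable [Fintype V]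

/-- Delete the soft edges uv and ab. Each sees at most 2(t - 1) new colors towards `s`, and the
remaining losses are the live colors except that of uv and the cross colors. -/
theorem card_colors_le_live_cross (hc : ∀ a b, c a b = c b a) (hno : NoRainbow c (t + 1))
    (hN : Fintype.card V = 2 * t + 4) (hC : C.card + 1 = t) (k : Mixed c s C a b u v x y) :
    (colors c Finset.univ).card + 2 ≤
      2 * t ^ 2 + t + (live c C a b u v x y).card + (cross c C a b u v x y).card := by
  have h := k.six.ne
  have h' := k.six.notMem
  have f1 := k.config_left.card_fresh_pair_le hno k.six.rainbow hC h'.1 h'.2.1 h.1.1 rfl k.ab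
    (X := base c C a b u v x y) (by
      intro γ hγ
      rw [Finset.mem_insert] at hγ
      rcases hγ with rfl | hγ
      · exact Finset.mem_union_right _ (mem_colors.mpr ⟨u, by simp, v, by simp, by simp [h], rfl⟩)
      · exact Finset.mem_union_left _ hγ)
  have f2 := k.config_right.card_fresh_pair_le hno k.six.rainbow hC (by simp [h']) (by simp [h'])
    (by simp [h]) rfl k.vy (X := base c C a b u v x y) (by
      intro γ hγ
      simp only [Finset.mem_insert] at hγ
      rcases hγ with rfl | rfl | hγ
      · simp [base]
      · exact Finset.mem_union_right _ (mem_colors.mpr ⟨v, by simp, y, by simp, by simp [h], rfl⟩)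
      · simp [base, hγ])
  have f3 := Finset.card_erase_of_mem k.uv_mem_live
  have f4 := Finset.card_pos.mpr ⟨_, k.uv_mem_live⟩
  have hS : IsRainbow ⊤ c {u, v, a, b} {c u v, c a b} :=
    (IsRainbow.pair (c := c) h.1.1).add (by simp [h]) (by simp [h]) (by simp [h])
      (by simp [k.uv_ne])
  generalize hF1 : fresh c _ u v s = F1 at f1
  generalize hF2 : fresh c _ a b s = F2 at f2
  have g1 := Finset.card_union_le (F1 ∪ F2 ∪ (live c C a b u v x y).erase (c u v))
    (cross c C a b u v x y)
  have g2 := Finset.card_union_le (F1 ∪ F2) ((live c C a b u v x y).erase (c u v))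
  have g3 := Finset.card_union_le F1 F2
  have := card_colors_le_of_two_soft hc hno hN (by omega) hS (Finset.card_pair k.uv_ne)
    (Y := F1 ∪ F2 ∪ (live c C a b u v x y).erase (c u v) ∪ cross c C a b u v x y) (by
      generalize hT : colors c (Finset.univ \ {u, v, a, b}) ∪ {c u v, c a b} ∪
        (F1 ∪ F2 ∪ (live c C a b u v x y).erase (c u v) ∪ cross c C a b u v x y) = T
      have hCT : C ⊆ T := by
        rw [← hT]
        refine (k.six.rainbow.subset_colors (A := Finset.univ \ {u, v, a, b}) fun z hz => ?_).trans
          (Finset.subset_union_left.trans Finset.subset_union_left)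
        simp only [Finset.mem_sdiff, Finset.mem_univ, true_and, Finset.mem_insert,
          Finset.mem_singleton]
        rintro (rfl | rfl | rfl | rfl) <;> simp [hz] at h'
      have hab : c a b ∈ T := by rw [← hT]; simp
      have huv : c u v ∈ T := by rw [← hT]; simp
      have hbase : base c C a b u v x y ⊆ T :=
        base_subset (Finset.insert_subset hab hCT) huv (by
          rw [← hT]; intro γ hγ; simp only [Finset.mem_union]; tauto)
      have hcross : cross c C a b u v x y ⊆ T := by
        rw [← hT]; exact Finset.subset_union_right.trans Finset.subset_union_right
      have e1 := mem_of_fresh_subset hbase (hF1.trans_subset (by rw [← hT]; intro z hz; simp [hz]))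
      have e2 := mem_of_fresh_subset hbase (hF2.trans_subset (by rw [← hT]; intro z hz; simp [hz]))
      intro p hp z hz
      by_cases hzs : z ∈ s
      · simp only [Finset.mem_insert, Finset.mem_singleton] at hp
        rcases hp with rfl | rfl | rfl | rfl
        exacts [(e1 z hzs).1, (e1 z hzs).2, (e2 z hzs).1, (e2 z hzs).2]
      · refine mem_of_base_subset hc hbase hcross ?_ ?_ hz.symm
        · clear f1 f2 f3 f4 hS hF1 hF2 hno e1 e2
          simp only [Finset.mem_insert, Finset.mem_singleton] at hp ⊢; tauto
        · have := (k.six.cover z).resolve_left hzs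
          simpa only [Finset.mem_insert, Finset.mem_singleton] using this)
  omega

end Mixed

end AntiRamsey

/-! ### Replaceable edges. -/

namespace AntiRamsey

variable {V : Type*} [DecidableEq V] {c : V → V → ℕ} {s : Finset V} {C : Finset ℕ} {t : ℕ}
  {a b u v x y : V}

theorem NoRainbow.eq_or_eq_of_add_three (hno : NoRainbow c (t + 1)) (h : IsRainbow ⊤ c s C)
    (hC : C.card + 1 = t) {a b d e f g : V}
    (hs : a ∉ s ∧ b ∉ s ∧ d ∉ s ∧ e ∉ s ∧ f ∉ s ∧ g ∉ s) (hnd : [a, b, d, e, f, g].Nodup)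
    (h1 : c a b ∉ C) (h2 : c d e ∉ C) (h3 : c f g ∉ C) (h12 : c a b ≠ c d e) :
    c f g = c a b ∨ c f g = c d e := by
  by_contra hne
  rw [not_or] at hne
  exact hno.false_of_add_three h (by omega) hs hnd h1 h2 h3 h12 (Ne.symm hne.1) (Ne.symm hne.2)

/-- If two edges from `a` have distinct new colors, then an edge from `b` has an old color. -/
theorem NoRainbow.mem_of_same_end (hno : NoRainbow c (t + 1))
    (h : IsRainbow ⊤ c s C) (hC : C.card + 1 = t) {p q r w : V}
    (hs : a ∉ s ∧ b ∉ s ∧ p ∉ s ∧ q ∉ s ∧ r ∉ s ∧ w ∉ s) (hnd : [a, b, p, q, r, w].Nodup)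
    (hap : c a p ∉ C) (haq : c a q ∉ C) (hne : c a p ≠ c a q) (hpw : c p w ∉ C) (hqw : c q w ∉ C)
    (hne' : c p w ≠ c q w) (h1 : c a p ≠ c p w) (h2 : c a p ≠ c q w) (h3 : c a q ≠ c p w)
    (h4 : c a q ≠ c q w) : c b r ∈ C ∧ Replaceable c s C := by
  simp only [List.nodup_cons, List.mem_cons, not_or, List.not_mem_nil, not_false_eq_true,
    List.nodup_nil, and_true] at hnd
  have hnd1 : [a, p, q, w, b, r].Nodup := by simp; grind
  have hnd2 : [a, q, p, w, b, r].Nodup := by simp; grind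
  have hs1 : a ∉ s ∧ p ∉ s ∧ q ∉ s ∧ w ∉ s ∧ b ∉ s ∧ r ∉ s := by simp [hs]
  have hs2 : a ∉ s ∧ q ∉ s ∧ p ∉ s ∧ w ∉ s ∧ b ∉ s ∧ r ∉ s := by simp [hs]
  -- If br had a new color, this would have to be one of the colors of ap and qw, and also one of
  -- those of aq and pw; but all these colors are different.
  have hbr : c b r ∈ C := by
    by_contra hbr
    rcases hno.eq_or_eq_of_add_three h hC hs1 hnd1 hap hqw hbr h2 with e1 | e1 <;>
    rcases hno.eq_or_eq_of_add_three h hC hs2 hnd2 haq hpw hbr h3 with e2 | e2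
    · exact hne (e1.symm.trans e2)
    · exact h1 (e1.symm.trans e2)
    · exact h4 (e2.symm.trans e1)
    · exact hne' (e2.symm.trans e1)
  exact ⟨hbr, a, p, q, w, b, r, hs1, hnd1, hap, hqw, h2, hbr⟩

theorem exists_fourth {U : Finset V} (hU : U.card = 4) (p q z : V) :
    ∃ w ∈ U, w ≠ p ∧ w ≠ q ∧ w ≠ z := by
  have h1 : 0 < (U \ {p, q, z}).card := by
    have h2 := Finset.le_card_sdiff {p, q, z} U
    have h3 := Finset.card_le_three (a := p) (b := q) (c := z)
    omega
  obtain ⟨w, hw⟩ := Finset.card_pos.mp h1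
  rw [Finset.mem_sdiff] at hw
  refine ⟨w, hw.1, ?_⟩
  have := hw.2
  simp only [Finset.mem_insert, Finset.mem_singleton, not_or] at this
  exact this

/-- Assume that all edges inside a four-element set `U` have new colors and that the colors at all
but at most one of its vertices are distinct. If there are two further colors between `{a, b}` and
`U`, then some edge of the matching is replaceable. -/
theorem NoRainbow.replaceable_of_live (hno : NoRainbow c (t + 1)) (hc : ∀ a b, c a b = c b a)
    (h : IsRainbow ⊤ c s C) (hC : C.card + 1 = t) {U : Finset V} (hU : U.card = 4)
    (hUs : ∀ p ∈ U, p ∉ s ∧ p ≠ a ∧ p ≠ b) (hab : a ∉ s ∧ b ∉ s ∧ a ≠ b)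
    (hlive : ∀ p ∈ U, ∀ q ∈ U, p ≠ q → c p q ∉ C)
    {z : V} (hz : ∀ r ∈ U, r ≠ z → ∀ p ∈ U, ∀ q ∈ U, p ≠ r → q ≠ r → p ≠ q → c r p ≠ c r q)
    {p q p' q' : V} (hp : p = a ∨ p = b) (hq : q = a ∨ q = b) (hp' : p' ∈ U) (hq' : q' ∈ U)
    (h1 : c p p' ∉ C ∪ colors c U) (h2 : c q q' ∉ C ∪ colors c U) (hne : c p p' ≠ c q q') :
    Replaceable c s C := by
  have hcol : ∀ γ, γ ∉ C ∪ colors c U → γ ∉ C ∧ ∀ p ∈ U, ∀ q ∈ U, p ≠ q → γ ≠ c p q := by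
    intro γ hγ
    rw [Finset.mem_union, not_or] at hγ
    exact ⟨hγ.1, fun p hp q hq hpq e => hγ.2 (mem_colors.mpr ⟨p, hp, q, hq, hpq, e.symm⟩)⟩
  -- Two new colors at the same end, towards p and q: choose w in `U` where the edges to p and q
  -- differ in color and apply `mem_of_same_end`.
  have same : ∀ a b, a ∉ s → b ∉ s → a ≠ b → (∀ p ∈ U, p ≠ a ∧ p ≠ b) → ∀ p ∈ U, ∀ q ∈ U,
      c a p ∉ C ∪ colors c U → c a q ∉ C ∪ colors c U → c a p ≠ c a q → Replaceable c s C := by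
    intro a b ha hb hab hU' p hp q hq h1 h2 hne
    have hpq : p ≠ q := fun e => hne (by rw [e])
    obtain ⟨w, hw, w1, w2, w3⟩ := exists_fourth hU p q z
    obtain ⟨r, hr, r1, r2, r3⟩ := exists_fourth hU p q w
    obtain ⟨h3, h4⟩ := hcol _ h1
    obtain ⟨h5, h6⟩ := hcol _ h2
    refine (hno.mem_of_same_end h hC (a := a) (b := b) (p := p) (q := q) (r := r) (w := w)
      ⟨ha, hb, (hUs p hp).1, (hUs q hq).1, (hUs r hr).1, (hUs w hw).1⟩ ?_ h3 h5 hne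
      (hlive p hp w hw w1.symm) (hlive q hq w hw w2.symm) ?_ (h4 p hp w hw w1.symm)
      (h4 q hq w hw w2.symm) (h6 p hp w hw w1.symm) (h6 q hq w hw w2.symm)).2
    · have e1 := hU' p hp
      have e2 := hU' q hq
      have e3 := hU' r hr
      have e4 := hU' w hw
      simp only [List.nodup_cons, List.mem_cons, not_or, List.not_mem_nil, not_false_eq_true,
        List.nodup_nil, and_true]
      exact ⟨⟨hab, e1.1.symm, e2.1.symm, e3.1.symm, e4.1.symm⟩,
        ⟨e1.2.symm, e2.2.symm, e3.2.symm, e4.2.symm⟩, ⟨hpq, r1.symm, w1.symm⟩, ⟨r2.symm, w2.symm⟩, r3⟩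
    · rw [hc p, hc q]; exact hz w hw w3 p hp q hq w1.symm w2.symm hpq
  -- New colors at different ends: if they lead to different vertices, the other two vertices of `U`
  -- complete a rainbow matching with t + 2 edges. If they lead to the same p and nothing is
  -- replaceable, then every edge from a or b to another vertex of `U` has the color of the pair
  -- formed by the two remaining ones, and aq, br, pw become three disjoint edges of distinct new
  -- colors.
  have opp : ∀ p' ∈ U, ∀ q' ∈ U, c a p' ∉ C ∪ colors c U → c b q' ∉ C ∪ colors c U →
      c a p' ≠ c b q' → Replaceable c s C := by
    intro p hp q hq h1 h2 hne
    obtain ⟨h3, h4⟩ := hcol _ h1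
    obtain ⟨h5, h6⟩ := hcol _ h2
    obtain ⟨ha, hb, hab⟩ := hab
    by_cases hpq : p = q
    · subst hpq
      by_contra hrep
      have key : ∀ w₁ ∈ U, ∀ w₂ ∈ U, ∀ w₃ ∈ U, [p, w₁, w₂, w₃].Nodup →
          c a w₁ = c w₂ w₃ ∧ c b w₁ = c w₂ w₃ := by
        intro w₁ hw₁ w₂ hw₂ w₃ hw₃ hnd
        simp only [List.nodup_cons, List.mem_cons, not_or, List.not_mem_nil, not_false_eq_true,
          List.nodup_nil, and_true] at hnd
        obtain ⟨⟨n1, n2, n3⟩, ⟨n4, n5⟩, n6⟩ := hnd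
        have e0 := hUs p hp
        have e1 := hUs w₁ hw₁
        have e2 := hUs w₂ hw₂
        have e3 := hUs w₃ hw₃
        have hs1 : a ∉ s ∧ p ∉ s ∧ w₂ ∉ s ∧ w₃ ∉ s ∧ b ∉ s ∧ w₁ ∉ s := by simp [*]
        have hs2 : b ∉ s ∧ p ∉ s ∧ w₂ ∉ s ∧ w₃ ∉ s ∧ a ∉ s ∧ w₁ ∉ s := by simp [*]
        have hnd1 : [a, p, w₂, w₃, b, w₁].Nodup := by
          clear hz hlive same hcol h4 h6 hc h hno; simp; grind
        have hnd2 : [b, p, w₂, w₃, a, w₁].Nodup := by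
          clear hz hlive same hcol h4 h6 hc h hno; simp; grind
        have h23 := hlive w₂ hw₂ w₃ hw₃ n6
        have g1 : c b w₁ ∉ C := fun hcon =>
          hrep ⟨a, p, w₂, w₃, b, w₁, hs1, hnd1, h3, h23, h4 _ hw₂ _ hw₃ n6, hcon⟩
        have g2 : c a w₁ ∉ C := fun hcon =>
          hrep ⟨b, p, w₂, w₃, a, w₁, hs2, hnd2, h5, h23, h6 _ hw₂ _ hw₃ n6, hcon⟩
        constructor
        · rcases hno.eq_or_eq_of_add_three h hC hs2 hnd2 h5 h23 g2 (h6 _ hw₂ _ hw₃ n6) with e | e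
          · exact absurd (same a b ha hb hab (fun p hp => (hUs p hp).2) p hp w₁ hw₁ h1 (by rwa [e])
              (by rw [e]; exact hne)) hrep
          · exact e
        · rcases hno.eq_or_eq_of_add_three h hC hs1 hnd1 h3 h23 g1 (h4 _ hw₂ _ hw₃ n6) with e | e
          · exact absurd (same b a hb ha hab.symm (fun p hp => (hUs p hp).2.symm) p hp w₁ hw₁ h2
              (by rwa [e]) (by rw [e]; exact hne.symm)) hrep
          · exact e
      obtain ⟨w, hw, w1, w2, -⟩ := exists_fourth hU p z z
      obtain ⟨q, hq, q1, q2, -⟩ := exists_fourth hU p w w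
      obtain ⟨r, hr, r1, r2, r3⟩ := exists_fourth hU p w q
      have e1 := (key q hq r hr w hw (by simp; grind)).1
      have e2 := (key r hr q hq w hw (by simp; grind)).2
      refine hno.false_of_add_three h (by omega) (a := a) (b := q) (d := b) (e := r) (f := p)
        (g := w) ⟨ha, (hUs _ hq).1, hb, (hUs _ hr).1, (hUs _ hp).1, (hUs _ hw).1⟩ ?_
        (by rw [e1]; exact hlive r hr w hw r2) (by rw [e2]; exact hlive q hq w hw q2)
        (hlive p hp w hw w1.symm) ?_ ?_ ?_
      · have e1 := (hUs p hp).2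
        have e2 := (hUs q hq).2
        have e3 := (hUs r hr).2
        have e4 := (hUs w hw).2
        clear hz hlive same hcol h4 h6 hc h hno key; simp; grind
      · rw [e1, e2, hc r, hc q]; exact hz w hw w2 r hr q hq r2 q2 r3
      · rw [e1, hc r, hc p]; exact hz w hw w2 r hr p hp r2 w1.symm r1
      · rw [e2, hc q, hc p]; exact hz w hw w2 q hq p hp q2 w1.symm q1
    · obtain ⟨w, hw, w1, w2, -⟩ := exists_fourth hU p q q
      obtain ⟨r, hr, r1, r2, r3⟩ := exists_fourth hU p q w
      exfalso
      refine hno.false_of_add_three h (by omega) (a := a) (b := p) (d := b) (e := q) (f := r)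
        (g := w) ⟨ha, (hUs _ hp).1, hb, (hUs _ hq).1, (hUs _ hr).1, (hUs _ hw).1⟩ ?_ h3 h5
        (hlive r hr w hw r3) hne (h4 r hr w hw r3) (h6 r hr w hw r3)
      have e1 := (hUs p hp).2
      have e2 := (hUs q hq).2
      have e3 := (hUs r hr).2
      have e4 := (hUs w hw).2
      clear hz hlive same hcol h4 h6 hc h hno; simp; grind
  rcases hp with rfl | rfl <;> rcases hq with rfl | rfl
  · exact same _ b hab.1 hab.2.1 hab.2.2 (fun p hp => (hUs p hp).2) p' hp' q' hq' h1 h2 hne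
  · exact opp p' hp' q' hq' h1 h2 hne
  · exact opp q' hq' p' hp' h2 h1 hne.symm
  · exact same _ a hab.2.1 hab.1 hab.2.2.symm (fun p hp => (hUs p hp).2.symm) p' hp' q' hq' h1 h2 hne

namespace Mixed

theorem eq_of_base (hno : NoRainbow c (t + 1)) (hC : C.card + 1 = t)
    (k : Mixed c s C a b u v x y) {p q r w : V}
    (hnd : [a, p, b, q, r, w].Nodup) (hp : p ∈ ({u, v, x, y} : Finset V))
    (hq : q ∈ ({u, v, x, y} : Finset V)) (hr : r ∈ ({u, v, x, y} : Finset V))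
    (hw : w ∈ ({u, v, x, y} : Finset V)) (hrw : c r w ∉ C)
    (h1 : c a p ∉ base c C a b u v x y) (h2 : c b q ∉ base c C a b u v x y) : c a p = c b q := by
  have hU : ∀ p ∈ ({u, v, x, y} : Finset V), p ∉ s := by
    have h := k.six.notMem
    intro p hp
    simp only [Finset.mem_insert, Finset.mem_singleton] at hp
    rcases hp with rfl | rfl | rfl | rfl <;> simp [h]
  have hrw' : r ≠ w := by
    simp only [List.nodup_cons, List.mem_cons, not_or, List.not_mem_nil, not_false_eq_true,
      List.nodup_nil, and_true] at hnd
    tauto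
  obtain ⟨h3, h4, h5⟩ := notMem_of_notMem_base h1
  obtain ⟨h6, h7, h8⟩ := notMem_of_notMem_base h2
  exact k.eq_of_live hno hC ⟨hU p hp, hU q hq, hU r hr, hU w hw⟩ hnd hrw
    ⟨h3, h5 r hr w hw hrw'⟩ ⟨h6, h8 r hr w hw hrw'⟩

/-- The disjoint pairs au, bx and ax, bu leave over vy, and av, by and ay, bv leave over ux, each of
a color outside `C`. Thus each of the four pairs shows at most one cross color. -/
theorem card_cross_le (hno : NoRainbow c (t + 1)) (hC : C.card + 1 = t)
    (k : Mixed c s C a b u v x y) : (cross c C a b u v x y).card ≤ 4 := by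
  have h := k.six.ne
  have hux : c u x ∉ C := by rw [k.ux]; exact k.ab
  have hsub : cross c C a b u v x y ⊆
      (({c a u, c b x, c a x, c b u} : Finset ℕ) \ base c C a b u v x y) ∪
      (({c a v, c b y, c a y, c b v} : Finset ℕ) \ base c C a b u v x y) := by
    intro γ hγ
    simp only [cross, fresh, Finset.mem_biUnion, Finset.mem_sdiff, Finset.mem_insert,
      Finset.mem_singleton, Finset.mem_union] at hγ ⊢
    obtain ⟨z, hz, hγ, hB⟩ := hγ
    simp only [hB, not_false_eq_true, and_true]
    rcases hz with rfl | rfl | rfl | rfl <;> rcases hγ with rfl | rfl <;> simp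
  have h1 := Finset.card_le_card hsub
  have h2 := Finset.card_union_le
    (({c a u, c b x, c a x, c b u} : Finset ℕ) \ base c C a b u v x y)
    (({c a v, c b y, c a y, c b v} : Finset ℕ) \ base c C a b u v x y)
  have h3 := card_sdiff_le_two (X := base c C a b u v x y)
    (k.eq_of_base hno hC (p := u) (q := x) (r := v) (w := y) (by simp [h]) (by simp) (by simp)
      (by simp) (by simp) k.vy)
    (k.eq_of_base hno hC (p := x) (q := u) (r := v) (w := y) (by simp [h]) (by simp) (by simp)
      (by simp) (by simp) k.vy)
  have h4 := card_sdiff_le_two (X := base c C a b u v x y)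
    (k.eq_of_base hno hC (p := v) (q := y) (r := u) (w := x) (by simp [h]) (by simp) (by simp)
      (by simp) (by simp) hux)
    (k.eq_of_base hno hC (p := y) (q := v) (r := u) (w := x) (by simp [h]) (by simp) (by simp)
      (by simp) (by simp) hux)
  omega

/-- Two new colors at `a` whose end vertices are joined by an edge of the pair without common
color. -/
def Good (c : V → V → ℕ) (C : Finset ℕ) (a b u v x y p q r : V) : Prop :=
  c p q ∉ base c C a b u v x y ∧ c p r ∉ base c C a b u v x y ∧ c p q ≠ c p r

/-- Split the edges between ab and the four vertices into au, ay, bx, bv and av, ax, bu, by. Within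
a class, an edge at a and an edge at b of new colors have the same color. So a class with two cross
colors has them at one end, which makes this end good. -/
theorem good_of_three_le (hno : NoRainbow c (t + 1)) (hC : C.card + 1 = t)
    (k : Mixed c s C a b u v x y) (h3 : 3 ≤ (cross c C a b u v x y).card) :
    (Good c C a b u v x y a u y ∨ Good c C a b u v x y b u y) ∨
      (Good c C a b u v x y a x v ∨ Good c C a b u v x y b x v) := by
  by_contra hcon
  simp only [Good, not_or, not_and, not_not] at hcon
  obtain ⟨⟨g1, g2⟩, g3, g4⟩ := hcon
  have h := k.six.ne
  have hux : c u x ∉ C := by rw [k.ux]; exact k.ab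
  have hxy : c x y ∉ C := by rw [k.xy]; exact k.uv
  have e1 := k.eq_of_base hno hC (p := u) (q := x) (r := v) (w := y) (by simp [h]) (by simp)
    (by simp) (by simp) (by simp) k.vy
  have e2 := k.eq_of_base hno hC (p := x) (q := u) (r := v) (w := y) (by simp [h]) (by simp)
    (by simp) (by simp) (by simp) k.vy
  have e3 := k.eq_of_base hno hC (p := v) (q := y) (r := u) (w := x) (by simp [h]) (by simp)
    (by simp) (by simp) (by simp) hux
  have e4 := k.eq_of_base hno hC (p := y) (q := v) (r := u) (w := x) (by simp [h]) (by simp)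
    (by simp) (by simp) (by simp) hux
  have e5 := k.eq_of_base hno hC (p := u) (q := v) (r := x) (w := y) (by simp [h]) (by simp)
    (by simp) (by simp) (by simp) hxy
  have e6 := k.eq_of_base hno hC (p := v) (q := u) (r := x) (w := y) (by simp [h]) (by simp)
    (by simp) (by simp) (by simp) hxy
  have e7 := k.eq_of_base hno hC (p := x) (q := y) (r := u) (w := v) (by simp [h]) (by simp)
    (by simp) (by simp) (by simp) k.uv
  have e8 := k.eq_of_base hno hC (p := y) (q := x) (r := u) (w := v) (by simp [h]) (by simp)
    (by simp) (by simp) (by simp) k.uv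
  have hsub : cross c C a b u v x y ⊆
      (({c a u, c b x, c a y, c b v} : Finset ℕ) \ base c C a b u v x y) ∪
      (({c a v, c b y, c a x, c b u} : Finset ℕ) \ base c C a b u v x y) := by
    intro γ hγ
    simp only [cross, fresh, Finset.mem_biUnion, Finset.mem_sdiff, Finset.mem_insert,
      Finset.mem_singleton, Finset.mem_union] at hγ ⊢
    obtain ⟨z, hz, hγ, hB⟩ := hγ
    simp only [hB, not_false_eq_true, and_true]
    rcases hz with rfl | rfl | rfl | rfl <;> rcases hγ with rfl | rfl <;> simp
  clear hno k hux hxy h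
  generalize base c C a b u v x y = B at *
  have h1 : (({c a u, c b x, c a y, c b v} : Finset ℕ) \ B).card ≤ 1 := by
    rw [Finset.card_le_one]
    intro p hp q hq
    simp only [Finset.mem_sdiff, Finset.mem_insert, Finset.mem_singleton] at hp hq
    clear hsub h3 e2 e3 e6 e7
    grind
  have h2 : (({c a v, c b y, c a x, c b u} : Finset ℕ) \ B).card ≤ 1 := by
    rw [Finset.card_le_one]
    intro p hp q hq
    simp only [Finset.mem_sdiff, Finset.mem_insert, Finset.mem_singleton] at hp hq
    clear hsub h3 h1 e1 e4 e5 e8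
    grind
  have h4 := Finset.card_le_card hsub
  have h5 := Finset.card_union_le (({c a u, c b x, c a y, c b v} : Finset ℕ) \ B)
    (({c a v, c b y, c a x, c b u} : Finset ℕ) \ B)
  omega

/-- The edges ux and yx have the distinct colors of ab and uv, so `mem_of_same_end` applies with w =
x. -/
theorem mem_of_good (hno : NoRainbow c (t + 1)) (hc : ∀ a b, c a b = c b a) (hC : C.card + 1 = t)
    (k : Mixed c s C a b u v x y) (hg : Good c C a b u v x y a u y) :
    c b v ∈ C ∧ Replaceable c s C := by
  have h := k.six.ne
  have h' := k.six.notMem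
  obtain ⟨h1, h2, h3⟩ := hg
  obtain ⟨i1, i2, i3⟩ := notMem_of_notMem_base h1
  obtain ⟨j1, j2, j3⟩ := notMem_of_notMem_base h2
  have e1 : c y x = c u v := by rw [hc, k.xy]
  refine hno.mem_of_same_end k.six.rainbow hC (a := a) (p := u) (q := y) (r := v) (w := x)
    (by simp [h']) (by simp [h]) i1 j1 h3 (by rw [k.ux]; exact k.ab) (by rw [e1]; exact k.uv)
    (by rw [e1, k.ux]; exact k.uv_ne.symm) (by rw [k.ux]; exact i2)
    (i3 y (by simp) x (by simp) (by simp [h])) (by rw [k.ux]; exact j2)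
    (j3 y (by simp) x (by simp) (by simp [h]))

theorem base_swap (hc : ∀ a b, c a b = c b a) : base c C b a u v x y = base c C a b u v x y := by
  simp only [base, hc b a]

theorem base_exchange : base c C a b x y u v = base c C a b u v x y := by
  have : ({x, y, u, v} : Finset V) = {u, v, x, y} := by ext z; simp; tauto
  simp only [base, this]

theorem replaceable_of_three_le (hno : NoRainbow c (t + 1)) (hc : ∀ a b, c a b = c b a)
    (hC : C.card + 1 = t) (k : Mixed c s C a b u v x y) (h3 : 3 ≤ (cross c C a b u v x y).card) :
    Replaceable c s C := by
  rcases k.good_of_three_le hno hC h3 with (h | h) | (h | h)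
  · exact (k.mem_of_good hno hc hC h).2
  · exact ((k.swap hc).mem_of_good hno hc hC (by simpa only [Good, base_swap hc] using h)).2
  · exact ((k.exchange hc).mem_of_good hno hc hC (by simpa only [Good, base_exchange] using h)).2
  · exact ((k.exchange hc).swap hc |>.mem_of_good hno hc hC
      (by simpa only [Good, base_exchange, base_swap hc] using h)).2

/-- With three live colors, uy or vx gives the third. If the other one has an old color, it is
replaced directly by ab and the live one. Otherwise all six edges among the four vertices have new
colors, and `replaceable_of_live` applies. -/
theorem replaceable_of_two_le (hno : NoRainbow c (t + 1)) (hc : ∀ a b, c a b = c b a)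
    (hC : C.card + 1 = t) (k : Mixed c s C a b u v x y) (hl : 3 ≤ (live c C a b u v x y).card)
    (h2 : 2 ≤ (cross c C a b u v x y).card) : Replaceable c s C := by
  have h := k.six.ne
  have h' := k.six.notMem
  have hux : c u x ∉ C := by rw [k.ux]; exact k.ab
  have hxy : c x y ∉ C := by rw [k.xy]; exact k.uv
  have k1 := k.config_left
  have e : c u y ∉ insert (c a b) C → c v x ∉ insert (c a b) C → c u y = c v x :=
    fun h1 h2 => hno.eq_of_add_two k1.rainbow (by rw [Finset.card_insert_of_notMem k.ab, hC])
      (by simp [h, h']) (by simp [h]) h1 h2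
  simp only [Finset.mem_insert, not_or] at e
  have hne : c u v ≠ c v y ∧ ((c u y ∉ insert (c a b) C ∧ c u y ≠ c u v ∧ c u y ≠ c v y) ∨
      (c v x ∉ insert (c a b) C ∧ c v x ≠ c u v ∧ c v x ≠ c v y)) := by
    by_contra hcon
    have hsub : ∃ p q, live c C a b u v x y ⊆ {p, q} := by
      by_cases hd : c u v = c v y
      · by_cases huy : c u y ∈ insert (c a b) C
        · refine ⟨c u v, c v x, fun γ hγ => ?_⟩
          rw [live, Finset.mem_sdiff, mem_colors_four hc (by simp [h])] at hγ
          have := k.ux; have := k.xy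
          clear hno k k1 hc
          grind
        · refine ⟨c u v, c u y, fun γ hγ => ?_⟩
          rw [live, Finset.mem_sdiff, mem_colors_four hc (by simp [h])] at hγ
          have := k.ux; have := k.xy
          clear hno k k1 hc
          grind
      · refine ⟨c u v, c v y, fun γ hγ => ?_⟩
        rw [live, Finset.mem_sdiff, mem_colors_four hc (by simp [h])] at hγ
        have := k.ux; have := k.xy
        clear hno k k1 hc
        grind
    obtain ⟨p, q, hsub⟩ := hsub
    have := (Finset.card_le_card hsub).trans Finset.card_le_two
    omega
  simp only [Finset.mem_insert, not_or] at hne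
  by_cases huy : c u y ∈ C
  · exact ⟨v, x, a, b, u, y, by simp [h'], by simp [h], by grind, k.ab, by grind, huy⟩
  by_cases hvx : c v x ∈ C
  · exact ⟨u, y, a, b, v, x, by simp [h'], by simp [h], by grind, k.ab, by grind, hvx⟩
  have hlive : ∀ p ∈ ({u, v, x, y} : Finset V), ∀ q ∈ ({u, v, x, y} : Finset V), p ≠ q →
      c p q ∉ C := by
    intro p hp q hq hpq hmem
    have : c p q ∈ colors c {u, v, x, y} := mem_colors.mpr ⟨p, hp, q, hq, hpq, rfl⟩
    rw [mem_colors_four hc (by simp [h])] at this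
    have := k.uv; have := k.vy
    clear hno k k1 hc
    grind
  obtain ⟨p, hp, q, hq, hpq⟩ := Finset.one_lt_card.mp (show 1 < _ from h2)
  simp only [cross, fresh, Finset.mem_biUnion, Finset.mem_sdiff] at hp hq
  obtain ⟨p', hp', hp, hpB⟩ := hp
  obtain ⟨q', hq', hq, hqB⟩ := hq
  have hcard : ({u, v, x, y} : Finset V).card = 4 := by
    rw [Finset.card_insert_of_notMem (by simp [h]), Finset.card_insert_of_notMem (by simp [h]),
      Finset.card_pair (by simp [h])]
  have hBsub : C ∪ colors c {u, v, x, y} ⊆ base c C a b u v x y :=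
    Finset.union_subset_union (Finset.subset_insert _ _) subset_rfl
  have hz : ∃ z, ∀ r ∈ ({u, v, x, y} : Finset V), r ≠ z → ∀ p ∈ ({u, v, x, y} : Finset V),
      ∀ q ∈ ({u, v, x, y} : Finset V), p ≠ r → q ≠ r → p ≠ q → c r p ≠ c r q := by
    have i1 := k.ux
    have i2 := k.xy
    have i3 := k.uv_ne
    have i4 := k.vy_ne
    have j1 := hc v u
    have j2 := hc x u
    have j3 := hc y u
    have j4 := hc x v
    have j5 := hc y v
    have j6 := hc y x
    clear hno k k1 hc hcard hBsub hpB hqB hp hq hp' hq' hlive hl h2 h'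
    -- Only uy or vx can repeat the color ab of ux, and not both of them, so edges of equal color
    -- meet at most in u in the first case and in x in the second.
    refine ⟨if c u y = c a b then u else x, ?_⟩
    simp only [Finset.mem_insert, Finset.mem_singleton]
    rintro r (rfl | rfl | rfl | rfl) hr p (rfl | rfl | rfl | rfl) q (rfl | rfl | rfl | rfl)
      n1 n2 n3 <;> first
      | exact absurd rfl n1
      | exact absurd rfl n2
      | exact absurd rfl n3
      | (clear h; grind)
  obtain ⟨z, hz⟩ := hz
  have hU : ∀ p ∈ ({u, v, x, y} : Finset V), p ∉ s ∧ p ≠ a ∧ p ≠ b := by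
    intro p hp
    simp only [Finset.mem_insert, Finset.mem_singleton] at hp
    rcases hp with rfl | rfl | rfl | rfl <;> simp [h, h']
  rw [Finset.mem_insert, Finset.mem_singleton] at hp hq
  obtain ⟨p₁, hp₁, rfl⟩ : ∃ p₁, (p₁ = a ∨ p₁ = b) ∧ p = c p₁ p' := by
    rcases hp with rfl | rfl
    exacts [⟨a, .inl rfl, rfl⟩, ⟨b, .inr rfl, rfl⟩]
  obtain ⟨q₁, hq₁, rfl⟩ : ∃ q₁, (q₁ = a ∨ q₁ = b) ∧ q = c q₁ q' := by
    rcases hq with rfl | rfl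
    exacts [⟨a, .inl rfl, rfl⟩, ⟨b, .inr rfl, rfl⟩]
  exact hno.replaceable_of_live hc k.six.rainbow hC hcard hU ⟨h'.1, h'.2.1, h.1.1⟩ hlive hz hp₁ hq₁
    hp' hq' (fun hm => hpB (hBsub hm)) (fun hm => hqB (hBsub hm)) hpq

end Mixed

end AntiRamsey

/-! ### Three soft edges in a mixed configuration. -/

namespace AntiRamsey

variable {V : Type*} [DecidableEq V] {c : V → V → ℕ} {s : Finset V} {C : Finset ℕ} {t : ℕ}
  {a b u v x y : V}

namespace Mixed

variable [Fintype V]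

/-- The replaceable edge de is a third soft edge besides uv and ab. The losses are 2(t - 2) colors
twice towards the rest of the matching, the live colors except that of uv, at most four cross
colors, and at most 2t + 2 colors at de. -/
theorem card_colors_le_of_replaceable (hc : ∀ a b, c a b = c b a) (hno : NoRainbow c (t + 1))
    (hN : Fintype.card V = 2 * t + 4) (hC : C.card + 1 = t) (k : Mixed c s C a b u v x y)
    (hr : Replaceable c s C) :
    2 ≤ t ∧ (colors c Finset.univ).card + t ≤ 2 * t ^ 2 + 6 + (live c C a b u v x y).card := by
  obtain ⟨i, j, p, q, m, n, hs, hnd, hij, hpq, hne, hmn⟩ := hr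
  obtain ⟨d, e, s', C', F, hd, he, hde, hcol, hγ, rfl, rfl, hs', -, hF, hcov⟩ :=
    exists_soft_edge hno k.six.rainbow hC hs hnd hij hpq hne hmn
  rw [← hcol] at hγ k hcov hC hij hpq ⊢
  rw [Finset.card_insert_of_notMem hγ] at hC
  refine ⟨by omega, ?_⟩
  have h := k.six.ne
  have h' := k.six.notMem
  have k1 := k.uv
  have k2 := k.ab
  have k3 := k.vy
  simp only [Finset.mem_insert, not_or] at h' k1 k2 k3
  obtain ⟨B, hB⟩ : ∃ B, B = base c (insert (c d e) C') a b u v x y := ⟨_, rfl⟩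
  have f1 := k.config_left.card_fresh_pair_pair_le hno hs' (by omega) (by simp [h', hd, he])
    (by simp [h', h, hde]) rfl k2.2 rfl hγ k2.1 (X := B) (by
      rw [hB]
      intro γ hγ
      rw [Finset.mem_insert] at hγ
      rcases hγ with rfl | hγ
      · exact Finset.mem_union_right _ (mem_colors.mpr ⟨u, by simp, v, by simp, by simp [h], rfl⟩)
      · exact Finset.mem_union_left _ hγ)
  have f2 := k.config_right.card_fresh_pair_pair_le hno hs' (by omega) (by simp [h', hd, he])
    (by simp [h', h, hde]) rfl k3.2 rfl hγ k3.1 (X := B) (by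
      rw [hB]
      intro γ hγ
      rw [Finset.mem_insert, Finset.mem_insert] at hγ
      rcases hγ with rfl | rfl | hγ
      · simp [base]
      · exact Finset.mem_union_right _ (mem_colors.mpr ⟨v, by simp, y, by simp, by simp [h], rfl⟩)
      · exact Finset.mem_union_left _ (Finset.mem_insert_of_mem hγ))
  have f3 := Finset.card_erase_of_mem k.uv_mem_live
  have f4 := Finset.card_pos.mpr ⟨_, k.uv_mem_live⟩
  have f5 := k.card_cross_le hno (by rw [Finset.card_insert_of_notMem hγ]; omega)
  have hS : IsRainbow ⊤ c {u, v, a, b, d, e} {c u v, c a b, c d e} :=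
    ((IsRainbow.pair (c := c) hde).add (a := a) (b := b) (by simp [h']) (by simp [h']) (by simp [h])
      (by simp [k2])).add (by simp [h, h']) (by simp [h, h']) (by simp [h]) (by simp [k1, k.uv_ne])
  have hD : ({c u v, c a b, c d e} : Finset ℕ).card = 3 := Finset.card_eq_three.mpr
    ⟨_, _, _, k.uv_ne, k1.1, k2.1, rfl⟩
  have hcross := fun T => mem_of_base_subset (c := c) (C := insert (c d e) C') (a := a) (b := b)
    (u := u) (v := v) (x := x) (y := y) (T := T) hc
  have hbase := fun T => base_subset (T := T) (c := c) (C := insert (c d e) C') (a := a) (b := b) (u := u)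
    (v := v) (x := x) (y := y)
  have hcover := k.six.cover
  simp only [Finset.mem_insert] at hcover
  generalize hF1 : fresh c B u v s' = F1 at f1
  generalize hF2 : fresh c B a b s' = F2 at f2
  generalize hLv : (live c (insert (c d e) C') a b u v x y).erase (c u v) = L at *
  generalize cross c (insert (c d e) C') a b u v x y = W at *
  have g1 := Finset.card_union_le (F1 ∪ F2 ∪ L ∪ W) F
  have g2 := Finset.card_union_le (F1 ∪ F2 ∪ L) W
  have g3 := Finset.card_union_le (F1 ∪ F2) L
  have g4 := Finset.card_union_le F1 F2
  have := card_colors_le_of_three_soft hc hno hN (by omega) hS hD (Y := F1 ∪ F2 ∪ L ∪ W ∪ F) (by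
      generalize hT : colors c (Finset.univ \ {u, v, a, b, d, e}) ∪ {c u v, c a b, c d e} ∪
        (F1 ∪ F2 ∪ L ∪ W ∪ F) = T
      clear f1 f2 f3 f4 f5 g1 g2 g3 g4
      have hCT : C' ⊆ T := by
        rw [← hT]
        refine (hs'.subset_colors (A := Finset.univ \ {u, v, a, b, d, e}) fun z hz => ?_).trans
          (Finset.subset_union_left.trans Finset.subset_union_left)
        simp only [Finset.mem_sdiff, Finset.mem_univ, true_and, Finset.mem_insert,
          Finset.mem_singleton]
        rintro (rfl | rfl | rfl | rfl | rfl | rfl)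
        exacts [h'.2.2.1.2.2 hz, h'.2.2.2.1.2.2 hz, h'.1.2.2 hz, h'.2.1.2.2 hz, hd hz, he hz]
      have hab : c a b ∈ T := by rw [← hT]; simp
      have huv : c u v ∈ T := by rw [← hT]; simp
      have hdeT : c d e ∈ T := by rw [← hT]; simp
      have hsub : ∀ Z, Z ⊆ F1 ∪ F2 ∪ L ∪ W ∪ F → Z ⊆ T := fun Z hZ => by
        rw [← hT]; exact hZ.trans Finset.subset_union_right
      have hB1 := hbase T (Finset.insert_subset hab (Finset.insert_subset hdeT hCT)) huv
        (hsub _ (by intro z hz; simp [hz]))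
      have hW := fun p q => hcross T hB1 (hsub _ (by intro z hz; simp [hz])) (p := p) (q := q)
      rw [← hB] at hB1
      have e1 := mem_of_fresh_subset hB1 (hF1.trans_subset (hsub _ (by intro z hz; simp [hz])))
      have e2 := mem_of_fresh_subset hB1 (hF2.trans_subset (hsub _ (by intro z hz; simp [hz])))
      have hin : ∀ z, z ∉ insert d (insert e s') → z = a ∨ z = b ∨ z ∈ ({u, v, x, y} : Finset V) := by
        intro z hz
        have := hcover z
        simp only [Finset.mem_insert, not_or, Finset.mem_singleton] at hz ⊢
        grind
      have hnd' := hnd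
      simp only [List.nodup_cons, List.mem_cons, not_or, List.not_mem_nil, not_false_eq_true,
        List.nodup_nil, and_true] at hnd'
      have hcov' : ∀ z, z ≠ d → z ≠ e → c d z ∈ T ∧ c e z ∈ T := by
        have hsubT : insert (c i j) (insert (c p q) (insert (c d e) C')) ∪ F ⊆ T := by
          refine Finset.union_subset (Finset.insert_subset ?_ (Finset.insert_subset ?_
            (Finset.insert_subset hdeT hCT))) (hsub _ (by intro z hz; simp [hz]))
          · exact hW i j (hin i hs.1) (hin j hs.2.1) hnd'.1.1
          · exact hW p q (hin p hs.2.2.1) (hin q hs.2.2.2.1) hnd'.2.2.1.1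
        exact fun z h1 h2 => ⟨hsubT (hcov z h1 h2).1, hsubT (hcov z h1 h2).2⟩
      clear hcov hno hbase hcross
      intro m' hm z hz
      have hde' : m' = d ∨ m' = e ∨ (m' ≠ d ∧ m' ≠ e ∧
          (m' = u ∨ m' = v ∨ m' = a ∨ m' = b)) := by
        clear hcov' hnd hnd' hin e1 e2 hW hsub
        simp only [Finset.mem_insert, Finset.mem_singleton] at hm
        grind
      rcases hde' with rfl | rfl | ⟨n1, n2, hm'⟩
      · by_cases hze : z = e
        · rwa [hze]
        · exact (hcov' z hz hze).1
      · by_cases hzd : z = d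
        · rwa [hzd, hc]
        · exact (hcov' z hzd hz).2
      by_cases hzd : z = d
      · rw [hzd, hc]; exact (hcov' m' n1 n2).1
      by_cases hze : z = e
      · rw [hze, hc]; exact (hcov' m' n1 n2).2
      by_cases hzs : z ∈ s'
      · rcases hm' with rfl | rfl | rfl | rfl
        exacts [(e1 z hzs).1, (e1 z hzs).2, (e2 z hzs).1, (e2 z hzs).2]
      · refine hW _ _ ?_ (hin z (by simp [hzd, hze, hzs])) hz.symm
        simp only [Finset.mem_insert, Finset.mem_singleton]
        rcases hm' with hm' | hm' | hm' | hm' <;> simp [hm'])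
  omega

end Mixed

end AntiRamsey

/-! ### Eight vertices: six of them with many pairings. -/

namespace AntiRamsey

variable {V : Type*} [DecidableEq V] {c : V → V → ℕ} {W : Finset V} {B : Finset ℕ} {a b d e : V}

/-- Two disjoint pairs of vertices of `W` outside of `{p, q}` with distinct colors. -/
def Pairing (c : V → V → ℕ) (W : Finset V) (p q i j k l : V) : Prop :=
  (i ∈ W ∧ j ∈ W ∧ k ∈ W ∧ l ∈ W) ∧ [p, q, i, j, k, l].Nodup ∧ c i j ≠ c k l

/-- Otherwise dp, eq, ij and kl form a rainbow matching with four edges. -/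
theorem Pairing.eq_of_fresh (hno : NoRainbow c 3) {p q i j k l : V} (hP : Pairing c W p q i j k l)
    (hd : d ∉ W) (he : e ∉ W) (hde : d ≠ e) (hp : p ∈ W) (hq : q ∈ W) (h1 : c d p ≠ c i j)
    (h2 : c d p ≠ c k l) (h3 : c e q ≠ c i j) (h4 : c e q ≠ c k l) : c d p = c e q := by
  by_contra hne
  obtain ⟨⟨hi, hj, hk, hl⟩, hnd, h5⟩ := hP
  have hW : ∀ z ∈ W, d ≠ z ∧ e ≠ z := fun z hz => ⟨fun h => hd (h ▸ hz), fun h => he (h ▸ hz)⟩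
  have m1 := hW p hp
  have m2 := hW q hq
  have m3 := hW i hi
  have m4 := hW j hj
  have m5 := hW k hk
  have m6 := hW l hl
  simp only [List.nodup_cons, List.mem_cons, not_or, List.not_mem_nil, not_false_eq_true,
    List.nodup_nil, and_true] at hnd
  refine hno.false_of_add_four (.nil) (by simp) (a := d) (b := p) (d := e) (e := q) (f := i) (g := j)
    (k := k) (l := l) (by simp) ?_ (by simp) (by simp) (by simp) (by simp) ?_
  · simp only [List.nodup_cons, List.mem_cons, not_or, List.not_mem_nil, not_false_eq_true,
      List.nodup_nil, and_true]
    obtain ⟨⟨n1, n2, n3, n4, n5⟩, ⟨n6, n7, n8, n9⟩, n10⟩ := hnd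
    exact ⟨⟨m1.1, hde, m2.1, m3.1, m4.1, m5.1, m6.1⟩, ⟨m1.2.symm, n1, n2, n3, n4, n5⟩,
      ⟨m2.2, m3.2, m4.2, m5.2, m6.2⟩, ⟨n6, n7, n8, n9⟩, n10⟩
  · simp only [List.nodup_cons, List.mem_cons, not_or, List.not_mem_nil, not_false_eq_true,
      List.nodup_nil, and_true]
    exact ⟨⟨hne, h1, h2⟩, ⟨h3, h4⟩, h5⟩

/-- A pairing that also avoids the color of er forces dq to have that color. For a third vertex q',
any pairing of the rest then forces dq' to have it too, against the distinctness of the colors at d.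
-/
theorem false_of_hub (hno : NoRainbow c 3) (hd : d ∉ W) (he : e ∉ W) (hde : d ≠ e)
    (hB : colors c W ⊆ B)
    (h1 : ∀ p ∈ W, ∀ q ∈ W, p ≠ q → (p ≠ a ∧ p ≠ b) ∨ (q ≠ a ∧ q ≠ b) →
      ∃ i j k l, Pairing c W p q i j k l)
    (hW : 2 < W.card) {r q : V} (hr : r ∈ W) (hq : q ∈ W) (hra : r ≠ a ∧ r ≠ b)
    (h2 : ∀ γ, ∃ i j k l, Pairing c W q r i j k l ∧ γ ≠ c i j ∧ γ ≠ c k l)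
    (hfresh : ∀ p ∈ W, c d p ∉ B) (hinj : ∀ p ∈ W, ∀ p' ∈ W, c d p = c d p' → p = p') : False := by
  have hin : ∀ i ∈ W, ∀ j ∈ W, ∀ p ∈ W, i ≠ j → c d p ≠ c i j := fun i hi j hj p hp hij h =>
    hfresh p hp (hB (mem_colors.mpr ⟨i, hi, j, hj, hij, h.symm⟩))
  have hne : ∀ {p q i j k l : V}, Pairing c W p q i j k l → i ≠ j ∧ k ≠ l := by
    intro p q i j k l h
    have := h.2.1
    simp only [List.nodup_cons, List.mem_cons, not_or, List.not_mem_nil, not_false_eq_true,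
      List.nodup_nil, and_true] at this
    tauto
  obtain ⟨i, j, k, l, hP, e1, e2⟩ := h2 (c e r)
  have key : c d q = c e r := hP.eq_of_fresh hno hd he hde hq hr
    (hin i hP.1.1 j hP.1.2.1 q hq (hne hP).1) (hin k hP.1.2.2.1 l hP.1.2.2.2 q hq (hne hP).2) e1 e2
  obtain ⟨q', hq', hq'2⟩ : ∃ q' ∈ W, q' ∉ ({r, q} : Finset V) := by
    by_contra hcon
    push Not at hcon
    have := (Finset.card_le_card hcon).trans Finset.card_le_two
    omega
  simp only [Finset.mem_insert, Finset.mem_singleton, not_or] at hq'2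
  obtain ⟨i, j, k, l, hP⟩ := h1 q' hq' r hr hq'2.1 (.inr hra)
  have n1 := hin i hP.1.1 j hP.1.2.1
  have n2 := hin k hP.1.2.2.1 l hP.1.2.2.2
  have := hP.eq_of_fresh hno hd he hde hq' hr (n1 q' hq' (hne hP).1) (n2 q' hq' (hne hP).2)
    (key ▸ n1 q hq (hne hP).1) (key ▸ n2 q hq (hne hP).2)
  exact hq'2.2 (hinj _ hq' _ hq (this.trans key.symm))

/-- All six new colors come from the six edges at d, so each of these is new and no two agree. -/
theorem exists_hub (hW : W.card = 6) (h : ∀ p ∈ W, c e p ∈ B)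
    (h6 : 6 ≤ (fresh c B d e W).card) :
    (∀ p ∈ W, c d p ∉ B) ∧ ∀ p ∈ W, ∀ p' ∈ W, c d p = c d p' → p = p' := by
  have hsub : fresh c B d e W ⊆ (W.filter fun p => c d p ∉ B).image (c d) := by
    intro γ hγ
    simp only [fresh, Finset.mem_biUnion, Finset.mem_sdiff, Finset.mem_insert,
      Finset.mem_singleton, Finset.mem_image, Finset.mem_filter] at hγ ⊢
    obtain ⟨p, hp, rfl | rfl, hγ⟩ := hγ
    · exact ⟨p, ⟨hp, hγ⟩, rfl⟩
    · exact absurd (h p hp) hγ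
  have h1 := Finset.card_le_card hsub
  have h2 := Finset.card_image_le (s := W.filter fun p => c d p ∉ B) (f := c d)
  have h3 := Finset.card_filter_le W fun p => c d p ∉ B
  have h4 : (W.filter fun p => c d p ∉ B) = W :=
    Finset.eq_of_subset_of_card_le (Finset.filter_subset _ _) (by omega)
  rw [Finset.filter_eq_self] at h4
  rw [Finset.filter_true_of_mem h4] at h1
  refine ⟨h4, ?_⟩
  have := Finset.injOn_of_card_image_eq (s := W) (f := c d)
    (le_antisymm Finset.card_image_le (by omega))
  exact fun p hp p' hp' h => this hp hp' h

/-- Two vertices outside of six vertices in which one finds many pairings: without rainbow perfect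
matchings there are at most five new colors between them. -/
theorem card_fresh_le_five (hno : NoRainbow c 3) (hW : W.card = 6) (hd : d ∉ W) (he : e ∉ W)
    (hde : d ≠ e) (hB : colors c W ⊆ B)
    (h1 : ∀ p ∈ W, ∀ q ∈ W, p ≠ q → (p ≠ a ∧ p ≠ b) ∨ (q ≠ a ∧ q ≠ b) →
      ∃ i j k l, Pairing c W p q i j k l)
    {r q : V} (hr : r ∈ W) (hq : q ∈ W) (hra : r ≠ a ∧ r ≠ b)
    (h2 : ∀ γ, ∃ i j k l, Pairing c W q r i j k l ∧ γ ≠ c i j ∧ γ ≠ c k l) :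
    (fresh c B d e W).card ≤ 5 := by
  by_contra hcon
  have h6 : 6 ≤ (fresh c B d e W).card := by omega
  have key : ∀ p ∈ W, ∀ q ∈ W, c d p ∉ B → c e q ∉ B → (p ≠ a ∧ p ≠ b) ∨ (q ≠ a ∧ q ≠ b) → p ≠ q →
      c d p = c e q := by
    intro p hp q hq hdp heq hab hpq
    obtain ⟨i, j, k, l, hP⟩ := h1 p hp q hq hpq hab
    have hnd := hP.2.1
    simp only [List.nodup_cons, List.mem_cons, not_or, List.not_mem_nil, not_false_eq_true,
      List.nodup_nil, and_true] at hnd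
    have m1 := hB (mem_colors.mpr ⟨i, hP.1.1, j, hP.1.2.1, by tauto, rfl⟩)
    have m2 := hB (mem_colors.mpr ⟨k, hP.1.2.2.1, l, hP.1.2.2.2, by tauto, rfl⟩)
    exact hP.eq_of_fresh hno hd he hde hp hq (fun h => hdp (h ▸ m1)) (fun h => hdp (h ▸ m2))
      (fun h => heq (h ▸ m1)) fun h => heq (h ▸ m2)
  -- If only one of d and e sees new colors, it is a hub, which is impossible. If both do, `key`
  -- identifies the colors at d with those at e outside a few vertices, so five values suffice.
  by_cases hZ2 : ∀ p ∈ W, c e p ∈ B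
  · obtain ⟨k1, k2⟩ := exists_hub hW hZ2 h6
    exact false_of_hub hno hd he hde hB h1 (by omega) hr hq hra h2 k1 k2
  by_cases hZ1 : ∀ p ∈ W, c d p ∈ B
  · have hsymm : fresh c B e d W = fresh c B d e W := by
      unfold fresh
      congr 1
      ext1 h
      rw [Finset.pair_comm]
    obtain ⟨k1, k2⟩ := exists_hub hW hZ1 (hsymm ▸ h6)
    exact false_of_hub hno he hd hde.symm hB h1 (by omega) hr hq hra h2 k1 k2
  push Not at hZ1 hZ2
  obtain ⟨p₀, hp₀, hdp₀⟩ := hZ1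
  obtain ⟨q₀, hq₀, heq₀⟩ := hZ2
  have hfive : ∀ x₁ x₂ x₃ x₄ x₅ : ℕ, fresh c B d e W ⊆ {x₁, x₂, x₃, x₄, x₅} → False := by
    intro x₁ x₂ x₃ x₄ x₅ h
    have := (Finset.card_le_card h).trans Finset.card_le_five
    omega
  by_cases hp : ∃ p ∈ W, (p ≠ a ∧ p ≠ b) ∧ c d p ∉ B
  · obtain ⟨p, hp, hpab, hdp⟩ := hp
    by_cases hq : ∃ q ∈ W, (q ≠ a ∧ q ≠ b) ∧ c e q ∉ B
    · obtain ⟨q, hq, hqab, heq⟩ := hq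
      refine hfive (c d p) (c e p) (c e q) (c d q) 0 fun γ hγ => ?_
      simp only [fresh, Finset.mem_biUnion, Finset.mem_sdiff, Finset.mem_insert,
        Finset.mem_singleton] at hγ ⊢
      obtain ⟨z, hz, rfl | rfl, hγ⟩ := hγ
      · by_cases hzq : z = q
        · simp [hzq]
        · simp [key z hz q hq hγ heq (.inr hqab) hzq]
      · by_cases hzp : p = z
        · simp [hzp]
        · simp [key p hp z hz hdp hγ (.inl hpab) hzp]
    · push Not at hq
      refine hfive (c d p) (c e p) (c e q₀) (c d a) (c d b) fun γ hγ => ?_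
      simp only [fresh, Finset.mem_biUnion, Finset.mem_sdiff, Finset.mem_insert,
        Finset.mem_singleton] at hγ ⊢
      obtain ⟨z, hz, rfl | rfl, hγ⟩ := hγ
      · by_cases hza : z = a
        · simp [hza]
        by_cases hzb : z = b
        · simp [hzb]
        have hzq : z ≠ q₀ := fun h => heq₀ (hq q₀ hq₀ ⟨h ▸ hza, h ▸ hzb⟩)
        simp [key z hz q₀ hq₀ hγ heq₀ (.inl ⟨hza, hzb⟩) hzq]
      · by_cases hzp : p = z
        · simp [hzp]
        · simp [key p hp z hz hdp hγ (.inl hpab) hzp]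
  · push Not at hp
    by_cases hq : ∃ q ∈ W, (q ≠ a ∧ q ≠ b) ∧ c e q ∉ B
    · obtain ⟨q, hq, hqab, heq⟩ := hq
      refine hfive (c e q) (c d q) (c d p₀) (c e a) (c e b) fun γ hγ => ?_
      simp only [fresh, Finset.mem_biUnion, Finset.mem_sdiff, Finset.mem_insert,
        Finset.mem_singleton] at hγ ⊢
      obtain ⟨z, hz, rfl | rfl, hγ⟩ := hγ
      · by_cases hzq : z = q
        · simp [hzq]
        · simp [key z hz q hq hγ heq (.inr hqab) hzq]
      · by_cases hza : z = a
        · simp [hza]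
        by_cases hzb : z = b
        · simp [hzb]
        have hzp : p₀ ≠ z := fun h => hdp₀ (hp p₀ hp₀ ⟨h ▸ hza, h ▸ hzb⟩)
        simp [key p₀ hp₀ z hz hdp₀ hγ (.inr ⟨hza, hzb⟩) hzp]
    · push Not at hq
      refine hfive (c d a) (c d b) (c e a) (c e b) 0 fun γ hγ => ?_
      simp only [fresh, Finset.mem_biUnion, Finset.mem_sdiff, Finset.mem_insert,
        Finset.mem_singleton] at hγ ⊢
      obtain ⟨z, hz, rfl | rfl, hγ⟩ := hγ
      · by_cases hza : z = a
        · simp [hza]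
        by_cases hzb : z = b
        · simp [hzb]
        exact absurd (hp z hz ⟨hza, hzb⟩) hγ
      · by_cases hza : z = a
        · simp [hza]
        by_cases hzb : z = b
        · simp [hzb]
        exact absurd (hq z hz ⟨hza, hzb⟩) hγ

end AntiRamsey

/-! ### Eight vertices: hubs and squares. -/

namespace AntiRamsey

variable {V : Type*} [DecidableEq V] {c : V → V → ℕ} {s : Finset V} {C : Finset ℕ} {t : ℕ}
  {a b u v x y : V}

theorem Pairing.symm {W : Finset V} {p q i j k l : V} (h : Pairing c W p q i j k l) :
    Pairing c W q p i j k l := by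
  refine ⟨h.1, ?_, h.2.2⟩
  have := h.2.1
  simp only [List.nodup_cons, List.mem_cons, not_or, List.not_mem_nil, not_false_eq_true,
    List.nodup_nil, and_true] at this ⊢
  grind

theorem forall_pairs {P : V → V → Prop} (hP : ∀ p q, P p q → P q p) (h1 : P a u) (h2 : P a v)
    (h3 : P a x) (h4 : P a y) (h5 : P b u) (h6 : P b v) (h7 : P b x) (h8 : P b y) (h9 : P u v)
    (h10 : P u x) (h11 : P u y) (h12 : P v x) (h13 : P v y) (h14 : P x y) :
    ∀ p ∈ ({a, b, u, v, x, y} : Finset V), ∀ q ∈ ({a, b, u, v, x, y} : Finset V), p ≠ q →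
      (p ≠ a ∧ p ≠ b) ∨ (q ≠ a ∧ q ≠ b) → P p q := by
  simp only [Finset.mem_insert, Finset.mem_singleton]
  rintro p (rfl | rfl | rfl | rfl | rfl | rfl) q (rfl | rfl | rfl | rfl | rfl | rfl) hpq hab
  all_goals
    first
    | assumption
    | (apply hP; assumption)
    | (exact absurd rfl hpq)
    | (exfalso; clear hP; simp at hab)

theorem pairing_of {W : Finset V} {p q i j m l : V}
    (h : (i ∈ W ∧ j ∈ W ∧ m ∈ W ∧ l ∈ W) ∧ [p, q, i, j, m, l].Nodup) (hne : c i j ≠ c m l) :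
    Pairing c W p q i j m l :=
  ⟨h.1, h.2, hne⟩

variable [Fintype V]

/-- For t = 2 the matching is a single edge de. All colors not in `B` lie between de and the six
other vertices. -/
theorem Six.card_colors_le (hc : ∀ a b, c a b = c b a) (hno : NoRainbow c 3)
    (k : Six c s C a b u v x y) (hC : C.card = 1) {B : Finset ℕ} (hCB : C ⊆ B)
    (hB : colors c {a, b, u, v, x, y} ⊆ B)
    (h1 : ∀ p ∈ ({a, b, u, v, x, y} : Finset V), ∀ q ∈ ({a, b, u, v, x, y} : Finset V), p ≠ q →
      (p ≠ a ∧ p ≠ b) ∨ (q ≠ a ∧ q ≠ b) → ∃ i j k l, Pairing c {a, b, u, v, x, y} p q i j k l)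
    {r q : V} (hr : r ∈ ({a, b, u, v, x, y} : Finset V)) (hq : q ∈ ({a, b, u, v, x, y} : Finset V))
    (hra : r ≠ a ∧ r ≠ b)
    (h2 : ∀ γ, ∃ i j k l, Pairing c {a, b, u, v, x, y} q r i j k l ∧ γ ≠ c i j ∧ γ ≠ c k l) :
    (colors c Finset.univ).card ≤ B.card + 5 := by
  obtain ⟨γ, hγ⟩ := Finset.card_pos.mp (show 0 < C.card by omega)
  obtain ⟨d, e, s', C', hd, he, hde, hcol, hγ', rfl, rfl, hs'⟩ := k.rainbow.exists_eq_insert hγ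
  rw [Finset.card_insert_of_notMem hγ'] at hC
  have hs0 : s' = ∅ := Finset.card_eq_zero.mp (by rw [hs'.card_eq]; omega)
  subst hs0
  have h := k.ne
  have h' := k.notMem
  simp only [Finset.mem_insert, not_or, Finset.notMem_empty, not_false_eq_true, and_true] at h'
  have hW : ({a, b, u, v, x, y} : Finset V).card = 6 := by
    rw [Finset.card_insert_of_notMem (by simp [h]), Finset.card_insert_of_notMem (by simp [h]),
      Finset.card_insert_of_notMem (by simp [h]), Finset.card_insert_of_notMem (by simp [h]),
      Finset.card_pair (by simp [h])]
  have hcov : ∀ z, z = d ∨ z = e ∨ z ∈ ({a, b, u, v, x, y} : Finset V) := by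
    intro z
    have := k.cover z
    simp only [Finset.mem_insert, Finset.notMem_empty, or_false, Finset.mem_singleton] at this ⊢
    rwa [or_assoc] at this
  have hdW : d ∉ ({a, b, u, v, x, y} : Finset V) := by
    simp only [Finset.mem_insert, Finset.mem_singleton, not_or]
    exact ⟨Ne.symm h'.1.1, Ne.symm h'.2.1.1, Ne.symm h'.2.2.1.1, Ne.symm h'.2.2.2.1.1,
      Ne.symm h'.2.2.2.2.1.1, Ne.symm h'.2.2.2.2.2.1⟩
  have heW : e ∉ ({a, b, u, v, x, y} : Finset V) := by
    simp only [Finset.mem_insert, Finset.mem_singleton, not_or]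
    exact ⟨Ne.symm h'.1.2, Ne.symm h'.2.1.2, Ne.symm h'.2.2.1.2, Ne.symm h'.2.2.2.1.2,
      Ne.symm h'.2.2.2.2.1.2, Ne.symm h'.2.2.2.2.2.2⟩
  have hfive := card_fresh_le_five hno hW hdW heW hde hB h1 hr hq hra h2
  clear h1 h2 h h' hW hdW heW hs' k hr hq hra hγ
  generalize ({a, b, u, v, x, y} : Finset V) = W at *
  have hsub : colors c Finset.univ ⊆ B ∪ fresh c B d e W := by
    have hdW' : ∀ z ∈ W, c d z ∈ B ∪ fresh c B d e W ∧ c e z ∈ B ∪ fresh c B d e W :=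
      mem_of_fresh_subset Finset.subset_union_left Finset.subset_union_right
    have hde' : c d e ∈ B ∪ fresh c B d e W :=
      Finset.mem_union_left _ (hCB (by simp [hcol]))
    intro δ hδ
    obtain ⟨p, -, q, -, hpq, rfl⟩ := mem_colors.mp hδ
    rcases hcov p with hp | hp | hp <;> rcases hcov q with hq | hq | hq
    · exact absurd (hp.trans hq.symm) hpq
    · rwa [hp, hq]
    · rw [hp]; exact (hdW' q hq).1
    · rwa [hp, hq, hc]
    · exact absurd (hp.trans hq.symm) hpq
    · rw [hp]; exact (hdW' q hq).2
    · rw [hq, hc]; exact (hdW' p hp).1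
    · rw [hq, hc]; exact (hdW' p hp).2
    · exact Finset.mem_union_left _ (hB (mem_colors.mpr ⟨p, hp, q, hq, hpq, rfl⟩))
  have h3 := Finset.card_le_card hsub
  have h4 := Finset.card_union_le B (fresh c B d e W)
  omega

/-- The edges from b to the four vertices all have the one matching color, whereas au, av and ax
have new ones. Mixing them gives two colors for every pair of vertices to be left out other than ab.
-/
theorem Six.card_colors_le_of_hub (hc : ∀ a b, c a b = c b a) (hno : NoRainbow c 3)
    (k : Six c s C a b u v x y) (hC : C.card = 1) {B : Finset ℕ} (hCB : C ⊆ B)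
    (hB : colors c {a, b, u, v, x, y} ⊆ B) (hb : c b u ∈ C ∧ c b v ∈ C ∧ c b x ∈ C ∧ c b y ∈ C)
    (hu : c a u ∉ C ∪ colors c {u, v, x, y}) (hv : c a v ∉ C) (hx : c a x ∉ C)
    (huv : c a u ≠ c a v) (cuv : c u v ∉ C) (cxy : c x y ∉ C) (cab : c a b ∉ C)
    (hne : c a b ≠ c u v) (hvxy : c a v ≠ c x y) :
    (colors c Finset.univ).card ≤ B.card + 5 := by
  obtain ⟨b1, b2, b3, b4⟩ := hb
  have h := k.ne
  rw [Finset.mem_union, not_or] at hu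
  have hne' : ∀ {γ δ}, γ ∈ C → δ ∉ C → γ ≠ δ := fun h h' e => h' (e ▸ h)
  have hau : ∀ p q, p ∈ ({u, v, x, y} : Finset V) → q ∈ ({u, v, x, y} : Finset V) → p ≠ q →
      c a u ≠ c p q := fun p q hp hq hpq e =>
    hu.2 (mem_colors.mpr ⟨p, hp, q, hq, hpq, e.symm⟩)
  have hP : ∀ p q, (∃ i j k l, Pairing c {a, b, u, v, x, y} p q i j k l) →
      ∃ i j k l, Pairing c {a, b, u, v, x, y} q p i j k l :=
    fun p q ⟨i, j, k, l, h⟩ => ⟨i, j, k, l, h.symm⟩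
  refine k.card_colors_le hc hno hC hCB hB (r := y) (q := x) (forall_pairs hP
    ⟨b, v, x, y, pairing_of ⟨⟨by simp, by simp, by simp, by simp⟩, by simp [h]⟩ (hne' b2 cxy)⟩
    ⟨b, u, x, y, pairing_of ⟨⟨by simp, by simp, by simp, by simp⟩, by simp [h]⟩ (hne' b1 cxy)⟩
    ⟨b, y, u, v, pairing_of ⟨⟨by simp, by simp, by simp, by simp⟩, by simp [h]⟩ (hne' b4 cuv)⟩
    ⟨b, x, u, v, pairing_of ⟨⟨by simp, by simp, by simp, by simp⟩, by simp [h]⟩ (hne' b3 cuv)⟩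
    ⟨a, v, x, y, pairing_of ⟨⟨by simp, by simp, by simp, by simp⟩, by simp [h]⟩ hvxy⟩
    ⟨a, u, x, y, pairing_of ⟨⟨by simp, by simp, by simp, by simp⟩, by simp [h]⟩ (hau x y (by simp) (by simp) (by simp [h]))⟩
    ⟨a, u, v, y, pairing_of ⟨⟨by simp, by simp, by simp, by simp⟩, by simp [h]⟩ (hau v y (by simp) (by simp) (by simp [h]))⟩
    ⟨a, u, v, x, pairing_of ⟨⟨by simp, by simp, by simp, by simp⟩, by simp [h]⟩ (hau v x (by simp) (by simp) (by simp [h]))⟩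
    ⟨b, y, a, x, pairing_of ⟨⟨by simp, by simp, by simp, by simp⟩, by simp [h]⟩ (hne' b4 hx)⟩
    ⟨b, y, a, v, pairing_of ⟨⟨by simp, by simp, by simp, by simp⟩, by simp [h]⟩ (hne' b4 hv)⟩
    ⟨b, x, a, v, pairing_of ⟨⟨by simp, by simp, by simp, by simp⟩, by simp [h]⟩ (hne' b3 hv)⟩
    ⟨b, y, a, u, pairing_of ⟨⟨by simp, by simp, by simp, by simp⟩, by simp [h]⟩ (hne' b4 hu.1)⟩
    ⟨b, x, a, u, pairing_of ⟨⟨by simp, by simp, by simp, by simp⟩, by simp [h]⟩ (hne' b3 hu.1)⟩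
    ⟨b, u, a, v, pairing_of ⟨⟨by simp, by simp, by simp, by simp⟩, by simp [h]⟩ (hne' b1 hv)⟩) (by simp) (by simp) (by simp [h]) ?_
  -- With x and y left out there are three pairings of a, b, u, v, and any single color is avoided
  -- by one of them.
  intro γ
  by_cases h1 : γ ∈ C
  · exact ⟨a, b, u, v, pairing_of ⟨⟨by simp, by simp, by simp, by simp⟩, by simp [h]⟩ hne, hne' h1 cab, hne' h1 cuv⟩
  by_cases h2 : γ = c a v
  · exact ⟨b, v, a, u, pairing_of ⟨⟨by simp, by simp, by simp, by simp⟩, by simp [h]⟩ (hne' b2 hu.1), (hne' b2 h1).symm,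
      by rw [h2]; exact huv.symm⟩
  · exact ⟨b, u, a, v, pairing_of ⟨⟨by simp, by simp, by simp, by simp⟩, by simp [h]⟩ (hne' b1 hv), (hne' b1 h1).symm, h2⟩

/-- The four edges between ab and uy have distinct colors that do not occur among u, v, x, y, so the
two perfect matchings of this square provide the pairing that avoids a prescribed color. -/
theorem Six.card_colors_le_of_square (hc : ∀ a b, c a b = c b a) (hno : NoRainbow c 3)
    (k : Six c s C a b u v x y) (hC : C.card = 1) {B : Finset ℕ} (hCB : C ⊆ B)
    (hB : colors c {a, b, u, v, x, y} ⊆ B) (hb : c b v ∈ C ∧ c b x ∈ C)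
    (hfr : ∀ p, p = a ∨ p = b → ∀ q, q = u ∨ q = y → c p q ∉ C ∪ colors c {u, v, x, y})
    (h1 : c a u ≠ c b y) (h2 : c a u ≠ c b u) (h3 : c a u ≠ c a y) (h4 : c b y ≠ c b u)
    (h5 : c b y ≠ c a y) (h6 : c a y ≠ c b u) (hvx : c a b ≠ c v x) :
    (colors c Finset.univ).card ≤ B.card + 5 := by
  obtain ⟨b1, b2⟩ := hb
  have h := k.ne
  have hne' : ∀ {γ δ}, γ ∈ C → δ ∉ C → γ ≠ δ := fun h h' e => h' (e ▸ h)
  have hau : ∀ p, p = a ∨ p = b → ∀ q, q = u ∨ q = y → c p q ∉ C := fun p hp q hq e =>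
    hfr p hp q hq (Finset.mem_union_left _ e)
  have hU : ∀ p, p = a ∨ p = b → ∀ q, q = u ∨ q = y → ∀ i j, i ∈ ({u, v, x, y} : Finset V) →
      j ∈ ({u, v, x, y} : Finset V) → i ≠ j → c p q ≠ c i j := fun p hp q hq i j hi hj hij e =>
    hfr p hp q hq (Finset.mem_union_right _ (mem_colors.mpr ⟨i, hi, j, hj, hij, e.symm⟩))
  have hP : ∀ p q, (∃ i j k l, Pairing c {a, b, u, v, x, y} p q i j k l) →
      ∃ i j k l, Pairing c {a, b, u, v, x, y} q p i j k l :=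
    fun p q ⟨i, j, k, l, h⟩ => ⟨i, j, k, l, h.symm⟩
  refine k.card_colors_le hc hno hC hCB hB (r := x) (q := v) (forall_pairs hP
    ⟨b, y, v, x, pairing_of ⟨⟨by simp, by simp, by simp, by simp⟩, by simp [h]⟩ (hU _ (by simp) _ (by simp) _ _ (by simp) (by simp) (by simp [h]))⟩
    ⟨b, u, x, y, pairing_of ⟨⟨by simp, by simp, by simp, by simp⟩, by simp [h]⟩ (hU _ (by simp) _ (by simp) _ _ (by simp) (by simp) (by simp [h]))⟩
    ⟨b, u, v, y, pairing_of ⟨⟨by simp, by simp, by simp, by simp⟩, by simp [h]⟩ (hU _ (by simp) _ (by simp) _ _ (by simp) (by simp) (by simp [h]))⟩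
    ⟨b, u, v, x, pairing_of ⟨⟨by simp, by simp, by simp, by simp⟩, by simp [h]⟩ (hU _ (by simp) _ (by simp) _ _ (by simp) (by simp) (by simp [h]))⟩
    ⟨a, y, v, x, pairing_of ⟨⟨by simp, by simp, by simp, by simp⟩, by simp [h]⟩ (hU _ (by simp) _ (by simp) _ _ (by simp) (by simp) (by simp [h]))⟩
    ⟨a, u, x, y, pairing_of ⟨⟨by simp, by simp, by simp, by simp⟩, by simp [h]⟩ (hU _ (by simp) _ (by simp) _ _ (by simp) (by simp) (by simp [h]))⟩
    ⟨a, u, v, y, pairing_of ⟨⟨by simp, by simp, by simp, by simp⟩, by simp [h]⟩ (hU _ (by simp) _ (by simp) _ _ (by simp) (by simp) (by simp [h]))⟩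
    ⟨a, u, v, x, pairing_of ⟨⟨by simp, by simp, by simp, by simp⟩, by simp [h]⟩ (hU _ (by simp) _ (by simp) _ _ (by simp) (by simp) (by simp [h]))⟩
    ⟨b, x, a, y, pairing_of ⟨⟨by simp, by simp, by simp, by simp⟩, by simp [h]⟩ (hne' b2 (hau _ (by simp) _ (by simp)))⟩
    ⟨b, v, a, y, pairing_of ⟨⟨by simp, by simp, by simp, by simp⟩, by simp [h]⟩ (hne' b1 (hau _ (by simp) _ (by simp)))⟩
    ⟨a, b, v, x, pairing_of ⟨⟨by simp, by simp, by simp, by simp⟩, by simp [h]⟩ hvx⟩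
    ⟨a, u, b, y, pairing_of ⟨⟨by simp, by simp, by simp, by simp⟩, by simp [h]⟩ h1⟩
    ⟨b, x, a, u, pairing_of ⟨⟨by simp, by simp, by simp, by simp⟩, by simp [h]⟩ (hne' b2 (hau _ (by simp) _ (by simp)))⟩
    ⟨b, v, a, u, pairing_of ⟨⟨by simp, by simp, by simp, by simp⟩, by simp [h]⟩ (hne' b1 (hau _ (by simp) _ (by simp)))⟩)
    (by simp) (by simp) (by simp [h]) ?_
  intro γ
  by_cases e1 : γ = c a u ∨ γ = c b y
  · refine ⟨a, y, b, u, pairing_of ⟨⟨by simp, by simp, by simp, by simp⟩, by simp [h]⟩ h6, ?_, ?_⟩ <;> rcases e1 with rfl | rfl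
    exacts [h3, h5, h2, h4]
  · rw [not_or] at e1
    exact ⟨a, u, b, y, pairing_of ⟨⟨by simp, by simp, by simp, by simp⟩, by simp [h]⟩ h1, e1.1, e1.2⟩

end AntiRamsey

/-! ### The bound for mixed configurations. -/

namespace AntiRamsey

variable {V : Type*} [DecidableEq V] {c : V → V → ℕ} {s : Finset V} {C : Finset ℕ} {t : ℕ}
  {a b u v x y : V}

namespace Mixed

theorem live_swap (hc : ∀ a b, c a b = c b a) : live c C b a u v x y = live c C a b u v x y := by
  simp only [live, hc b a]

theorem cross_swap (hc : ∀ a b, c a b = c b a) :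
    cross c C b a u v x y = cross c C a b u v x y := by
  simp only [cross, fresh, base_swap hc, Finset.pair_comm (c b _)]

theorem four_exchange : ({x, y, u, v} : Finset V) = {u, v, x, y} := by
  ext z; simp only [Finset.mem_insert, Finset.mem_singleton]; tauto

theorem live_exchange : live c C a b x y u v = live c C a b u v x y := by
  simp only [live, four_exchange]

theorem cross_exchange : cross c C a b x y u v = cross c C a b u v x y := by
  simp only [cross, base_exchange, four_exchange]

/-- The two classes of `good_of_three_le` contain at most two cross colors each, so four cross
colors make both classes good. -/
theorem good_of_four_le (hno : NoRainbow c (t + 1)) (hC : C.card + 1 = t)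
    (k : Mixed c s C a b u v x y) (h3 : 4 ≤ (cross c C a b u v x y).card) :
    (Good c C a b u v x y a u y ∨ Good c C a b u v x y b x v) ∧
      (Good c C a b u v x y a x v ∨ Good c C a b u v x y b u y) := by
  have h := k.six.ne
  have hux : c u x ∉ C := by rw [k.ux]; exact k.ab
  have hxy : c x y ∉ C := by rw [k.xy]; exact k.uv
  have e1 := k.eq_of_base hno hC (p := u) (q := x) (r := v) (w := y) (by simp [h]) (by simp)
    (by simp) (by simp) (by simp) k.vy
  have e2 := k.eq_of_base hno hC (p := x) (q := u) (r := v) (w := y) (by simp [h]) (by simp)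
    (by simp) (by simp) (by simp) k.vy
  have e3 := k.eq_of_base hno hC (p := v) (q := y) (r := u) (w := x) (by simp [h]) (by simp)
    (by simp) (by simp) (by simp) hux
  have e4 := k.eq_of_base hno hC (p := y) (q := v) (r := u) (w := x) (by simp [h]) (by simp)
    (by simp) (by simp) (by simp) hux
  have e5 := k.eq_of_base hno hC (p := u) (q := v) (r := x) (w := y) (by simp [h]) (by simp)
    (by simp) (by simp) (by simp) hxy
  have e6 := k.eq_of_base hno hC (p := v) (q := u) (r := x) (w := y) (by simp [h]) (by simp)
    (by simp) (by simp) (by simp) hxy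
  have e7 := k.eq_of_base hno hC (p := x) (q := y) (r := u) (w := v) (by simp [h]) (by simp)
    (by simp) (by simp) (by simp) k.uv
  have e8 := k.eq_of_base hno hC (p := y) (q := x) (r := u) (w := v) (by simp [h]) (by simp)
    (by simp) (by simp) (by simp) k.uv
  have hsub : cross c C a b u v x y ⊆
      (({c a u, c b x, c a y, c b v} : Finset ℕ) \ base c C a b u v x y) ∪
      (({c a x, c b u, c a v, c b y} : Finset ℕ) \ base c C a b u v x y) := by
    intro γ hγ
    simp only [cross, fresh, Finset.mem_biUnion, Finset.mem_sdiff, Finset.mem_insert,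
      Finset.mem_singleton, Finset.mem_union] at hγ ⊢
    obtain ⟨z, hz, hγ, hB⟩ := hγ
    simp only [hB, not_false_eq_true, and_true]
    rcases hz with rfl | rfl | rfl | rfl <;> rcases hγ with rfl | rfl <;> simp
  clear hno k hux hxy h
  simp only [Good]
  generalize base c C a b u v x y = B at *
  have f1 := card_sdiff_le_two (X := B) e1 e4
  have f2 := card_sdiff_le_two (X := B) e2 e3
  have h4 := Finset.card_le_card hsub
  have h5 := Finset.card_union_le (({c a u, c b x, c a y, c b v} : Finset ℕ) \ B)
    (({c a x, c b u, c a v, c b y} : Finset ℕ) \ B)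
  clear hsub
  constructor
  · by_contra hcon
    have h1 : (({c a u, c b x, c a y, c b v} : Finset ℕ) \ B).card ≤ 1 := by
      rw [Finset.card_le_one]
      intro p hp q hq
      simp only [Finset.mem_sdiff, Finset.mem_insert, Finset.mem_singleton] at hp hq
      clear f1 f2 h4 h5 e2 e3 e6 e7
      grind
    omega
  · by_contra hcon
    have h2 : (({c a x, c b u, c a v, c b y} : Finset ℕ) \ B).card ≤ 1 := by
      rw [Finset.card_le_one]
      intro p hp q hq
      simp only [Finset.mem_sdiff, Finset.mem_insert, Finset.mem_singleton] at hp hq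
      clear f1 f2 h4 h5 e1 e4 e5 e8
      grind
    omega

/-- If the two colors agreed, only one further live color could come from uy and vx. -/
theorem uv_ne_vy (hc : ∀ a b, c a b = c b a) (hno : NoRainbow c (t + 1)) (hC : C.card + 1 = t)
    (k : Mixed c s C a b u v x y) (hl : 3 ≤ (live c C a b u v x y).card) : c u v ≠ c v y := by
  intro hd
  have h := k.six.ne
  have h' := k.six.notMem
  have k1 := k.config_left
  have e : c u y ∉ insert (c a b) C → c v x ∉ insert (c a b) C → c u y = c v x :=
    fun h1 h2 => hno.eq_of_add_two k1.rainbow (by rw [Finset.card_insert_of_notMem k.ab, hC])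
      (by simp [h, h']) (by simp [h]) h1 h2
  have hsub : ∃ p q, live c C a b u v x y ⊆ {p, q} := by
    by_cases huy : c u y ∈ insert (c a b) C
    · refine ⟨c u v, c v x, fun γ hγ => ?_⟩
      rw [live, Finset.mem_sdiff, mem_colors_four hc (by simp [h])] at hγ
      have := k.ux; have := k.xy
      clear hno k k1 hc
      grind
    · refine ⟨c u v, c u y, fun γ hγ => ?_⟩
      rw [live, Finset.mem_sdiff, mem_colors_four hc (by simp [h])] at hγ
      have := k.ux; have := k.xy
      clear hno k k1 hc
      grind
  obtain ⟨p, q, hsub⟩ := hsub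
  have := (Finset.card_le_card hsub).trans Finset.card_le_two
  omega

/-- If two new colors at `a` are good, then the edges from `b` to the other two vertices have
colors of the matching. -/
theorem mem_mem_of_good (hc : ∀ a b, c a b = c b a) (hno : NoRainbow c (t + 1))
    (hC : C.card + 1 = t) (k : Mixed c s C a b u v x y)
    (hl : 3 ≤ (live c C a b u v x y).card) (hg : Good c C a b u v x y a u y) :
    c b v ∈ C ∧ c b x ∈ C := by
  refine ⟨(k.mem_of_good hno hc hC hg).1, ?_⟩
  have h := k.six.ne
  have h' := k.six.notMem
  have hne := k.uv_ne_vy hc hno hC hl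
  obtain ⟨h1, h2, h3⟩ := hg
  obtain ⟨i1, i2, i3⟩ := notMem_of_notMem_base h1
  obtain ⟨j1, j2, j3⟩ := notMem_of_notMem_base h2
  exact (hno.mem_of_same_end k.six.rainbow hC (a := a) (p := u) (q := y) (r := x) (w := v)
    (by simp [h']) (by simp [h]) i1 j1 h3 k.uv (by rw [hc]; exact k.vy)
    (by rw [hc y v]; exact hne) (i3 u (by simp) v (by simp) (by simp [h]))
    (i3 y (by simp) v (by simp) (by simp [h])) (j3 u (by simp) v (by simp) (by simp [h]))
    (j3 y (by simp) v (by simp) (by simp [h]))).1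

theorem colors_six_subset (hc : ∀ a b, c a b = c b a) :
    colors c {a, b, u, v, x, y} ⊆ base c C a b u v x y ∪ cross c C a b u v x y := by
  intro γ hγ
  obtain ⟨p, hp, q, hq, hpq, rfl⟩ := mem_colors.mp hγ
  rw [Finset.mem_insert, Finset.mem_insert] at hp hq
  exact mem_of_base_subset hc Finset.subset_union_left Finset.subset_union_right hp hq hpq

theorem card_base_le (hC : C.card = 1) (hl : (live c C a b u v x y).card ≤ 3) :
    (base c C a b u v x y).card ≤ 5 := by
  have h1 : base c C a b u v x y = insert (c a b) C ∪ live c C a b u v x y := by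
    rw [base, live, Finset.union_sdiff_self_eq_union]
  have h2 := Finset.card_union_le (insert (c a b) C) (live c C a b u v x y)
  have h3 := Finset.card_insert_le (c a b) C
  rw [h1]
  omega

theorem distinct_of_four_le {p q r w : ℕ} {X : Finset ℕ} (h : 4 ≤ X.card) (hX : X ⊆ {p, q, r, w}) :
    p ≠ q ∧ p ≠ r ∧ p ≠ w ∧ q ≠ r ∧ q ≠ w ∧ r ≠ w := by
  have h1 := h.trans (Finset.card_le_card hX)
  by_contra hcon
  have : ∃ i j k : ℕ, ({p, q, r, w} : Finset ℕ) ⊆ {i, j, k} := by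
    by_cases e1 : p = q
    · exact ⟨p, r, w, by intro z; simp [e1]⟩
    by_cases e2 : p = r
    · exact ⟨p, q, w, by intro z; simp [e2]; tauto⟩
    by_cases e3 : p = w
    · exact ⟨p, q, r, by intro z; simp [e3]; tauto⟩
    by_cases e4 : q = r
    · exact ⟨p, q, w, by intro z; simp [e4]⟩
    by_cases e5 : q = w
    · exact ⟨p, q, r, by intro z; simp [e5]; tauto⟩
    · have e6 : r = w := by tauto
      exact ⟨p, q, r, by intro z; simp [e6]⟩
  obtain ⟨i, j, k, hs⟩ := this
  have := (Finset.card_le_card hs).trans Finset.card_le_three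
  omega

variable [Fintype V]

/-- Both good pairs are at a, so every edge from b to the four vertices has an old color and the
cross colors are the four colors at a. Then `base` and `cross` have at most 5 + 4 colors, and five
more are possible at de. -/
theorem card_colors_le_of_good_hub (hc : ∀ a b, c a b = c b a) (hno : NoRainbow c 3)
    (hC : C.card = 1) (k : Mixed c s C a b u v x y) (hl : 3 ≤ (live c C a b u v x y).card)
    (hw : 4 ≤ (cross c C a b u v x y).card) (h1 : Good c C a b u v x y a u y)
    (h2 : Good c C a b u v x y a x v) : (colors c Finset.univ).card ≤ 14 := by
  have h := k.six.ne
  have hC' : C.card + 1 = 2 := by omega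
  obtain ⟨bv, bx⟩ := k.mem_mem_of_good hc hno hC' hl h1
  obtain ⟨by', bu⟩ := (k.exchange hc).mem_mem_of_good hc hno hC' (by rwa [live_exchange])
    (by simpa only [Good, base_exchange] using h2)
  have hsub : cross c C a b u v x y ⊆ {c a u, c a y, c a x, c a v} := by
    have hCB : C ⊆ base c C a b u v x y :=
      (Finset.subset_insert _ _).trans Finset.subset_union_left
    intro γ hγ
    simp only [cross, fresh, Finset.mem_biUnion, Finset.mem_sdiff, Finset.mem_insert,
      Finset.mem_singleton] at hγ ⊢
    obtain ⟨z, hz, hγ, hB⟩ := hγ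
    rcases hγ with rfl | rfl
    · rcases hz with rfl | rfl | rfl | rfl <;> simp
    · exfalso
      rcases hz with rfl | rfl | rfl | rfl
      exacts [hB (hCB bu), hB (hCB bv), hB (hCB bx), hB (hCB by')]
  obtain ⟨n1, n2, n3, n4, n5, n6⟩ := distinct_of_four_le hw hsub
  obtain ⟨i1, i2, i3⟩ := notMem_of_notMem_base h1.1
  obtain ⟨j1, j2, j3⟩ := notMem_of_notMem_base h2.1
  obtain ⟨l1, l2, l3⟩ := notMem_of_notMem_base h2.2.1
  have hxy : c x y ∉ C := by rw [k.xy]; exact k.uv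
  have := k.six.card_colors_le_of_hub hc hno hC
    (B := base c C a b u v x y ∪ cross c C a b u v x y)
    ((Finset.subset_insert _ _).trans (Finset.subset_union_left.trans Finset.subset_union_left))
    (colors_six_subset hc) ⟨bu, bv, bx, by'⟩
    (fun hm => h1.1 (Finset.union_subset_union (Finset.subset_insert _ _) subset_rfl hm)) l1 j1 n3
    k.uv hxy k.ab k.uv_ne.symm (l3 x (by simp) y (by simp) (by simp [h]))
  have h3 := Finset.card_union_le (base c C a b u v x y) (cross c C a b u v x y)
  have h4 := card_base_le (c := c) (a := a) (b := b) (u := u) (v := v) (x := x) (y := y) hC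
    (k.card_live_le hc hno hC')
  have h5 := k.card_cross_le hno hC'
  omega

/-- The good pairs are at a and at b, both towards u and y, so the edges to v and x are old and the
four cross colors lie on the square between ab and uy. -/
theorem card_colors_le_of_good_square (hc : ∀ a b, c a b = c b a) (hno : NoRainbow c 3)
    (hC : C.card = 1) (k : Mixed c s C a b u v x y) (hl : 3 ≤ (live c C a b u v x y).card)
    (hw : 4 ≤ (cross c C a b u v x y).card) (h1 : Good c C a b u v x y a u y)
    (h2 : Good c C a b u v x y b u y) : (colors c Finset.univ).card ≤ 14 := by
  have h := k.six.ne
  have hC' : C.card + 1 = 2 := by omega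
  obtain ⟨bv, bx⟩ := k.mem_mem_of_good hc hno hC' hl h1
  obtain ⟨av, ax⟩ := (k.swap hc).mem_mem_of_good hc hno hC' (by rwa [live_swap hc])
    (by simpa only [Good, base_swap hc] using h2)
  have hsub : cross c C a b u v x y ⊆ {c a u, c a y, c b u, c b y} := by
    have hCB : C ⊆ base c C a b u v x y :=
      (Finset.subset_insert _ _).trans Finset.subset_union_left
    intro γ hγ
    simp only [cross, fresh, Finset.mem_biUnion, Finset.mem_sdiff, Finset.mem_insert,
      Finset.mem_singleton] at hγ ⊢
    obtain ⟨z, hz, hγ, hB⟩ := hγ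
    rcases hz with rfl | rfl | rfl | rfl <;> rcases hγ with rfl | rfl <;>
      first
      | simp
      | exact absurd (hCB av) hB
      | exact absurd (hCB ax) hB
      | exact absurd (hCB bv) hB
      | exact absurd (hCB bx) hB
  obtain ⟨n1, n2, n3, n4, n5, n6⟩ := distinct_of_four_le hw hsub
  have hvx : c a b ≠ c v x := fun e => n3 (k.eq_of_base hno hC' (p := u) (q := y) (r := v) (w := x)
    (by simp [h]) (by simp) (by simp) (by simp) (by simp) (e ▸ k.ab) h1.1 h2.2.1)
  have := k.six.card_colors_le_of_square hc hno hC
    (B := base c C a b u v x y ∪ cross c C a b u v x y)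
    ((Finset.subset_insert _ _).trans (Finset.subset_union_left.trans Finset.subset_union_left))
    (colors_six_subset hc) ⟨bv, bx⟩
    (by
      have hsubB : C ∪ colors c {u, v, x, y} ⊆ base c C a b u v x y :=
        Finset.union_subset_union (Finset.subset_insert _ _) subset_rfl
      rintro p (rfl | rfl) q (rfl | rfl) hm
      exacts [h1.1 (hsubB hm), h1.2.1 (hsubB hm), h2.1 (hsubB hm), h2.2.1 (hsubB hm)])
    n3 n2 n1 n6.symm n5.symm n4 hvx
  have h3 := Finset.card_union_le (base c C a b u v x y) (cross c C a b u v x y)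
  have h4 := card_base_le (c := c) (a := a) (b := b) (u := u) (v := v) (x := x) (y := y) hC
    (k.card_live_le hc hno hC')
  have h5 := k.card_cross_le hno hC'
  omega

theorem card_colors_le_fourteen (hc : ∀ a b, c a b = c b a) (hno : NoRainbow c 3)
    (hC : C.card = 1) (k : Mixed c s C a b u v x y) (hl : 3 ≤ (live c C a b u v x y).card)
    (hw : 4 ≤ (cross c C a b u v x y).card) : (colors c Finset.univ).card ≤ 14 := by
  obtain ⟨h1 | h1, h2 | h2⟩ := k.good_of_four_le (t := 2) hno (by omega) hw
  · exact k.card_colors_le_of_good_hub hc hno hC hl hw h1 h2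
  · exact k.card_colors_le_of_good_square hc hno hC hl hw h1 h2
  · exact (k.exchange hc).card_colors_le_of_good_square hc hno hC (by rwa [live_exchange])
      (by rwa [cross_exchange]) (by simpa only [Good, base_exchange] using h2)
      (by simpa only [Good, base_exchange] using h1)
  · exact (k.swap hc).card_colors_le_of_good_hub hc hno hC (by rwa [live_swap hc])
      (by rwa [cross_swap hc]) (by simpa only [Good, base_swap hc] using h2)
      (by simpa only [Good, base_swap hc] using h1)

/-- The number of colors is not too large if there is a mixed configuration. -/
theorem card_colors_le (hc : ∀ a b, c a b = c b a) (hno : NoRainbow c (t + 1))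
    (hN : Fintype.card V = 2 * t + 4) (hC : C.card + 1 = t) (k : Mixed c s C a b u v x y) :
    (colors c Finset.univ).card ≤ 2 * t ^ 2 + t + 2 ∨
      2 * (colors c Finset.univ).card ≤ 3 * t ^ 2 + 7 * t + 2 := by
  have h1 := k.card_colors_le_live_cross hc hno hN hC
  have h2 := k.card_live_le hc hno hC
  have h3 := k.card_cross_le hno hC
  -- The first estimate suffices unless live and cross colors number at least five. A third soft
  -- edge is enough for large t. The critical small case is t = 2 with three live and four cross
  -- colors, where the count would give 15 instead of 14. With exactly two cross colors and t ≤ 4,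
  -- the second bound is large enough.
  by_cases hw : 3 ≤ (cross c C a b u v x y).card
  · obtain ⟨h4, h5⟩ := k.card_colors_le_of_replaceable hc hno hN hC
      (k.replaceable_of_three_le hno hc hC hw)
    obtain rfl | rfl | ht : t = 2 ∨ t = 3 ∨ 4 ≤ t := by omega
    · right
      by_cases h6 : 3 ≤ (live c C a b u v x y).card ∧ 4 ≤ (cross c C a b u v x y).card
      · have := k.card_colors_le_fourteen hc hno (by omega) h6.1 h6.2
        omega
      · omega
    · omega
    · left; omega
  · by_cases hl : 3 ≤ (live c C a b u v x y).card ∧ 2 ≤ (cross c C a b u v x y).card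
    · by_cases ht : 5 ≤ t
      · obtain ⟨h4, h5⟩ := k.card_colors_le_of_replaceable hc hno hN hC
          (k.replaceable_of_two_le hno hc hC hl.1 hl.2)
        left; omega
      · have : 1 ≤ t := by omega
        have : t ≤ 4 := by omega
        right
        interval_cases t <;> omega
    · left; omega

end Mixed

end AntiRamsey

/-! ### Colorings without mixed configurations. -/

namespace AntiRamsey

variable {V : Type*} [DecidableEq V] {c : V → V → ℕ} {s : Finset V} {C : Finset ℕ} {t : ℕ}
  {a b u v x y : V}

/-- A rainbow matching in `A` avoiding the colors `D` can be augmented by two vertices of `A`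
inside of a rainbow graph, or there are few colors on `A` outside `D`. -/
theorem IsRainbow.exists_augment (hc : ∀ a b, c a b = c b a) {A : Finset V} {D : Finset ℕ}
    (h : IsRainbow ⊤ c s C) (hsA : s ⊆ A) (hD : Disjoint C D) :
    ((colors c A \ D).card ≤ 2 * C.card ^ 2 + C.card ∨
      2 * (colors c A \ D).card + C.card * (C.card + 1) ≤ 2 * C.card * A.card) ∨
    ∃ G p q C', IsRainbow G c s C ∧ InjOnEdges G c ∧ p ∈ A ∧ q ∈ A ∧ p ∉ s ∧ q ∉ s ∧ p ≠ q ∧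
      IsRainbow G c (insert p (insert q s)) C' ∧ Disjoint C' D := by
  obtain ⟨G, h1, h2, h3, h4⟩ := h.exists_rep hc A hD
  by_contra! hcon
  obtain ⟨hcon, hno⟩ := hcon
  have h5 := card_le_adjPairs (G := G) hc (A := A) (F := colors c A \ D)
    (fun γ hγ => by
      rw [Finset.mem_sdiff] at hγ
      by_cases hγC : γ ∈ C
      · obtain ⟨a, b, _, _, _, hab, he, hs, -⟩ := h1.exists_edge hγC
        exact ⟨a, hsA (by simp [hs]), b, hsA (by simp [hs]), hab, he⟩
      · exact h4 γ hγ.1 hγ.2 hγC)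
  have := card_adjPairs_le G A.card A C.card le_rfl
    (fun S hSA hM => by
      by_contra hlt
      obtain ⟨p, q, hp', hp, hq', hq, hpq, hM'⟩ :=
        IsMatched.exists_augment s.card le_rfl h1.isMatched hM (by rw [h1.card_eq]; omega)
      obtain ⟨C', hC'⟩ := IsRainbow.of_isMatched h2 hM'
      exact hno G p q C' h1 h2 (hSA hp') (hSA hq') hp hq hpq hC'
        (Finset.disjoint_left.mpr fun γ hγ => by
          obtain ⟨a, b, _, _, _, hab, rfl, _⟩ := hC'.exists_edge hγ
          exact h3 a b hab))
  omega

/-- There is no mixed configuration. -/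
def NoMixed (c : V → V → ℕ) (t : ℕ) : Prop :=
  ∀ s C a b u v x y, C.card + 1 = t → ¬ Mixed c s C a b u v x y

namespace Config

variable [Fintype V]

theorem cover (k : Config c s C u v x y) (hC : C.card = t) (hN : Fintype.card V = 2 * t + 4)
    (z : V) : z ∈ s ∨ z = u ∨ z = v ∨ z = x ∨ z = y := by
  have h := k.ne
  have h' := k.notMem
  have h1 : (insert u (insert v (insert x (insert y s)))).card = Fintype.card V := by
    rw [Finset.card_insert_of_notMem (by simp [h, h']), Finset.card_insert_of_notMem (by simp [h, h']),
      Finset.card_insert_of_notMem (by simp [h, h']), Finset.card_insert_of_notMem (by simp [h']),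
      k.rainbow.card_eq, hN, hC]
  have h2 := Finset.mem_univ z
  rw [← Finset.card_eq_iff_eq_univ _ |>.mp h1] at h2
  simp only [Finset.mem_insert] at h2
  tauto

/-- Deleting an edge of the matching. -/
theorem exists_six (k : Config c s C u v x y) (hC : C.card = t)
    (hN : Fintype.card V = 2 * t + 4) {γ : ℕ} (hγ : γ ∈ C) :
    ∃ a b s' C', Six c s' C' a b u v x y ∧ c a b = γ ∧ γ ∉ C' ∧ s = insert a (insert b s') ∧
      C = insert γ C' ∧ C'.card + 1 = t := by
  obtain ⟨a, b, s', C', ha, hb, hab, hcol, hγ', rfl, rfl, hs'⟩ := k.rainbow.exists_eq_insert hγ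
  have h := k.ne
  have h' := k.notMem
  simp only [Finset.mem_insert, not_or] at h'
  refine ⟨a, b, s', C', ⟨hs', ⟨ha, hb, h'.1.2.2, h'.2.1.2.2, h'.2.2.1.2.2, h'.2.2.2.2.2⟩, ?_, ?_⟩,
    hcol, hγ', rfl, rfl, by rwa [Finset.card_insert_of_notMem hγ'] at hC⟩
  · simp only [List.nodup_cons, List.mem_cons, not_or, List.not_mem_nil, not_false_eq_true,
      List.nodup_nil, and_true]
    exact ⟨⟨hab, Ne.symm h'.1.1, Ne.symm h'.2.1.1, Ne.symm h'.2.2.1.1, Ne.symm h'.2.2.2.1⟩,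
      ⟨Ne.symm h'.1.2.1, Ne.symm h'.2.1.2.1, Ne.symm h'.2.2.1.2.1, Ne.symm h'.2.2.2.2.1⟩,
      ⟨h.1, h.2.1, h.2.2.1⟩, ⟨h.2.2.2.1, h.2.2.2.2.1⟩, h.2.2.2.2.2⟩
  · intro z
    have := k.cover hC hN z
    rw [Finset.mem_insert, Finset.mem_insert] at this
    rcases this with (h | h | h) | h
    · exact .inr (.inl h)
    · exact .inr (.inr (.inl h))
    · exact .inl h
    · exact .inr (.inr (.inr h))

/-- If vy had the color of a matching edge ab, then ab, uv, xy, vy and the new color of ux would be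
a mixed configuration with the names of the four vertices permuted. If vy has a new color, the edges
ux and vy extend the matching unless their colors agree. -/
theorem eq_of_noMixed (hc : ∀ a b, c a b = c b a) (hno : NoRainbow c (t + 1)) (hM : NoMixed c t)
    (k : Config c s C u v x y) (hC : C.card = t) (hN : Fintype.card V = 2 * t + 4)
    (h1 : c u x ∉ C) : c v y = c u x := by
  have h := k.ne
  have h' := k.notMem
  by_cases h2 : c v y ∈ C
  · exfalso
    obtain ⟨a, b, s', C', k', hab, hγ, rfl, rfl, hC'⟩ := k.exists_six hC hN h2
    have h3 := k.new
    rw [Finset.mem_insert, not_or] at h1 h3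
    have h4 := k'.ne
    refine hM s' C' a b v u y x hC' ⟨⟨k'.rainbow, by simp [k'.notMem], by simp [h4], ?_⟩, ?_, ?_, ?_,
      hab.symm, ?_, h1.2, ?_⟩
    · intro z
      have := k'.cover z
      grind
    · rw [hc]; exact h3.2
    · rw [hc, k.eq, hc]
    · rwa [hab]
    · rw [hc, hab]; exact h3.1
    · rw [hab]; exact h1.1
  · exact (hno.eq_of_add_two k.rainbow (by omega) ⟨h'.1, h'.2.2.1, h'.2.1, h'.2.2.2⟩
      (by simp [h, h.2.2.2.1.symm]) h1 h2).symm

end Config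

theorem two_mul_card_colors_le (hc : ∀ a b, c a b = c b a) (A : Finset V) :
    2 * (colors c A).card ≤ A.card * (A.card - 1) := by
  have h1 := card_le_adjPairs (G := ⊤) hc (A := A) (F := colors c A) (fun γ hγ => by
    obtain ⟨a, ha, b, hb, hab, he⟩ := mem_colors.mp hγ
    exact ⟨a, ha, b, hb, hab, he⟩)
  have h2 : adjPairs ⊤ A ⊆ A.offDiag := by
    intro p hp
    rw [mem_adjPairs] at hp
    exact Finset.mem_offDiag.mpr hp
  have h3 := Finset.card_le_card h2
  rw [Finset.offDiag_card] at h3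
  rw [Nat.mul_sub, mul_one]
  omega

variable [Fintype V]

/-- If there are many colors, then some edge of a rainbow matching sees many new colors. -/
theorem exists_edge_fresh (hc : ∀ a b, c a b = c b a) (h : IsRainbow ⊤ c s C) {U : Finset V}
    (hU : ∀ z, z ∈ s ∨ z ∈ U) {k m : ℕ} (hm : (colors c U \ C).card ≤ m)
    (hK : s.card * (s.card - 1) + 2 * m + 2 * k * C.card < 2 * (colors c Finset.univ).card) :
    ∃ a b s' C', a ∉ s' ∧ b ∉ s' ∧ a ≠ b ∧ c a b ∉ C' ∧ s = insert a (insert b s') ∧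
      C = insert (c a b) C' ∧ IsRainbow ⊤ c s' C' ∧
      k < (fresh c (C ∪ colors c U) a b U).card := by
  by_contra! hcon
  have h1 := two_mul_card_colors_le hc s
  -- Otherwise every matching edge contributes at most `k` colors towards `U`; the other colors lie
  -- inside `s`, on at most |s|(|s| - 1)/2 edges, or inside `U`.
  have h2 := h.card_biUnion_le (X := fun z => U.image (c z) \ (C ∪ colors c U)) (k := k)
    (fun a b s' ha hb hab hC hs h' => by
      have := hcon a b s' (C.erase (c a b)) ha hb hab (Finset.notMem_erase _ _) hs
        (Finset.insert_erase hC).symm h'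
      refine (Finset.card_le_card ?_).trans this
      intro γ hγ
      simp only [Finset.mem_union, Finset.mem_sdiff, Finset.mem_image, fresh, Finset.mem_biUnion,
        Finset.mem_insert, Finset.mem_singleton] at hγ ⊢
      rcases hγ with ⟨⟨z, hz, rfl⟩, hB⟩ | ⟨⟨z, hz, rfl⟩, hB⟩
      · exact ⟨z, hz, .inl rfl, hB⟩
      · exact ⟨z, hz, .inr rfl, hB⟩)
  have h3 : colors c Finset.univ ⊆ colors c s ∪ (colors c U \ C) ∪
      s.biUnion fun z => U.image (c z) \ (C ∪ colors c U) := by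
    intro γ hγ
    have hCs := h.subset_colors (A := s) subset_rfl
    have hst : ∀ p ∈ s, ∀ q ∈ U, c p q ∈ colors c s ∪ (colors c U \ C) ∪
        s.biUnion fun z => U.image (c z) \ (C ∪ colors c U) := by
      intro p hp q hq
      by_cases h1 : c p q ∈ C
      · exact Finset.mem_union_left _ (Finset.mem_union_left _ (hCs h1))
      by_cases h2 : c p q ∈ colors c U
      · exact Finset.mem_union_left _ (Finset.mem_union_right _ (Finset.mem_sdiff.mpr ⟨h2, h1⟩))
      · refine Finset.mem_union_right _ (Finset.mem_biUnion.mpr ⟨p, hp, Finset.mem_sdiff.mpr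
          ⟨Finset.mem_image_of_mem _ hq, ?_⟩⟩)
        rw [Finset.mem_union, not_or]
        exact ⟨h1, h2⟩
    obtain ⟨p, -, q, -, hpq, rfl⟩ := mem_colors.mp hγ
    by_cases hp : p ∈ s
    · by_cases hq : q ∈ s
      · exact Finset.mem_union_left _ (Finset.mem_union_left _
          (mem_colors.mpr ⟨p, hp, q, hq, hpq, rfl⟩))
      · exact hst p hp q ((hU q).resolve_left hq)
    · by_cases hq : q ∈ s
      · rw [hc]
        exact hst q hq p ((hU p).resolve_left hp)
      · by_cases h1 : c p q ∈ C
        · exact Finset.mem_union_left _ (Finset.mem_union_left _ (hCs h1))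
        · exact Finset.mem_union_left _ (Finset.mem_union_right _ (Finset.mem_sdiff.mpr
            ⟨mem_colors.mpr ⟨p, (hU p).resolve_left hp, q, (hU q).resolve_left hq, hpq, rfl⟩, h1⟩))
  have h4 := Finset.card_le_card h3
  have h5 := Finset.card_union_le (colors c s ∪ (colors c U \ C))
    (s.biUnion fun z => U.image (c z) \ (C ∪ colors c U))
  have h6 := Finset.card_union_le (colors c s) (colors c U \ C)
  have h7 : 2 * k * C.card = 2 * (k * C.card) := by ring
  omega

end AntiRamsey

/-! ### One new color among the uncovered vertices. -/

namespace AntiRamsey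

variable {V : Type*} [DecidableEq V] {c : V → V → ℕ} {s : Finset V} {C : Finset ℕ} {t : ℕ}
  {a b u v x y : V} [Fintype V]

theorem IsRainbow.exists_common_edge {G : SimpleGraph V} {s' : Finset V} {C' : Finset ℕ} {γ : ℕ}
    (hG : InjOnEdges G c) (h : IsRainbow G c s C) (h' : IsRainbow G c s' C') (hγ : γ ∈ C)
    (hγ' : γ ∈ C') :
    ∃ a b s₁ s₂, (a ∉ s₁ ∧ b ∉ s₁) ∧ (a ∉ s₂ ∧ b ∉ s₂) ∧ a ≠ b ∧ c a b = γ ∧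
      s = insert a (insert b s₁) ∧ s' = insert a (insert b s₂) ∧
      IsRainbow G c s₁ (C.erase γ) ∧ IsRainbow G c s₂ (C'.erase γ) := by
  obtain ⟨a, b, s₁, ha, hb, hab, hcol, hs, h1⟩ := h.exists_edge hγ
  obtain ⟨a', b', s₂, ha', hb', hab', hcol', hs', h2⟩ := h'.exists_edge hγ'
  rcases hG a b a' b' hab hab' (hcol.trans hcol'.symm) with ⟨rfl, rfl⟩ | ⟨rfl, rfl⟩
  · exact ⟨a, b, s₁, s₂, ⟨ha, hb⟩, ⟨ha', hb'⟩, hab.ne, hcol, hs, hs', h1, h2⟩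
  · exact ⟨a, b, s₁, s₂, ⟨ha, hb⟩, ⟨hb', ha'⟩, hab.ne, hcol, hs, by rw [hs', Finset.insert_comm],
      h1, h2⟩

namespace Config

/-- Besides uv also ab is soft: in the matching on u, x and `s` its color is unused, and vy repeats
it. By `hall` the uncovered vertices of either configuration contribute no colors, so at most 2(t -
1) + 2t colors are lost besides the two soft ones. -/
theorem card_colors_le_of_common_edge (hc : ∀ a b, c a b = c b a) (hno : NoRainbow c (t + 1))
    (hN : Fintype.card V = 2 * t + 4)
    (hall : ∀ s C u v x y, C.card = t → Config c s C u v x y → c u x ∈ insert (c u v) C)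
    {C' : Finset ℕ}
    (k : Config c (insert a (insert b s)) (insert (c a b) C) u v x y) (hC : C.card + 1 = t)
    (hs : IsRainbow ⊤ c s C) (ha : a ∉ s) (hb : b ∉ s) (hab : a ≠ b) (hγ : c a b ∉ C)
    (hγ' : c a b ∉ C') (hC' : C'.card = t)
    (h' : IsRainbow ⊤ c (insert u (insert x s)) C') (hvy : c v y = c a b) :
    (colors c Finset.univ).card ≤ 2 * t ^ 2 + t + 1 := by
  have h := k.ne
  have hm := k.notMem
  simp only [Finset.mem_insert, not_or] at hm
  have hCt : (insert (c a b) C).card = t := by rw [Finset.card_insert_of_notMem hγ]; omega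
  have k2 : Config c (insert u (insert x s)) C' a b v y := by
    refine ⟨h', ?_, ?_, hγ', hvy⟩
    · simp only [Finset.mem_insert, not_or]
      exact ⟨⟨Ne.symm hm.1.1, Ne.symm hm.2.2.1.1, ha⟩, ⟨Ne.symm hm.1.2.1, Ne.symm hm.2.2.1.2.1, hb⟩,
        ⟨h.1.symm, h.2.2.2.1, hm.2.1.2.2⟩, h.2.2.1.symm, h.2.2.2.2.2.symm, hm.2.2.2.2.2⟩
    · simp only [List.nodup_cons, List.mem_cons, not_or, List.not_mem_nil, not_false_eq_true,
        List.nodup_nil, and_true]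
      exact ⟨⟨hab, Ne.symm hm.2.1.1, Ne.symm hm.2.2.2.1⟩, ⟨Ne.symm hm.2.1.2.1,
        Ne.symm hm.2.2.2.2.1⟩, h.2.2.2.2.1⟩
  have f1 := k.card_fresh_pair_le hno hs hC ha hb hab rfl hγ subset_rfl
  have f2 := k2.card_fresh_self_le hno hC' subset_rfl
  have u1 := hall _ _ _ _ _ _ hCt k
  have u2 := hall _ _ _ _ _ _ hCt (k.swap_right hc)
  have u3 := hall _ _ _ _ _ _ hCt (k.swap hc)
  have u4 := hall _ _ _ _ _ _ hCt ((k.swap hc).swap_right hc)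
  have w1 := hall _ _ _ _ _ _ hC' k2
  have w2 := hall _ _ _ _ _ _ hC' (k2.swap_right hc)
  have w3 := hall _ _ _ _ _ _ hC' (k2.swap hc)
  have w4 := hall _ _ _ _ _ _ hC' ((k2.swap hc).swap_right hc)
  rw [hc v u] at u3 u4
  rw [hc b a] at w3 w4
  have hne : c u v ≠ c a b := fun e => k.new (by simp [e])
  have hcover := k.cover hCt hN
  have hS : IsRainbow ⊤ c {u, v, a, b} {c u v, c a b} :=
    (IsRainbow.pair hab).add (by simp [hm]) (by simp [hm]) h.1 (by simp [hne])
  generalize hF1 : fresh c _ u v s = F1 at f1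
  generalize hF2 : fresh c _ a b _ = F2 at f2
  have g1 := Finset.card_union_le F1 F2
  have := card_colors_le_of_two_soft hc hno hN (by omega) hS (Finset.card_pair hne) (Y := F1 ∪ F2)
    (by
      generalize hT : colors c (Finset.univ \ {u, v, a, b}) ∪ {c u v, c a b} ∪ (F1 ∪ F2) = T
      clear f1 f2 g1 hno hall
      have hsub : ∀ z ∈ s, z ∈ Finset.univ \ ({u, v, a, b} : Finset V) := fun z hz => by
        simp only [Finset.mem_sdiff, Finset.mem_univ, true_and, Finset.mem_insert,
          Finset.mem_singleton]
        rintro (rfl | rfl | rfl | rfl)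
        exacts [hm.1.2.2 hz, hm.2.1.2.2 hz, ha hz, hb hz]
      have hx : x ∈ Finset.univ \ ({u, v, a, b} : Finset V) := by
        simp [h.2.1.symm, h.2.2.2.1.symm, hm]
      have hcolT : colors c (Finset.univ \ {u, v, a, b}) ⊆ T := by
        rw [← hT]; exact Finset.subset_union_left.trans Finset.subset_union_left
      have huv : c u v ∈ T := by rw [← hT]; simp
      have habT : c a b ∈ T := by rw [← hT]; simp
      have hCT : insert (c u v) (insert (c a b) C) ⊆ T :=
        Finset.insert_subset huv (Finset.insert_subset habT
          ((hs.subset_colors hsub).trans hcolT))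
      have e1 := mem_of_fresh_subset hCT (hF1.trans_subset (by rw [← hT]; intro z hz; simp [hz]))
      have hCT' : insert (c a b) C' ⊆ T := by
        refine Finset.insert_subset habT fun δ hδ => ?_
        obtain ⟨p, hp, q, hq, hpq, rfl⟩ := mem_colors.mp (h'.subset_colors subset_rfl hδ)
        rw [Finset.mem_insert, Finset.mem_insert] at hp hq
        have hxs : ∀ z, z = x ∨ z ∈ s → c u z ∈ T ∧ z ∈ Finset.univ \ ({u, v, a, b} : Finset V) := by
          rintro z (rfl | hz)
          · exact ⟨hCT u1, hx⟩
          · exact ⟨(e1 z hz).1, hsub z hz⟩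
        rcases hp with rfl | hp
        · exact (hxs q (hq.resolve_left (Ne.symm hpq))).1
        · rcases hq with rfl | hq
          · rw [hc]; exact (hxs p hp).1
          · exact hcolT (mem_colors.mpr ⟨p, (hxs p hp).2, q, (hxs q hq).2, hpq, rfl⟩)
      have e2 := mem_of_fresh_subset hCT' (hF2.trans_subset (by rw [← hT]; intro z hz; simp [hz]))
      have m1 := e2 u (by simp)
      have m2 := e2 x (by simp)
      have m3 : ∀ z ∈ s, c a z ∈ T ∧ c b z ∈ T := fun z hz => e2 z (by simp [hz])
      replace u1 := hCT u1
      replace u2 := hCT u2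
      replace u3 := hCT u3
      replace u4 := hCT u4
      replace w1 := hCT' w1
      replace w2 := hCT' w2
      replace w3 := hCT' w3
      replace w4 := hCT' w4
      clear e2 hCT hCT' hF1 hF2 hT hsub hS k k2 hx hcolT
      intro p hp z hz
      have hz' := hcover z
      simp only [Finset.mem_insert, Finset.mem_singleton] at hp hz'
      rcases hp with rfl | rfl | rfl | rfl <;>
        rcases hz' with (rfl | rfl | hz') | rfl | rfl | rfl | rfl <;>
        first
        | exact absurd rfl hz
        | assumption
        | (rw [hc]; assumption)
        | exact (e1 _ hz').1
        | exact (e1 _ hz').2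
        | exact (m3 _ hz').1
        | exact (m3 _ hz').2
        | exact m1.1
        | exact m1.2
        | exact m2.1
        | exact m2.2
        | (rw [hc]; exact m1.1)
        | (rw [hc]; exact m1.2))
  omega

/-- Next to the augmented matching, vy is disjoint from all edges, so its color occurs in both
matchings. Both lie in one rainbow graph, hence the color belongs to the same edge ab in both, and
`card_colors_le_of_common_edge` applies after removing ab. -/
theorem card_colors_le_of_augment (hc : ∀ a b, c a b = c b a) (hno : NoRainbow c (t + 1))
    (hN : Fintype.card V = 2 * t + 4)
    (hall : ∀ s C u v x y, C.card = t → Config c s C u v x y → c u x ∈ insert (c u v) C)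
    (k : Config c s C u v x y) (hC : C.card = t) {G : SimpleGraph V} {C' : Finset ℕ}
    (hG : InjOnEdges G c) (hs : IsRainbow G c s C) (hs' : IsRainbow G c (insert u (insert x s)) C')
    (hα : c u v ∉ C') : (colors c Finset.univ).card ≤ 2 * t ^ 2 + t + 1 := by
  have h := k.ne
  have hm := k.notMem
  have hC' : C'.card = t + 1 := by
    have h1 := hs'.card_eq
    rw [Finset.card_insert_of_notMem (by simp [h, hm]), Finset.card_insert_of_notMem (by simp [hm]),
      hs.card_eq] at h1
    omega
  have hγ' : c v y ∈ C' := hno.mem_of_add_one hs'.top hC' (by simp [h.1.symm, h, hm])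
    (by simp [h.2.2.1.symm, h.2.2.2.2.2.symm, hm]) h.2.2.2.2.1
  have hγ : c v y ∈ C := by
    have := hall _ _ _ _ _ _ hC ((k.swap hc).swap_right hc)
    rw [Finset.mem_insert, hc v u] at this
    exact this.resolve_left fun e => hα (e ▸ hγ')
  obtain ⟨a, b, s₁, s₂, ⟨ha, hb⟩, ⟨ha', hb'⟩, hab, hcol, hss, hs2, h1, h2⟩ :=
    hs.exists_common_edge hG hs' hγ hγ'
  have hs₂ : s₂ = insert u (insert x s₁) := by
    ext z
    have := Finset.ext_iff.mp hs2 z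
    rw [hss] at this hm
    simp only [Finset.mem_insert, not_or] at this hm ⊢
    clear hno hc hall
    grind
  have hCe : C = insert (c a b) (C.erase (c v y)) := by rw [hcol, Finset.insert_erase hγ]
  rw [hss, hCe] at k
  rw [hs₂] at h2
  refine k.card_colors_le_of_common_edge hc hno hN hall ?_ h1.top ha hb hab (by simp [hcol])
    (C' := C'.erase (c v y)) (by simp [hcol]) ?_ h2.top hcol.symm
  · rw [Finset.card_erase_add_one hγ, hC]
  · rw [Finset.card_erase_of_mem hγ', hC']; rfl

/-- If the t edges cannot be augmented without the color of uv, Erdős–Gallai with m = t applies to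
the other colors. If they can, the two added vertices must meet both uv and xy, whose color is
missing in the augmented matching, so up to symmetry they are u and x. -/
theorem card_colors_le_of_common (hc : ∀ a b, c a b = c b a) (hno : NoRainbow c (t + 1))
    (hN : Fintype.card V = 2 * t + 4)
    (hall : ∀ s C u v x y, C.card = t → Config c s C u v x y → c u x ∈ insert (c u v) C)
    (k : Config c s C u v x y) (hC : C.card = t) :
    (colors c Finset.univ).card ≤ 2 * t ^ 2 + t + 2 ∨
      2 * (colors c Finset.univ).card ≤ 3 * t ^ 2 + 7 * t + 2 := by
  have h := k.ne
  have hm := k.notMem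
  rcases k.rainbow.exists_augment hc (A := Finset.univ) (D := {c u v}) (Finset.subset_univ _)
    (by simp [k.new]) with h1 | ⟨G, p, q, C', h1, h2, -, -, hp, hq, hpq, h3, h4⟩
  · have h2 : (colors c Finset.univ).card ≤ (colors c Finset.univ \ {c u v}).card + 1 := by
      have := Finset.le_card_sdiff {c u v} (colors c Finset.univ)
      simp only [Finset.card_singleton] at this
      omega
    rw [hC, Finset.card_univ, hN] at h1
    rcases h1 with h1 | h1
    · left; omega
    · right
      have : t * (t + 1) = t ^ 2 + t := by ring
      have : 2 * t * (2 * t + 4) = 4 * t ^ 2 + 8 * t := by ring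
      omega
  · left
    have hα : c u v ∉ C' := by simpa using h4
    have hC' : C'.card = t + 1 := by
      have h1' := h3.card_eq
      rw [Finset.card_insert_of_notMem (by simp [hp, hpq]), Finset.card_insert_of_notMem hq,
        h1.card_eq] at h1'
      omega
    have huv : ∀ i j, i ∉ s → j ∉ s → i ≠ j → c i j ∉ C' → (i ≠ p ∧ i ≠ q) → (j ≠ p ∧ j ≠ q) →
        False := fun i j hi hj hij hcij hi' hj' => hcij (hno.mem_of_add_one h3.top hC'
          (by simp [hi, hi']) (by simp [hj, hj']) hij)
    have hp' := (k.cover hC hN p).resolve_left hp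
    have hq' := (k.cover hC hN q).resolve_left hq
    have k1 := k.swap hc
    have k2 := k.swap_right hc
    have k3 := k1.swap_right hc
    have hvu : c v u ∉ C' := by rwa [hc]
    have hxy := huv x y hm.2.2.1 hm.2.2.2 h.2.2.2.2.2 (by rwa [k.eq])
    have huv' := huv u v hm.1 hm.2.1 h.1 hα
    obtain ⟨-, m1, m2, m3, m4, -⟩ := h
    have n1 := m1.symm
    have n2 := m3.symm
    have n3 := m2.symm
    have n4 := m4.symm
    have h5 : IsRainbow G c (insert q (insert p s)) C' := by rwa [Finset.insert_comm]
    rcases hp' with rfl | rfl | rfl | rfl <;> rcases hq' with rfl | rfl | rfl | rfl <;>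
      first
      | exact absurd rfl hpq
      | exact (hxy ⟨n1, n2⟩ ⟨n3, n4⟩).elim
      | exact (hxy ⟨n2, n1⟩ ⟨n4, n3⟩).elim
      | exact (huv' ⟨m1, m2⟩ ⟨m3, m4⟩).elim
      | exact (huv' ⟨m2, m1⟩ ⟨m4, m3⟩).elim
      | (first
        | exact (k.card_colors_le_of_augment hc hno hN hall hC h2 h1 h3 hα).trans (by omega)
        | exact (k1.card_colors_le_of_augment hc hno hN hall hC h2 h1 h3 hvu).trans (by omega)
        | exact (k2.card_colors_le_of_augment hc hno hN hall hC h2 h1 h3 hα).trans (by omega)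
        | exact (k3.card_colors_le_of_augment hc hno hN hall hC h2 h1 h3 hvu).trans (by omega)
        | exact (k.card_colors_le_of_augment hc hno hN hall hC h2 h1 h5 hα).trans (by omega)
        | exact (k1.card_colors_le_of_augment hc hno hN hall hC h2 h1 h5 hvu).trans (by omega)
        | exact (k2.card_colors_le_of_augment hc hno hN hall hC h2 h1 h5 hα).trans (by omega)
        | exact (k3.card_colors_le_of_augment hc hno hN hall hC h2 h1 h5 hvu).trans (by omega))

end Config

end AntiRamsey

/-! ### Three new colors among the uncovered vertices. -/

namespace AntiRamsey

variable {V : Type*} [DecidableEq V] {c : V → V → ℕ} {s : Finset V} {C : Finset ℕ} {t : ℕ}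
  {a b u v x y : V} [Fintype V] {U : Finset V}

theorem exists_pair_of_card_four (hU : U.card = 4) {p q : V} (hp : p ∈ U) (hq : q ∈ U)
    (hpq : p ≠ q) : ∃ r w, U = {p, q, r, w} ∧ [p, q, r, w].Nodup := by
  have h1 : ((U.erase p).erase q).card = 2 := by
    rw [Finset.card_erase_of_mem (Finset.mem_erase.mpr ⟨hpq.symm, hq⟩), Finset.card_erase_of_mem hp,
      hU]
  obtain ⟨r, w, hrw, h2⟩ := Finset.card_eq_two.mp h1
  have hr : r ∈ (U.erase p).erase q := by simp [h2]
  have hw : w ∈ (U.erase p).erase q := by simp [h2]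
  simp only [Finset.mem_erase] at hr hw
  refine ⟨r, w, ?_, ?_⟩
  · rw [← h2, Finset.insert_erase (Finset.mem_erase.mpr ⟨hpq.symm, hq⟩), Finset.insert_erase hp]
  · simp [hpq, hrw, Ne.symm hr.1, Ne.symm hr.2.1, Ne.symm hw.1, Ne.symm hw.2.1]

/-- Forbid the color of de and the colors inside `U`, and delete d and e. If the matching with t - 1
edges on `s'` and ab were augmented, two vertices r, w of `U` would remain, and rw and de would
extend it to t + 2 edges. So Erdős–Gallai with m = t - 1 holds on 2t + 2 vertices; the losses are at
most four forbidden colors and 2t + 2 colors at the soft edge de. -/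
theorem card_colors_le_of_replaceable_live (hc : ∀ a b, c a b = c b a)
    (hno : NoRainbow c (t + 1)) (hN : Fintype.card V = 2 * t + 4) (ht : 3 ≤ t)
    (hs : IsRainbow ⊤ c s C) (hC : C.card + 1 = t) (hab : a ∉ s ∧ b ∉ s ∧ a ≠ b)
    (hφ : c a b ∉ C) (hU : U.card = 4) (hUs : ∀ p ∈ U, p ∉ s ∧ p ≠ a ∧ p ≠ b)
    (hcov : ∀ z, z ∈ s ∨ z = a ∨ z = b ∨ z ∈ U)
    (hlive : ∀ p ∈ U, ∀ q ∈ U, p ≠ q → c p q ∉ insert (c a b) C) (hΛ : (colors c U).card ≤ 3)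
    (hr : Replaceable c s C) :
    (colors c Finset.univ).card ≤ 2 * t ^ 2 + t + 2 ∨
      2 * (colors c Finset.univ).card ≤ 3 * t ^ 2 + 7 * t + 2 := by
  obtain ⟨i, j, k, l, p, q, hsix, hnd, hij, hkl, hne, hpq⟩ := hr
  obtain ⟨d, e, s', C', F, hd, he, hde, hcol, hγ, rfl, rfl, hs', -, hF, hsoft⟩ :=
    exists_soft_edge hno hs hC hsix hnd hij hkl hne hpq
  rw [← hcol] at hγ hsoft hlive hφ hC
  rw [Finset.card_insert_of_notMem hγ] at hC
  simp only [Finset.mem_insert, not_or] at hab hφ hUs hsix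
  simp only [List.nodup_cons, List.mem_cons, not_or, List.not_mem_nil, not_false_eq_true,
    List.nodup_nil, and_true] at hnd
  have hA : (Finset.univ \ {d, e} : Finset V).card = 2 * t + 2 := by
    rw [Finset.card_sdiff_of_subset (Finset.subset_univ _), Finset.card_univ, hN,
      Finset.card_pair hde]
    omega
  have hmem : ∀ z, z ≠ d → z ≠ e → z ∈ (Finset.univ \ {d, e} : Finset V) := by
    intro z h1 h2; simp [h1, h2]
  have hs'A : insert a (insert b s') ⊆ (Finset.univ \ {d, e} : Finset V) := by
    intro z hz
    simp only [Finset.mem_insert] at hz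
    rcases hz with rfl | rfl | hz
    · exact hmem _ hab.1.1 hab.1.2.1
    · exact hmem _ hab.2.1.1 hab.2.1.2.1
    · exact hmem _ (fun e => hd (e ▸ hz)) (fun e => he (e ▸ hz))
  have hγU : ∀ r ∈ U, ∀ w ∈ U, r ≠ w → c r w ≠ c d e ∧ c r w ≠ c a b ∧ c r w ∉ C' := by
    intro r hr w hw hrw
    have := hlive r hr w hw hrw
    simp only [Finset.mem_insert, not_or] at this
    exact ⟨this.2.1, this.1, this.2.2⟩
  have hdisj : Disjoint (insert (c a b) C') (insert (c d e) (colors c U)) := by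
    rw [Finset.disjoint_left]
    intro δ h1 h2
    rw [Finset.mem_insert] at h1 h2
    rcases h2 with rfl | h2
    · exact h1.elim (fun h => hφ.1 h.symm) hγ
    · obtain ⟨r, hr, w, hw, hrw, rfl⟩ := mem_colors.mp h2
      have := hγU r hr w hw hrw
      exact h1.elim this.2.1 this.2.2
  rcases (hs'.add hab.1.2.2 hab.2.1.2.2 hab.2.2 hφ.2).exists_augment hc hs'A hdisj with
    h1 | ⟨G, p', q', C2, -, -, hp, hq, hp', hq', hpq', h3, h4⟩
  · have hsub : colors c Finset.univ ⊆
        (colors c (Finset.univ \ {d, e}) \ insert (c d e) (colors c U)) ∪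
          insert (c d e) (colors c U) ∪ F := by
      rw [Finset.sdiff_union_self_eq_union]
      generalize hT : colors c (Finset.univ \ {d, e}) ∪ insert (c d e) (colors c U) ∪ F = T
      have hAT : colors c (Finset.univ \ {d, e}) ⊆ T := by
        rw [← hT]; exact Finset.subset_union_left.trans Finset.subset_union_left
      have hde' : c d e ∈ T := by rw [← hT]; simp
      have hX : insert (c i j) (insert (c k l) (insert (c d e) C')) ∪ F ⊆ T := by
        refine Finset.union_subset (Finset.insert_subset ?_ (Finset.insert_subset ?_
          (Finset.insert_subset hde' ?_))) (by rw [← hT]; exact Finset.subset_union_right)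
        · exact hAT (mem_colors.mpr ⟨i, hmem _ hsix.1.1 hsix.1.2.1, j, hmem _ hsix.2.1.1 hsix.2.1.2.1,
            hnd.1.1, rfl⟩)
        · exact hAT (mem_colors.mpr ⟨k, hmem _ hsix.2.2.1.1 hsix.2.2.1.2.1, l,
            hmem _ hsix.2.2.2.1.1 hsix.2.2.2.1.2.1, hnd.2.2.1.1, rfl⟩)
        · exact (hs'.subset_colors fun z hz => hs'A (by simp [hz])).trans hAT
      intro δ hδ
      obtain ⟨z, -, w, -, hzw, rfl⟩ := mem_colors.mp hδ
      have key : ∀ z w, z ≠ w → z = d ∨ z = e → c z w ∈ T := by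
        rintro z w hzw (rfl | rfl)
        · by_cases hw : w = e
          · rwa [hw]
          · exact hX (hsoft w hzw.symm hw).1
        · by_cases hw : w = d
          · rwa [hw, hc]
          · exact hX (hsoft w hw hzw.symm).2
      by_cases h1 : z = d ∨ z = e
      · exact key z w hzw h1
      by_cases h2 : w = d ∨ w = e
      · rw [hc]; exact key w z hzw.symm h2
      rw [not_or] at h1 h2
      exact hAT (mem_colors.mpr ⟨z, hmem _ h1.1 h1.2, w, hmem _ h2.1 h2.2, hzw, rfl⟩)
    have g1 := Finset.card_le_card hsub
    have g2 := Finset.card_union_le ((colors c (Finset.univ \ {d, e}) \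
      insert (c d e) (colors c U)) ∪ insert (c d e) (colors c U)) F
    have g3 := Finset.card_union_le (colors c (Finset.univ \ {d, e}) \
      insert (c d e) (colors c U)) (insert (c d e) (colors c U))
    have g4 := Finset.card_insert_le (c d e) (colors c U)
    have g5 : (insert (c a b) C').card = t - 1 := by
      rw [Finset.card_insert_of_notMem hφ.2]; omega
    rw [hA, g5] at h1
    obtain ⟨m, rfl⟩ : ∃ m, t = m + 1 := ⟨t - 1, by omega⟩
    rw [Nat.add_sub_cancel] at h1
    rcases h1 with h1 | h1
    · left; nlinarith
    · right; nlinarith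
  · exfalso
    have hin : ∀ z, z ∈ (Finset.univ \ {d, e} : Finset V) → z ∉ insert a (insert b s') → z ∈ U := by
      intro z h1 h2
      have := hcov z
      simp only [Finset.mem_insert, Finset.mem_sdiff, Finset.mem_univ, true_and,
        Finset.mem_singleton, not_or] at h1 h2 this
      rcases this with (h | h | h) | h | h | h
      exacts [absurd h h1.1, absurd h h1.2, absurd h h2.2.2, absurd h h2.1, absurd h h2.2.1, h]
    have hpU := hin p' hp hp'
    have hqU := hin q' hq hq'
    obtain ⟨r, w, rfl, hnd4⟩ := exists_pair_of_card_four hU hpU hqU hpq'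
    have hC2 : C2.card = t := by
      have h5 := h3.card_eq
      rw [Finset.card_insert_of_notMem (by simp [hp', hpq']), Finset.card_insert_of_notMem hq',
        Finset.card_insert_of_notMem (by simp [hab]), Finset.card_insert_of_notMem (by simp [hab]),
        hs'.card_eq] at h5
      omega
    simp only [List.nodup_cons, List.mem_cons, not_or, List.not_mem_nil, not_false_eq_true,
      List.nodup_nil, and_true] at hnd4
    have hrU := hUs r (by simp)
    have hwU := hUs w (by simp)
    have hpU' := hUs p' (by simp)
    have hqU' := hUs q' (by simp)
    refine (hγU r (by simp) w (by simp) hnd4.2.2).1 (hno.eq_of_add_two h3.top (by omega)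
      (a := r) (b := w) (d := d) (e := e) ⟨?_, ?_, ?_, ?_⟩ ?_ ?_ ?_)
    · simp [Ne.symm hnd4.1.2.1, Ne.symm hnd4.2.1.1, hrU]
    · simp [Ne.symm hnd4.1.2.2, Ne.symm hnd4.2.1.2, hwU]
    · simp [Ne.symm hpU'.1.1, Ne.symm hqU'.1.1, Ne.symm hab.1.1, Ne.symm hab.2.1.1, hd]
    · simp [Ne.symm hpU'.1.2.1, Ne.symm hqU'.1.2.1, Ne.symm hab.1.2.1, Ne.symm hab.2.1.2.1, he]
    · simp [hnd4, hrU, hwU, hde]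
    · exact fun hm => Finset.disjoint_left.mp h4 hm (Finset.mem_insert_of_mem
        (mem_colors.mpr ⟨r, by simp, w, by simp, hnd4.2.2, rfl⟩))
    · exact fun hm => Finset.disjoint_left.mp h4 hm (Finset.mem_insert_self _ _)

/-- Any two of the three new colors at a put edges at b into the one matching color, by
`mem_of_same_end` and the proper coloring. So b sees no new colors and the hub bound applies, with
at most 2 + 3 + 4 colors in `B`. -/
theorem Six.card_colors_le_of_proper_hub (hc : ∀ a b, c a b = c b a) (hno : NoRainbow c 3)
    (k : Six c s C a b u v x y) (hC : C.card = 1) (hab : c a b ∉ C)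
    (hlive : ∀ p ∈ ({u, v, x, y} : Finset V), ∀ q ∈ ({u, v, x, y} : Finset V), p ≠ q →
      c p q ∉ insert (c a b) C)
    (hprop : ∀ p ∈ ({u, v, x, y} : Finset V), ∀ q ∈ ({u, v, x, y} : Finset V),
      ∀ r ∈ ({u, v, x, y} : Finset V), p ≠ q → p ≠ r → q ≠ r → c p q ≠ c p r)
    (hΛ : (colors c {u, v, x, y}).card ≤ 3)
    (hu : c a u ∉ C ∪ colors c {u, v, x, y}) (hv : c a v ∉ C ∪ colors c {u, v, x, y})
    (hx : c a x ∉ C ∪ colors c {u, v, x, y}) (huv : c a u ≠ c a v) (hux : c a u ≠ c a x)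
    (hvx : c a v ≠ c a x) : (colors c Finset.univ).card ≤ 14 := by
  have h := k.ne
  have hm := k.notMem
  have hl : ∀ p ∈ ({u, v, x, y} : Finset V), ∀ q ∈ ({u, v, x, y} : Finset V), p ≠ q →
      c p q ∉ C := fun p hp q hq hpq hmem => hlive p hp q hq hpq (Finset.mem_insert_of_mem hmem)
  have hfr : ∀ γ, γ ∉ C ∪ colors c {u, v, x, y} → γ ∉ C ∧ ∀ p ∈ ({u, v, x, y} : Finset V),
      ∀ q ∈ ({u, v, x, y} : Finset V), p ≠ q → γ ≠ c p q := fun γ hγ =>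
    ⟨fun h1 => hγ (Finset.mem_union_left _ h1), fun p hp q hq hpq e =>
      hγ (Finset.mem_union_right _ (mem_colors.mpr ⟨p, hp, q, hq, hpq, e.symm⟩))⟩
  have key : ∀ p q r w, [a, b, p, q, r, w].Nodup → p ∈ ({u, v, x, y} : Finset V) →
      q ∈ ({u, v, x, y} : Finset V) → r ∈ ({u, v, x, y} : Finset V) →
      w ∈ ({u, v, x, y} : Finset V) → c a p ∉ C ∪ colors c {u, v, x, y} →
      c a q ∉ C ∪ colors c {u, v, x, y} → c a p ≠ c a q → c b r ∈ C := by
    intro p q r w hnd hp hq hr hw h1 h2 h3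
    obtain ⟨i1, i2⟩ := hfr _ h1
    obtain ⟨j1, j2⟩ := hfr _ h2
    have hs : ∀ z ∈ ({u, v, x, y} : Finset V), z ∉ s := by
      intro z hz
      simp only [Finset.mem_insert, Finset.mem_singleton] at hz
      rcases hz with rfl | rfl | rfl | rfl <;> simp [hm]
    have hnd' := hnd
    simp only [List.nodup_cons, List.mem_cons, not_or, List.not_mem_nil, not_false_eq_true,
      List.nodup_nil, and_true] at hnd'
    obtain ⟨-, -, ⟨n1, -, n2⟩, ⟨-, n3⟩, -⟩ := hnd'
    refine (hno.mem_of_same_end k.rainbow (by omega)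
      ⟨hm.1, hm.2.1, hs p hp, hs q hq, hs r hr, hs w hw⟩ hnd i1 j1 h3 (hl p hp w hw n2)
      (hl q hq w hw n3) ?_ (i2 p hp w hw n2) (i2 q hq w hw n3) (j2 p hp w hw n2)
      (j2 q hq w hw n3)).1
    rw [hc p w, hc q w]
    exact hprop w hw p hp q hq (Ne.symm n2) (Ne.symm n3) n1
  have bx := key u v x y (by simp [h]) (by simp) (by simp) (by simp) (by simp) hu hv huv
  have by' := key u v y x (by simp [h]) (by simp) (by simp) (by simp) (by simp) hu hv huv
  have bv := key u x v y (by simp [h]) (by simp) (by simp) (by simp) (by simp) hu hx hux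
  have bu := key v x u y (by simp [h]) (by simp) (by simp) (by simp) (by simp) hv hx hvx
  have huv' := hlive u (by simp) v (by simp) (by simp [h])
  rw [Finset.mem_insert, not_or] at huv'
  obtain ⟨B, hB⟩ : ∃ B, B = insert (c a b) C ∪ colors c {u, v, x, y} ∪ {c a u, c a v, c a x, c a y} :=
    ⟨_, rfl⟩
  have hCB : insert (c a b) C ⊆ B := by
    rw [hB]; exact Finset.subset_union_left.trans Finset.subset_union_left
  have := k.card_colors_le_of_hub hc hno hC (B := B) ((Finset.subset_insert _ _).trans hCB) (by
      have hUB : colors c {u, v, x, y} ⊆ B := by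
        rw [hB]; exact Finset.subset_union_right.trans Finset.subset_union_left
      have haB : ∀ z ∈ ({u, v, x, y} : Finset V), c a z ∈ B ∧ c b z ∈ B := by
        have hCB' : C ⊆ B := (Finset.subset_insert _ _).trans hCB
        intro z hz
        simp only [Finset.mem_insert, Finset.mem_singleton] at hz
        rcases hz with rfl | rfl | rfl | rfl
        exacts [⟨by simp [hB], hCB' bu⟩, ⟨by simp [hB], hCB' bv⟩, ⟨by simp [hB], hCB' bx⟩,
          ⟨by simp [hB], hCB' by'⟩]
      have habB : c a b ∈ B := hCB (Finset.mem_insert_self _ _)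
      intro γ hγ
      obtain ⟨p, hp, q, hq, hpq, rfl⟩ := mem_colors.mp hγ
      rw [Finset.mem_insert, Finset.mem_insert] at hp hq
      rcases hp with rfl | rfl | hp <;> rcases hq with rfl | rfl | hq
      · exact absurd rfl hpq
      · exact habB
      · exact (haB q hq).1
      · rwa [hc]
      · exact absurd rfl hpq
      · exact (haB q hq).2
      · rw [hc]; exact (haB p hp).1
      · rw [hc]; exact (haB p hp).2
      · exact hUB (mem_colors.mpr ⟨p, hp, q, hq, hpq, rfl⟩))
    ⟨bu, bv, bx, by'⟩ hu (hfr _ hv).1 (hfr _ hx).1 huv huv'.2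
    (hl x (by simp) y (by simp) (by simp [h])) hab (Ne.symm huv'.1)
    ((hfr _ hv).2 x (by simp) y (by simp) (by simp [h]))
  have g1 := Finset.card_union_le (insert (c a b) C ∪ colors c {u, v, x, y})
    {c a u, c a v, c a x, c a y}
  have g2 := Finset.card_union_le (insert (c a b) C) (colors c {u, v, x, y})
  have g3 := Finset.card_insert_le (c a b) C
  have g4 := Finset.card_le_four (a := c a u) (b := c a v) (c := c a x) (d := c a y)
  rw [← hB] at g1
  omega

end AntiRamsey

namespace AntiRamsey

variable {V : Type*} [DecidableEq V] {c : V → V → ℕ} {s : Finset V} {C : Finset ℕ} {t : ℕ}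
  {a b u v x y : V} {U : Finset V}

/-- Three new colors at a pair of vertices are new at one end of this pair. -/
theorem three_le_image {α : Type*} [DecidableEq α] {f g : V → α} {U : Finset V} {B : Finset α}
    (h : ∀ p ∈ U, ∀ q ∈ U, p ≠ q → f p ∉ B → g q ∉ B → f p = g q)
    (h3 : 3 ≤ (U.image f \ B ∪ U.image g \ B).card) :
    3 ≤ (U.image f \ B).card ∨ 3 ≤ (U.image g \ B).card := by
  by_contra! hcon
  -- If f takes two new values, one of them is taken at a vertex other than z, so a new value of g
  -- at z agrees with it.
  have key : ∀ (f g : V → α), (∀ p ∈ U, ∀ q ∈ U, p ≠ q → f p ∉ B → g q ∉ B → f p = g q) →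
      2 ≤ (U.image f \ B).card → U.image g \ B ⊆ U.image f \ B := by
    intro f g h h2 γ hγ
    obtain ⟨γ₁, h1, γ₂, h2, hne⟩ := Finset.one_lt_card.mp (show 1 < _ from h2)
    rw [Finset.mem_sdiff, Finset.mem_image] at h1 h2 hγ
    obtain ⟨⟨z, hz, rfl⟩, hzB⟩ := hγ
    obtain ⟨⟨p, hp, rfl⟩, hpB⟩ := h1
    obtain ⟨⟨q, hq, rfl⟩, hqB⟩ := h2
    rw [Finset.mem_sdiff, Finset.mem_image]
    refine ⟨?_, hzB⟩
    by_cases hpz : p = z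
    · by_cases hqz : q = z
      · exact absurd (by rw [hpz, hqz]) hne
      · exact ⟨q, hq, h q hq z hz hqz hqB hzB⟩
    · exact ⟨p, hp, h p hp z hz hpz hpB hzB⟩
  have h4 := Finset.card_union_le (U.image f \ B) (U.image g \ B)
  by_cases h5 : 2 ≤ (U.image f \ B).card
  · rw [Finset.union_eq_left.mpr (key f g h h5)] at h3
    omega
  · rw [Finset.union_eq_right.mpr (key g f (fun p hp q hq hpq h6 h7 =>
      (h q hq p hp hpq.symm h7 h6).symm) (by omega))] at h3
    omega

theorem fresh_eq_image_union (B : Finset ℕ) :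
    fresh c B a b U = U.image (c a) \ B ∪ U.image (c b) \ B := by
  ext γ
  simp only [fresh, Finset.mem_biUnion, Finset.mem_sdiff, Finset.mem_insert, Finset.mem_singleton,
    Finset.mem_union, Finset.mem_image]
  constructor
  · rintro ⟨z, hz, rfl | rfl, h⟩
    · exact .inl ⟨⟨z, hz, rfl⟩, h⟩
    · exact .inr ⟨⟨z, hz, rfl⟩, h⟩
  · rintro (⟨⟨z, hz, rfl⟩, h⟩ | ⟨⟨z, hz, rfl⟩, h⟩)
    · exact ⟨z, hz, .inl rfl, h⟩
    · exact ⟨z, hz, .inr rfl, h⟩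

variable [Fintype V]

/-- New colors at a and b towards different vertices agree, because the remaining two vertices of
`U` have a new color as well. Hence three new colors already occur at one end, which is a hub. -/
theorem card_colors_le_of_proper (hc : ∀ a b, c a b = c b a) (hno : NoRainbow c 3)
    (hs : IsRainbow ⊤ c s C) (hC : C.card = 1) (hab : a ∉ s ∧ b ∉ s ∧ a ≠ b)
    (hφ : c a b ∉ C) (hU : U.card = 4) (hUs : ∀ p ∈ U, p ∉ s ∧ p ≠ a ∧ p ≠ b)
    (hcov : ∀ z, z ∈ s ∨ z = a ∨ z = b ∨ z ∈ U)
    (hlive : ∀ p ∈ U, ∀ q ∈ U, p ≠ q → c p q ∉ insert (c a b) C)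
    (hprop : ∀ p ∈ U, ∀ q ∈ U, ∀ r ∈ U, p ≠ q → p ≠ r → q ≠ r → c p q ≠ c p r)
    (hΛ : (colors c U).card ≤ 3)
    (hw : 3 ≤ (fresh c (insert (c a b) C ∪ colors c U) a b U).card) :
    (colors c Finset.univ).card ≤ 14 := by
  rw [fresh_eq_image_union] at hw
  have key : ∀ a b, (a ∉ s ∧ b ∉ s ∧ a ≠ b) → c a b ∉ C → (∀ p ∈ U, p ∉ s ∧ p ≠ a ∧ p ≠ b) →
      (∀ z, z ∈ s ∨ z = a ∨ z = b ∨ z ∈ U) →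
      (∀ p ∈ U, ∀ q ∈ U, p ≠ q → c p q ∉ insert (c a b) C) →
      3 ≤ (U.image (c a) \ (insert (c a b) C ∪ colors c U)).card →
      (colors c Finset.univ).card ≤ 14 := by
    intro a b hab hφ hUs hcov hlive h3
    obtain ⟨γ₁, h1, γ₂, h2, γ₃, h3, h12, h13, h23⟩ := Finset.two_lt_card.mp (show 2 < _ from h3)
    simp only [Finset.mem_sdiff, Finset.mem_image] at h1 h2 h3
    obtain ⟨⟨p, hp, rfl⟩, hpB⟩ := h1
    obtain ⟨⟨q, hq, rfl⟩, hqB⟩ := h2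
    obtain ⟨⟨r, hr, rfl⟩, hrB⟩ := h3
    obtain ⟨r', w, rfl, hnd⟩ := exists_pair_of_card_four hU hp hq (fun e => h12 (by rw [e]))
    have hsub : C ∪ colors c {p, q, r', w} ⊆ insert (c a b) C ∪ colors c {p, q, r', w} :=
      Finset.union_subset_union (Finset.subset_insert _ _) subset_rfl
    have hsix : Six c s C a b p q r' w := by
      refine ⟨hs, ⟨hab.1, hab.2.1, (hUs p (by simp)).1, (hUs q (by simp)).1, (hUs r' (by simp)).1,
        (hUs w (by simp)).1⟩, ?_, ?_⟩
      · have h1 := hUs p (by simp)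
        have h2 := hUs q (by simp)
        have h3 := hUs r' (by simp)
        have h4 := hUs w (by simp)
        simp only [List.nodup_cons, List.mem_cons, not_or, List.not_mem_nil, not_false_eq_true,
          List.nodup_nil, and_true] at hnd ⊢
        exact ⟨⟨hab.2.2, h1.2.1.symm, h2.2.1.symm, h3.2.1.symm, h4.2.1.symm⟩,
          ⟨h1.2.2.symm, h2.2.2.symm, h3.2.2.symm, h4.2.2.symm⟩, hnd⟩
      · intro z
        simpa only [Finset.mem_insert, Finset.mem_singleton] using hcov z
    simp only [Finset.mem_insert, Finset.mem_singleton] at hr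
    rcases hr with rfl | rfl | rfl | rfl
    · exact absurd rfl h13
    · exact absurd rfl h23
    · exact hsix.card_colors_le_of_proper_hub hc hno hC hφ hlive hprop hΛ (fun h => hpB (hsub h))
        (fun h => hqB (hsub h)) (fun h => hrB (hsub h)) h12 h13 h23
    · have e : ({p, q, r', r} : Finset V) = {p, q, r, r'} := by
        rw [Finset.pair_comm]
      simp only [e] at hlive hprop hΛ hpB hqB hrB hsub
      have hsix' : Six c s C a b p q r r' := by
        refine ⟨hs, ?_, ?_, ?_⟩
        · have := hsix.notMem; simp [this]
        · have := hsix.ne; simp [this]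
        · intro z; have := hsix.cover z; grind
      exact hsix'.card_colors_le_of_proper_hub hc hno hC hφ hlive hprop hΛ (fun h => hpB (hsub h))
        (fun h => hqB (hsub h)) (fun h => hrB (hsub h)) h12 h13 h23
  rcases three_le_image (f := c a) (g := c b) (fun p hp q hq hpq h1 h2 => by
      rw [Finset.mem_union, not_or, Finset.mem_insert, not_or] at h1 h2
      obtain ⟨r, w, rfl, hnd⟩ := exists_pair_of_card_four hU hp hq hpq
      have hnd' := hnd
      simp only [List.nodup_cons, List.mem_cons, not_or, List.not_mem_nil, not_false_eq_true,
        List.nodup_nil, and_true] at hnd'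
      have hrw : r ≠ w := hnd'.2.2
      have m1 := hUs p hp
      have m2 := hUs q hq
      have m3 := hUs r (by simp)
      have m4 := hUs w (by simp)
      have hl := hlive r (by simp) w (by simp) hrw
      rw [Finset.mem_insert, not_or] at hl
      have hrwU : c r w ∈ colors c {p, q, r, w} :=
        mem_colors.mpr ⟨r, by simp, w, by simp, hrw, rfl⟩
      refine ((hno.eq_or_eq_of_add_three (t := 2) hs (by omega) (a := r) (b := w) (d := a) (e := p)
        (f := b) (g := q) ⟨m3.1, m4.1, hab.1, m1.1, hab.2.1, m2.1⟩ ?_ hl.2 h1.1.2 h2.1.2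
        (fun e => h1.2 (e ▸ hrwU))).resolve_left (fun e => h2.2 (e ▸ hrwU))).symm
      simp only [List.nodup_cons, List.mem_cons, not_or, List.not_mem_nil, not_false_eq_true,
        List.nodup_nil, and_true]
      exact ⟨⟨hrw, m3.2.1, Ne.symm hnd'.1.2.1, m3.2.2, Ne.symm hnd'.2.1.1⟩,
        ⟨m4.2.1, Ne.symm hnd'.1.2.2, m4.2.2, Ne.symm hnd'.2.1.2⟩,
        ⟨m1.2.1.symm, hab.2.2, m2.2.1.symm⟩, ⟨m1.2.2, hpq⟩, m2.2.2.symm⟩) hw with h | h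
  · exact key a b hab hφ hUs hcov hlive h
  · have e : c b a = c a b := hc _ _
    exact key b a ⟨hab.2.1, hab.1, hab.2.2.symm⟩ (by rwa [e])
      (fun p hp => ⟨(hUs p hp).1, (hUs p hp).2.2, (hUs p hp).2.1⟩)
      (fun z => by have := hcov z; grind) (by rwa [e]) (by rwa [e])

/-- The case of three new colors outside of a rainbow matching. -/
theorem Config.card_colors_le_of_three (hc : ∀ a b, c a b = c b a) (hno : NoRainbow c (t + 1))
    (hN : Fintype.card V = 2 * t + 4) (ht : 1 ≤ t) (hM : NoMixed c t) (k : Config c s C u v x y)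
    (hC : C.card = t) (h1 : c u x ∉ C) (h2 : c u y ∉ C) (h12 : c u x ≠ c u v) (h13 : c u y ≠ c u v)
    (h23 : c u x ≠ c u y) : (colors c Finset.univ).card ≤ 2 * t ^ 2 + t + 2 ∨
      2 * (colors c Finset.univ).card ≤ 3 * t ^ 2 + 7 * t + 2 := by
  by_contra hcon
  rw [not_or, not_le, not_le] at hcon
  have h := k.ne
  have hm := k.notMem
  -- Opposite pairs among the four vertices agree, so these vertices are properly colored with three
  -- new colors.
  have e1 := k.eq_of_noMixed hc hno hM hC hN h1
  have e2 := (k.swap_right hc).eq_of_noMixed hc hno hM hC hN h2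
  have e0 := k.eq
  have hnew := k.new
  have hU : ({u, v, x, y} : Finset V).card = 4 := by
    rw [Finset.card_insert_of_notMem (by simp [h]), Finset.card_insert_of_notMem (by simp [h]),
      Finset.card_pair (by simp [h])]
  have hcol : colors c {u, v, x, y} ⊆ {c u v, c u x, c u y} := by
    intro γ hγ
    rw [Mixed.mem_colors_four hc k.nodup] at hγ
    simp only [Finset.mem_insert, Finset.mem_singleton]
    rcases hγ with rfl | rfl | rfl | rfl | rfl | rfl
    exacts [.inl rfl, .inr (.inl rfl), .inr (.inr rfl), .inr (.inr e2), .inr (.inl e1), .inl e0]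
  have hΛ : (colors c {u, v, x, y}).card ≤ 3 := (Finset.card_le_card hcol).trans Finset.card_le_three
  have hlive : ∀ p ∈ ({u, v, x, y} : Finset V), ∀ q ∈ ({u, v, x, y} : Finset V), p ≠ q →
      c p q ∉ C := by
    intro p hp q hq hpq
    have := hcol (mem_colors.mpr ⟨p, hp, q, hq, hpq, rfl⟩)
    simp only [Finset.mem_insert, Finset.mem_singleton] at this
    rcases this with e | e | e <;> rw [e] <;> assumption
  have hprop : ∀ p ∈ ({u, v, x, y} : Finset V), ∀ q ∈ ({u, v, x, y} : Finset V),
      ∀ r ∈ ({u, v, x, y} : Finset V), p ≠ q → p ≠ r → q ≠ r → c p q ≠ c p r := by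
    have j1 := hc v u
    have j2 := hc x u
    have j3 := hc y u
    have j4 := hc x v
    have j5 := hc y v
    have j6 := hc y x
    clear hno k hc hcon hM hcol hlive
    simp only [Finset.mem_insert, Finset.mem_singleton]
    rintro r (rfl | rfl | rfl | rfl) p (rfl | rfl | rfl | rfl) q (rfl | rfl | rfl | rfl)
      n1 n2 n3 <;> first
      | exact absurd rfl n1
      | exact absurd rfl n2
      | exact absurd rfl n3
      | (clear h hm; grind)
  have hcov : ∀ z, z ∈ s ∨ z ∈ ({u, v, x, y} : Finset V) := fun z => by
    simpa only [Finset.mem_insert, Finset.mem_singleton] using k.cover hC hN z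
  have hUs : ∀ p ∈ ({u, v, x, y} : Finset V), p ∉ s := by
    intro z hz
    simp only [Finset.mem_insert, Finset.mem_singleton] at hz
    rcases hz with rfl | rfl | rfl | rfl <;> simp [hm]
  generalize ({u, v, x, y} : Finset V) = U at *
  have hm3 : (colors c U \ C).card ≤ 3 := (Finset.card_le_card Finset.sdiff_subset).trans hΛ
  have hs2 : s.card * (s.card - 1) + 2 * t = 4 * t ^ 2 := by
    rw [k.rainbow.card_eq, hC]
    obtain ⟨m, rfl⟩ : ∃ m, t = m + 1 := ⟨t - 1, by omega⟩
    rw [show 2 * (m + 1) - 1 = 2 * m + 1 by omega]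
    ring
  -- Two new colors at one matching edge suffice for a replaceable edge, but t = 2 needs three of
  -- them, and the assumed number of colors is large enough for this.
  have hK : s.card * (s.card - 1) + 2 * 3 + 2 * (if t = 2 then 2 else 1) * C.card <
      2 * (colors c Finset.univ).card := by
    rw [hC]
    split_ifs with h2
    · subst h2; omega
    · omega
  obtain ⟨a, b, s', C', ha, hb, hab, hφ, rfl, rfl, hs', hw⟩ :=
    exists_edge_fresh hc k.rainbow hcov hm3 hK
  rw [Finset.card_insert_of_notMem hφ] at hC
  have hUs' : ∀ p ∈ U, p ∉ s' ∧ p ≠ a ∧ p ≠ b := by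
    intro p hp
    have := hUs p hp
    simp only [Finset.mem_insert, not_or] at this
    exact ⟨this.2.2, this.1, this.2.1⟩
  have hcov' : ∀ z, z ∈ s' ∨ z = a ∨ z = b ∨ z ∈ U := by
    intro z
    have := hcov z
    simp only [Finset.mem_insert] at this
    rcases this with (h | h | h) | h
    exacts [.inr (.inl h), .inr (.inr (.inl h)), .inl h, .inr (.inr (.inr h))]
  have hw1 : 1 < (fresh c (insert (c a b) C' ∪ colors c U) a b U).card := by
    split_ifs at hw <;> omega
  have hr : Replaceable c s' C' := by
    obtain ⟨p, hp, q, hq, hpq⟩ := Finset.one_lt_card.mp hw1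
    simp only [fresh, Finset.mem_biUnion, Finset.mem_sdiff, Finset.mem_insert,
      Finset.mem_singleton] at hp hq
    obtain ⟨p', hp', hp, hpB⟩ := hp
    obtain ⟨q', hq', hq, hqB⟩ := hq
    have hBsub : C' ∪ colors c U ⊆ insert (c a b) C' ∪ colors c U :=
      Finset.union_subset_union (Finset.subset_insert _ _) subset_rfl
    obtain ⟨p₁, hp₁, rfl⟩ : ∃ p₁, (p₁ = a ∨ p₁ = b) ∧ p = c p₁ p' := by
      rcases hp with rfl | rfl
      exacts [⟨a, .inl rfl, rfl⟩, ⟨b, .inr rfl, rfl⟩]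
    obtain ⟨q₁, hq₁, rfl⟩ : ∃ q₁, (q₁ = a ∨ q₁ = b) ∧ q = c q₁ q' := by
      rcases hq with rfl | rfl
      exacts [⟨a, .inl rfl, rfl⟩, ⟨b, .inr rfl, rfl⟩]
    exact hno.replaceable_of_live hc hs' hC hU hUs' ⟨ha, hb, hab⟩
      (fun p hp q hq hpq hmem => hlive p hp q hq hpq (Finset.mem_insert_of_mem hmem)) (z := a)
      (fun r hr _ p hp q hq h1 h2 h3 => hprop r hr p hp q hq h1.symm h2.symm h3) hp₁ hq₁ hp' hq'
      (fun h => hpB (hBsub h)) (fun h => hqB (hBsub h)) hpq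
  -- For t = 1 the matching without ab is empty, so nothing can be replaced.
  obtain rfl | rfl | ht' : t = 1 ∨ t = 2 ∨ 3 ≤ t := by omega
  · obtain ⟨i, j, k, l, p, q, -, -, -, -, -, hpq⟩ := hr
    have := Finset.card_pos.mpr ⟨_, hpq⟩
    omega
  · rw [if_pos rfl] at hw
    have := card_colors_le_of_proper hc hno hs' (by omega) ⟨ha, hb, hab⟩ hφ hU hUs' hcov' hlive hprop
      hΛ hw
    omega
  · rcases card_colors_le_of_replaceable_live hc hno hN ht' hs' hC ⟨ha, hb, hab⟩ hφ hU hUs' hcov'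
      hlive hΛ hr with h | h <;> omega

end AntiRamsey

/-! ### Two new colors: alternating four-cycles. -/

namespace AntiRamsey

variable {V : Type*} [DecidableEq V] {c : V → V → ℕ} {s : Finset V} {C : Finset ℕ} {t : ℕ}
  {a b u v x y d e : V}

/-- The edges of the cycle `uvxy` have alternately two new colors, and there are no further new
colors inside of `{u, v, x, y}`. -/
structure Cycle (c : V → V → ℕ) (s : Finset V) (C : Finset ℕ) (a b u v x y : V) : Prop where
  six : Six c s C a b u v x y
  ab : c a b ∉ C
  uv : c u v ∉ insert (c a b) C
  vx : c v x ∉ insert (c a b) C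
  xy : c x y = c u v
  uy : c u y = c v x
  ne : c u v ≠ c v x
  colors_subset : colors c {u, v, x, y} ⊆ insert (c u v) (insert (c v x) (insert (c a b) C))

namespace Cycle

/-- The colors inside of `{u, v, x, y}` and those of the matching with the edge `ab`. -/
def base (c : V → V → ℕ) (C : Finset ℕ) (a b u v x : V) : Finset ℕ :=
  insert (c u v) (insert (c v x) (insert (c a b) C))

theorem swap (hc : ∀ a b, c a b = c b a) (k : Cycle c s C a b u v x y) : Cycle c s C b a u v x y := by
  have e : c b a = c a b := hc _ _
  exact ⟨k.six.swap, e ▸ k.ab, e ▸ k.uv, e ▸ k.vx, k.xy, k.uy, k.ne, e ▸ k.colors_subset⟩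

theorem rotate (hc : ∀ a b, c a b = c b a) (k : Cycle c s C a b u v x y) :
    Cycle c s C a b v x y u := by
  have h := k.six.ne
  have e : ({v, x, y, u} : Finset V) = {u, v, x, y} := by
    ext z; simp only [Finset.mem_insert, Finset.mem_singleton]; tauto
  refine ⟨⟨k.six.rainbow, by simp [k.six.notMem], by simp [h], fun z => ?_⟩, k.ab, k.vx, ?_, ?_, ?_,
    ?_, ?_⟩
  · have := k.six.cover z; grind
  · rw [k.xy]; exact k.uv
  · rw [hc, k.uy]
  · rw [hc, k.xy]
  · rw [k.xy]; exact k.ne.symm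
  · rw [e, k.xy, Finset.insert_comm (c v x)]; exact k.colors_subset

theorem base_swap (hc : ∀ a b, c a b = c b a) : base c C b a u v x = base c C a b u v x := by
  simp only [base, hc b a]

theorem base_rotate (k : Cycle c s C a b u v x y) : base c C a b v x y = base c C a b u v x := by
  simp only [base, k.xy]; rw [Finset.insert_comm]

theorem config (k : Cycle c s C a b u v x y) :
    Config c (insert a (insert b s)) (insert (c a b) C) u v x y := by
  have h := k.six.ne
  have h' := k.six.notMem
  exact ⟨k.six.rainbow.add h'.1 h'.2.1 h.1.1 k.ab, by simp [h, h'], by simp [h], k.uv, k.xy⟩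

/-- The edge xy is a third disjoint edge with a new color, and the color of neither au nor bv equals
that of xy. -/
theorem eq_of_base (hno : NoRainbow c (t + 1)) (hC : C.card + 1 = t)
    (k : Cycle c s C a b u v x y)
    (h1 : c a u ∉ base c C a b u v x) (h2 : c b v ∉ base c C a b u v x) : c a u = c b v := by
  have h := k.six.ne
  have h' := k.six.notMem
  have hxy := k.uv
  rw [← k.xy] at hxy
  simp only [base, Finset.mem_insert, not_or] at h1 h2 hxy
  refine ((hno.eq_or_eq_of_add_three k.six.rainbow hC (a := x) (b := y) (d := a) (e := u) (f := b)
    (g := v) (by simp [h']) (by simp [h]) hxy.2 h1.2.2.2 h2.2.2.2 (by rw [k.xy]; exact Ne.symm h1.1)).resolve_left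
    (by rw [k.xy]; exact h2.1)).symm

/-- Three new colors between `{a, b}` and the cycle force two of them at antipodal vertices. -/
theorem exists_antipodal (hc : ∀ a b, c a b = c b a) (hno : NoRainbow c (t + 1))
    (hC : C.card + 1 = t) (k : Cycle c s C a b u v x y)
    (h3 : 3 ≤ (fresh c (base c C a b u v x) a b {u, v, x, y}).card) :
    ∃ a b u v x y, Cycle c s C a b u v x y ∧ c a u ∉ base c C a b u v x ∧
      c a x ∉ base c C a b u v x ∧ c a u ≠ c a x := by
  by_contra! hcon
  have k1 := k.rotate hc
  have k2 := k1.rotate hc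
  have k3 := k2.rotate hc
  have b1 := k.base_rotate
  have b2 := k1.base_rotate.trans b1
  have b3 := k2.base_rotate.trans b2
  have e0 := k.eq_of_base hno hC
  have e1 := k1.eq_of_base hno hC
  have e2 := k2.eq_of_base hno hC
  have e3 := k3.eq_of_base hno hC
  have f0 := (k.swap hc).eq_of_base hno hC
  have f1 := (k1.swap hc).eq_of_base hno hC
  have f2 := (k2.swap hc).eq_of_base hno hC
  have f3 := (k3.swap hc).eq_of_base hno hC
  have g0 := hcon _ _ _ _ _ _ k
  have g1 := hcon _ _ _ _ _ _ k1
  have g2 := hcon _ _ _ _ _ _ (k.swap hc)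
  have g3 := hcon _ _ _ _ _ _ (k1.swap hc)
  rw [base_swap hc] at f0 f1 f2 f3 g2 g3
  rw [b1] at e1 f1 g1 g3
  rw [b2] at e2 f2
  rw [b3] at e3 f3
  -- Edges from a and from b to adjacent vertices of the cycle agree if new. If also the new colors
  -- at antipodal vertices agree, each of the two classes has just one new color.
  have hsub : fresh c (base c C a b u v x) a b {u, v, x, y} ⊆
      (({c a u, c a x, c b v, c b y} : Finset ℕ) \ base c C a b u v x) ∪
      (({c a v, c a y, c b u, c b x} : Finset ℕ) \ base c C a b u v x) := by
    intro γ hγ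
    simp only [fresh, Finset.mem_biUnion, Finset.mem_sdiff, Finset.mem_insert,
      Finset.mem_singleton, Finset.mem_union] at hγ ⊢
    obtain ⟨z, hz, hγ, hB⟩ := hγ
    simp only [hB, not_false_eq_true, and_true]
    rcases hz with rfl | rfl | rfl | rfl <;> rcases hγ with rfl | rfl <;> simp
  clear hno k k1 k2 k3 hcon b1 b2 b3
  generalize base c C a b u v x = B at *
  have h1 : (({c a u, c a x, c b v, c b y} : Finset ℕ) \ B).card ≤ 1 := by
    rw [Finset.card_le_one]
    intro p hp q hq
    simp only [Finset.mem_sdiff, Finset.mem_insert, Finset.mem_singleton] at hp hq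
    clear hsub h3
    grind
  have h2 : (({c a v, c a y, c b u, c b x} : Finset ℕ) \ B).card ≤ 1 := by
    rw [Finset.card_le_one]
    intro p hp q hq
    simp only [Finset.mem_sdiff, Finset.mem_insert, Finset.mem_singleton] at hp hq
    clear hsub h3 h1
    grind
  have h4 := Finset.card_le_card hsub
  have h5 := Finset.card_union_le (({c a u, c a x, c b v, c b y} : Finset ℕ) \ B)
    (({c a v, c a y, c b u, c b x} : Finset ℕ) \ B)
  omega

/-- From u and x the edges to y, and those to v, have the two different colors of the cycle. So
`mem_of_same_end` applies with w = y and with w = v. -/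
theorem mem_of_antipodal (hc : ∀ a b, c a b = c b a) (hno : NoRainbow c (t + 1))
    (hC : C.card + 1 = t) (k : Cycle c s C a b u v x y) (h1 : c a u ∉ base c C a b u v x)
    (h2 : c a x ∉ base c C a b u v x) (h12 : c a u ≠ c a x) : c b v ∈ C ∧ c b y ∈ C := by
  have h := k.six.ne
  have h' := k.six.notMem
  have huv := k.uv
  have hvx := k.vx
  have hne := k.ne
  simp only [base, Finset.mem_insert, not_or] at h1 h2 huv hvx
  constructor
  · exact (hno.mem_of_same_end k.six.rainbow hC (a := a) (p := u) (q := x) (r := v) (w := y)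
      (by simp [h']) (by simp [h]) h1.2.2.2 h2.2.2.2 h12 (by rw [k.uy]; exact hvx.2)
      (by rw [k.xy]; exact huv.2) (by rw [k.uy, k.xy]; exact hne.symm) (by rw [k.uy]; exact h1.2.1)
      (by rw [k.xy]; exact h1.1) (by rw [k.uy]; exact h2.2.1) (by rw [k.xy]; exact h2.1)).1
  · exact (hno.mem_of_same_end k.six.rainbow hC (a := a) (p := u) (q := x) (r := y) (w := v)
      (by simp [h']) (by simp [h]) h1.2.2.2 h2.2.2.2 h12 huv.2
      (by rw [hc]; exact hvx.2) (by rw [hc x v]; exact hne) h1.1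
      (by rw [hc x v]; exact h1.2.1) h2.1 (by rw [hc x v]; exact h2.2.1)).1

variable [Fintype V]

/-- The soft edges uv and de are deleted. Besides `F` only 2(t - 1) colors at uv and the second
color of the cycle are lost. -/
theorem card_colors_le_of_soft (hc : ∀ a b, c a b = c b a) (hno : NoRainbow c (t + 1))
    (hN : Fintype.card V = 2 * t + 4) (hs : IsRainbow ⊤ c s C) (hC : C.card + 2 = t)
    (hd : d ∉ s) (he : e ∉ s) (hde : d ≠ e) (hγ : c d e ∉ C)
    (k : Cycle c (insert d (insert e s)) (insert (c d e) C) a b u v x y) {F : Finset ℕ}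
    (hF : ∀ z, z ≠ d → z ≠ e →
      c d z ∈ insert (c a u) (insert (c a x) (base c (insert (c d e) C) a b u v x)) ∪ F ∧
      c e z ∈ insert (c a u) (insert (c a x) (base c (insert (c d e) C) a b u v x)) ∪ F) :
    (colors c Finset.univ).card + t ≤ 2 * t ^ 2 + 2 + F.card := by
  have h := k.six.ne
  have h' := k.six.notMem
  have huv := k.uv
  have hab := k.ab
  simp only [Finset.mem_insert, not_or] at h' huv hab
  have hs1 : IsRainbow ⊤ c (insert a (insert b s)) (insert (c a b) C) :=
    hs.add h'.1.2.2 h'.2.1.2.2 h.1.1 hab.2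
  have hC1 : (insert (c a b) C).card = C.card + 1 := Finset.card_insert_of_notMem hab.2
  have k1 := k.config
  have eV : insert a (insert b (insert d (insert e s))) = insert d (insert e (insert a (insert b s))) := by
    ext z; simp only [Finset.mem_insert]; tauto
  rw [eV, Finset.insert_comm (c a b)] at k1
  have f1 := k1.card_fresh_pair_le hno hs1 (by omega) (by simp [Ne.symm h'.1.1, Ne.symm h'.2.1.1, hd])
    (by simp [Ne.symm h'.1.2.1, Ne.symm h'.2.1.2.1, he]) hde rfl (by simp [hγ, Ne.symm hab.1])
    subset_rfl
  have hS : IsRainbow ⊤ c {u, v, d, e} {c u v, c d e} :=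
    (IsRainbow.pair hde).add (by simp [h']) (by simp [h']) (by simp [h]) (by simp [huv])
  have hcover := k.six.cover
  have hcolU := k.colors_subset
  generalize hF1 : fresh c _ u v _ = F1 at f1
  have g1 := Finset.card_union_le (F ∪ F1) {c v x}
  have g2 := Finset.card_union_le F F1
  rw [Finset.card_singleton] at g1
  have := card_colors_le_of_two_soft hc hno hN (by omega) hS (Finset.card_pair huv.2.1)
    (Y := F ∪ F1 ∪ {c v x}) (by
      generalize hT : colors c (Finset.univ \ {u, v, d, e}) ∪ {c u v, c d e} ∪ (F ∪ F1 ∪ {c v x}) = T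
      clear f1 g1 g2 hno hS
      have hsub : ∀ z ∈ insert a (insert b s), z ∈ Finset.univ \ ({u, v, d, e} : Finset V) := by
        intro z hz
        simp only [Finset.mem_sdiff, Finset.mem_univ, true_and, Finset.mem_insert,
          Finset.mem_singleton] at hz ⊢
        rintro hz'
        rcases hz with rfl | rfl | hz
        · simp [h, h'] at hz'
        · simp [h, h'] at hz'
        · rcases hz' with rfl | rfl | rfl | rfl
          exacts [h'.2.2.1.2.2 hz, h'.2.2.2.1.2.2 hz, hd hz, he hz]
      have hcolT : colors c (Finset.univ \ {u, v, d, e}) ⊆ T := by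
        rw [← hT]; exact Finset.subset_union_left.trans Finset.subset_union_left
      have hsubT : ∀ Z, Z ⊆ F ∪ F1 ∪ {c v x} → Z ⊆ T := fun Z hZ => by
        rw [← hT]; exact hZ.trans Finset.subset_union_right
      have huvT : c u v ∈ T := by rw [← hT]; simp
      have hdeT : c d e ∈ T := by rw [← hT]; simp
      have hvxT : c v x ∈ T := by rw [← hT]; simp
      have hC1T := (hs1.subset_colors hsub).trans hcolT
      have hbase : base c (insert (c d e) C) a b u v x ⊆ T := by
        refine Finset.insert_subset huvT (Finset.insert_subset hvxT ?_)
        rw [Finset.insert_comm]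
        exact Finset.insert_subset hdeT hC1T
      have e1 := mem_of_fresh_subset (Finset.insert_subset huvT (Finset.insert_subset hdeT hC1T))
        (hF1.trans_subset (hsubT _ (by intro z hz; simp [hz])))
      have hx : x ∈ Finset.univ \ ({u, v, d, e} : Finset V) := by
        simp [h, h']
      have hFT : insert (c a u) (insert (c a x) (base c (insert (c d e) C) a b u v x)) ∪ F ⊆ T := by
        refine Finset.union_subset (Finset.insert_subset ?_ (Finset.insert_subset ?_ hbase))
          (hsubT _ (by intro z hz; simp [hz]))
        · rw [hc]; exact (e1 a (by simp)).1
        · exact hcolT (mem_colors.mpr ⟨a, hsub a (by simp), x, hx, by simp [h], rfl⟩)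
      have hcU : ∀ p ∈ ({u, v, x, y} : Finset V), ∀ q ∈ ({u, v, x, y} : Finset V), p ≠ q → c p q ∈ T :=
        fun p hp q hq hpq => hbase (hcolU (mem_colors.mpr ⟨p, hp, q, hq, hpq, rfl⟩))
      have hde' : ∀ z, z ≠ d → z ≠ e → c d z ∈ T ∧ c e z ∈ T := fun z h1 h2 =>
        ⟨hFT (hF z h1 h2).1, hFT (hF z h1 h2).2⟩
      clear hF hFT hF1 hT hsub hbase hcolU hC1T hcolT hsubT k k1 hs hs1
      intro p hp z hz
      simp only [Finset.mem_insert, Finset.mem_singleton] at hp hcover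
      by_cases hpd : p = d
      · rw [hpd] at hz ⊢
        by_cases hze : z = e
        · rwa [hze]
        · exact (hde' z hz hze).1
      by_cases hpe : p = e
      · rw [hpe] at hz ⊢
        by_cases hzd : z = d
        · rwa [hzd, hc]
        · exact (hde' z hzd hz).2
      by_cases hzd : z = d
      · rw [hzd, hc]; exact (hde' p hpd hpe).1
      by_cases hze : z = e
      · rw [hze, hc]; exact (hde' p hpd hpe).2
      have hp' : p = u ∨ p = v := by simpa [hpd, hpe] using hp
      by_cases hzs : z ∈ insert a (insert b s)
      · rcases hp' with rfl | rfl
        exacts [(e1 z hzs).1, (e1 z hzs).2]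
      · simp only [Finset.mem_insert, not_or] at hzs
        refine hcU p ?_ z ?_ hz.symm
        · rcases hp' with rfl | rfl <;> simp
        · have := hcover z
          simp only [hzd, hze, hzs, false_or] at this
          simpa only [Finset.mem_insert, Finset.mem_singleton] using this)
  omega

end Cycle

end AntiRamsey

/-! ### Two further soft edges at a cycle. -/

namespace AntiRamsey

variable {V : Type*} [DecidableEq V] {c : V → V → ℕ} {s : Finset V} {C : Finset ℕ} {t : ℕ}
  {a b u v x y d e d' e' : V}

namespace Cycle

/-- Now uv, de and d'e' are deleted, with losses `F`, `F'`, 2(t - 2) colors at uv and the second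
color of the cycle. -/
theorem card_colors_le_of_soft_soft [Fintype V] (hc : ∀ a b, c a b = c b a) (hno : NoRainbow c (t + 1))
    (hN : Fintype.card V = 2 * t + 4) (hs : IsRainbow ⊤ c s C) (hC : C.card + 3 = t)
    (hd : d ∉ s ∧ e ∉ s ∧ d' ∉ s ∧ e' ∉ s) (hde : [d, e, d', e'].Nodup) (hγ : c d e ∉ C)
    (hγ' : c d' e' ∉ C) (hγγ' : c d e ≠ c d' e')
    (k : Cycle c (insert d (insert e (insert d' (insert e' s))))
      (insert (c d e) (insert (c d' e') C)) a b u v x y) {F F' : Finset ℕ}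
    (hF : ∀ z, z ≠ d → z ≠ e →
      c d z ∈ insert (c a u) (base c (insert (c d e) (insert (c d' e') C)) a b u v x) ∪ F ∧
      c e z ∈ insert (c a u) (base c (insert (c d e) (insert (c d' e') C)) a b u v x) ∪ F)
    (hF' : ∀ z, z ≠ d' → z ≠ e' →
      c d' z ∈ insert (c a u) (base c (insert (c d e) (insert (c d' e') C)) a b u v x) ∪ F' ∧
      c e' z ∈ insert (c a u) (base c (insert (c d e) (insert (c d' e') C)) a b u v x) ∪ F') :
    (colors c Finset.univ).card + 5 * t ≤ 2 * t ^ 2 + 6 + F.card + F'.card := by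
  have h := k.six.ne
  have h' := k.six.notMem
  have huv := k.uv
  have hab := k.ab
  simp only [Finset.mem_insert, not_or] at h' huv hab
  have hs1 : IsRainbow ⊤ c (insert a (insert b s)) (insert (c a b) C) :=
    hs.add h'.1.2.2.2.2 h'.2.1.2.2.2.2 h.1.1 hab.2.2
  have hC1 : (insert (c a b) C).card = C.card + 1 := Finset.card_insert_of_notMem hab.2.2
  have k1 := k.config
  have eV : insert a (insert b (insert d (insert e (insert d' (insert e' s))))) =
      insert d (insert e (insert d' (insert e' (insert a (insert b s))))) := by
    rw [Finset.insert_comm b d, Finset.insert_comm a d, Finset.insert_comm b e, Finset.insert_comm a e,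
      Finset.insert_comm b d', Finset.insert_comm a d', Finset.insert_comm b e',
      Finset.insert_comm a e']
  have eC : insert (c a b) (insert (c d e) (insert (c d' e') C)) =
      insert (c d e) (insert (c d' e') (insert (c a b) C)) := by
    rw [Finset.insert_comm (c a b), Finset.insert_comm (c a b)]
  rw [eV, eC] at k1
  have hde' := hde
  simp only [List.nodup_cons, List.mem_cons, not_or, List.not_mem_nil, not_false_eq_true,
    List.nodup_nil, and_true] at hde'
  have f1 := k1.card_fresh_pair_pair_le hno hs1 (by omega)
    (by simp [Ne.symm h'.1.1, Ne.symm h'.2.1.1, Ne.symm h'.1.2.1, Ne.symm h'.2.1.2.1,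
      Ne.symm h'.1.2.2.1, Ne.symm h'.2.1.2.2.1, Ne.symm h'.1.2.2.2.1, Ne.symm h'.2.1.2.2.2.1, hd])
    hde rfl (by simp [hγ, Ne.symm hab.1]) rfl (by simp [hγ', Ne.symm hab.2.1]) hγγ' subset_rfl
  have hS : IsRainbow ⊤ c {u, v, d, e, d', e'} {c u v, c d e, c d' e'} :=
    ((IsRainbow.pair hde'.2.2).add (a := d) (b := e) (by simp [hde']) (by simp [hde']) hde'.1.1
      (by simp [hγγ'])).add (by simp [h']) (by simp [h']) (by simp [h]) (by simp [huv])
  have hD : ({c u v, c d e, c d' e'} : Finset ℕ).card = 3 := Finset.card_eq_three.mpr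
    ⟨_, _, _, huv.2.1, huv.2.2.1, hγγ', rfl⟩
  have hcover := k.six.cover
  have hcolU := k.colors_subset
  generalize hF1 : fresh c _ u v _ = F1 at f1
  have g1 := Finset.card_union_le (F ∪ F' ∪ F1) {c v x}
  have g2 := Finset.card_union_le (F ∪ F') F1
  have g3 := Finset.card_union_le F F'
  rw [Finset.card_singleton] at g1
  have := card_colors_le_of_three_soft hc hno hN (by omega) hS hD
    (Y := F ∪ F' ∪ F1 ∪ {c v x}) (by
      generalize hT : colors c (Finset.univ \ {u, v, d, e, d', e'}) ∪ {c u v, c d e, c d' e'} ∪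
        (F ∪ F' ∪ F1 ∪ {c v x}) = T
      clear f1 g1 g2 g3 hno hS
      have hsub : ∀ z ∈ insert a (insert b s), z ∈ Finset.univ \ ({u, v, d, e, d', e'} : Finset V) := by
        intro z hz
        simp only [Finset.mem_sdiff, Finset.mem_univ, true_and, Finset.mem_insert,
          Finset.mem_singleton] at hz ⊢
        rintro hz'
        rcases hz with rfl | rfl | hz
        · simp [h, h'] at hz'
        · simp [h, h'] at hz'
        · rcases hz' with rfl | rfl | rfl | rfl | rfl | rfl
          exacts [h'.2.2.1.2.2.2.2 hz, h'.2.2.2.1.2.2.2.2 hz, hd.1 hz, hd.2.1 hz, hd.2.2.1 hz,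
            hd.2.2.2 hz]
      have hcolT : colors c (Finset.univ \ {u, v, d, e, d', e'}) ⊆ T := by
        rw [← hT]; exact Finset.subset_union_left.trans Finset.subset_union_left
      have hsubT : ∀ Z, Z ⊆ F ∪ F' ∪ F1 ∪ {c v x} → Z ⊆ T := fun Z hZ => by
        rw [← hT]; exact hZ.trans Finset.subset_union_right
      have huvT : c u v ∈ T := by rw [← hT]; simp
      have hdeT : c d e ∈ T := by rw [← hT]; simp
      have hdeT' : c d' e' ∈ T := by rw [← hT]; simp
      have hvxT : c v x ∈ T := by rw [← hT]; simp
      have hC1T := (hs1.subset_colors hsub).trans hcolT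
      have hbase : base c (insert (c d e) (insert (c d' e') C)) a b u v x ⊆ T := by
        refine Finset.insert_subset huvT (Finset.insert_subset hvxT ?_)
        rw [eC]
        exact Finset.insert_subset hdeT (Finset.insert_subset hdeT' hC1T)
      have e1 := mem_of_fresh_subset (Finset.insert_subset huvT (Finset.insert_subset hdeT
        (Finset.insert_subset hdeT' hC1T)))
        (hF1.trans_subset (hsubT _ (by intro z hz; simp [hz])))
      have hau : c a u ∈ T := by rw [hc]; exact (e1 a (by simp)).1
      have hFT := Finset.union_subset (Finset.insert_subset hau hbase)
        (hsubT F (by intro z hz; simp [hz]))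
      have hFT' := Finset.union_subset (Finset.insert_subset hau hbase)
        (hsubT F' (by intro z hz; simp [hz]))
      have hcU : ∀ p ∈ ({u, v, x, y} : Finset V), ∀ q ∈ ({u, v, x, y} : Finset V), p ≠ q → c p q ∈ T :=
        fun p hp q hq hpq => hbase (hcolU (mem_colors.mpr ⟨p, hp, q, hq, hpq, rfl⟩))
      have key : ∀ p, p = d ∨ p = e ∨ p = d' ∨ p = e' → ∀ z, z ≠ p → c p z ∈ T := by
        have key' : ∀ d e : V, ∀ X, X ⊆ T → c d e ∈ T → (∀ z, z ≠ d → z ≠ e → c d z ∈ X ∧ c e z ∈ X) →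
            ∀ p, p = d ∨ p = e → ∀ z, z ≠ p → c p z ∈ T := by
          rintro d e X hX hde hz p (rfl | rfl) z hzp
          · by_cases hze : z = e
            · rwa [hze]
            · exact hX (hz z hzp hze).1
          · by_cases hzd : z = d
            · rwa [hzd, hc]
            · exact hX (hz z hzd hzp).2
        rintro p (hp | hp | hp | hp)
        exacts [key' _ _ _ hFT hdeT hF p (.inl hp), key' _ _ _ hFT hdeT hF p (.inr hp),
          key' _ _ _ hFT' hdeT' hF' p (.inl hp), key' _ _ _ hFT' hdeT' hF' p (.inr hp)]
      clear hF hF' hFT hFT' hF1 hT hsub hbase hcolU hC1T hcolT hsubT k k1 hs hs1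
      intro p hp z hz
      simp only [Finset.mem_insert, Finset.mem_singleton] at hp hcover
      by_cases hpd : p = d ∨ p = e ∨ p = d' ∨ p = e'
      · exact key p hpd z hz
      by_cases hzd : z = d ∨ z = e ∨ z = d' ∨ z = e'
      · rw [hc]; exact key z hzd p hz.symm
      have hp' : p = u ∨ p = v := by
        rcases hp with hp | hp | hp
        exacts [.inl hp, .inr hp, absurd hp hpd]
      rw [not_or, not_or, not_or] at hzd
      by_cases hzs : z ∈ insert a (insert b s)
      · rcases hp' with rfl | rfl
        exacts [(e1 z hzs).1, (e1 z hzs).2]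
      · simp only [Finset.mem_insert, not_or] at hzs
        refine hcU p ?_ z ?_ hz.symm
        · rcases hp' with rfl | rfl <;> simp
        · have := hcover z
          simp only [hzd, hzs, false_or] at this
          simpa only [Finset.mem_insert, Finset.mem_singleton] using this)
  omega

/-- The variables are the colors from d and e to the six vertices a, b, u, v, x, y. The b-hypotheses
tie the edges to v and y to those to b, the p-hypotheses tie the edges to u and x to those to a, and
the q-hypotheses tie those to u and x to those to v. In each case at most four values outside `X`
remain. -/
theorem exists_four_values {X : Finset ℕ} {da ea db eb du eu dv ev dx ex dy ey : ℕ}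
    (b1 : db ∉ X → ev = db) (b2 : eb ∉ X → dv = eb) (b3 : dv ∉ X → eb = dv) (b4 : ev ∉ X → db = ev)
    (b5 : db ∉ X → ey = db) (b6 : eb ∉ X → dy = eb) (b7 : dy ∉ X → eb = dy) (b8 : ey ∉ X → db = ey)
    (b9 : db ∉ X → eb ∉ X → db = eb)
    (p1 : da ∉ X → eu ∉ X → da = eu) (p2 : ea ∉ X → du ∉ X → ea = du)
    (p3 : da ∉ X → ex ∉ X → da = ex) (p4 : ea ∉ X → dx ∉ X → ea = dx)
    (q1 : dv ∉ X → eu ∉ X → dv = eu) (q2 : ev ∉ X → du ∉ X → ev = du)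
    (q3 : dv ∉ X → ex ∉ X → dv = ex) (q4 : ev ∉ X → dx ∉ X → ev = dx) :
    ∃ F : Finset ℕ, F.card ≤ 4 ∧
      ({da, ea, db, eb, du, eu, dv, ev, dx, ex, dy, ey} : Finset ℕ) ⊆ X ∪ F := by
  have key : ∀ F : Finset ℕ, (∀ z, z = da ∨ z = ea ∨ z = db ∨ z = eb ∨ z = du ∨ z = eu ∨ z = dv ∨
      z = ev ∨ z = dx ∨ z = ex ∨ z = dy ∨ z = ey → z ∉ X → z ∈ F) →
      ({da, ea, db, eb, du, eu, dv, ev, dx, ex, dy, ey} : Finset ℕ) ⊆ X ∪ F := by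
    intro F h z hz
    simp only [Finset.mem_insert, Finset.mem_singleton] at hz
    by_cases hzX : z ∈ X
    · exact Finset.mem_union_left _ hzX
    · exact Finset.mem_union_right _ (h z hz hzX)
  by_cases hdb : db ∈ X
  · by_cases heb : eb ∈ X
    · by_cases hda : da ∈ X
      · by_cases hea : ea ∈ X
        · exact ⟨{du, dx, eu, ex}, Finset.card_le_four, key _ (by simp only [Finset.mem_insert, Finset.mem_singleton]; grind)⟩
        · exact ⟨{ea, ea, eu, ex}, Finset.card_le_four, key _ (by simp only [Finset.mem_insert, Finset.mem_singleton]; grind)⟩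
      · exact ⟨{da, ea, du, dx}, Finset.card_le_four, key _ (by simp only [Finset.mem_insert, Finset.mem_singleton]; grind)⟩
    · by_cases hea : ea ∈ X
      · exact ⟨{eb, da, du, dx}, Finset.card_le_four, key _ (by simp only [Finset.mem_insert, Finset.mem_singleton]; grind)⟩
      · exact ⟨{eb, da, ea, ea}, Finset.card_le_four, key _ (by simp only [Finset.mem_insert, Finset.mem_singleton]; grind)⟩
  · by_cases heb : eb ∈ X
    · by_cases hda : da ∈ X
      · exact ⟨{db, ea, eu, ex}, Finset.card_le_four, key _ (by simp only [Finset.mem_insert, Finset.mem_singleton]; grind)⟩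
      · exact ⟨{db, da, ea, ea}, Finset.card_le_four, key _ (by simp only [Finset.mem_insert, Finset.mem_singleton]; grind)⟩
    · exact ⟨{db, da, ea, ea}, Finset.card_le_four, key _ (by simp only [Finset.mem_insert, Finset.mem_singleton]; grind)⟩

end Cycle

end AntiRamsey

/-! ### Antipodal new colors at a cycle. -/

namespace AntiRamsey

variable {V : Type*} [DecidableEq V] [Fintype V] {c : V → V → ℕ} {s : Finset V} {C : Finset ℕ}
  {t : ℕ} {a b u v x y d e : V}

/-- The vertices outside of a rainbow matching see at most two new colors. -/
def NoThree (c : V → V → ℕ) (t : ℕ) : Prop :=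
  ∀ s C u v x y, C.card = t → Config c s C u v x y → c u x ∉ C → c u y ∉ C → c u x ≠ c u v →
    c u y ≠ c u v → c u x = c u y

namespace Cycle

/-- As bv and by both repeat its color, de is soft with respect to two matchings, one containing xy
and one containing vx. This cuts its new colors towards the six vertices to four; with 2(t - 2)
towards `s` these are 2t instead of the 2t + 2 of a general soft edge. -/
theorem exists_soft_of_same_color (hc : ∀ a b, c a b = c b a) (hno : NoRainbow c (t + 1))
    (hN : Fintype.card V = 2 * t + 4) (hM : NoMixed c t) (h3 : NoThree c t)
    (hs : IsRainbow ⊤ c s C) (hC : C.card + 2 = t) (hd : d ∉ s) (he : e ∉ s) (hde : d ≠ e)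
    (hγ : c d e ∉ C) (k : Cycle c (insert d (insert e s)) (insert (c d e) C) a b u v x y)
    (h1 : c a u ∉ base c (insert (c d e) C) a b u v x)
    (h2 : c a x ∉ base c (insert (c d e) C) a b u v x) (hbv : c b v = c d e)
    (hby : c b y = c d e) : ∃ F : Finset ℕ, F.card ≤ 2 * t ∧ ∀ z, z ≠ d → z ≠ e →
      c d z ∈ insert (c a u) (insert (c a x) (base c (insert (c d e) C) a b u v x)) ∪ F ∧
      c e z ∈ insert (c a u) (insert (c a x) (base c (insert (c d e) C) a b u v x)) ∪ F := by
  obtain ⟨X, hX⟩ : ∃ X, X = insert (c a u) (insert (c a x) (base c (insert (c d e) C) a b u v x)) :=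
    ⟨_, rfl⟩
  rw [← hX]
  have h := k.six.ne
  have h' := k.six.notMem
  have huv := k.uv
  have hvx := k.vx
  have hxy := k.xy
  have huy := k.uy
  have hne := k.ne
  simp only [base, Finset.mem_insert, not_or] at huv hvx h1 h2
  obtain ⟨K1, -⟩ := hs.soft_edge hno hC hd he hde hγ (i := a) (j := u) (k := x) (l := y) (p := b)
    (q := v) ⟨h'.1, h'.2.2.1, h'.2.2.2.2.1, h'.2.2.2.2.2, h'.2.1, h'.2.2.2.1⟩ (by simp [h])
    (by simp [h1]) (by simp [hxy, huv]) (by rw [hxy]; exact h1.1) hbv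
  obtain ⟨K2, -⟩ := hs.soft_edge hno hC hd he hde hγ (i := a) (j := u) (k := v) (l := x) (p := b)
    (q := y) ⟨h'.1, h'.2.2.1, h'.2.2.2.1, h'.2.2.2.2.1, h'.2.1, h'.2.2.2.2.2⟩ (by simp [h])
    (by simp [h1]) (by simp [hvx]) h1.2.1 hby
  have hcard : ∀ r w, c r w ∉ C → c a u ≠ c r w →
      (insert (c a u) (insert (c r w) C)).card = t := by
    intro r w h3 h4
    rw [Finset.card_insert_of_notMem (by simp [h4, h1]), Finset.card_insert_of_notMem h3, hC]
  have hC1 := hcard x y (by rw [hxy]; exact huv.2.2) (by rw [hxy]; exact h1.1)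
  have hC2 := hcard v x hvx.2.2 h1.2.1
  have hCX : insert (c d e) C ⊆ X := by
    rw [hX]; intro z hz; simp only [base, Finset.mem_insert] at hz ⊢; simp [hz]
  have hX1 : insert (c a u) (insert (c x y) C) ⊆ X := by
    rw [hX, hxy]; intro z hz; simp only [base, Finset.mem_insert] at hz ⊢
    rcases hz with hz | hz | hz <;> simp [hz]
  have hX2 : insert (c a u) (insert (c v x) C) ⊆ X := by
    rw [hX]; intro z hz; simp only [base, Finset.mem_insert] at hz ⊢
    rcases hz with hz | hz | hz <;> simp [hz]
  have hγX : c d e ∈ X := hCX (Finset.mem_insert_self _ _)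
  have f1 := K1.card_fresh_pair_pair_le hno hs hC (X := X) (by
      simp only [Finset.mem_insert, not_or] at h'
      exact ⟨h'.1.2.2, h'.2.2.1.2.2, h'.2.2.2.2.1.2.2, h'.2.2.2.2.2.2.2⟩) (by simp [h]) rfl
    h1.2.2.2.2 rfl (by rw [hxy]; exact huv.2.2) (by rw [hxy]; exact h1.1)
    (Finset.insert_subset hγX hX1)
  have b1 : c d b ∉ X → c e v = c d b := fun hn =>
    K1.eq_of_noMixed hc hno hM hC1 hN fun hm => hn (hX1 hm)
  have b2 : c e b ∉ X → c d v = c e b := fun hn =>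
    (K1.swap hc).eq_of_noMixed hc hno hM hC1 hN fun hm => hn (hX1 hm)
  have b3 : c d v ∉ X → c e b = c d v := fun hn =>
    (K1.swap_right hc).eq_of_noMixed hc hno hM hC1 hN fun hm => hn (hX1 hm)
  have b4 : c e v ∉ X → c d b = c e v := fun hn =>
    ((K1.swap hc).swap_right hc).eq_of_noMixed hc hno hM hC1 hN fun hm => hn (hX1 hm)
  have b5 : c d b ∉ X → c e y = c d b := fun hn =>
    K2.eq_of_noMixed hc hno hM hC2 hN fun hm => hn (hX2 hm)
  have b6 : c e b ∉ X → c d y = c e b := fun hn =>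
    (K2.swap hc).eq_of_noMixed hc hno hM hC2 hN fun hm => hn (hX2 hm)
  have b7 : c d y ∉ X → c e b = c d y := fun hn =>
    (K2.swap_right hc).eq_of_noMixed hc hno hM hC2 hN fun hm => hn (hX2 hm)
  have b8 : c e y ∉ X → c d b = c e y := fun hn =>
    ((K2.swap hc).swap_right hc).eq_of_noMixed hc hno hM hC2 hN fun hm => hn (hX2 hm)
  have b9 : c d b ∉ X → c e b ∉ X → c d b = c e b := by
    intro n1 n2
    have e1 := b2 n2
    rw [← e1] at n2 ⊢
    exact h3 _ _ _ _ _ _ hC1 K1 (fun hm => n1 (hX1 hm)) (fun hm => n2 (hX1 hm))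
      (fun e => n1 (e ▸ hγX)) (fun e => n2 (e ▸ hγX))
  have hX' : ∀ {δ δ' : ℕ}, δ ∈ X → δ' ∉ X → δ' ≠ δ := fun h h' e => h' (e ▸ h)
  have pair : ∀ d e p q r w m n, [d, p, e, q, r, w, m, n].Nodup →
      (d ∉ s ∧ p ∉ s ∧ e ∉ s ∧ q ∉ s ∧ r ∉ s ∧ w ∉ s ∧ m ∉ s ∧ n ∉ s) → c r w ∈ X → c m n ∈ X →
      c r w ∉ C → c m n ∉ C → c r w ≠ c m n → c d p ∉ X → c e q ∉ X → c d p = c e q := by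
    intro d e p q r w m n hnd hs' m1 m2 m3 m4 m5 n1 n2
    by_contra hcon
    exact hno.false_of_add_four hs (by omega) hs' hnd
      (fun hm => n1 (hCX (Finset.mem_insert_of_mem hm)))
      (fun hm => n2 (hCX (Finset.mem_insert_of_mem hm))) m3 m4
      (by simp [hcon, m5, hX' m1 n1, hX' m1 n2, hX' m2 n1, hX' m2 n2])
  have huvX : c u v ∈ X := by rw [hX]; simp [base]
  have hvxX : c v x ∈ X := by rw [hX]; simp [base]
  have hauX : c a u ∈ X := by rw [hX]; simp
  have haxX : c a x ∈ X := by rw [hX]; simp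
  simp only [Finset.mem_insert, not_or] at h'
  have nd : (d ≠ a ∧ d ≠ b ∧ d ≠ u ∧ d ≠ v ∧ d ≠ x ∧ d ≠ y) ∧
      (e ≠ a ∧ e ≠ b ∧ e ≠ u ∧ e ≠ v ∧ e ≠ x ∧ e ≠ y) :=
    ⟨⟨Ne.symm h'.1.1, Ne.symm h'.2.1.1, Ne.symm h'.2.2.1.1, Ne.symm h'.2.2.2.1.1,
      Ne.symm h'.2.2.2.2.1.1, Ne.symm h'.2.2.2.2.2.1⟩,
      ⟨Ne.symm h'.1.2.1, Ne.symm h'.2.1.2.1, Ne.symm h'.2.2.1.2.1, Ne.symm h'.2.2.2.1.2.1,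
      Ne.symm h'.2.2.2.2.1.2.1, Ne.symm h'.2.2.2.2.2.2.1⟩⟩
  have hxyX : c x y ∈ X := by rwa [hxy]
  have huyX : c u y ∈ X := by rwa [huy]
  have hbvX : c b v ∈ X := by rwa [hbv]
  have hbyX : c b y ∈ X := by rwa [hby]
  have hxyC : c x y ∉ C := by rw [hxy]; exact huv.2.2
  have huyC : c u y ∉ C := by rw [huy]; exact hvx.2.2
  have hbvC : c b v ∉ C := by rwa [hbv]
  have hbyC : c b y ∉ C := by rwa [hby]
  have hxyγ : c x y ≠ c b v := by rw [hxy, hbv]; exact huv.2.1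
  have huyγ : c u y ≠ c b v := by rw [huy, hbv]; exact hvx.2.1
  have haxγ : c a x ≠ c b y := by rw [hby]; exact h2.2.2.2.1
  have hauγ : c a u ≠ c b y := by rw [hby]; exact h1.2.2.2.1
  have haxC : c a x ∉ C := h2.2.2.2.2
  have hauC : c a u ∉ C := h1.2.2.2.2
  obtain ⟨F, hF, hsub⟩ := exists_four_values (X := X) b1 b2 b3 b4 b5 b6 b7 b8 b9
    (pair d e a u x y b v (by simp [h, h', nd, hde]) (by simp [h', hd, he]) hxyX hbvX hxyC
      hbvC hxyγ)
    (pair e d a u x y b v (by simp [h, h', nd, hde.symm]) (by simp [h', hd, he]) hxyX hbvX hxyC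
      hbvC hxyγ)
    (pair d e a x u y b v (by simp [h, h', nd, hde]) (by simp [h', hd, he]) huyX hbvX huyC
      hbvC huyγ)
    (pair e d a x u y b v (by simp [h, h', nd, hde.symm]) (by simp [h', hd, he]) huyX hbvX huyC
      hbvC huyγ)
    (pair d e v u a x b y (by simp [h, h', nd, hde]) (by simp [h', hd, he]) haxX hbyX haxC
      hbyC haxγ)
    (pair e d v u a x b y (by simp [h, h', nd, hde.symm]) (by simp [h', hd, he]) haxX hbyX haxC
      hbyC haxγ)
    (pair d e v x a u b y (by simp [h, h', nd, hde]) (by simp [h', hd, he]) hauX hbyX hauC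
      hbyC hauγ)
    (pair e d v x a u b y (by simp [h, h', nd, hde.symm]) (by simp [h', hd, he]) hauX hbyX hauC
      hbyC hauγ)
  have hcover := k.six.cover
  generalize hF1 : fresh c X d e s = F1 at f1
  refine ⟨F1 ∪ F, (Finset.card_union_le _ _).trans (by omega), fun z hzd hze => ?_⟩
  have e1 := mem_of_fresh_subset (T := X ∪ (F1 ∪ F)) Finset.subset_union_left
    (hF1.trans_subset (Finset.subset_union_left.trans Finset.subset_union_right))
  have hsub' := hsub.trans (Finset.union_subset_union_right (t₁ := F) (t₂ := F1 ∪ F) (s := X)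
    Finset.subset_union_right)
  have := hcover z
  simp only [Finset.mem_insert, hzd, hze, false_or] at this
  rcases this with hz | rfl | rfl | rfl | rfl | rfl | rfl
  · exact e1 z hz
  all_goals exact ⟨hsub' (by simp), hsub' (by simp)⟩

/-- The edges bv and by have matching colors. If these are equal, the single soft edge has the
improved count 2t; if they differ, there are two further soft edges. -/
theorem card_colors_le_of_antipodal (hc : ∀ a b, c a b = c b a) (hno : NoRainbow c (t + 1))
    (hN : Fintype.card V = 2 * t + 4) (hM : NoMixed c t) (h3 : NoThree c t) (hC : C.card + 1 = t)
    (k : Cycle c s C a b u v x y) (h1 : c a u ∉ base c C a b u v x)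
    (h2 : c a x ∉ base c C a b u v x) (h12 : c a u ≠ c a x) :
    (colors c Finset.univ).card ≤ 2 * t ^ 2 + t + 2 ∨
      2 * (colors c Finset.univ).card ≤ 3 * t ^ 2 + 7 * t + 2 := by
  obtain ⟨hbv, hby⟩ := k.mem_of_antipodal hc hno hC h1 h2 h12
  obtain ⟨d, e, s', C', hd, he, hde, hcol, hγ, rfl, rfl, hs'⟩ := k.six.rainbow.exists_eq_insert hbv
  rw [← hcol] at hγ k h1 h2 hC hby
  rw [Finset.card_insert_of_notMem hγ] at hC
  by_cases hγ' : c b y = c d e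
  · obtain ⟨F, hF, hcov⟩ := k.exists_soft_of_same_color hc hno hN hM h3 hs' hC hd he hde hγ h1 h2
      hcol.symm hγ'
    have := k.card_colors_le_of_soft hc hno hN hs' hC hd he hde hγ hcov
    left; omega
  obtain ⟨d', e', s'', C'', hd', he', hde', hcol', hγ₂, rfl, rfl, hs''⟩ :=
    hs'.exists_eq_insert (Finset.mem_of_mem_insert_of_ne hby hγ')
  rw [← hcol'] at hγ hγ₂ k h1 h2 hC hγ'
  rw [Finset.card_insert_of_notMem hγ₂] at hC
  have h := k.six.ne
  have h' := k.six.notMem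
  have huv := k.uv
  have hvx := k.vx
  have hxy := k.xy
  have huv' := k.uv
  have hvx' := k.vx
  have hau := h1
  simp only [base, Finset.mem_insert, not_or] at huv hvx h1 h2
  simp only [Finset.mem_insert, not_or] at h' hd he hγ
  obtain ⟨-, F, hF, hcov⟩ := (hs''.add hd' he' hde' hγ₂).soft_edge hno
    (by rw [Finset.card_insert_of_notMem hγ₂]; exact hC) (d := d) (e := e) (by simp [hd])
    (by simp [he]) hde (by simp [hγ]) (i := a) (j := u) (k := x) (l := y) (p := b)
    (q := v) (by simp [h']) (by simp [h]) (by simp [h1]) (by simp [hxy, huv])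
    (by rw [hxy]; exact h1.1) hcol.symm
  obtain ⟨-, F', hF', hcov'⟩ := (hs''.add hd.2.2 he.2.2 hde hγ.2).soft_edge hno
    (by rw [Finset.card_insert_of_notMem hγ.2]; exact hC) (d := d') (e := e')
    (by simp [Ne.symm hd.1, Ne.symm he.1, hd']) (by simp [Ne.symm hd.2.1, Ne.symm he.2.1, he'])
    hde' (by simp [hγ', hγ₂]) (i := a) (j := u) (k := v) (l := x) (p := b)
    (q := y) (by simp [h']) (by simp [h]) (by simp [h1]) (by simp [hvx])
    h1.2.1 hcol'.symm
  have hsub : insert (c a u) (insert (c x y) (insert (c d e) (insert (c d' e') C''))) ∪ F ⊆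
      insert (c a u) (base c (insert (c d e) (insert (c d' e') C'')) a b u v x) ∪ F := by
    refine Finset.union_subset_union (Finset.insert_subset_insert _ ?_) subset_rfl
    rw [hxy]
    exact Finset.insert_subset_insert _ ((Finset.subset_insert _ _).trans (Finset.subset_insert _ _))
  -- For t = 3 one soft edge with the general count gives 25 colors, which is exactly the second
  -- bound.
  by_cases ht : t = 3
  · have := k.card_colors_le_of_soft hc hno hN (hs''.add hd' he' hde' hγ₂)
      (by rw [Finset.card_insert_of_notMem hγ₂]; exact hC) (by simp [hd]) (by simp [he]) hde
      (by simp [hγ]) (F := F) (fun z hz hz' => by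
        have hsub' : insert (c a u) (base c (insert (c d e) (insert (c d' e') C'')) a b u v x) ∪ F ⊆
            insert (c a u) (insert (c a x) (base c (insert (c d e) (insert (c d' e') C''))
              a b u v x)) ∪ F :=
          Finset.union_subset_union (Finset.insert_subset_insert _ (Finset.subset_insert _ _))
            subset_rfl
        exact ⟨hsub' (hsub (hcov z hz hz').1), hsub' (hsub (hcov z hz hz').2)⟩)
    subst ht
    right; omega
  · have := k.card_colors_le_of_soft_soft hc hno hN hs'' (by omega) ⟨hd.2.2, he.2.2, hd', he'⟩
      (by simp [hde, hde', hd, he]) hγ.2 hγ₂ (Ne.symm hγ') (F := F) (F' := F')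
      (fun z hz hz' => ⟨hsub (hcov z hz hz').1, hsub (hcov z hz hz').2⟩) (fun z hz hz' => by
        have hsub' : insert (c a u) (insert (c v x) (insert (c d' e') (insert (c d e) C''))) ∪ F' ⊆
            insert (c a u) (base c (insert (c d e) (insert (c d' e') C'')) a b u v x) ∪ F' := by
          refine Finset.union_subset_union (Finset.insert_subset_insert _ ?_) subset_rfl
          rw [Finset.insert_comm (c d' e')]
          exact (Finset.insert_subset_insert _ (Finset.subset_insert _ _)).trans
            (Finset.subset_insert _ _)
        exact ⟨hsub' (hcov' z hz hz').1, hsub' (hcov' z hz hz').2⟩)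
    have : 4 ≤ t := by omega
    left; omega

end Cycle

end AntiRamsey

/-! ### Rainbow matchings on 2t + 4 vertices. -/

namespace AntiRamsey

variable {V : Type*} [DecidableEq V] [Fintype V] {c : V → V → ℕ} {s : Finset V} {C : Finset ℕ}
  {t : ℕ} {a b u v x y d e : V}

/-- The case of two new colors outside of a rainbow matching. -/
theorem Config.card_colors_le_of_two (hc : ∀ a b, c a b = c b a) (hno : NoRainbow c (t + 1))
    (hN : Fintype.card V = 2 * t + 4) (ht : 1 ≤ t) (hM : NoMixed c t) (h3 : NoThree c t)
    (k : Config c s C u v x y) (hC : C.card = t) (h1 : c u y ∉ C) (h12 : c u y ≠ c u v) :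
    (colors c Finset.univ).card ≤ 2 * t ^ 2 + t + 2 ∨
      2 * (colors c Finset.univ).card ≤ 3 * t ^ 2 + 7 * t + 2 := by
  by_contra hcon
  rw [not_or, not_le, not_le] at hcon
  have h := k.ne
  have hm := k.notMem
  have e1 := (k.swap_right hc).eq_of_noMixed hc hno hM hC hN h1
  have e0 := k.eq
  have hnew := k.new
  have hux : c u x ∈ insert (c u v) (insert (c v x) C) := by
    simp only [Finset.mem_insert, or_iff_not_imp_left]
    intro h4
    by_contra h5
    rw [Classical.not_imp, e1] at h5
    exact h5.1 (h3 _ _ _ _ _ _ hC k h5.2 h1 h4 h12)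
  have hvy : c v y ∈ insert (c u v) (insert (c v x) C) := by
    by_cases h4 : c v y ∈ C
    · simp [h4]
    · have := ((k.swap hc).swap_right hc).eq_of_noMixed hc hno hM hC hN h4
      rwa [← this]
  have hcol : colors c {u, v, x, y} ⊆ insert (c u v) (insert (c v x) C) := by
    intro γ hγ
    rw [Mixed.mem_colors_four hc k.nodup] at hγ
    rcases hγ with rfl | rfl | rfl | rfl | rfl | rfl
    exacts [by simp, hux, by simp [e1], by simp, hvy, by simp [e0]]
  have hcov : ∀ z, z ∈ s ∨ z ∈ ({u, v, x, y} : Finset V) := fun z => by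
    simpa only [Finset.mem_insert, Finset.mem_singleton] using k.cover hC hN z
  have hm2 : (colors c {u, v, x, y} \ C).card ≤ 2 := by
    refine (Finset.card_le_card fun γ hγ => ?_).trans (Finset.card_le_two (a := c u v) (b := c v x))
    rw [Finset.mem_sdiff] at hγ
    have := hcol hγ.1
    simp only [Finset.mem_insert, Finset.mem_singleton, hγ.2, or_false] at this ⊢
    exact this
  have hs2 : s.card * (s.card - 1) + 2 * t = 4 * t ^ 2 := by
    rw [k.rainbow.card_eq, hC]
    obtain ⟨m, rfl⟩ : ∃ m, t = m + 1 := ⟨t - 1, by omega⟩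
    rw [show 2 * (m + 1) - 1 = 2 * m + 1 by omega]
    ring
  -- If every matching edge saw at most two new colors towards the cycle, there would be at most 2t²
  -- + t + 2 colors.
  obtain ⟨a, b, s', C', ha, hb, hab, hφ, rfl, rfl, hs', hw⟩ :=
    exists_edge_fresh hc k.rainbow hcov hm2 (k := 2) (by rw [hC]; omega)
  rw [Finset.card_insert_of_notMem hφ] at hC
  simp only [Finset.mem_insert, not_or] at hm
  have k' : Cycle c s' C' a b u v x y := by
    refine ⟨⟨hs', ⟨ha, hb, hm.1.2.2, hm.2.1.2.2, hm.2.2.1.2.2, hm.2.2.2.2.2⟩, ?_, ?_⟩, hφ, hnew,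
      e1 ▸ h1, e0, e1.symm, fun e => h12 (e1 ▸ e.symm), hcol⟩
    · simp only [List.nodup_cons, List.mem_cons, not_or, List.not_mem_nil, not_false_eq_true,
        List.nodup_nil, and_true]
      exact ⟨⟨hab, Ne.symm hm.1.1, Ne.symm hm.2.1.1, Ne.symm hm.2.2.1.1, Ne.symm hm.2.2.2.1⟩,
        ⟨Ne.symm hm.1.2.1, Ne.symm hm.2.1.2.1, Ne.symm hm.2.2.1.2.1, Ne.symm hm.2.2.2.2.1⟩,
        ⟨h.1, h.2.1, h.2.2.1⟩, ⟨h.2.2.2.1, h.2.2.2.2.1⟩, h.2.2.2.2.2⟩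
    · intro z
      have := hcov z
      simp only [Finset.mem_insert, Finset.mem_singleton] at this
      rcases this with (h | h | h) | h
      exacts [.inr (.inl h), .inr (.inr (.inl h)), .inl h, .inr (.inr (.inr h))]
  have hbase : Cycle.base c C' a b u v x ⊆ insert (c a b) C' ∪ colors c {u, v, x, y} := by
    have hU : ∀ p ∈ ({u, v, x, y} : Finset V), ∀ q ∈ ({u, v, x, y} : Finset V), p ≠ q →
        c p q ∈ insert (c a b) C' ∪ colors c {u, v, x, y} := fun p hp q hq hpq =>
      Finset.mem_union_right _ (mem_colors.mpr ⟨p, hp, q, hq, hpq, rfl⟩)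
    exact Finset.insert_subset (hU u (by simp) v (by simp) h.1)
      (Finset.insert_subset (hU v (by simp) x (by simp) h.2.2.2.1) Finset.subset_union_left)
  have hw' : 3 ≤ (fresh c (Cycle.base c C' a b u v x) a b {u, v, x, y}).card := by
    refine le_trans hw (Finset.card_le_card fun γ hγ => ?_)
    simp only [fresh, Finset.mem_biUnion, Finset.mem_sdiff] at hγ ⊢
    obtain ⟨z, hz, h5, h6⟩ := hγ
    exact ⟨z, hz, h5, fun h7 => h6 (hbase h7)⟩
  obtain ⟨a', b', u', v', x', y', k2, g1, g2, g3⟩ := k'.exists_antipodal hc hno hC hw'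
  rcases k2.card_colors_le_of_antipodal hc hno hN hM h3 hC g1 g2 g3 with h | h <;> omega

/-- The number of colors without rainbow matchings with `t + 2` edges on `2 * t + 4` vertices. -/
theorem card_colors_le_of_noRainbow (hc : ∀ a b, c a b = c b a) (hno : NoRainbow c (t + 1))
    (hN : Fintype.card V = 2 * t + 4) (ht : 1 ≤ t) :
    (colors c Finset.univ).card ≤ 2 * t ^ 2 + t + 2 ∨
      2 * (colors c Finset.univ).card ≤ 3 * t ^ 2 + 7 * t + 2 := by
  by_cases hM : NoMixed c t
  swap
  · simp only [NoMixed, not_forall, not_not] at hM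
    obtain ⟨s, C, a, b, u, v, x, y, hC, k⟩ := hM
    exact k.card_colors_le hc hno hN hC
  by_cases h3 : NoThree c t
  swap
  · simp only [NoThree, not_forall] at h3
    obtain ⟨s, C, u, v, x, y, hC, k, h1, h2, h4, h5, h6⟩ := h3
    exact k.card_colors_le_of_three hc hno hN ht hM hC h1 h2 h4 h5 h6
  by_cases hall : ∀ s C u v x y, C.card = t → Config c s C u v x y → c u x ∈ insert (c u v) C
  swap
  · simp only [not_forall] at hall
    obtain ⟨s, C, u, v, x, y, hC, k, h⟩ := hall
    rw [Finset.mem_insert, not_or] at h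
    exact (k.swap_right hc).card_colors_le_of_two hc hno hN ht hM h3 hC h.2 h.1
  -- A rainbow matching with t + 1 edges leaves two vertices x, y, and xy repeats the color of a
  -- matching edge uv, so there is a configuration. Without such a matching, Erdős–Gallai with m = t
  -- suffices.
  by_cases hr : ∃ s C, IsRainbow ⊤ c s C ∧ t < C.card
  · obtain ⟨s, C, hs, hC⟩ := hr
    have hC1 : C.card = t + 1 := by have := hno s C hs; omega
    have hs2 := hs.card_eq
    have hcard : 1 < (Finset.univ \ s).card := by
      rw [Finset.card_sdiff_of_subset (Finset.subset_univ _), Finset.card_univ]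
      omega
    obtain ⟨x, hx, y, hy, hxy⟩ := Finset.one_lt_card.mp hcard
    rw [Finset.mem_sdiff] at hx hy
    have hmem := hno.mem_of_add_one hs hC1 hx.2 hy.2 hxy
    obtain ⟨u, v, s', C', hu, hv, huv, hcol, hγ, rfl, rfl, hs'⟩ := hs.exists_eq_insert hmem
    rw [Finset.card_insert_of_notMem hγ] at hC1
    simp only [Finset.mem_insert, not_or] at hx hy
    refine Config.card_colors_le_of_common hc hno hN hall (s := s') (C := C') (u := u) (v := v)
      (x := x) (y := y) ⟨hs', ⟨hu, hv, hx.2.2.2, hy.2.2.2⟩, ?_, ?_, hcol.symm⟩ (by omega)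
    · simp only [List.nodup_cons, List.mem_cons, not_or, List.not_mem_nil, not_false_eq_true,
        List.nodup_nil, and_true]
      exact ⟨⟨huv, Ne.symm hx.2.1, Ne.symm hy.2.1⟩, ⟨Ne.symm hx.2.2.1, Ne.symm hy.2.2.1⟩, hxy⟩
    · rwa [hcol]
  · have := AntiRamsey.card_colors_le c hc Finset.univ ∅ t fun s C hs _ _ => by
      by_contra hlt
      exact hr ⟨s, C, hs, by omega⟩
    rw [Finset.sdiff_empty, Finset.card_univ, hN] at this
    rcases this with h | h
    · left; omega
    · right
      have : t * (t + 1) = t ^ 2 + t := by ring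
      have : 2 * t * (2 * t + 4) = 4 * t ^ 2 + 8 * t := by ring
      omega

end AntiRamsey

/-! ### From rainbow matchings to the path: exchanges. -/

namespace AntiRamsey

variable {V : Type*} [DecidableEq V] {c : V → V → ℕ} {s : Finset V} {C : Finset ℕ} {t : ℕ}
  {u v w x y : V}

/-- There is no rainbow path on four vertices together with a disjoint matching with `t` edges. -/
def NoRainbowPath (c : V → V → ℕ) (t : ℕ) : Prop :=
  ∀ s C p q r w, IsRainbow ⊤ c s C → t ≤ C.card → (p ∉ s ∧ q ∉ s ∧ r ∉ s ∧ w ∉ s) →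
    [p, q, r, w].Nodup → c p q ∉ C → c q r ∉ C → c r w ∉ C → c p q ≠ c q r → c p q ≠ c r w →
    c q r ≠ c r w → False

namespace NoRainbowPath

/-- The matching has one edge more than needed, so the single color that it may share with the path
can be given up. -/
theorem false_of_one (hP : NoRainbowPath c t) (h : IsRainbow ⊤ c s C) (hC : t + 1 ≤ C.card)
    {p q r w : V} (hs : p ∉ s ∧ q ∉ s ∧ r ∉ s ∧ w ∉ s) (hnd : [p, q, r, w].Nodup) (δ : ℕ)
    (h1 : c p q ∈ C → c p q = δ) (h2 : c q r ∈ C → c q r = δ) (h3 : c r w ∈ C → c r w = δ)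
    (h12 : c p q ≠ c q r) (h13 : c p q ≠ c r w) (h23 : c q r ≠ c r w) : False := by
  by_cases hδ : δ ∈ C
  · obtain ⟨a, b, s', -, -, -, -, rfl, h'⟩ := h.exists_edge hδ
    simp only [Finset.mem_insert, not_or] at hs
    refine hP s' (C.erase δ) p q r w h' (by rw [Finset.card_erase_of_mem hδ]; omega)
      ⟨hs.1.2.2, hs.2.1.2.2, hs.2.2.1.2.2, hs.2.2.2.2.2⟩ hnd ?_ ?_ ?_ h12 h13 h23 <;>
      rw [Finset.mem_erase] <;> rintro ⟨n1, n2⟩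
    exacts [n1 (h1 n2), n1 (h2 n2), n1 (h3 n2)]
  · exact hP s C p q r w h (by omega) hs hnd (fun hm => hδ (h1 hm ▸ hm)) (fun hm => hδ (h2 hm ▸ hm))
      (fun hm => hδ (h3 hm ▸ hm)) h12 h13 h23

/-- A new color on an edge between two matching edges would join them to a rainbow path on four
vertices, and t matching edges would remain. -/
theorem mem_of_mem (hP : NoRainbowPath c t) (hc : ∀ a b, c a b = c b a) (h : IsRainbow ⊤ c s C)
    (hC : C.card = t + 2) (hx : x ∈ s) (hy : y ∈ s) (hxy : x ≠ y) : c x y ∈ C := by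
  by_contra hcon
  obtain ⟨b, s', hx', hb, hxb, hmem, rfl, h'⟩ := h.exists_partner hc hx
  rw [Finset.mem_insert, Finset.mem_insert] at hy
  rcases hy with rfl | rfl | hy
  · exact hxy rfl
  · exact hcon hmem
  obtain ⟨b', s'', hy', hb', hyb, hmem', rfl, h''⟩ := h'.exists_partner hc hy
  rw [Finset.mem_erase] at hmem'
  simp only [Finset.mem_insert, not_or] at hx' hb
  refine hP _ _ b x y b' h'' ?_ ⟨hb.2.2, hx'.2.2, hy', hb'⟩ ?_ ?_ ?_ ?_ ?_ ?_ ?_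
  · rw [Finset.card_erase_of_mem (Finset.mem_erase.mpr hmem'), Finset.card_erase_of_mem hmem]; omega
  · simp [hxb.ne.symm, hb, hx', hyb.ne]
  · rw [hc b x]; simp
  · exact fun hm => hcon (Finset.mem_of_mem_erase (Finset.mem_of_mem_erase hm))
  · simp
  · rw [hc b x]; exact fun e => hcon (e ▸ hmem)
  · rw [hc b x]; exact Ne.symm hmem'.1
  · exact fun e => hcon (e ▸ hmem'.2)

/-- The situation of a vertex `v` outside of a rainbow matching with the edge `uw`. -/
structure Edge (c : V → V → ℕ) (s : Finset V) (C : Finset ℕ) (t : ℕ) (u w : V) : Prop where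
  rainbow : IsRainbow ⊤ c s C
  card : C.card = t + 1
  notMem : u ∉ s ∧ w ∉ s ∧ u ≠ w
  new : c u w ∉ C

theorem Edge.symm (hc : ∀ a b, c a b = c b a) (k : Edge c s C t u w) : Edge c s C t w u :=
  ⟨k.rainbow, k.card, ⟨k.notMem.2.1, k.notMem.1, k.notMem.2.2.symm⟩, by rw [hc]; exact k.new⟩

theorem exists_edge (hc : ∀ a b, c a b = c b a) (h : IsRainbow ⊤ c s C) (hC : C.card = t + 2)
    (hu : u ∈ s) : ∃ w s' C', Edge c s' C' t u w ∧ s = insert u (insert w s') ∧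
      C = insert (c u w) C' := by
  obtain ⟨w, s', hu', hw, huw, hmem, hs, h'⟩ := h.exists_partner hc hu
  refine ⟨w, s', _, ⟨h', ?_, ⟨hu', hw, huw.ne⟩, by simp⟩, hs, (Finset.insert_erase hmem).symm⟩
  rw [Finset.card_erase_of_mem hmem]; omega

/-- Otherwise w, u, v, x is a rainbow path, and t edges remain after removing uw and the edge at x.
-/
theorem mem_insert_of_new (hP : NoRainbowPath c t) (hc : ∀ a b, c a b = c b a)
    (k : Edge c s C t u w) (hv : v ∉ insert u (insert w s)) (hvu : c v u ∉ insert (c u w) C)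
    (hx : x ∈ s) : c v x ∈ insert (c v u) (insert (c u w) C) := by
  by_contra hcon
  obtain ⟨hu, hw, huw⟩ := k.notMem
  obtain ⟨b, s', hx', hb, hxb, hmem, rfl, h'⟩ := k.rainbow.exists_partner hc hx
  simp only [Finset.mem_insert, not_or] at hv hvu hcon hu hw
  refine hP _ _ w u v x h' ?_ ⟨hw.2.2, hu.2.2, hv.2.2.2.2, hx'⟩ ?_ ?_ ?_ ?_ ?_ ?_ ?_
  · rw [Finset.card_erase_of_mem hmem, k.card]; omega
  · simp [huw.symm, hw, hu, Ne.symm hv.1, Ne.symm hv.2.1, hv]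
  · rw [hc w u]; exact fun hm => k.new (Finset.mem_of_mem_erase hm)
  · rw [hc u v]; exact fun hm => hvu.2 (Finset.mem_of_mem_erase hm)
  · exact fun hm => hcon.2.2 (Finset.mem_of_mem_erase hm)
  · rw [hc w, hc u v]; exact Ne.symm hvu.1
  · rw [hc w]; exact Ne.symm hcon.2.1
  · rw [hc u v]; exact Ne.symm hcon.1

/-- A further new color on v'u gives the rainbow path v', u, v, w, and symmetrically for v'w. If it
is on v'z with z on another matching edge zz', then v'z replaces zz' and the path z', u, v, w shares
at most the color of z'u with the new matching. -/
theorem mem_pair_of_new_pair (hP : NoRainbowPath c t) (hc : ∀ a b, c a b = c b a)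
    (k : Edge c s C t u w) (hv : v ∉ insert u (insert w s)) (hvu : c v u ∉ insert (c u w) C)
    (hvw : c v w ∉ insert (c u w) C) (hne : c v u ≠ c v w) {v' z : V}
    (hv' : v' ∉ insert u (insert w s)) (hvv' : v' ≠ v) (hz : z ∈ insert u (insert w s)) :
    c v' z ∈ insert (c v u) (insert (c v w) (insert (c u w) C)) := by
  by_contra hcon
  obtain ⟨hu, hw, huw⟩ := k.notMem
  simp only [Finset.mem_insert, not_or] at hv hvu hvw hcon hv'
  rw [Finset.mem_insert, Finset.mem_insert] at hz
  rcases hz with rfl | rfl | hz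
  · refine hP _ _ v' z v w k.rainbow (by rw [k.card]; omega) ⟨hv'.2.2, hu, hv.2.2, hw⟩ ?_ hcon.2.2.2
      (by rw [hc]; exact hvu.2) hvw.2 (by rw [hc z v]; exact hcon.1) hcon.2.1
      (by rw [hc z v]; exact hne)
    simp [hv', hvv', huw, Ne.symm hv.1, hv]
  · refine hP _ _ v' z v u k.rainbow (by rw [k.card]; omega) ⟨hv'.2.2, hw, hv.2.2, hu⟩ ?_ hcon.2.2.2
      (by rw [hc]; exact hvw.2) hvu.2 (by rw [hc z v]; exact hcon.2.1) hcon.1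
      (by rw [hc z v]; exact hne.symm)
    simp [hv', hvv', huw.symm, Ne.symm hv.2.1, hv]
  · have h4 : insert (c u w) C ⊆ insert (c u w) C := subset_rfl
    have hzu : ∀ z' ∈ s, c z' u ∈ insert (c u w) C := fun z' hz' =>
      hP.mem_of_mem hc (k.rainbow.add hu hw huw k.new)
        (by rw [Finset.card_insert_of_notMem k.new, k.card]) (by simp [hz']) (by simp)
        (fun e => hu (e ▸ hz'))
    obtain ⟨z', s', hz1, hz2, hzz', hmem, rfl, h'⟩ := k.rainbow.exists_partner hc hz
    simp only [Finset.mem_insert, not_or] at hv hu hw hv'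
    have hzu' := hzu z' (by simp)
    have hne' : ∀ {δ}, δ ∉ insert (c u w) C → δ ≠ c z' u := fun h e => h (e ▸ hzu')
    refine hP.false_of_one (h'.add (a := v') (b := z) hv'.2.2.2.2 hz1 hv'.2.2.1
      (fun hm => hcon.2.2.2 (Finset.mem_of_mem_erase hm))) ?_ (p := z') (q := u) (r := v) (w := w)
      ⟨?_, ?_, ?_, ?_⟩ ?_ (c z' u) (fun _ => rfl) (fun hm => ?_) (fun hm => ?_) ?_ ?_ ?_
    · rw [Finset.card_insert_of_notMem (fun hm => hcon.2.2.2 (Finset.mem_of_mem_erase hm)),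
        Finset.card_erase_of_mem hmem, k.card]
      omega
    · simp [Ne.symm hv'.2.2.2.1, hzz'.ne.symm, hz2]
    · simp [Ne.symm hv'.1, hu]
    · simp [hvv'.symm, hv]
    · simp [Ne.symm hv'.2.1, hw]
    · simp [Ne.symm hu.2.1, Ne.symm hv.2.2.2.1, Ne.symm hw.2.1, Ne.symm hv.1, huw, hv]
    · rw [Finset.mem_insert, hc u v] at hm
      exact absurd hm (not_or.mpr ⟨Ne.symm hcon.1, fun hm => hvu.2 (Finset.mem_of_mem_erase hm)⟩)
    · rw [Finset.mem_insert] at hm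
      exact absurd hm (not_or.mpr ⟨Ne.symm hcon.2.1, fun hm => hvw.2 (Finset.mem_of_mem_erase hm)⟩)
    · rw [hc u v]; exact (hne' (by simp [hvu])).symm
    · exact (hne' (by simp [hvw])).symm
    · rw [hc u v]; exact hne

/-- If vv' and vv'' had distinct new colors, excluding the paths v, v'', u, w and v', v, v'', u
would force v''u to have the color of vv''. By symmetry v'u would have the color of vv' and v''w
that of vv'', and then v', u, w, v'' is a rainbow path. -/
theorem eq_of_adjacent (hP : NoRainbowPath c t) (hc : ∀ a b, c a b = c b a)
    (k : Edge c s C t u w) {v' v'' : V} (hv : v ∉ insert u (insert w s))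
    (hv' : v' ∉ insert u (insert w s)) (hv'' : v'' ∉ insert u (insert w s)) (h1 : v ≠ v')
    (h2 : v ≠ v'') (h3 : v' ≠ v'') (hn1 : c v v' ∉ insert (c u w) C)
    (hn2 : c v v'' ∉ insert (c u w) C) : c v v' = c v v'' := by
  by_contra hne
  have key : ∀ u w v' v'', Edge c s C t u w → v ∉ insert u (insert w s) →
      v' ∉ insert u (insert w s) → v'' ∉ insert u (insert w s) → v ≠ v' → v ≠ v'' → v' ≠ v'' →
      c v v' ∉ insert (c u w) C → c v v'' ∉ insert (c u w) C → c v v' ≠ c v v'' →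
      c v'' u = c v v'' := by
    intro u w v' v'' k hv hv' hv'' h1 h2 h3 hn1 hn2 hne
    by_contra hcon
    obtain ⟨hu, hw, huw⟩ := k.notMem
    simp only [Finset.mem_insert, not_or] at hv hv' hv'' hn1 hn2
    by_cases he : c v'' u = c v v'
    · refine hP _ _ v v'' u w k.rainbow (by rw [k.card]; omega) ⟨hv.2.2, hv''.2.2, hu, hw⟩
        (by simp [h2, hv, hv'', huw]) hn2.2 (by rw [he]; exact hn1.2) k.new (Ne.symm hcon) hn2.1
        (by rw [he]; exact hn1.1)
    · refine hP.false_of_one k.rainbow (by rw [k.card]) (p := v') (q := v) (r := v'') (w := u)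
        ⟨hv'.2.2, hv.2.2, hv''.2.2, hu⟩ (by simp [h1.symm, h3, hv', h2, hv, hv'']) (c v'' u)
        (fun hm => absurd hm (by rw [hc]; exact hn1.2)) (fun hm => absurd hm hn2.2) (fun _ => rfl)
        (by rw [hc v' v]; exact hne) (by rw [hc v' v]; exact Ne.symm he) (Ne.symm hcon)
  have e1 := key u w v'' v' k hv hv'' hv' h2 h1 h3.symm hn2 hn1 (Ne.symm hne)
  have e2 := key w u v' v'' (k.symm hc) (by rwa [Finset.insert_comm]) (by rwa [Finset.insert_comm])
    (by rwa [Finset.insert_comm]) h1 h2 h3 (by rwa [hc w u]) (by rwa [hc w u]) hne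
  obtain ⟨hu, hw, huw⟩ := k.notMem
  simp only [Finset.mem_insert, not_or] at hv' hv'' hn1 hn2
  exact hP _ _ v' u w v'' k.rainbow (by rw [k.card]; omega) ⟨hv'.2.2, hu, hw, hv''.2.2⟩
    (by simp [hv', h3, huw, Ne.symm hv''.1, Ne.symm hv''.2.1]) (by rw [e1]; exact hn1.2) k.new
    (by rw [hc w, e2]; exact hn2.2) (by rw [e1]; exact hn1.1) (by rw [e1, hc w, e2]; exact hne)
    (by rw [hc w v'', e2]; exact Ne.symm hn2.1)

end NoRainbowPath

end AntiRamsey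

/-! ### From rainbow matchings to the path: counting colors. -/

namespace AntiRamsey

variable {V : Type*} [DecidableEq V] {c : V → V → ℕ} {s : Finset V} {C : Finset ℕ} {t : ℕ}
  {u v w x y : V}

namespace NoRainbowPath

/-- For disjoint edges ab and de, either the color of bd is new and two steps between adjacent edges
give the claim, or it is old and a, b, d, e is a path sharing only this color with the matching. -/
theorem eq_of_new (hP : NoRainbowPath c t) (hc : ∀ a b, c a b = c b a) (h : IsRainbow ⊤ c s C)
    (hC : C.card = t + 2) {a b d e : V} (ha : a ∉ s) (hb : b ∉ s) (hd : d ∉ s) (he : e ∉ s)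
    (hab : a ≠ b) (hde : d ≠ e) (h1 : c a b ∉ C) (h2 : c d e ∉ C) : c a b = c d e := by
  obtain ⟨u, hu⟩ : s.Nonempty := Finset.card_pos.mp (by rw [h.card_eq]; omega)
  obtain ⟨w, s', C', k, rfl, rfl⟩ := exists_edge hc h hC hu
  have adj : ∀ {v v' v'' : V}, v ∉ insert u (insert w s') → v' ∉ insert u (insert w s') →
      v'' ∉ insert u (insert w s') → v ≠ v' → v ≠ v'' → c v v' ∉ insert (c u w) C' →
      c v v'' ∉ insert (c u w) C' → c v v' = c v v'' := by
    intro v v' v'' hv hv' hv'' n1 n2 m1 m2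
    by_cases n3 : v' = v''
    · rw [n3]
    · exact hP.eq_of_adjacent hc k hv hv' hv'' n1 n2 n3 m1 m2
  have h1' : c b a ∉ insert (c u w) C' := by rwa [hc b a]
  have h2' : c e d ∉ insert (c u w) C' := by rwa [hc e d]
  by_cases had : a = d
  · subst had; exact adj ha hb he hab hde h1 h2
  by_cases hae : a = e
  · subst hae; rw [hc d]; exact adj ha hb hd hab hde.symm h1 h2'
  by_cases hbd : b = d
  · subst hbd; rw [hc a]; exact adj hb ha he hab.symm hde h1' h2
  by_cases hbe : b = e
  · subst hbe; rw [hc a, hc d]; exact adj hb ha hd hab.symm hde.symm h1' h2'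
  by_cases hbd' : c b d ∈ insert (c u w) C'
  · by_contra hne
    refine hP.false_of_one h (by omega) (p := a) (q := b) (r := d) (w := e) ⟨ha, hb, hd, he⟩
      (by simp [hab, had, hae, hbd, hbe, hde]) (c b d) (fun hm => absurd hm h1) (fun _ => rfl)
      (fun hm => absurd hm h2) (fun e => h1 (e ▸ hbd')) hne (fun e => h2 (e ▸ hbd'))
  · rw [hc a, adj hb ha hd hab.symm hbd h1' hbd', hc b]
    exact adj hd hb he (Ne.symm hbd) hde (by rwa [hc d b]) h2

variable [Fintype V]

theorem card_colors_le (hP : NoRainbowPath c t) (hc : ∀ a b, c a b = c b a)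
    (h : IsRainbow ⊤ c s C) (hC : C.card = t + 2) :
    (colors c Finset.univ).card ≤ t + 3 + max 2 (Fintype.card V - (2 * t + 4)) := by
  have h1 : (colors c (Finset.univ \ s) \ C).card ≤ 1 := by
    rw [Finset.card_le_one]
    intro γ hγ δ hδ
    rw [Finset.mem_sdiff, mem_colors] at hγ hδ
    obtain ⟨⟨a, ha, b, hb, hab, rfl⟩, h1⟩ := hγ
    obtain ⟨⟨d, hd, e, he, hde, rfl⟩, h2⟩ := hδ
    rw [Finset.mem_sdiff] at ha hb hd he
    exact hP.eq_of_new hc h hC ha.2 hb.2 hd.2 he.2 hab hde h1 h2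
  have hQ : (Finset.univ \ s).card = Fintype.card V - (2 * t + 4) := by
    rw [Finset.card_sdiff_of_subset (Finset.subset_univ _), Finset.card_univ, h.card_eq, hC]
    rfl
  -- Either every uncovered vertex sees at most one new color towards the matching, or some vertex
  -- sees two; these then lead to the two ends of one matching edge, and no other uncovered vertex
  -- sees a third new color.
  have h2 : ((Finset.univ \ s).biUnion fun v => s.image (c v) \ C).card ≤
      max 2 (Fintype.card V - (2 * t + 4)) := by
    by_cases hall : ∀ v ∈ Finset.univ \ s, (s.image (c v) \ C).card ≤ 1
    · have := Finset.card_biUnion_le_card_mul _ _ 1 hall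
      rw [mul_one, hQ] at this
      exact this.trans (le_max_right _ _)
    push Not at hall
    obtain ⟨v, hv, h1⟩ := hall
    obtain ⟨γ, hγ, δ, hδ, hne⟩ := Finset.one_lt_card.mp h1
    rw [Finset.mem_sdiff, Finset.mem_image] at hγ hδ
    obtain ⟨⟨u, hu, rfl⟩, hγ⟩ := hγ
    obtain ⟨⟨z, hz, rfl⟩, hδ⟩ := hδ
    replace hv := (Finset.mem_sdiff.mp hv).2
    obtain ⟨w, s', C', k, rfl, rfl⟩ := exists_edge hc h hC hu
    have hzw : z = w := by
      rw [Finset.mem_insert, Finset.mem_insert] at hz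
      rcases hz with rfl | rfl | hz
      · exact absurd rfl hne
      · rfl
      · have := hP.mem_insert_of_new hc k hv hγ hz
        rw [Finset.mem_insert] at this
        exact absurd (this.resolve_left (Ne.symm hne)) hδ
    subst hzw
    refine le_trans (Finset.card_le_card (t := {c v u, c v z}) fun γ' hγ' => ?_)
      (Finset.card_le_two.trans (le_max_left _ _))
    simp only [Finset.mem_biUnion, Finset.mem_sdiff, Finset.mem_univ, true_and,
      Finset.mem_image] at hγ'
    obtain ⟨v', hv', ⟨z', hz', rfl⟩, hn⟩ := hγ'
    have : c v' z' ∈ insert (c v u) (insert (c v z) (insert (c u z) C')) := by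
      by_cases hvv' : v' = v
      · subst hvv'
        rw [Finset.mem_insert, Finset.mem_insert] at hz'
        rcases hz' with rfl | rfl | hz'
        · simp
        · simp
        · exact Finset.insert_subset_insert _ (Finset.subset_insert _ _)
            (hP.mem_insert_of_new hc k hv hγ hz')
      · exact hP.mem_pair_of_new_pair hc k hv hγ hδ hne hv' hvv' hz'
    rw [Finset.mem_insert, Finset.mem_insert] at this
    rw [Finset.mem_insert, Finset.mem_singleton]
    tauto
  have h3 : colors c Finset.univ ⊆ C ∪ ((Finset.univ \ s).biUnion fun v => s.image (c v) \ C) ∪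
      (colors c (Finset.univ \ s) \ C) := by
    intro γ hγ
    obtain ⟨p, -, q, -, hpq, rfl⟩ := mem_colors.mp hγ
    by_cases hm : c p q ∈ C
    · simp [hm]
    rw [Finset.mem_union, Finset.mem_union]
    by_cases hp : p ∈ s <;> by_cases hq : q ∈ s
    · exact absurd (hP.mem_of_mem hc h hC hp hq hpq) hm
    · refine .inl (.inr (Finset.mem_biUnion.mpr ⟨q, by simp [hq], Finset.mem_sdiff.mpr ⟨?_, hm⟩⟩))
      rw [hc]; exact Finset.mem_image_of_mem _ hp
    · exact .inl (.inr (Finset.mem_biUnion.mpr ⟨p, by simp [hp], Finset.mem_sdiff.mpr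
        ⟨Finset.mem_image_of_mem _ hq, hm⟩⟩))
    · exact .inr (Finset.mem_sdiff.mpr ⟨mem_colors.mpr ⟨p, by simp [hp], q, by simp [hq], hpq, rfl⟩, hm⟩)
  have h4 := Finset.card_le_card h3
  have h5 := Finset.card_union_le (C ∪ ((Finset.univ \ s).biUnion fun v => s.image (c v) \ C))
    (colors c (Finset.univ \ s) \ C)
  have h6 := Finset.card_union_le C ((Finset.univ \ s).biUnion fun v => s.image (c v) \ C)
  omega

theorem bound (hP : NoRainbowPath c t) (hc : ∀ a b, c a b = c b a) (h : IsRainbow ⊤ c s C)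
    (hC : C.card = t + 2) (ht : 1 ≤ t) (hN : 2 * t + 5 ≤ Fintype.card V) :
    Bound t (Fintype.card V) (colors c Finset.univ).card := by
  have h1 := hP.card_colors_le hc h hC
  generalize (colors c Finset.univ).card = K at *
  generalize Fintype.card V = N at *
  obtain ⟨m, rfl⟩ : ∃ m, t = m + 1 := ⟨t - 1, by omega⟩
  rcases le_total (N - (2 * (m + 1) + 4)) 2 with h2 | h2
  · rw [max_eq_left h2] at h1
    rcases m with _ | m
    · right; omega
    · left; nlinarith
  · rw [max_eq_right h2] at h1
    right
    have : K + m + 2 ≤ N := by omega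
    nlinarith [Nat.zero_le (m * N), Nat.mul_le_mul_left m hN]

theorem card_colors_le_of_subset (hP : NoRainbowPath c t) (hc : ∀ a b, c a b = c b a)
    (h : IsRainbow ⊤ c s C) (hC : C.card = t + 2) (hN : Fintype.card V = 2 * t + 4) :
    (colors c Finset.univ).card ≤ t + 2 := by
  have hs : s = Finset.univ := by
    rw [← Finset.card_eq_iff_eq_univ, h.card_eq, hC, hN]; ring
  rw [← hC]
  refine Finset.card_le_card fun γ hγ => ?_
  obtain ⟨p, -, q, -, hpq, rfl⟩ := mem_colors.mp hγ
  exact hP.mem_of_mem hc h hC (by simp [hs]) (by simp [hs]) hpq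

/-- The general estimate would allow more colors here, so the case is treated directly. The matching
consists of uw and xy, and ux has one of their two colors; whichever it is, an edge of a third color
with an end off the matching closes a rainbow path. -/
theorem card_colors_le_two (hP : NoRainbowPath c 0) (hc : ∀ a b, c a b = c b a)
    (h : IsRainbow ⊤ c s C) (hC : C.card = 2) : (colors c Finset.univ).card ≤ 2 := by
  have four : ∀ p q r w, [p, q, r, w].Nodup → c p q ≠ c q r → c p q ≠ c r w → c q r ≠ c r w →
      False := fun p q r w hnd => hP ∅ ∅ p q r w .nil (by simp) (by simp) hnd (by simp) (by simp)
      (by simp)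
  have hin : ∀ p ∈ s, ∀ q ∈ s, p ≠ q → c p q ∈ C := fun p hp q hq => hP.mem_of_mem hc h hC hp hq
  obtain ⟨u, hu⟩ : s.Nonempty := Finset.card_pos.mp (by rw [h.card_eq]; omega)
  have key : ∀ u ∈ s, ∃ w x y, s = {u, w, x, y} ∧ [u, w, x, y].Nodup ∧ C = {c u w, c x y} ∧
      c u w ≠ c x y := by
    intro u hu
    obtain ⟨w, s', C', k, rfl, rfl⟩ := exists_edge hc h hC hu
    obtain ⟨hu', hw, huw⟩ := k.notMem
    obtain ⟨γ, rfl⟩ := Finset.card_eq_one.mp k.card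
    obtain ⟨x, y, s'', hx, hy, hxy, rfl, rfl, h''⟩ := k.rainbow.exists_edge (Finset.mem_singleton_self _)
    have : s'' = ∅ := Finset.card_eq_zero.mp (by rw [h''.card_eq]; simp)
    subst this
    refine ⟨w, x, y, by simp, ?_, rfl, by simpa using k.new⟩
    simp only [Finset.mem_insert, not_or] at hu' hw
    simp [huw, hu', hw, hxy.ne]
  have hQ : ∀ v, v ∉ s → ∀ u ∈ s, c v u ∈ C := by
    intro v hv u hu
    by_contra hcon
    obtain ⟨w, x, y, rfl, hnd, rfl, hne⟩ := key u hu
    have hux := hin u (by simp) x (by simp)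
    simp only [List.nodup_cons, List.mem_cons, not_or, List.not_mem_nil, not_false_eq_true,
      List.nodup_nil, and_true, Finset.mem_insert, Finset.mem_singleton] at hnd hv hcon hux
    have f1 := four y x v u (by simp [Ne.symm hnd.2.2, Ne.symm hnd.1.2.2, Ne.symm hnd.1.2.1, Ne.symm hv.2.2.2, Ne.symm hv.2.2.1, hv])
    have f2 := four w u v x (by simp [hnd, Ne.symm hnd.1.1, Ne.symm hv.2.1, Ne.symm hv.1, hv])
    have f3 := four v u x y (by simp [hnd, hv])
    have f4 := four v x u w (by simp [hnd, Ne.symm hnd.1.2.1, Ne.symm hnd.2.1.1, hv])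
    rw [hc y x, hc x v] at f1
    rw [hc w u, hc u v] at f2
    rw [hc x u] at f4
    have := hux hnd.1.2.1
    clear hin key four hP h
    grind
  rw [← hC]
  refine Finset.card_le_card fun γ hγ => ?_
  obtain ⟨v', -, v, -, hvv', rfl⟩ := mem_colors.mp hγ
  by_cases hv' : v' ∈ s <;> by_cases hv : v ∈ s
  · exact hin _ hv' _ hv hvv'
  · rw [hc]; exact hQ v hv v' hv'
  · exact hQ v' hv' v hv
  · by_contra hcon
    obtain ⟨w, x, y, rfl, hnd, rfl, hne⟩ := key u hu
    have hux := hin u (by simp) x (by simp)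
    have hvu := hQ v hv u (by simp)
    have hvx := hQ v hv x (by simp)
    simp only [List.nodup_cons, List.mem_cons, not_or, List.not_mem_nil, not_false_eq_true,
      List.nodup_nil, and_true, Finset.mem_insert, Finset.mem_singleton] at hnd hv hv' hcon hux hvu hvx
    have f1 := four v' v u w (by simp [hnd, hvv', hv, hv'])
    have f2 := four v' v x y (by simp [hnd, hvv', hv, hv'])
    have f3 := four v' v u x (by simp [hnd, hvv', hv, hv'])
    have f4 := four v' v x u (by simp [Ne.symm hnd.1.2.1, hvv', hv, hv'])
    rw [hc x u] at f4
    have := hux hnd.1.2.1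
    clear hin key four hP h hQ
    grind

end NoRainbowPath

end AntiRamsey

/-! ### The upper bounds. -/

namespace AntiRamsey

theorem IsRainbow.exists_card_eq {V : Type*} [DecidableEq V] {G : SimpleGraph V} {c : V → V → ℕ}
    {m : ℕ} (k : ℕ) : ∀ {s : Finset V} {C : Finset ℕ}, IsRainbow G c s C → C.card = m + k →
    ∃ s' C', IsRainbow G c s' C' ∧ C'.card = m := by
  induction k with
  | zero => exact fun h hC => ⟨_, _, h, hC⟩
  | succ k ih =>
    intro s C h hC
    obtain ⟨γ, hγ⟩ : C.Nonempty := Finset.card_pos.mp (by omega)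
    obtain ⟨a, b, s', -, -, -, -, -, h'⟩ := h.exists_edge hγ
    exact ih h' (by rw [Finset.card_erase_of_mem hγ]; omega)

variable {V : Type*} [DecidableEq V] {c : V → V → ℕ} {t : ℕ}

theorem noRainbow_or_exists_card_eq (c : V → V → ℕ) (m : ℕ) :
    NoRainbow c m ∨ ∃ s C, IsRainbow ⊤ c s C ∧ C.card = m + 1 := by
  by_cases h : NoRainbow c m
  · exact .inl h
  · simp only [NoRainbow, not_forall, not_lt] at h
    obtain ⟨s, C, h, hC⟩ := h
    exact .inr (h.exists_card_eq (C.card - (m + 1)) (by omega))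

namespace NoRainbowPath

variable [Fintype V]

theorem bound_card_colors (hP : NoRainbowPath c t) (hc : ∀ a b, c a b = c b a) (ht : 1 ≤ t)
    (hN : 2 * t + 5 ≤ Fintype.card V) : Bound t (Fintype.card V) (colors c Finset.univ).card := by
  rcases noRainbow_or_exists_card_eq c (t + 1) with hno | ⟨s, C, h, hC⟩
  · exact bound_of_noRainbow hc hno hN
  · exact hP.bound hc h hC ht hN

theorem card_colors_le_of_card_eq (hP : NoRainbowPath c t) (hc : ∀ a b, c a b = c b a) (ht : 1 ≤ t)
    (hN : Fintype.card V = 2 * t + 4) :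
    (colors c Finset.univ).card ≤ 2 * t ^ 2 + t + 2 ∨
      2 * (colors c Finset.univ).card ≤ 3 * t ^ 2 + 7 * t + 2 := by
  rcases noRainbow_or_exists_card_eq c (t + 1) with hno | ⟨s, C, h, hC⟩
  · exact card_colors_le_of_noRainbow hc hno hN ht
  · have := hP.card_colors_le_of_subset hc h hC hN
    left
    nlinarith

theorem card_colors_le_two_of_zero (hP : NoRainbowPath c 0) (hc : ∀ a b, c a b = c b a)
    (hN : 5 ≤ Fintype.card V) : (colors c Finset.univ).card ≤ 2 := by
  rcases noRainbow_or_exists_card_eq c 1 with hno | ⟨s, C, h, hC⟩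
  · rcases bound_of_noRainbow (t := 0) hc hno hN with h | h <;> omega
  · exact hP.card_colors_le_two hc h hC

/-- Without a rainbow perfect matching of K₄ the edges of each of its three perfect matchings share
a color. With one, the vertices are all covered and only its two colors occur. -/
theorem card_colors_le_three {c : Fin 4 → Fin 4 → ℕ} (hP : NoRainbowPath c 0)
    (hc : ∀ a b, c a b = c b a) : (colors c Finset.univ).card ≤ 3 := by
  rcases noRainbow_or_exists_card_eq c 1 with hno | ⟨s, C, h, hC⟩
  · have key : ∀ a b d e : Fin 4, [a, b, d, e].Nodup → c a b = c d e := by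
      intro a b d e hnd
      by_contra hne
      simp only [List.nodup_cons, List.mem_cons, List.not_mem_nil, or_false, not_or] at hnd
      have := hno _ _ ((IsRainbow.pair (c := c) hnd.2.2.1).add (a := a) (b := b)
        (by simp [hnd]) (by simp [hnd]) hnd.1.1 (by simpa using hne))
      rw [Finset.card_insert_of_notMem (by simpa using hne), Finset.card_singleton] at this
      omega
    have h1 := key 0 1 2 3 (by decide)
    have h2 := key 0 2 1 3 (by decide)
    have h3 := key 0 3 1 2 (by decide)
    refine (Finset.card_le_card (t := {c 0 1, c 0 2, c 0 3}) fun γ hγ => ?_).trans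
      Finset.card_le_three
    obtain ⟨a, -, b, -, hab, rfl⟩ := mem_colors.mp hγ
    fin_cases a <;> fin_cases b <;> first | exact absurd rfl hab | skip
    all_goals simp [h1, h2, h3, hc 1 0, hc 2 0, hc 3 0, hc 2 1, hc 3 1, hc 3 2]
  · exact (hP.card_colors_le_of_subset hc h hC (by simp)).trans (by omega)

end NoRainbowPath

end AntiRamsey

/-! ### Lower bounds: colorings with one repeated color. -/

namespace AntiRamsey

variable {V : Type*} [DecidableEq V] {c : V → V → ℕ}

/-- At most half of the vertices of a clique are used by the colors of a rainbow matching that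
only occur inside the clique. -/
theorem IsRainbow.two_mul_card_erase_le {s : Finset V} {C : Finset ℕ} (h : IsRainbow ⊤ c s C)
    {A : Finset V} (hA : ∀ a b, c a b ≠ 0 → a ∈ A ∧ b ∈ A) :
    2 * (C.erase 0).card ≤ (s ∩ A).card := by
  induction h with
  | nil => simp
  | @cons s C a b hs ha hb hab hC ih =>
    by_cases h0 : c a b = 0
    · rw [h0] at hC ⊢
      rw [Finset.erase_insert hC]
      rw [Finset.erase_eq_of_notMem hC] at ih
      exact ih.trans (Finset.card_le_card (by grind))
    · obtain ⟨h1, h2⟩ := hA a b h0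
      rw [Finset.erase_insert_of_ne h0, Finset.card_insert_of_notMem (by grind),
        Finset.insert_inter_of_mem h1, Finset.insert_inter_of_mem h2,
        Finset.card_insert_of_notMem, Finset.card_insert_of_notMem (by grind)]
      · omega
      · have := hab.ne
        grind

theorem IsRainbow.card_erase_le {s : Finset V} {C : Finset ℕ} (h : IsRainbow ⊤ c s C)
    {A : Finset V} (hA : ∀ a b, c a b ≠ 0 → a ∈ A ∨ b ∈ A) :
    (C.erase 0).card ≤ (s ∩ A).card := by
  induction h with
  | nil => simp
  | @cons s C a b hs ha hb hab hC ih =>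
    by_cases h0 : c a b = 0
    · rw [h0] at hC ⊢
      rw [Finset.erase_insert hC]
      rw [Finset.erase_eq_of_notMem hC] at ih
      exact ih.trans (Finset.card_le_card (by grind))
    · rw [Finset.erase_insert_of_ne h0, Finset.card_insert_of_notMem (by grind)]
      refine Nat.lt_of_le_of_lt ih (Finset.card_lt_card ?_)
      rw [Finset.ssubset_iff]
      rcases hA a b h0 with h1 | h1
      · exact ⟨a, by grind, by grind⟩
      · exact ⟨b, by grind, by grind⟩

/-- The coloring in which the edges of `G` have pairwise distinct colors and all other edges have
the color `0`. -/
noncomputable def edgeColoring {n : ℕ} (G : SimpleGraph (Fin n)) (a b : Fin n) : ℕ :=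
  open Classical in
  -- The successor keeps the color 0 for the edges outside of `G`.
  if G.Adj a b then Encodable.encode (min a b, max a b) + 1 else 0

section edgeColoring

variable {n : ℕ} {G : SimpleGraph (Fin n)}

theorem edgeColoring_comm (a b : Fin n) : edgeColoring G a b = edgeColoring G b a := by
  by_cases h : G.Adj a b
  · simp [edgeColoring, h, h.symm, min_comm a b, max_comm a b]
  · have h' : ¬ G.Adj b a := fun h' => h h'.symm
    simp [edgeColoring, h, h']

theorem adj_of_edgeColoring_ne_zero {a b : Fin n} (h : edgeColoring G a b ≠ 0) : G.Adj a b := by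
  by_contra h'
  simp [edgeColoring, h'] at h

theorem card_colors_edgeColoring (hG : G ≠ ⊤) :
    (colors (edgeColoring G) Finset.univ).card = G.edgeSet.ncard + 1 := by
  classical
  have hsymm : ∀ a b : Fin n, Encodable.encode (min a b, max a b) + 1 =
    Encodable.encode (min b a, max b a) + 1 := fun a b => by rw [min_comm, max_comm]
  let g : Sym2 (Fin n) → ℕ := Sym2.lift ⟨fun a b => Encodable.encode (min a b, max a b) + 1, hsymm⟩
  have hg : Function.Injective g := by
    intro x y
    induction x using Sym2.ind with | _ a b
    induction y using Sym2.ind with | _ d e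
    intro h
    have h' : (min a b, max a b) = (min d e, max d e) :=
      Encodable.encode_injective (Nat.succ_injective h)
    rw [Prod.mk.injEq] at h'
    grind [Sym2.eq_iff]
  have h : (colors (edgeColoring G) Finset.univ : Set ℕ) = insert 0 (g '' G.edgeSet) := by
    ext γ
    simp only [Finset.mem_coe, mem_colors, Finset.mem_univ, true_and, Set.mem_insert_iff,
      Set.mem_image]
    constructor
    · rintro ⟨a, b, -, rfl⟩
      by_cases hab : G.Adj a b
      · exact .inr ⟨s(a, b), hab, by simp [g, edgeColoring, hab]⟩
      · exact .inl (by simp [edgeColoring, hab])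
    · rintro (rfl | ⟨e, he, rfl⟩)
      · by_contra hcon
        refine hG (eq_top_iff.mpr fun a b hab => ?_)
        by_contra hG'
        exact hcon ⟨a, b, hab, by simp [edgeColoring, hG']⟩
      · induction e using Sym2.ind with | _ a b
        exact ⟨a, b, he.ne, by simp [g, edgeColoring, G.mem_edgeSet.mp he]⟩
  rw [← Set.ncard_coe_finset, h, Set.ncard_insert_of_notMem, Set.ncard_image_of_injective _ hg]
  rintro ⟨e, -, he⟩
  induction e using Sym2.ind with | _ a b
  simp [g] at he

end edgeColoring

end AntiRamsey

/-! ### The extremal colorings. -/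

namespace AntiRamsey

variable {n : ℕ}

/-- The complete graph on the vertex set `A`, as a graph on `Fin n`. -/
def completeOn (A : Finset (Fin n)) : SimpleGraph (Fin n) where
  Adj a b := a ≠ b ∧ a ∈ A ∧ b ∈ A
  symm := ⟨fun _ _ h => ⟨h.1.symm, h.2.2, h.2.1⟩⟩
  loopless := ⟨fun _ h => h.1 rfl⟩

theorem ncard_edgeSet_completeOn (A : Finset (Fin n)) :
    (completeOn A).edgeSet.ncard = A.card.choose 2 := by
  rw [← Sym2.card_image_offDiag, ← Set.ncard_coe_finset]
  congr 1
  ext e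
  induction e using Sym2.ind with | _ a b
  simp only [SimpleGraph.mem_edgeSet, completeOn, Finset.coe_image, Set.mem_image,
    Finset.mem_coe, Finset.mem_offDiag, Prod.exists]
  constructor
  · rintro ⟨h1, h2, h3⟩
    exact ⟨a, b, ⟨h2, h3, h1⟩, rfl⟩
  · rintro ⟨d, e, ⟨h1, h2, h3⟩, h4⟩
    rcases Sym2.eq_iff.mp h4 with ⟨rfl, rfl⟩ | ⟨rfl, rfl⟩
    · exact ⟨h3, h1, h2⟩
    · exact ⟨h3.symm, h2, h1⟩

theorem ncard_edgeSet_compl_completeOn (A : Finset (Fin n)) :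
    (completeOn A)ᶜ.edgeSet.ncard = n.choose 2 - A.card.choose 2 := by
  have h : (⊤ : SimpleGraph (Fin n)) = completeOn Finset.univ := by
    ext a b
    simp [completeOn]
  rw [← top_sdiff, SimpleGraph.edgeSet_sdiff, Set.ncard_sdiff (SimpleGraph.edgeSet_mono le_top),
    ncard_edgeSet_completeOn, h, ncard_edgeSet_completeOn, Finset.card_univ, Fintype.card_fin]

/-- At most t disjoint edges fit into 2t + 1 vertices, and only one edge of a rainbow matching can
have the common color. The condition on n guarantees that this color occurs among the two or more
other vertices. -/
theorem exists_noRainbow_of_clique {t : ℕ} (hn : 2 * t + 3 ≤ n) :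
    ∃ c : Fin n → Fin n → ℕ, (∀ a b, c a b = c b a) ∧ NoRainbow c (t + 1) ∧
      (colors c Finset.univ).card = t * (2 * t + 1) + 1 := by
  obtain ⟨A, -, hA⟩ := Finset.exists_subset_card_eq (s := (Finset.univ : Finset (Fin n)))
    (n := 2 * t + 1) (by rw [Finset.card_univ, Fintype.card_fin]; omega)
  refine ⟨edgeColoring (completeOn A), edgeColoring_comm, fun s C h => ?_, ?_⟩
  · have h1 := h.two_mul_card_erase_le (A := A) fun a b h0 => (adj_of_edgeColoring_ne_zero h0).2
    have h2 := Finset.card_le_card (Finset.inter_subset_right (s₁ := s) (s₂ := A))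
    have h3 := Finset.pred_card_le_card_erase (s := C) (a := 0)
    omega
  · rw [card_colors_edgeColoring, ncard_edgeSet_completeOn, hA, Nat.choose_two_right,
      Nat.add_sub_cancel, show (2 * t + 1) * (2 * t) = 2 * (t * (2 * t + 1)) by ring,
      Nat.mul_div_cancel_left _ two_pos]
    intro hG
    obtain ⟨a, ha, b, hb, hab⟩ := Finset.one_lt_card.mp
      (show 1 < Aᶜ.card by rw [Finset.card_compl, Fintype.card_fin]; omega)
    have : (completeOn A).Adj a b := by rw [hG]; exact hab
    exact Finset.mem_compl.mp ha this.2.1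

/-- Every edge of a rainbow matching but one meets the fixed set of t vertices. -/
theorem exists_noRainbow_of_cover {t : ℕ} (hn : t + 2 ≤ n) :
    ∃ c : Fin n → Fin n → ℕ, (∀ a b, c a b = c b a) ∧ NoRainbow c (t + 1) ∧
      (colors c Finset.univ).card = n.choose 2 - (n - t).choose 2 + 1 := by
  obtain ⟨A, -, hA⟩ := Finset.exists_subset_card_eq (s := (Finset.univ : Finset (Fin n)))
    (n := t) (by rw [Finset.card_univ, Fintype.card_fin]; omega)
  have hA' : Aᶜ.card = n - t := by rw [Finset.card_compl, hA, Fintype.card_fin]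
  refine ⟨edgeColoring (completeOn Aᶜ)ᶜ, edgeColoring_comm, fun s C h => ?_, ?_⟩
  · have h1 := h.card_erase_le (A := A) fun a b h0 => by
      have := adj_of_edgeColoring_ne_zero h0
      rw [SimpleGraph.compl_adj] at this
      by_contra hcon
      rw [not_or] at hcon
      exact this.2 ⟨this.1, Finset.mem_compl.mpr hcon.1, Finset.mem_compl.mpr hcon.2⟩
    have h2 := Finset.card_le_card (Finset.inter_subset_right (s₁ := s) (s₂ := A))
    have h3 := Finset.pred_card_le_card_erase (s := C) (a := 0)
    omega
  · rw [card_colors_edgeColoring, ncard_edgeSet_compl_completeOn, hA']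
    intro hG
    obtain ⟨a, ha, b, hb, hab⟩ := Finset.one_lt_card.mp (show 1 < Aᶜ.card by omega)
    have : ((completeOn Aᶜ)ᶜ).Adj a b := by rw [hG]; exact hab
    exact ((SimpleGraph.compl_adj _ _ _).mp this).2 ⟨hab, ha, hb⟩

/-- The complete graph on `2 t + 1` vertices is rainbow; of the remaining edges those with exactly
one end in a fixed pair of the other three vertices get a second new color. -/
theorem exists_noRainbow_of_pair (t : ℕ) :
    ∃ c : Fin (2 * t + 4) → Fin (2 * t + 4) → ℕ, (∀ a b, c a b = c b a) ∧ NoRainbow c (t + 1) ∧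
      t * (2 * t + 1) + 2 ≤ (colors c Finset.univ).card := by
  let x : Fin (2 * t + 4) := ⟨2 * t + 1, by omega⟩
  let y : Fin (2 * t + 4) := ⟨2 * t + 2, by omega⟩
  let z : Fin (2 * t + 4) := ⟨2 * t + 3, by omega⟩
  have hxy : x ≠ y := by simp [x, y]
  have hxz : x ≠ z := by simp [x, z]
  have hyz : y ≠ z := by simp [y, z]
  let A : Finset (Fin (2 * t + 4)) := {x, y, z}ᶜ
  have hA : A.card = 2 * t + 1 := by
    rw [Finset.card_compl, Fintype.card_fin, Finset.card_eq_three.mpr ⟨x, y, z, hxy, hxz, hyz, rfl⟩]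
    omega
  have hmem : ∀ v, v ∈ A ↔ v ≠ x ∧ v ≠ y ∧ v ≠ z := by simp [A]
  let P : Fin (2 * t + 4) → Prop := fun v => v = x ∨ v = y
  have hG : completeOn A ≠ ⊤ := fun hG => by
    have : (completeOn A).Adj x y := by rw [hG]; exact hxy
    exact ((hmem x).mp this.2.1).1 rfl
  have hcard : (colors (edgeColoring (completeOn A)) Finset.univ).card = t * (2 * t + 1) + 1 := by
    rw [card_colors_edgeColoring hG, ncard_edgeSet_completeOn, hA, Nat.choose_two_right,
      Nat.add_sub_cancel, show (2 * t + 1) * (2 * t) = 2 * (t * (2 * t + 1)) by ring,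
      Nat.mul_div_cancel_left _ two_pos]
  -- Clique colors are shifted to values of at least 2, so that the color 1 remains for the edges
  -- with exactly one end in x, y.
  let c : Fin (2 * t + 4) → Fin (2 * t + 4) → ℕ := fun a b =>
    if edgeColoring (completeOn A) a b = 0 ∧ (P a ↔ P b) then 0
    else edgeColoring (completeOn A) a b + 1
  have hout : ∀ a b, a ∉ A → edgeColoring (completeOn A) a b = 0 := fun a b ha => by
    by_contra h0
    exact ha (adj_of_edgeColoring_ne_zero h0).2.1
  have hc : ∀ a b, c a b = c b a := fun a b => by
    simp only [c, edgeColoring_comm a b, iff_comm (a := P a)]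
  have hx : x ∉ A := fun h => ((hmem x).mp h).1 rfl
  have hy : y ∉ A := fun h => ((hmem y).mp h).2.1 rfl
  have hz : z ∉ A := fun h => ((hmem z).mp h).2.2 rfl
  have hPz : ¬ P z := fun h => h.elim (fun h => hxz h.symm) (fun h => hyz h.symm)
  have hone : ∀ a b, a ∉ A → P a → ¬ P b → c a b = 1 := fun a b ha h1 h2 => by
    simp [c, hout a b ha, h1, h2]
  have hzero : ∀ a b, a ∉ A → (P a ↔ P b) → c a b = 0 := fun a b ha h1 => by
    simp [c, hout a b ha, h1]
  refine ⟨c, hc, fun s C h => ?_, ?_⟩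
  · by_contra hlt
    -- A rainbow matching with t + 2 edges would be perfect. If it contains xy, then this edge and
    -- the edge at z both have color 0; otherwise the edges at x and at y both have color 1.
    obtain ⟨s, C, h, hC⟩ := h.exists_card_eq (m := t + 2) (C.card - (t + 2)) (by omega)
    have hs : s = Finset.univ := by
      rw [← Finset.card_eq_iff_eq_univ, h.card_eq, hC, Fintype.card_fin]; ring
    obtain ⟨b, s', h1, h2, h3, h4, h5, h6⟩ := h.exists_partner hc (v := x) (hs ▸ Finset.mem_univ x)
    have hall : ∀ v, v = x ∨ v = b ∨ v ∈ s' := fun v => by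
      have := hs ▸ Finset.mem_univ v
      rw [h5] at this
      simpa using this
    by_cases hb : b = y
    · subst hb
      have hzs : z ∈ s' := ((hall z).resolve_left hxz.symm).resolve_left hyz.symm
      obtain ⟨d, s'', -, -, -, k1, k2, -⟩ := h6.exists_partner hc hzs
      have hd : d ∈ s' := by rw [k2]; simp
      have hPd : ¬ P d := by rintro (rfl | rfl) <;> contradiction
      rw [hzero x y hx (by simp [P]), hzero z d hz (by simp [hPz, hPd])] at k1
      simp at k1
    · have hPb : ¬ P b := by
        rintro (rfl | rfl)
        · exact h3.ne rfl
        · exact hb rfl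
      have hys : y ∈ s' := ((hall y).resolve_left hxy.symm).resolve_left (Ne.symm hb)
      obtain ⟨d, s'', k0, -, k3, k1, k2, -⟩ := h6.exists_partner hc hys
      have hd : d ∈ s' := by rw [k2]; simp
      have hPd : ¬ P d := by
        rintro (rfl | rfl)
        · contradiction
        · exact k3.ne rfl
      rw [hone x b hx (.inl rfl) hPb, hone y d hy (.inr rfl) hPd] at k1
      simp at k1
  · have hsub : insert 0 ((colors (edgeColoring (completeOn A)) Finset.univ).image Nat.succ) ⊆
        colors c Finset.univ := by
      intro γ hγ
      rw [mem_colors]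
      rcases Finset.mem_insert.mp hγ with rfl | hγ
      · exact ⟨x, by simp, y, by simp, hxy, hzero x y hx (by simp [P])⟩
      obtain ⟨δ, hδ, rfl⟩ := Finset.mem_image.mp hγ
      obtain ⟨a, -, b, -, hab, rfl⟩ := mem_colors.mp hδ
      by_cases h0 : edgeColoring (completeOn A) a b = 0
      · exact ⟨x, by simp, z, by simp, hxz, by rw [h0, hone x z hx (.inl rfl) hPz]⟩
      · exact ⟨a, by simp, b, by simp, hab, by simp [c, h0]⟩
    have := Finset.card_le_card hsub
    rw [Finset.card_insert_of_notMem (by simp), Finset.card_image_of_injective _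
      Nat.succ_injective, hcard] at this
    exact this

end AntiRamsey

/-! ### Edge-colorings of the complete graph as symmetric functions. -/

namespace AntiRamsey

/-- The symmetric function on pairs of vertices that an edge-coloring of `K_n` defines. -/
noncomputable def pairColoring {n : ℕ} (c : (⊤ : SimpleGraph (Fin n)).edgeSet → ℕ)
    (a b : Fin n) : ℕ :=
  if h : a ≠ b then c ⟨s(a, b), h⟩ else 0

section pairColoring

variable {n : ℕ} {c : (⊤ : SimpleGraph (Fin n)).edgeSet → ℕ}

theorem pairColoring_of_ne {a b : Fin n} (h : a ≠ b) : pairColoring c a b = c ⟨s(a, b), h⟩ :=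
  dif_pos h

theorem pairColoring_comm (a b : Fin n) : pairColoring c a b = pairColoring c b a := by
  by_cases h : a = b
  · rw [h]
  · rw [pairColoring_of_ne h, pairColoring_of_ne (Ne.symm h)]
    congr 2
    exact Sym2.eq_swap

theorem ncard_range_eq (c : (⊤ : SimpleGraph (Fin n)).edgeSet → ℕ) :
    (Set.range c).ncard = (colors (pairColoring c) Finset.univ).card := by
  rw [← Set.ncard_coe_finset]
  congr 1
  ext γ
  simp only [Set.mem_range, Finset.mem_coe, mem_colors, Finset.mem_univ, true_and]
  constructor
  · rintro ⟨⟨e, he⟩, rfl⟩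
    induction e using Sym2.ind with | _ a b
    exact ⟨a, b, he, pairColoring_of_ne he⟩
  · rintro ⟨a, b, hab, rfl⟩
    exact ⟨⟨s(a, b), hab⟩, (pairColoring_of_ne hab).symm⟩

/-- The edge-coloring of `K_n` that a symmetric function on pairs of vertices defines. -/
def ofPairColoring (d : Fin n → Fin n → ℕ) (hd : ∀ a b, d a b = d b a)
    (e : (⊤ : SimpleGraph (Fin n)).edgeSet) : ℕ :=
  Sym2.lift ⟨d, hd⟩ e.1

theorem pairColoring_ofPairColoring {d : Fin n → Fin n → ℕ} (hd : ∀ a b, d a b = d b a)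
    {a b : Fin n} (hab : a ≠ b) : pairColoring (ofPairColoring d hd) a b = d a b := by
  rw [pairColoring_of_ne hab]
  rfl

theorem ncard_range_ofPairColoring {d : Fin n → Fin n → ℕ} (hd : ∀ a b, d a b = d b a) :
    (Set.range (ofPairColoring d hd)).ncard = (colors d Finset.univ).card := by
  rw [ncard_range_eq]
  congr 1
  ext γ
  simp only [mem_colors]
  constructor <;> rintro ⟨a, ha, b, hb, hab, h⟩
  · exact ⟨a, ha, b, hb, hab, by rw [← h, pairColoring_ofPairColoring hd hab]⟩
  · exact ⟨a, ha, b, hb, hab, by rw [← h, pairColoring_ofPairColoring hd hab]⟩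

end pairColoring

theorem _root_.IsRainbowCopy.ne {W : Type*} {H : SimpleGraph W} {n : ℕ}
    {c : (⊤ : SimpleGraph (Fin n)).edgeSet → ℕ} {f : SimpleGraph.Copy H ⊤}
    (hf : IsRainbowCopy c f) {u v u' v' : W} (h : H.Adj u v) (h' : H.Adj u' v')
    (hne : s(u, v) ≠ s(u', v')) :
    pairColoring c (f u) (f v) ≠ pairColoring c (f u') (f v') := by
  rw [pairColoring_of_ne (show f u ≠ f v from f.injective.ne h.ne),
    pairColoring_of_ne (show f u' ≠ f v' from f.injective.ne h'.ne)]
  exact fun heq => hne (congrArg Subtype.val (@hf ⟨s(u, v), h⟩ ⟨s(u', v'), h'⟩ heq))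

theorem isRainbow_of_injective {V ι : Type*} [DecidableEq V] [DecidableEq ι] {c : V → V → ℕ}
    {a b : ι → V} (ha : Function.Injective a) (hb : Function.Injective b) (hne : ∀ i j, a i ≠ b j)
    (hc : Function.Injective fun i => c (a i) (b i)) (I : Finset ι) :
    IsRainbow ⊤ c (I.image a ∪ I.image b) (I.image fun i => c (a i) (b i)) := by
  induction I using Finset.induction_on with
  | empty => exact .nil
  | insert i I hi ih =>
    have h := ih.add (a := a i) (b := b i)
      (by
        simp only [Finset.mem_union, Finset.mem_image, not_or, not_exists, not_and]
        exact ⟨fun j hj e => hi (ha e ▸ hj), fun j _ e => hne _ _ e.symm⟩)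
      (by
        simp only [Finset.mem_union, Finset.mem_image, not_or, not_exists, not_and]
        exact ⟨fun j _ => hne _ _, fun j hj e => hi (hb e ▸ hj)⟩)
      (hne i i)
      (by
        simp only [Finset.mem_image, not_exists, not_and]
        exact fun j hj e => hi (hc e ▸ hj))
    convert h using 1
    · grind
    · rw [Finset.image_insert]

variable {t n : ℕ}

theorem pathForest_adj_inl {i j : Fin 4} (h : j.val = i.val + 1) :
    (pathForest t).Adj (.inl i) (.inl j) := by
  simp only [pathForest, SimpleGraph.sum_adj]
  rw [SimpleGraph.pathGraph_adj]
  exact .inl h.symm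

theorem pathForest_adj_inr (i : Fin t) : (pathForest t).Adj (.inr (i, 0)) (.inr (i, 1)) := by
  simp only [pathForest, SimpleGraph.sum_adj, disjointCopies]
  rw [SimpleGraph.pathGraph_adj]
  exact ⟨trivial, .inl rfl⟩

theorem mem_edgeSet_pathForest {e : Sym2 (Fin 4 ⊕ (Fin t × Fin 2))}
    (he : e ∈ (pathForest t).edgeSet) :
    e = s(.inl 0, .inl 1) ∨ e = s(.inl 1, .inl 2) ∨ e = s(.inl 2, .inl 3) ∨
      ∃ i, e = s(.inr (i, 0), .inr (i, 1)) := by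
  induction e using Sym2.ind with | _ a b
  rw [SimpleGraph.mem_edgeSet] at he
  rcases a with a | ⟨i, a⟩ <;> rcases b with b | ⟨j, b⟩
  · simp only [pathForest, SimpleGraph.sum_adj, SimpleGraph.pathGraph_adj] at he
    fin_cases a <;> fin_cases b <;> simp at he <;> simp [Sym2.eq_swap]
  · simp [pathForest] at he
  · simp [pathForest] at he
  · simp only [pathForest, SimpleGraph.sum_adj, disjointCopies, SimpleGraph.pathGraph_adj] at he
    obtain ⟨rfl, he⟩ := he
    right; right; right
    refine ⟨i, ?_⟩
    fin_cases a <;> fin_cases b <;> simp at he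
    · rfl
    · exact Sym2.eq_swap

/-- A rainbow copy of `P₄ ∪ t P₂` contains a rainbow matching with `t + 2` edges. -/
theorem not_isRainbowCopy {c : (⊤ : SimpleGraph (Fin n)).edgeSet → ℕ}
    (hno : NoRainbow (pairColoring c) (t + 1)) (f : SimpleGraph.Copy (pathForest t) ⊤) :
    ¬ IsRainbowCopy c f := by
  intro hf
  let a : Fin 2 ⊕ Fin t → Fin 4 ⊕ (Fin t × Fin 2) :=
    Sum.elim (fun i => .inl (if i = 0 then 0 else 2)) fun i => .inr (i, 0)
  let b : Fin 2 ⊕ Fin t → Fin 4 ⊕ (Fin t × Fin 2) :=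
    Sum.elim (fun i => .inl (if i = 0 then 1 else 3)) fun i => .inr (i, 1)
  have hadj : ∀ i, (pathForest t).Adj (a i) (b i) := by
    rintro (i | i)
    · fin_cases i
      · exact pathForest_adj_inl rfl
      · exact pathForest_adj_inl rfl
    · exact pathForest_adj_inr i
  have ha : Function.Injective a := by
    rintro (i | i) (j | j) h
    · fin_cases i <;> fin_cases j <;> simp [a] at h ⊢
    · simp [a] at h
    · simp [a] at h
    · simpa [a] using h
  have hb : Function.Injective b := by
    rintro (i | i) (j | j) h
    · fin_cases i <;> fin_cases j <;> simp [b] at h ⊢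
    · simp [b] at h
    · simp [b] at h
    · simpa [b] using h
  have hne : ∀ i j, a i ≠ b j := by
    rintro (i | i) (j | j)
    · fin_cases i <;> fin_cases j <;> simp [a, b]
    · simp [a, b]
    · simp [a, b]
    · simp [a, b]
  have hinj : Function.Injective fun i => pairColoring c (f (a i)) (f (b i)) := by
    intro i j hij
    by_contra hne'
    refine hf.ne (hadj i) (hadj j) (fun e => ?_) hij
    rcases Sym2.eq_iff.mp e with ⟨e, -⟩ | ⟨e, -⟩
    · exact hne' (ha e)
    · exact hne _ _ e
  have h := isRainbow_of_injective (c := pairColoring c) (a := fun i => f (a i))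
    (b := fun i => f (b i))
    (f.injective.comp ha) (f.injective.comp hb) (fun i j => f.injective.ne (hne i j))
    hinj Finset.univ
  have h2 := hno _ _ h
  rw [Finset.card_image_of_injective _ hinj] at h2
  simp at h2
  omega

/-- The edges of a rainbow matching, indexed by their colors. -/
theorem IsRainbow.exists_ends {V : Type*} [DecidableEq V] [Nonempty V] {c : V → V → ℕ} {s : Finset V}
    {C : Finset ℕ} (h : IsRainbow ⊤ c s C) : ∃ a b : ℕ → V,
      (∀ γ ∈ C, a γ ∈ s ∧ b γ ∈ s ∧ c (a γ) (b γ) = γ) ∧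
      ∀ γ ∈ C, ∀ δ ∈ C, a γ ≠ b δ ∧ (γ ≠ δ → a γ ≠ a δ ∧ b γ ≠ b δ) := by
  induction h with
  | nil => exact ⟨fun _ => Classical.arbitrary V, fun _ => Classical.arbitrary V, by simp, by simp⟩
  | @cons s C u w hs hu hw huw hC ih =>
    obtain ⟨a, b, h1, h2⟩ := ih
    refine ⟨fun γ => if γ = c u w then u else a γ, fun γ => if γ = c u w then w else b γ, ?_, ?_⟩
    · grind
    · have := huw.ne
      intro γ hγ δ hδ
      rw [Finset.mem_insert] at hγ hδ
      by_cases e1 : γ = c u w <;> by_cases e2 : δ = c u w <;> simp only [e1, e2, if_true, if_false]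
      all_goals grind

end AntiRamsey

/-! ### Rainbow copies and the anti-Ramsey number. -/

namespace AntiRamsey

variable {t n : ℕ}

theorem exists_isRainbowCopy {c : (⊤ : SimpleGraph (Fin n)).edgeSet → ℕ}
    {s : Finset (Fin n)} {C : Finset ℕ} {p q r w : Fin n}
    (h : IsRainbow ⊤ (pairColoring c) s C) (hC : t ≤ C.card)
    (hv : p ∉ s ∧ q ∉ s ∧ r ∉ s ∧ w ∉ s) (hnd : [p, q, r, w].Nodup)
    (h1 : pairColoring c p q ∉ C) (h2 : pairColoring c q r ∉ C) (h3 : pairColoring c r w ∉ C)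
    (h12 : pairColoring c p q ≠ pairColoring c q r) (h13 : pairColoring c p q ≠ pairColoring c r w)
    (h23 : pairColoring c q r ≠ pairColoring c r w) :
    ∃ f : SimpleGraph.Copy (pathForest t) (⊤ : SimpleGraph (Fin n)), IsRainbowCopy c f := by
  have : Nonempty (Fin n) := ⟨p⟩
  obtain ⟨a, b, hab, hinj⟩ := h.exists_ends
  obtain ⟨g⟩ : Nonempty (Fin t ↪ C) :=
    Function.Embedding.nonempty_of_card_le (by simpa using hC)
  let F : Fin 4 ⊕ (Fin t × Fin 2) → Fin n :=
    Sum.elim ![p, q, r, w] fun x => if x.2 = 0 then a (g x.1) else b (g x.1)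
  simp only [List.nodup_cons, List.mem_cons, List.not_mem_nil, or_false, not_or,
    List.nodup_nil, not_false_eq_true, and_true] at hnd
  obtain ⟨⟨n1, n2, n3⟩, ⟨n4, n5⟩, n6⟩ := hnd
  obtain ⟨hp, hq, hr, hw⟩ := hv
  have hs : ∀ x : Fin t × Fin 2, F (.inr x) ∈ s := by
    rintro ⟨i, j⟩
    have := hab _ (g i).2
    simp only [F, Sum.elim_inr]
    split_ifs
    · exact this.1
    · exact this.2.1
  have hns : ∀ i : Fin 4, F (.inl i) ∉ s := by
    intro i
    fin_cases i <;> assumption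
  have hF : Function.Injective F := by
    rintro (i | ⟨i, j⟩) (i' | ⟨i', j'⟩) hij
    · fin_cases i <;> fin_cases i' <;> simp_all [F]
    · exact absurd (hij ▸ hs _) (hns i)
    · exact absurd (hij ▸ hs _) (hns i')
    · have k1 := hinj _ (g i).2 _ (g i').2
      have k2 := hinj _ (g i').2 _ (g i).2
      have hi : i = i' := by
        by_contra hne
        have hne' : (g i : ℕ) ≠ g i' := fun e => hne (g.injective (Subtype.ext e))
        simp only [F, Sum.elim_inr] at hij
        split_ifs at hij
        · exact (k1.2 hne').1 hij
        · exact k1.1 hij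
        · exact k2.1 hij.symm
        · exact (k1.2 hne').2 hij
      subst hi
      have k3 := (hinj _ (g i).2 _ (g i).2).1
      fin_cases j <;> fin_cases j' <;> first | rfl | exact absurd hij k3 | exact absurd hij.symm k3
  have hFc : ∀ i, pairColoring c (F (.inr (i, 0))) (F (.inr (i, 1))) = g i := fun i =>
    (hab _ (g i).2).2.2
  let f : SimpleGraph.Copy (pathForest t) (⊤ : SimpleGraph (Fin n)) :=
    ⟨⟨F, fun hab => hF.ne hab.ne⟩, hF⟩
  have hf : ∀ (u v) (huv : s(u, v) ∈ (pathForest t).edgeSet),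
      c (f.mapEdgeSet ⟨s(u, v), huv⟩) = pairColoring c (F u) (F v) := fun u v huv =>

    (pairColoring_of_ne (hF.ne ((SimpleGraph.mem_edgeSet _).mp huv).ne)).symm
  refine ⟨f, ?_⟩
  rintro ⟨e, he⟩ ⟨e', he'⟩ hee
  rw [Subtype.mk.injEq]
  have e1 : pairColoring c (F (.inl 0)) (F (.inl 1)) = pairColoring c p q := rfl
  have e2 : pairColoring c (F (.inl 1)) (F (.inl 2)) = pairColoring c q r := rfl
  have e3 : pairColoring c (F (.inl 2)) (F (.inl 3)) = pairColoring c r w := rfl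
  have hg : ∀ i, (g i : ℕ) ∈ C := fun i => (g i).2
  rcases mem_edgeSet_pathForest he with rfl | rfl | rfl | ⟨i, rfl⟩ <;>
    rcases mem_edgeSet_pathForest he' with rfl | rfl | rfl | ⟨j, rfl⟩ <;>
    have hee := (hf _ _ he).symm.trans (hee.trans (hf _ _ he')) <;>
    simp only [e1, e2, e3, hFc] at hee
  any_goals rfl
  · exact absurd hee h12
  · exact absurd hee h13
  · exact absurd (hee ▸ hg j) h1
  · exact absurd hee.symm h12
  · exact absurd hee h23
  · exact absurd (hee ▸ hg j) h2
  · exact absurd hee.symm h13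
  · exact absurd hee.symm h23
  · exact absurd (hee ▸ hg j) h3
  · exact absurd (hee ▸ hg i) h1
  · exact absurd (hee ▸ hg i) h2
  · exact absurd (hee ▸ hg i) h3
  · rw [g.injective (Subtype.ext hee)]

theorem noRainbowPath_pairColoring {c : (⊤ : SimpleGraph (Fin n)).edgeSet → ℕ}
    (hno : ∀ f : SimpleGraph.Copy (pathForest t) (⊤ : SimpleGraph (Fin n)), ¬ IsRainbowCopy c f) :
    NoRainbowPath (pairColoring c) t := by
  intro s C p q r w h hC hv hnd h1 h2 h3 h12 h13 h23
  obtain ⟨f, hf⟩ := exists_isRainbowCopy h hC hv hnd h1 h2 h3 h12 h13 h23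
  exact hno f hf

theorem isGreatest_antiRamsey (t n : ℕ) :
    IsGreatest (rainbowFreeColorCounts n (pathForest t)) (antiRamsey n (pathForest t)) := by
  -- Boundedness matters: the supremum of an unbounded set of natural numbers is 0 and would not be
  -- attained.
  have hbdd : BddAbove (rainbowFreeColorCounts n (pathForest t)) := by
    refine ⟨Nat.card (⊤ : SimpleGraph (Fin n)).edgeSet, ?_⟩
    rintro m ⟨c, rfl, -⟩
    rw [← Nat.card_coe_set_eq]
    exact Finite.card_range_le c
  have hne : (rainbowFreeColorCounts n (pathForest t)).Nonempty := by
    refine ⟨_, fun _ => 0, rfl, fun f hf => ?_⟩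
    have a1 : (pathForest t).Adj (.inl 0) (.inl 1) := pathForest_adj_inl rfl
    have a2 : (pathForest t).Adj (.inl 1) (.inl 2) := pathForest_adj_inl rfl
    have h := congrArg Subtype.val (@hf ⟨s(.inl 0, .inl 1), a1⟩ ⟨s(.inl 1, .inl 2), a2⟩ rfl)
    simp at h
  exact ⟨Nat.sSup_mem hne hbdd, fun m hm => le_csSup hbdd hm⟩

/-- The bound is an arbitrary predicate because the upper bounds on the number of colors are
disjunctions. -/
theorem antiRamsey_le {K : ℕ → Prop}
    (h : ∀ c : Fin n → Fin n → ℕ, (∀ a b, c a b = c b a) → NoRainbowPath c t →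
      K (colors c Finset.univ).card) : K (antiRamsey n (pathForest t)) := by
  obtain ⟨c, hc, hno⟩ := (isGreatest_antiRamsey t n).1
  rw [← hc, ncard_range_eq]
  exact h _ pairColoring_comm (noRainbowPath_pairColoring hno)

theorem le_antiRamsey {c : Fin n → Fin n → ℕ} (hc : ∀ a b, c a b = c b a)
    (hno : NoRainbow c (t + 1)) : (colors c Finset.univ).card ≤ antiRamsey n (pathForest t) := by
  refine (isGreatest_antiRamsey t n).2 ⟨ofPairColoring c hc, ncard_range_ofPairColoring hc,
    not_isRainbowCopy fun s C h => hno s C ?_⟩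
  -- The two functions may differ on the diagonal, so the matching is transferred edge by edge.
  induction h with
  | nil => exact .nil
  | cons h ha hb hab hC ih =>
    rw [pairColoring_ofPairColoring hc hab] at hC ⊢
    exact ih.cons ha hb hab hC

/-- Two colors cannot color the three edges of a path differently. -/
theorem two_le_antiRamsey_zero (hn : 3 ≤ n) : 2 ≤ antiRamsey n (pathForest 0) := by
  let x : Fin n := ⟨0, by omega⟩
  let y : Fin n := ⟨1, by omega⟩
  let z : Fin n := ⟨2, by omega⟩
  let d : Fin n → Fin n → ℕ := fun a b => if a = x ∨ b = x then 1 else 0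
  have hd : ∀ a b, d a b = d b a := fun a b => by simp only [d, or_comm]
  have h2 : 2 ≤ (colors d Finset.univ).card := by
    rw [← Finset.card_pair (a := 0) (b := 1) (by simp)]
    refine Finset.card_le_card fun γ hγ => mem_colors.mpr ?_
    rcases Finset.mem_insert.mp hγ with rfl | hγ
    · exact ⟨y, by simp, z, by simp, by simp [y, z], by simp [d, x, y, z]⟩
    · exact ⟨x, by simp, y, by simp, by simp [x, y], by simp [d, Finset.mem_singleton.mp hγ]⟩
  refine h2.trans ((isGreatest_antiRamsey 0 n).2 ⟨ofPairColoring d hd,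
    ncard_range_ofPairColoring hd, fun f hf => ?_⟩)
  have hlt : ∀ u v, (pathForest 0).Adj u v →
      pairColoring (ofPairColoring d hd) (f u) (f v) < 2 := fun u v huv => by
    rw [pairColoring_ofPairColoring hd (show f u ≠ f v from f.injective.ne huv.ne)]
    simp only [d]
    split_ifs <;> omega
  have a1 : (pathForest 0).Adj (.inl 0) (.inl 1) := pathForest_adj_inl rfl
  have a2 : (pathForest 0).Adj (.inl 1) (.inl 2) := pathForest_adj_inl rfl
  have a3 : (pathForest 0).Adj (.inl 2) (.inl 3) := pathForest_adj_inl rfl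
  have := hf.ne a1 a2 (by simp)
  have := hf.ne a1 a3 (by simp)
  have := hf.ne a2 a3 (by simp)
  have := hlt _ _ a1
  have := hlt _ _ a2
  have := hlt _ _ a3
  omega

theorem three_le_antiRamsey_zero : 3 ≤ antiRamsey 4 (pathForest 0) := by
  -- The exclusive or gives the three perfect matchings of K₄ as color classes, so disjoint edges
  -- have the same color.
  let d : Fin 4 → Fin 4 → ℕ := fun a b => a.val ^^^ b.val
  have hd : ∀ a b, d a b = d b a := fun a b => Nat.xor_comm _ _
  have h3 : 3 ≤ (colors d Finset.univ).card := by decide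
  refine h3.trans (le_antiRamsey hd fun s C h => ?_)
  by_contra hlt
  obtain ⟨s, C, h, hC⟩ := h.exists_card_eq (m := 2) (C.card - 2) (by omega)
  obtain ⟨γ, hγ⟩ : C.Nonempty := Finset.card_pos.mp (by omega)
  obtain ⟨p, q, s', hp, hq, hpq, rfl, -, h'⟩ := h.exists_edge hγ
  obtain ⟨δ, hδ⟩ : (C.erase (d p q)).Nonempty :=
    Finset.card_pos.mp (by rw [Finset.card_erase_of_mem hγ]; omega)
  obtain ⟨r, w, s'', -, -, hrw, rfl, rfl, -⟩ := h'.exists_edge hδ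
  have key : ∀ p q r w : Fin 4,
      p ≠ q ∧ p ≠ r ∧ p ≠ w ∧ q ≠ r ∧ q ≠ w ∧ r ≠ w → d r w = d p q := by decide
  simp only [Finset.mem_insert, not_or] at hp hq
  exact (Finset.mem_erase.mp hδ).1 (key p q r w ⟨hpq.ne, hp.1, hp.2.1, hq.1, hq.2.1, hrw.ne⟩)

end AntiRamsey

/-! ### The theorem. -/

theorem corollary3 (t n : ℕ) (hn : 2 * t + 4 ≤ n) :
    IsGreatest (rainbowFreeColorCounts n (pathForest t)) (antiRamsey n (pathForest t)) ∧
    (t = 0 → n = 4 → antiRamsey n (pathForest t) = 3) ∧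
    (t = 0 → 5 ≤ n → antiRamsey n (pathForest t) = 2) ∧
    (1 ≤ t → t ≤ 4 → n = 2 * t + 4 →
      (antiRamsey n (pathForest t) : ℚ) = 1 / 2 * t * (3 * t + 7) + 1) ∧
    (5 ≤ t → n = 2 * t + 4 →
      antiRamsey n (pathForest t) = t * (2 * t + 1) + 2) ∧
    (1 ≤ t → 2 * t + 5 ≤ n → (n : ℚ) ≤ (5 * t + 3) / 2 →
      antiRamsey n (pathForest t) = t * (2 * t + 1) + 1) ∧
    (1 ≤ t → 2 * t + 5 ≤ n → (5 * t + 3 : ℚ) / 2 ≤ n →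
      (antiRamsey n (pathForest t) : ℚ) = t * (n - (t + 1) / 2) + 1) := by
  open AntiRamsey in
  have hclique : t * (2 * t + 1) + 1 ≤ antiRamsey n (pathForest t) := by
    obtain ⟨c, hc, hno, hcard⟩ := exists_noRainbow_of_clique (t := t) (n := n) (by omega)
    exact hcard ▸ le_antiRamsey hc hno
  have hcover : 2 * t * n + 2 ≤ 2 * antiRamsey n (pathForest t) + t * (t + 1) := by
    obtain ⟨c, hc, hno, hcard⟩ := exists_noRainbow_of_cover (t := t) (n := n) (by omega)
    have h1 := hcard ▸ le_antiRamsey hc hno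
    -- This form of n removes the truncated subtractions from the binomial coefficients; doubling
    -- removes the divisions.
    obtain ⟨m, rfl⟩ : ∃ m, n = m + 1 + t := ⟨n - t - 1, by omega⟩
    have h4 : (m + 1 + t).choose 2 * 2 = (m + 1 + t) * (m + t) := by
      rw [Nat.choose_two_right, show m + 1 + t - 1 = m + t by omega,
        Nat.div_mul_cancel]
      have := Nat.even_mul_succ_self (m + t)
      rw [show m + 1 + t = m + t + 1 by ring, mul_comm]
      exact this.two_dvd
    have h5 : (m + 1).choose 2 * 2 = (m + 1) * m := by
      rw [Nat.choose_two_right, Nat.add_sub_cancel, Nat.div_mul_cancel]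
      rw [mul_comm]
      exact (Nat.even_mul_succ_self m).two_dvd
    rw [Nat.add_sub_cancel] at h1
    have h6 : (m + 1 + t) * (m + t) + t * (t + 1) = (m + 1) * m + 2 * t * (m + 1 + t) := by ring
    omega
  have hlarge (ht : 1 ≤ t) (hN : 2 * t + 5 ≤ n) : Bound t n (antiRamsey n (pathForest t)) :=
    antiRamsey_le fun c hc hP => by
      simpa using hP.bound_card_colors hc ht (by simpa using hN)
  have hsmall (ht : 1 ≤ t) (hN : n = 2 * t + 4) :
      antiRamsey n (pathForest t) ≤ 2 * t ^ 2 + t + 2 ∨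
        2 * antiRamsey n (pathForest t) ≤ 3 * t ^ 2 + 7 * t + 2 :=
    antiRamsey_le (K := fun K => K ≤ 2 * t ^ 2 + t + 2 ∨ 2 * K ≤ 3 * t ^ 2 + 7 * t + 2)
      fun c hc hP => hP.card_colors_le_of_card_eq hc ht (by simpa using hN)
  refine ⟨isGreatest_antiRamsey t n, ?_, ?_, ?_, ?_, ?_, ?_⟩
  · rintro rfl rfl
    exact le_antisymm (antiRamsey_le (K := (· ≤ 3)) fun c hc hP => hP.card_colors_le_three hc)
      three_le_antiRamsey_zero
  · rintro rfl h5
    exact le_antisymm (antiRamsey_le (K := (· ≤ 2)) fun c hc hP =>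
      hP.card_colors_le_two_of_zero hc (by simpa using h5)) (two_le_antiRamsey_zero (by omega))
  · intro ht ht4 hN
    have h := hsmall ht hN
    generalize antiRamsey n (pathForest t) = K at *
    -- For 1 ≤ t ≤ 4 this value is at least 2(2t² + t + 2), so both alternatives of the upper bound
    -- agree with the coloring by a fixed set of t vertices.
    have hK : 2 * K = 3 * t ^ 2 + 7 * t + 2 := by
      subst hN
      interval_cases t <;> omega
    have hK' : (2 * K : ℚ) = 3 * t ^ 2 + 7 * t + 2 := by exact_mod_cast hK
    linarith
  · rintro ht rfl
    have h := hsmall (by omega) rfl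
    obtain ⟨c, hc, hno, hcard⟩ := exists_noRainbow_of_pair t
    have h' := hcard.trans (le_antiRamsey hc hno)
    generalize antiRamsey (2 * t + 4) (pathForest t) = K at *
    rcases h with h | h
    · linarith
    · nlinarith
  · intro ht hN hle
    have hle' : 2 * n ≤ 5 * t + 3 := by
      have : (2 * n : ℚ) ≤ 5 * t + 3 := by linarith
      exact_mod_cast this
    have h := hlarge ht hN
    generalize antiRamsey n (pathForest t) = K at *
    -- For 2n ≤ 5t + 3 the linear alternative of the upper bound is at most the clique value.
    rcases h with h | h <;> nlinarith
  · intro ht hN hle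
    have hle' : 5 * t + 3 ≤ 2 * n := by
      have : (5 * t + 3 : ℚ) ≤ 2 * n := by linarith
      exact_mod_cast this
    have h := hlarge ht hN
    generalize antiRamsey n (pathForest t) = K at *
    -- For 2n ≥ 5t + 3 the clique alternative of the upper bound is at most the linear one, which
    -- `hcover` attains.
    have hK : 2 * K + t * (t + 1) = 2 * t * n + 2 := by
      rcases h with h | h <;> nlinarith
    have hK' : (2 * K + t * (t + 1) : ℚ) = 2 * t * n + 2 := by exact_mod_cast hK
    linarith
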